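/- **Setting.** Let $d=s+1\ge 1$, $x\cdot y=x^0y^0-\mathbf x\cdot\mathbf y$ on $\mathbb R^d$, $k^2=k\cdot k$, $V^+_\mu=\{k: k^2>\mu^2,\ k^0>0\}$ with closure $\bar V^+_\mu$, and let $\mathcal S_n$ be the complex Schwartz functions on $\mathbb R^{dn}$ ($\mathcal S_0=\mathbb C$). $\mathcal Ff(k_1,\dots,k_n)=\hat f(k_1,\dots,k_n)=(2\pi)^{-dn/2}\int e^{-i(x_1\cdot k_1+\cdots+x_n\cdot k_n)}f(x_1,\dots,x_n)\,dx_1\cdots dx_n$, and $\bar{\mathcal F}=\mathcal F^{-1}$. $\underline{\mathcal S}=\bigoplus_{n\ge0}\mathcal S_n$ is the Borchers algebra with product $(f_n\otimes h_m)(x_1,\dots,x_{n+m})=f_n(x_1,\dots,x_n)h_m(x_{n+1},\dots,x_{n+m})$, involution $f_n^*(x_1,\dots,x_n)=\overline{f_n(x_n,\dots,x_1)}$ and direct sum topology. $\underline{\mathcal S}^{\rm ext}$ is the same construction over $\mathcal S(\mathbb R^d,\mathbb C^3)$: its degree $n$ part consists of the families of components $f^{a_1\cdots a_n}\in\mathcal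 S_n$, $a_i\in\{{\rm in},{\rm loc},{\rm out}\}$. Continuous linear functionals $\underline W=(W_n)_{n\ge0}$ on $\underline{\mathcal S}$ (Wightman functionals) are arbitrary sequences of tempered distributions, and likewise for $\underline{\mathcal S}^{\rm ext}$ (families $F_n^{a_1\cdots a_n}$). Proper orthochronous Poincaré transformations act by $\alpha_{\{\Lambda,a\}}f(x_1,\dots,x_n)=f(\Lambda^{-1}(x_1-a),\dots,\Lambda^{-1}(x_n-a))$, and componentwise on $\underline{\mathcal S}^{\rm ext}$. **Truncation.** $\underline W^T$ is defined recursively by $W^T_0=0$ and $W_n(x_1,\dots,x_n)=\sum_{\lambda}\prod_{l}W^T(x_{\lambda_l})$ for $n\ge1$, the sum over all partitions $\lambda=\{\lambda_1,\dots,\lambda_r\}$ of $\{1,\dots,n\}$, with the natural order kept in every block; for functionals on $\underline{\mathcal S}^{\rm ext}$ the labels $a_i$ go along with the variables. For a bilinear functional $\underline S(\underline f,\underline g)=\sum_{n,m}S_{n,m}(f_n\otimes g_m)$ on $\underline{\mathcal S}$ with $S_{n,m}\in\mathcal S_{n+m}'$, $\underline S^T$ is defined by $S^T_{0,0}=0$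 and $S_{n,m}(x_1,\dots,x_{n+m})=\sum_\lambda\prod_l S^T(x_{\lambda_l^<};x_{\lambda_l^>})$ for $n+m\ge1$, over the partitions of $\{1,\dots,n+m\}$, where $\lambda^<_l=\lambda_l\cap\{1,\dots,n\}$ and $\lambda^>_l=\lambda_l\cap\{n+1,\dots,n+m\}$. **Wave operators, form factors, S-matrix.** Let $m>0$, $0<\epsilon<m^2$, $\varphi\in C_0^\infty(\mathbb R,\mathbb R)$ with support in $(-\epsilon,\epsilon)$ and $\varphi=1$ on $(-\epsilon/2,\epsilon/2)$. Put $\chi^\pm(k)=\theta(\pm k^0)\varphi(k^2-m^2)$, $\omega=(|\mathbf k|^2+m^2)^{1/2}$, and $$\chi_t({\rm in},k)=\chi^+e^{-i(k^0-\omega)t}+\chi^-e^{-i(k^0+\omega)t},\quad \chi_t({\rm loc},k)=1,\quad \chi_t({\rm out},k)=\chi^+e^{i(k^0-\omega)t}+\chi^-e^{i(k^0+\omega)t}.$$ For times $t_n=(t_n^1,\dots,t_n^n)$ let $\Omega_{n,t_n}$ act on the component $a_1\cdots a_n$ as $\bar{\mathcal F}\,\prod_{l=1}^n\chi_{t_n^l}(a_l,k_l)\,\mathcal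 F$ ($\Omega_{0,t_0}=1$), and let $\underline\Omega_{\underline t}=\underline J\circ\bigoplus_n\Omega_{n,t_n}$, where $\underline J:\underline{\mathcal S}^{\rm ext}\to\underline{\mathcal S}$ sums all components in each degree. $\underline J^{a}:\underline{\mathcal S}\to\underline{\mathcal S}^{\rm ext}$, $a={\rm in},{\rm loc},{\rm out}$, is the injection onto the components $a\cdots a$. "$\lim_{\underline t\to+\infty}\underline W\circ\underline\Omega_{\underline t}=\underline F$ exists" means: for every degree, all components and every order of the times $t_n^1,\dots,t_n^n$, the iterated limit (first one $t^l_n\to+\infty$, then the next, etc.) exists in the topology of pointwise convergence of tempered distributions and equals the corresponding component of $\underline F$, independently of the order. The limit is called the form factor functional $\underline F$ of $\underline W$; the scattering matrix is $\underline S(\underline f,\underline g)=\underline F(\underline J^{\rm in}\underline f\otimes\underline J^{\rm out}\underline g)$. **Conditions.** *Hilbert space structure condition (HSSC)* for a functional $\underline R$: there is a continuous Hilbert seminorm $\underline p$ on the algebra with $|\underline R(\underline f^*\otimes\underline g)|\le\underline p(\underline f)\,\underline p(\underline g)$. *$\gamma$-continuity*: continuity for the topology $\gamma$ generated by the topologies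 $\gamma_{K,L}$, $K,L\in\mathbb N_0$, where $\gamma_{K,L}$ is the strongest locally convex topology on the algebra which in each degree induces the topology of the norm $\|f\|_{K,L}=\sup_{x,\,|\beta_1|,\dots,|\beta_n|\le K}\big|\prod_l(1+|x_l|^2)^{L/2}D^{\beta_1\cdots\beta_n}f(x_1,\dots,x_n)\big|$ (summed over components). Consider the following properties of a functional $\underline R$ on $\underline{\mathcal S}$: - *Poincaré invariance*: $\underline R\circ\alpha_{\{\Lambda,a\}}=\underline R$ for all $\{\Lambda,a\}$; - *spectral property*: $\underline R$ vanishes on the left ideal generated by the homogeneous $f_n$ with $\operatorname{supp}\hat f_n\subseteq\{\sum_{l=1}^nk_l\notin\bar V_0^+\}$; - *locality*: $\underline R$ vanishes on the two-sided ideal generated by the commutators $[f,h]$ of $f,h\in\mathcal S_1$ with space-like separated supports; - *hermiticity*: $\underline R(\underline f^*)=\overline{\underline R(\underline f)}$. Let $m_0>0$. - s1) $\underline W$ satisfies $W_0=1$, Poincaré invariance, the spectral property, locality, HSSC, hermiticity, and the cluster property $\lim_{t\to\infty}\underline W(\underline f\otimes\alpha_{\{1,ta\}}\underline g)=\underline W(\underline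 f)\underline W(\underline g)$ for all $\underline f,\underline g$ and all $a$ with $a^2<0$. Moreover there is a mass gap $m_0$: $\underline W^T$ vanishes on the vector space generated by the homogeneous $f_n$ with $\operatorname{supp}\hat f_n\subseteq\{\exists j,\ 2\le j\le n,\ \sum_{l=j}^nk_l\notin\bar V^+_{m_0}\}$. - s1$^T$) $\underline W^T$ satisfies $W_0^T=0$, Poincaré invariance, the spectral property, locality, $\gamma$-continuity, hermiticity, $\lim_{t\to\infty}\underline W^T(\underline f\otimes\alpha_{\{1,ta\}}\underline g)=0$ for $a^2<0$ and all $\underline f,\underline g$ with $f_0=g_0=0$, and the same mass gap condition. - s2) $\hat W^T_2(k_1,k_2)=\big[\delta_m^-(k_1)+\int_{m_0}^\infty\delta^-_\mu(k_1)\rho(\mu)\,d\mu\big]\delta(k_1+k_2)$ for some nonnegative, polynomially bounded, locally integrable $\rho$ on $[m_0,\infty)$, where $\delta_\mu^-(k)=\theta(-k^0)\delta(k^2-\mu^2)$ and $\hat W_2^T(h)=W_2^T(\bar{\mathcal F}h)$. - s3) $\underline F=\lim_{\underline t\to+\infty}\underline W\circ\underline\Omega_{\underline t}$ exists, is Poincaré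 invariant and satisfies HSSC on $\underline{\mathcal S}^{\rm ext}$. **Proposition.** Let $\underline W$ be a continuous linear functional on $\underline{\mathcal S}$ and $\underline W^T$ its truncation. (i) $\underline F=\lim_{\underline t\to+\infty}\underline W\circ\underline\Omega_{\underline t}$ exists if and only if $\underline F^{\tilde T}=\lim_{\underline t\to+\infty}\underline W^T\circ\underline\Omega_{\underline t}$ exists. In this case $\underline F^{\tilde T}=\underline F^T$, the truncation of $\underline F$. (ii) If $\underline F$ exists, then $\underline S^T(\underline f,\underline g)=\underline F^T(\underline J^{\rm in}\underline f\otimes\underline J^{\rm out}\underline g)$ for all $\underline f,\underline g\in\underline{\mathcal S}$. (iii) Let $m_0>0$ and $W_0=1$. Suppose that $\underline W^T$ satisfies s1$^T$) and s2), and that $\lim_{\underline t\to+\infty}\underline W^T\circ\underline\Omega_{\underline t}$ exists, is Poincaré invariant and $\gamma$-continuous. Then $\underline W$ satisfies s1), s2) and s3). -/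

import Mathlib

/-! ### Tensor products of tempered distributions, and scattering for Wightman functionals -/

open SchwartzMap LineDeriv FourierTransform Filter Topology MeasureTheory
open scoped ContDiff DirectSum

namespace WightmanScattering

noncomputable section

/-! ### Tensor products of Schwartz functions and of tempered distributions -/

section Pairing

variable {E F W : Type*} [NormedAddCommGroup E] [NormedSpace ℝ E]
  [NormedAddCommGroup F] [NormedSpace ℝ F] [NormedAddCommGroup W] [NormedSpace ℝ W]

theorem seminorm_lineDeriv_le (f : 𝓢(W, ℂ)) (k l : ℕ) (v : W) :
    SchwartzMap.seminorm ℂ k l (∂_{v} f) ≤ ‖v‖ * SchwartzMap.seminorm ℂ k (l + 1) f := by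
  refine SchwartzMap.seminorm_le_bound ℂ k l _ (by positivity) fun x => ?_
  have h : (⇑(∂_{v} f : 𝓢(W, ℂ)) : W → ℂ) = fun y => fderiv ℝ f y v := by
    ext y; exact SchwartzMap.lineDerivOp_apply_eq_fderiv v f y
  rw [h]
  have h1 : ‖iteratedFDeriv ℝ l (fun y => fderiv ℝ f y v) x‖ ≤
      ‖v‖ * ‖iteratedFDeriv ℝ l (fderiv ℝ f) x‖ :=
    norm_iteratedFDeriv_clm_apply_const (n := l)
      (((f.smooth ⊤).fderiv_right (m := (l : WithTop ℕ∞)) (by exact_mod_cast le_top)).contDiffAt) le_rfl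
  rw [norm_iteratedFDeriv_fderiv] at h1
  calc _ ≤ ‖x‖ ^ k * (‖v‖ * ‖iteratedFDeriv ℝ (l + 1) f x‖) := by gcongr
    _ = ‖v‖ * (‖x‖ ^ k * ‖iteratedFDeriv ℝ (l + 1) f x‖) := by ring
    _ ≤ _ := by gcongr; exact SchwartzMap.le_seminorm ℂ k (l + 1) f x

theorem seminorm_iteratedLineDeriv_le (k : ℕ) :
    ∀ (n : ℕ) (f : 𝓢(W, ℂ)) (l : ℕ) (m : Fin n → W),
    SchwartzMap.seminorm ℂ k l (∂^{m} f) ≤ (∏ i, ‖m i‖) * SchwartzMap.seminorm ℂ k (l + n) f := by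
  intro n
  induction n with
  | zero => intro f l m; simp
  | succ n ih =>
    intro f l m
    rw [iteratedLineDerivOp_succ_left, Fin.prod_univ_succ]
    calc _ ≤ ‖m 0‖ * SchwartzMap.seminorm ℂ k (l + 1) (∂^{Fin.tail m} f) :=
          seminorm_lineDeriv_le _ _ _ _
      _ ≤ ‖m 0‖ * ((∏ i, ‖Fin.tail m i‖) * SchwartzMap.seminorm ℂ k (l + 1 + n) f) := by
          gcongr; exact ih _ _ _
      _ = _ := by
          rw [show l + 1 + n = l + (n + 1) by ring, mul_assoc]; rfl

theorem lineDeriv_comm (f : 𝓢(W, ℂ)) (u v : W) : ∂_{u} (∂_{v} f) = ∂_{v} (∂_{u} f) := by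
  ext x
  have h (a b : W) : (∂_{a} (∂_{b} f)) x = iteratedFDeriv ℝ 2 f x ![a, b] := by
    rw [← SchwartzMap.iteratedLineDerivOp_eq_iteratedFDeriv]
    simp [iteratedLineDerivOp_succ_left]
  rw [h, h]
  have h2 : ContDiffAt ℝ 2 f x := f.contDiffAt 2
  have := (h2.isSymmSndFDerivAt (by simp)) u v
  rw [iteratedFDeriv_two_apply, iteratedFDeriv_two_apply]
  simpa using this

theorem iteratedLineDeriv_comm : ∀ (n : ℕ) (f : 𝓢(W, ℂ)) (m : Fin n → W) (v : W),
    ∂^{m} (∂_{v} f) = ∂_{v} (∂^{m} f) := by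
  intro n
  induction n with
  | zero => intro f m v; simp
  | succ n ih =>
    intro f m v
    rw [iteratedLineDerivOp_succ_left, iteratedLineDerivOp_succ_left, ih, lineDeriv_comm]

theorem taylor_bound (g : 𝓢(W, ℂ)) (k : ℕ) (z w : W) (hw : ‖w‖ ≤ 1) :
    ‖z‖ ^ k * ‖g (z + w) - g z - fderiv ℝ g z w‖ ≤
      2 ^ k * (SchwartzMap.seminorm ℂ 0 2 g + SchwartzMap.seminorm ℂ k 2 g) * ‖w‖ ^ 2 := by
  set B := 2 ^ k * (SchwartzMap.seminorm ℂ 0 2 g + SchwartzMap.seminorm ℂ k 2 g) with hB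
  have hB0 : 0 ≤ B := by positivity
  have hc1 : ∀ u, DifferentiableAt ℝ g u := fun u => g.differentiableAt
  have hc2 : ∀ u, DifferentiableAt ℝ (fderiv ℝ g) u := fun u =>
    ((g.smooth ⊤).fderiv_right (m := 1) (by norm_num; exact WithTop.coe_le_coe.2 (le_top : (2 : ℕ∞) ≤ ⊤))).differentiable
      (by simp) u
  have hball : ∀ u ∈ Metric.closedBall z ‖w‖, ‖z‖ ^ k * ‖fderiv ℝ (fderiv ℝ g) u‖ ≤ B := by
    intro u hu
    have hu' : ‖u - z‖ ≤ 1 := by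
      rw [mem_closedBall_iff_norm] at hu; exact hu.trans hw
    have hz : ‖z‖ ≤ ‖u‖ + 1 := by
      have := norm_sub_norm_le z u
      rw [norm_sub_rev] at this; linarith
    have e : ‖fderiv ℝ (fderiv ℝ g) u‖ = ‖iteratedFDeriv ℝ 2 g u‖ := by
      rw [← norm_iteratedFDeriv_fderiv, ← norm_iteratedFDeriv_fderiv, norm_iteratedFDeriv_zero]
    have hp : ‖z‖ ^ k ≤ 2 ^ k * (‖u‖ ^ k + 1) := by
      calc ‖z‖ ^ k ≤ (‖u‖ + 1) ^ k := by gcongr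
        _ ≤ 2 ^ (k - 1) * (‖u‖ ^ k + 1 ^ k) := add_pow_le (norm_nonneg _) zero_le_one k
        _ ≤ 2 ^ k * (‖u‖ ^ k + 1) := by
          rw [one_pow]; gcongr
          · norm_num
          · omega
    have h0 := SchwartzMap.le_seminorm ℂ 0 2 g u
    have hk := SchwartzMap.le_seminorm ℂ k 2 g u
    rw [e]
    calc _ ≤ 2 ^ k * (‖u‖ ^ k + 1) * ‖iteratedFDeriv ℝ 2 g u‖ := by gcongr
      _ = 2 ^ k * (‖u‖ ^ 0 * ‖iteratedFDeriv ℝ 2 g u‖ + ‖u‖ ^ k * ‖iteratedFDeriv ℝ 2 g u‖) := by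
        ring
      _ ≤ B := by rw [hB]; gcongr
  have hz0 : z ∈ Metric.closedBall z ‖w‖ := Metric.mem_closedBall_self (norm_nonneg _)
  have hzw : z + w ∈ Metric.closedBall z ‖w‖ := by simp
  set c : ℝ := ‖z‖ ^ k with hc
  have hc0 : 0 ≤ c := by positivity
  have hF : ∀ u ∈ Metric.closedBall z ‖w‖,
      ‖c • fderiv ℝ g u - c • fderiv ℝ g z‖ ≤ B * ‖u - z‖ := by
    intro u hu
    refine (convex_closedBall z ‖w‖).norm_image_sub_le_of_norm_fderiv_le (𝕜 := ℝ)
      (f := fun u => c • fderiv ℝ g u)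
      (fun x _ => (hc2 x).const_smul c) ?_ hz0 hu
    intro x hx
    rw [fderiv_fun_const_smul (hc2 x), norm_smul, Real.norm_of_nonneg hc0]
    exact hball x hx
  have key := (convex_closedBall z ‖w‖).norm_image_sub_le_of_norm_fderiv_le' (𝕜 := ℝ)
      (f := fun u => c • g u) (φ := c • fderiv ℝ g z) (C := B * ‖w‖)
      (fun x _ => (hc1 x).const_smul c) (by
        intro x hx
        rw [fderiv_fun_const_smul (hc1 x)]
        refine (hF x hx).trans ?_
        gcongr
        exact mem_closedBall_iff_norm.1 hx) hz0 hzw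
  have e2 : c • g (z + w) - c • g z - (c • fderiv ℝ g z) (z + w - z) =
      c • (g (z + w) - g z - fderiv ℝ g z w) := by
    simp [smul_sub]
  rw [e2, norm_smul, Real.norm_of_nonneg hc0, add_sub_cancel_left] at key
  calc _ ≤ B * ‖w‖ * ‖w‖ := key
    _ = _ := by ring

theorem seminorm_translate_sub_le (f : 𝓢(W, ℂ)) (k l : ℕ) (w : W) (hw : ‖w‖ ≤ 1) :
    SchwartzMap.seminorm ℂ k l (f.compSubConstCLM ℂ (-w) - f - ∂_{w} f) ≤
      2 ^ k * (SchwartzMap.seminorm ℂ 0 (2 + l) f + SchwartzMap.seminorm ℂ k (2 + l) f)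
        * ‖w‖ ^ 2 := by
  refine SchwartzMap.seminorm_le_bound ℂ k l _ (by positivity) fun z => ?_
  set B := 2 ^ k * (SchwartzMap.seminorm ℂ 0 (2 + l) f + SchwartzMap.seminorm ℂ k (2 + l) f)
  have hB0 : 0 ≤ B := by positivity
  have tr : ∀ (n : ℕ) (h : 𝓢(W, ℂ)) (m : Fin n → W),
      ∂^{m} (h.compSubConstCLM ℂ (-w)) = (∂^{m} h).compSubConstCLM ℂ (-w) := by
    intro n h m
    ext x
    rw [SchwartzMap.iteratedLineDerivOp_eq_iteratedFDeriv, SchwartzMap.compSubConstCLM_apply,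
      SchwartzMap.iteratedLineDerivOp_eq_iteratedFDeriv]
    have : (⇑(h.compSubConstCLM ℂ (-w)) : W → ℂ) = fun x => h (x + w) := by
      ext y; simp
    rw [this, iteratedFDeriv_comp_add_right]; simp
  have hm : ∀ m : Fin l → W, ‖z‖ ^ k *
      ‖iteratedFDeriv ℝ l (f.compSubConstCLM ℂ (-w) - f - ∂_{w} f : 𝓢(W, ℂ)) z m‖ ≤
        B * ‖w‖ ^ 2 * ∏ i, ‖m i‖ := by
    intro m
    rw [← SchwartzMap.iteratedLineDerivOp_eq_iteratedFDeriv]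
    have e : ∂^{m} (f.compSubConstCLM ℂ (-w) - f - ∂_{w} f) =
        (∂^{m} f).compSubConstCLM ℂ (-w) - ∂^{m} f - ∂_{w} (∂^{m} f) := by
      rw [sub_eq_add_neg, sub_eq_add_neg, iteratedLineDerivOp_add, iteratedLineDerivOp_add,
        iteratedLineDerivOp_neg, iteratedLineDerivOp_neg, tr, iteratedLineDeriv_comm]
      abel
    have e' : (∂^{m} (f.compSubConstCLM ℂ (-w) - f - ∂_{w} f)) z =
        (∂^{m} f) (z + w) - (∂^{m} f) z - fderiv ℝ (∂^{m} f : 𝓢(W, ℂ)) z w := by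
      rw [e]
      simp [SchwartzMap.lineDerivOp_apply_eq_fderiv]
    rw [e']
    refine (taylor_bound (∂^{m} f) k z w hw).trans ?_
    have h0 := seminorm_iteratedLineDeriv_le 0 l f 2 m
    have hk := seminorm_iteratedLineDeriv_le k l f 2 m
    calc _ ≤ 2 ^ k * ((∏ i, ‖m i‖) * SchwartzMap.seminorm ℂ 0 (2 + l) f +
            (∏ i, ‖m i‖) * SchwartzMap.seminorm ℂ k (2 + l) f) * ‖w‖ ^ 2 := by gcongr
      _ = _ := by ring
  rw [← Real.norm_of_nonneg (show (0:ℝ) ≤ ‖z‖ ^ k by positivity), ← norm_smul]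
  refine ContinuousMultilinearMap.opNorm_le_bound (by positivity) fun m => ?_
  rw [smul_apply, norm_smul,
    Real.norm_of_nonneg (show (0:ℝ) ≤ ‖z‖ ^ k by positivity)]
  exact hm m


theorem norm_iteratedFDeriv_comp_fst_le (f : 𝓢(E, ℂ)) (i : ℕ) (z : E × F) :
    ‖iteratedFDeriv ℝ i (fun z : E × F => f z.1) z‖ ≤ ‖iteratedFDeriv ℝ i f z.1‖ := by
  have h : (fun z : E × F => f z.1) = f ∘ ContinuousLinearMap.fst ℝ E F := rfl
  rw [h, ContinuousLinearMap.iteratedFDeriv_comp_right _ (f.smooth i) z le_rfl]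
  refine ((iteratedFDeriv ℝ i f _).norm_compContinuousLinearMap_le _).trans ?_
  have : (∏ _i : Fin i, ‖ContinuousLinearMap.fst ℝ E F‖) ≤ 1 :=
    Finset.prod_le_one (fun _ _ => norm_nonneg _) fun _ _ => ContinuousLinearMap.norm_fst_le ℝ E F
  exact mul_le_of_le_one_right (norm_nonneg _) this

theorem norm_iteratedFDeriv_comp_snd_le (f : 𝓢(F, ℂ)) (i : ℕ) (z : E × F) :
    ‖iteratedFDeriv ℝ i (fun z : E × F => f z.2) z‖ ≤ ‖iteratedFDeriv ℝ i f z.2‖ := by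
  have h : (fun z : E × F => f z.2) = f ∘ ContinuousLinearMap.snd ℝ E F := rfl
  rw [h, ContinuousLinearMap.iteratedFDeriv_comp_right _ (f.smooth i) z le_rfl]
  refine ((iteratedFDeriv ℝ i f _).norm_compContinuousLinearMap_le _).trans ?_
  have : (∏ _i : Fin i, ‖ContinuousLinearMap.snd ℝ E F‖) ≤ 1 :=
    Finset.prod_le_one (fun _ _ => norm_nonneg _) fun _ _ => ContinuousLinearMap.norm_snd_le ℝ E F
  exact mul_le_of_le_one_right (norm_nonneg _) this

/-- The tensor product `(f ⊗ g) (x, y) = f x * g y` of Schwartz functions. -/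
def tensorFun (f : 𝓢(E, ℂ)) (g : 𝓢(F, ℂ)) : 𝓢(E × F, ℂ) where
  toFun z := f z.1 * g z.2
  smooth' := ((f.smooth ⊤).comp contDiff_fst).mul ((g.smooth ⊤).comp contDiff_snd)
  decay' k n := by
    refine ⟨∑ i ∈ Finset.range (n + 1), (n.choose i : ℝ) *
      (SchwartzMap.seminorm ℂ k i f * SchwartzMap.seminorm ℂ 0 (n - i) g +
        SchwartzMap.seminorm ℂ 0 i f * SchwartzMap.seminorm ℂ k (n - i) g), fun z => ?_⟩
    have h := norm_iteratedFDeriv_mul_le (𝕜 := ℝ) (N := ∞) (n := n)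
      (f := fun z : E × F => f z.1) (g := fun z : E × F => g z.2)
      ((f.smooth ⊤).comp contDiff_fst) ((g.smooth ⊤).comp contDiff_snd) z
      (by exact_mod_cast le_top)
    have hz : ‖z‖ ^ k ≤ ‖z.1‖ ^ k + ‖z.2‖ ^ k := by
      rcases max_cases ‖z.1‖ ‖z.2‖ with ⟨h, -⟩ | ⟨h, -⟩ <;>
        rw [Prod.norm_def, h] <;> simp
    calc _ ≤ (‖z.1‖ ^ k + ‖z.2‖ ^ k) * ∑ i ∈ Finset.range (n + 1), (n.choose i : ℝ) *
            ‖iteratedFDeriv ℝ i (fun z : E × F => f z.1) z‖ *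
            ‖iteratedFDeriv ℝ (n - i) (fun z : E × F => g z.2) z‖ := by gcongr
      _ ≤ (‖z.1‖ ^ k + ‖z.2‖ ^ k) * ∑ i ∈ Finset.range (n + 1), (n.choose i : ℝ) *
            ‖iteratedFDeriv ℝ i f z.1‖ * ‖iteratedFDeriv ℝ (n - i) g z.2‖ := by
          gcongr
          · exact norm_iteratedFDeriv_comp_fst_le _ _ _
          · exact norm_iteratedFDeriv_comp_snd_le _ _ _
      _ = ∑ i ∈ Finset.range (n + 1), (n.choose i : ℝ) *
            ((‖z.1‖ ^ k * ‖iteratedFDeriv ℝ i f z.1‖) *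
              (‖z.2‖ ^ 0 * ‖iteratedFDeriv ℝ (n - i) g z.2‖) +
             (‖z.1‖ ^ 0 * ‖iteratedFDeriv ℝ i f z.1‖) *
              (‖z.2‖ ^ k * ‖iteratedFDeriv ℝ (n - i) g z.2‖)) := by
          rw [Finset.mul_sum]
          exact Finset.sum_congr rfl fun i _ => by ring
      _ ≤ _ := by
          gcongr <;> exact SchwartzMap.le_seminorm ℂ _ _ _ _

@[simp] theorem tensorFun_apply (f : 𝓢(E, ℂ)) (g : 𝓢(F, ℂ)) (z : E × F) :
    tensorFun f g z = f z.1 * g z.2 := rfl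

/-- The partial function `y ↦ f (x, y)` of a Schwartz function `f` of two variables. -/
def slice (x : E) : 𝓢(E × F, ℂ) →L[ℂ] 𝓢(F, ℂ) :=
  SchwartzMap.compCLM ℂ (g := fun y : F => ((x, y) : E × F))
    (by
      have h : (fun y : F => ((x, y) : E × F)) =
          (fun y => ContinuousLinearMap.inr ℝ E F y) + fun _ => ((x, 0) : E × F) := by
        ext y <;> simp
      rw [h]
      exact (ContinuousLinearMap.hasTemperateGrowth _).add (Function.HasTemperateGrowth.const _))
    ⟨1, 1, fun y => by
      have : ‖y‖ ≤ ‖((x, y) : E × F)‖ := le_max_right _ _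
      simp only [pow_one, one_mul]; linarith⟩

@[simp] theorem slice_apply (x : E) (f : 𝓢(E × F, ℂ)) (y : F) : slice x f y = f (x, y) := rfl

theorem seminorm_slice_le (x : E) (f : 𝓢(E × F, ℂ)) (j k l : ℕ) :
    ‖x‖ ^ j * SchwartzMap.seminorm ℂ k l (slice x f) ≤ SchwartzMap.seminorm ℂ (j + k) l f := by
  have hx : (0 : ℝ) ≤ ‖x‖ ^ j := by positivity
  rw [show ‖x‖ ^ j * SchwartzMap.seminorm ℂ k l (slice x f) =
    SchwartzMap.seminorm ℂ k l (((‖x‖ ^ j : ℝ) : ℂ) • slice x f) by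
      rw [map_smul_eq_mul, Complex.norm_of_nonneg hx]]
  refine SchwartzMap.seminorm_le_bound ℂ k l _ (by positivity) fun y => ?_
  have h1 : (⇑(((‖x‖ ^ j : ℝ) : ℂ) • slice x f) : F → ℂ) =
      fun y => (‖x‖ ^ j : ℝ) • slice x f y := by
    ext y; simp
  have hs : ContDiffAt ℝ l (slice x f) y := (slice x f).contDiffAt l
  rw [h1, show (fun y => (‖x‖ ^ j : ℝ) • slice x f y) = (‖x‖ ^ j : ℝ) • ⇑(slice x f) from rfl,
    iteratedFDeriv_const_smul_apply hs, norm_smul, Real.norm_of_nonneg hx]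
  have h2 : (⇑(slice x f) : F → ℂ) =
      (fun z : E × F => f ((x, 0) + z)) ∘ ContinuousLinearMap.inr ℝ E F := by
    ext y; simp
  have h3 : ‖iteratedFDeriv ℝ l (slice x f) y‖ ≤ ‖iteratedFDeriv ℝ l f (x, y)‖ := by
    have hd : ContDiff ℝ l (fun z : E × F => f ((x, 0) + z)) :=
      (f.smooth l).comp (contDiff_const.add contDiff_id)
    rw [h2, ContinuousLinearMap.iteratedFDeriv_comp_right _ hd y le_rfl,
      iteratedFDeriv_comp_add_left]
    have := (iteratedFDeriv ℝ l f ((x, 0) + ContinuousLinearMap.inr ℝ E F y)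
      ).norm_compContinuousLinearMap_le (fun _ : Fin l => ContinuousLinearMap.inr ℝ E F)
    refine this.trans ?_
    have hn : ‖ContinuousLinearMap.inr ℝ E F‖ ≤ 1 :=
      ContinuousLinearMap.opNorm_le_bound _ zero_le_one fun v => by simp
    have : (∏ _i : Fin l, ‖ContinuousLinearMap.inr ℝ E F‖) ≤ 1 :=
      Finset.prod_le_one (fun _ _ => norm_nonneg _) fun _ _ => hn
    calc _ ≤ ‖iteratedFDeriv ℝ l f ((x, 0) + ContinuousLinearMap.inr ℝ E F y)‖ * 1 := by gcongr
      _ = _ := by simp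
  have hx1 : ‖x‖ ≤ ‖((x, y) : E × F)‖ := le_max_left _ _
  have hy1 : ‖y‖ ≤ ‖((x, y) : E × F)‖ := le_max_right _ _
  calc _ ≤ ‖((x, y) : E × F)‖ ^ k * (‖((x, y) : E × F)‖ ^ j * ‖iteratedFDeriv ℝ l f (x, y)‖) := by
        gcongr
    _ = ‖((x, y) : E × F)‖ ^ (j + k) * ‖iteratedFDeriv ℝ l f (x, y)‖ := by ring
    _ ≤ _ := SchwartzMap.le_seminorm ℂ _ _ _ _

theorem distribution_bound (S : 𝓢'(F, ℂ)) : ∃ (s : Finset (ℕ × ℕ)) (C : ℝ), 0 ≤ C ∧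
    ∀ g : 𝓢(F, ℂ), ‖S g‖ ≤ C * ∑ i ∈ s, SchwartzMap.seminorm ℂ i.1 i.2 g := by
  have hc : Continuous (fun g : 𝓢(F, ℂ) => S g) := S.continuous
  obtain ⟨s, C, hb⟩ := Seminorm.bound_of_continuous (schwartz_withSeminorms ℂ F ℂ)
    ((normSeminorm ℂ ℂ).comp S.toLinearMap) (by
      exact continuous_norm.comp hc)
  refine ⟨s, C, C.2, fun g => ?_⟩
  obtain ⟨-, h⟩ := hb
  have h1 := h g
  refine (show ‖S g‖ ≤ _ from h1).trans ?_
  rw [smul_apply, NNReal.smul_def, smul_eq_mul]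
  gcongr
  refine Seminorm.finset_sup_apply_le (Finset.sum_nonneg fun i _ => apply_nonneg _ _) fun i hi => ?_
  exact Finset.single_le_sum (f := fun i : ℕ × ℕ => SchwartzMap.seminorm ℂ i.1 i.2 g)
    (fun i _ => apply_nonneg _ _) hi

variable [FiniteDimensional ℝ E]

theorem hasFDerivAt_pairing (S : 𝓢'(F, ℂ)) (f : 𝓢(E × F, ℂ)) (x : E) :
    ∃ L : E →L[ℝ] ℂ, HasFDerivAt (fun x => S (slice x f)) L x ∧
      ∀ v, L v = S (slice x (∂_{((v, 0) : E × F)} f)) := by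
  obtain ⟨s, C, hC, hS⟩ := distribution_bound S
  let L₀ : E →ₗ[ℝ] ℂ :=
    { toFun := fun v => S (slice x (∂_{((v, 0) : E × F)} f))
      map_add' := fun v w => by
        rw [← map_add, ← map_add, ← lineDerivOp_left_add]; simp
      map_smul' := fun c v => by
        have : (((c • v, 0) : E × F)) = c • (v, 0) := by simp
        rw [this, lineDerivOp_left_smul]
        have h2 : c • (∂_{((v, 0) : E × F)} f) = (c : ℂ) • (∂_{((v, 0) : E × F)} f) := by
          ext z; simp
        rw [h2, map_smul, map_smul]; simp }
  refine ⟨LinearMap.toContinuousLinearMap L₀, ?_, fun v => rfl⟩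
  set B : ℝ := C * ∑ i ∈ s, 2 ^ i.1 * (SchwartzMap.seminorm ℂ 0 (2 + i.2) f +
    SchwartzMap.seminorm ℂ i.1 (2 + i.2) f) with hB
  have key : ∀ v : E, ‖v‖ ≤ 1 →
      ‖S (slice (x + v) f) - S (slice x f) - S (slice x (∂_{((v, 0) : E × F)} f))‖ ≤
        B * ‖v‖ ^ 2 := by
    intro v hv
    have hw : ‖((v, 0) : E × F)‖ = ‖v‖ := by simp
    have e : S (slice (x + v) f) - S (slice x f) - S (slice x (∂_{((v, 0) : E × F)} f)) =
        S (slice x (f.compSubConstCLM ℂ (-((v, 0) : E × F)) - f - ∂_{((v, 0) : E × F)} f)) := by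
      rw [← map_sub, ← map_sub, map_sub (slice x), map_sub (slice x)]
      congr 3
      ext y; simp
    rw [e]
    refine (hS _).trans ?_
    rw [hB, mul_assoc, Finset.sum_mul]
    gcongr with i hi
    have h1 := seminorm_slice_le x
      (f.compSubConstCLM ℂ (-((v, 0) : E × F)) - f - ∂_{((v, 0) : E × F)} f) 0 i.1 i.2
    rw [pow_zero, one_mul, zero_add] at h1
    refine h1.trans ?_
    have h2 := seminorm_translate_sub_le f i.1 i.2 ((v, 0) : E × F) (by rw [hw]; exact hv)
    rwa [hw] at h2
  rw [hasFDerivAt_iff_isLittleO_nhds_zero]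
  refine Asymptotics.IsBigO.trans_isLittleO (g := fun v : E => ‖v‖ ^ 2) ?_ ?_
  · refine Asymptotics.IsBigO.of_bound B ?_
    filter_upwards [Metric.closedBall_mem_nhds (0 : E) one_pos] with v hv
    rw [Real.norm_of_nonneg (by positivity)]
    exact key v (by simpa using hv)
  · exact (Asymptotics.isLittleO_norm_pow_id one_lt_two)

theorem fderiv_pairing_apply (S : 𝓢'(F, ℂ)) (f : 𝓢(E × F, ℂ)) (x v : E) :
    fderiv ℝ (fun x => S (slice x f)) x v = S (slice x (∂_{((v, 0) : E × F)} f)) := by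
  obtain ⟨L, h, hL⟩ := hasFDerivAt_pairing S f x
  rw [h.fderiv, hL]

theorem contDiff_pairing_nat (S : 𝓢'(F, ℂ)) : ∀ (n : ℕ) (f : 𝓢(E × F, ℂ)),
    ContDiff ℝ n (fun x => S (slice x f)) := by
  intro n
  induction n with
  | zero =>
    intro f
    refine contDiff_zero.2 (continuous_iff_continuousAt.2 fun x => ?_)
    obtain ⟨L, h, -⟩ := hasFDerivAt_pairing S f x
    exact h.continuousAt
  | succ n ih =>
    intro f
    push_cast
    rw [contDiff_succ_iff_fderiv]
    refine ⟨fun x => ?_, by simp, ?_⟩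
    · obtain ⟨L, h, -⟩ := hasFDerivAt_pairing S f x
      exact h.differentiableAt
    · rw [contDiff_clm_apply_iff]
      intro v
      simp_rw [fderiv_pairing_apply]
      exact ih _

theorem contDiff_pairing (S : 𝓢'(F, ℂ)) (f : 𝓢(E × F, ℂ)) :
    ContDiff ℝ ∞ (fun x => S (slice x f)) :=
  contDiff_infty.2 fun n => contDiff_pairing_nat S n f

theorem iteratedFDeriv_pairing (S : 𝓢'(F, ℂ)) : ∀ (n : ℕ) (f : 𝓢(E × F, ℂ)) (x : E)
    (m : Fin n → E), iteratedFDeriv ℝ n (fun x => S (slice x f)) x m =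
      S (slice x (∂^{fun i => ((m i, 0) : E × F)} f)) := by
  intro n
  induction n with
  | zero => intro f x m; simp
  | succ n ih =>
    intro f x m
    rw [iteratedFDeriv_succ_apply_right, iteratedLineDerivOp_succ_right]
    have hc : ContDiff ℝ n (fderiv ℝ (fun x => S (slice x f))) :=
      (contDiff_pairing S f).fderiv_right (by exact_mod_cast le_top)
    rw [← iteratedFDeriv_clm_apply_const_apply hc le_rfl]
    simp_rw [fderiv_pairing_apply]
    rw [ih]
    rfl

theorem partialEval_bound (S : 𝓢'(F, ℂ)) (k n : ℕ) :
    ∃ (t : Finset (ℕ × ℕ)) (C : ℝ), 0 ≤ C ∧ ∀ (f : 𝓢(E × F, ℂ)) (x : E),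
      ‖x‖ ^ k * ‖iteratedFDeriv ℝ n (fun x => S (slice x f)) x‖ ≤
        C * t.sup (schwartzSeminormFamily ℂ (E × F) ℂ) f := by
  obtain ⟨s, C, hC, hS⟩ := distribution_bound S
  refine ⟨s.image (fun i => (k + i.1, i.2 + n)), C * s.card, by positivity, fun f x => ?_⟩
  have h3 : ∀ i ∈ s, SchwartzMap.seminorm ℂ (k + i.1) (i.2 + n) f ≤
      (s.image (fun i => (k + i.1, i.2 + n))).sup (schwartzSeminormFamily ℂ (E × F) ℂ) f :=
    fun i hi => (Finset.le_sup (f := schwartzSeminormFamily ℂ (E × F) ℂ)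
      (Finset.mem_image_of_mem (fun i : ℕ × ℕ => (k + i.1, i.2 + n)) hi)) f
  generalize (s.image (fun i => (k + i.1, i.2 + n))).sup
    (schwartzSeminormFamily ℂ (E × F) ℂ) = p at h3 ⊢
  have hx : (0 : ℝ) ≤ ‖x‖ ^ k := by positivity
  have hp : 0 ≤ p f := apply_nonneg _ _
  rw [← Real.norm_of_nonneg hx, ← norm_smul]
  refine ContinuousMultilinearMap.opNorm_le_bound (by positivity) fun m => ?_
  rw [smul_apply, norm_smul, Real.norm_of_nonneg hx, iteratedFDeriv_pairing]
  set g : 𝓢(E × F, ℂ) := ∂^{fun i => ((m i, 0) : E × F)} f with hg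
  have h1 : ∀ i ∈ s, ‖x‖ ^ k * SchwartzMap.seminorm ℂ i.1 i.2 (slice x g) ≤
      (∏ j, ‖m j‖) * p f := by
    intro i hi
    refine (seminorm_slice_le x g k i.1 i.2).trans ?_
    refine (seminorm_iteratedLineDeriv_le (k + i.1) n f i.2 _).trans ?_
    have h2 : (∏ j, ‖((m j, 0) : E × F)‖) = ∏ j, ‖m j‖ := by simp
    rw [h2]
    exact mul_le_mul_of_nonneg_left (h3 i hi) (by positivity)
  calc ‖x‖ ^ k * ‖S (slice x g)‖
      ≤ ‖x‖ ^ k * (C * ∑ i ∈ s, SchwartzMap.seminorm ℂ i.1 i.2 (slice x g)) := by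
        gcongr; exact hS _
    _ = C * ∑ i ∈ s, ‖x‖ ^ k * SchwartzMap.seminorm ℂ i.1 i.2 (slice x g) := by
        rw [← Finset.mul_sum]; ring
    _ ≤ C * ∑ i ∈ s, (∏ j, ‖m j‖) * p f :=
        mul_le_mul_of_nonneg_left (Finset.sum_le_sum h1) hC
    _ = C * s.card * p f * ∏ j, ‖m j‖ := by rw [Finset.sum_const, nsmul_eq_mul]; ring

/-- Evaluation of a tempered distribution in the second variable only: `f ↦ (x ↦ S (f (x, ·)))`.
The result is a Schwartz function of the first variable. -/
def partialEval (S : 𝓢'(F, ℂ)) : 𝓢(E × F, ℂ) →L[ℂ] 𝓢(E, ℂ) :=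
  SchwartzMap.mkCLM (𝕜 := ℂ) (𝕜' := ℂ) (fun f x => S (slice x f))
    (fun f g x => by simp) (fun a f x => by simp) (fun f => contDiff_pairing S f)
    (fun n => partialEval_bound S n.1 n.2)

@[simp] theorem partialEval_apply (S : 𝓢'(F, ℂ)) (f : 𝓢(E × F, ℂ)) (x : E) :
    partialEval S f x = S (slice x f) := rfl

/-- The tensor product `T ⊗ S` of tempered distributions, `(T ⊗ S) f = T (x ↦ S (y ↦ f (x, y)))`. -/
def tensorDist (T : 𝓢'(E, ℂ)) (S : 𝓢'(F, ℂ)) : 𝓢'(E × F, ℂ) :=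
  PointwiseConvergenceCLM.precomp ℂ (partialEval (E := E) (F := F) S) T

@[simp] theorem tensorDist_apply (T : 𝓢'(E, ℂ)) (S : 𝓢'(F, ℂ)) (f : 𝓢(E × F, ℂ)) :
    tensorDist T S f = T (partialEval S f) := rfl

end Pairing

/-! ### Minkowski space and configuration spaces -/

/-- Space-time `ℝ^d` with `d = s + 1`: coordinate `0` is time, the other `s` coordinates are
space. -/
abbrev Spacetime (s : ℕ) : Type := EuclideanSpace ℝ (Fin (s + 1))

/-- The Minkowski product `x · y = x⁰ y⁰ - 𝐱 · 𝐲`. -/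
def mink {s : ℕ} (x y : Spacetime s) : ℝ := x 0 * y 0 - ∑ j : Fin s, x j.succ * y j.succ

/-- The open forward cone `{k | k² > m², k⁰ > 0}`. -/
def forwardCone (s : ℕ) (m : ℝ) : Set (Spacetime s) := {k | m ^ 2 < mink k k ∧ 0 < k 0}

/-- The energy `ω = (|𝐤|² + m²)^{1/2}`. -/
def energy {s : ℕ} (m : ℝ) (k : Spacetime s) : ℝ := √(∑ j : Fin s, k j.succ ^ 2 + m ^ 2)

/-- Tuples `(x_i)_{i ∈ ι}` of space-time points, i.e. `ℝ^{dn}` for `ι = Fin n`. -/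
abbrev Conf (s : ℕ) (ι : Type) : Type := PiLp 2 (fun _ : ι => Spacetime s)

instance (s : ℕ) (ι : Type) [Fintype ι] : ContinuousSMul ℝ (Conf s ι) :=
  IsBoundedSMul.continuousSMul (α := ℝ) (β := Conf s ι)

/-- `ℝ^{dn} × ℝ^{dm} ≃ ℝ^{d(n+m)}`. -/
def appendLinear (s n m : ℕ) : (Conf s (Fin n) × Conf s (Fin m)) ≃ₗ[ℝ] Conf s (Fin (n + m)) where
  toFun p := WithLp.toLp 2 (Fin.append (fun i => p.1 i) (fun i => p.2 i))
  invFun x := (WithLp.toLp 2 (fun i => x (Fin.castAdd m i)),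
    WithLp.toLp 2 (fun i => x (Fin.natAdd n i)))
  left_inv p := by
    refine Prod.ext (PiLp.ext fun i => ?_) (PiLp.ext fun i => ?_) <;> simp
  right_inv x := by
    refine PiLp.ext fun i => ?_
    refine Fin.addCases (fun i => ?_) (fun i => ?_) i <;> simp
  map_add' p q := by
    refine PiLp.ext fun i => ?_
    refine Fin.addCases (fun i => ?_) (fun i => ?_) i <;> simp
  map_smul' c p := by
    refine PiLp.ext fun i => ?_
    refine Fin.addCases (fun i => ?_) (fun i => ?_) i <;> simp

/-- `ℝ^{dn} × ℝ^{dm} ≃ ℝ^{d(n+m)}`. -/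
def appendEquiv (s n m : ℕ) : (Conf s (Fin n) × Conf s (Fin m)) ≃L[ℝ] Conf s (Fin (n + m)) :=
  (appendLinear s n m).toContinuousLinearEquiv

/-- Splitting off the first of `r + 1` blocks of variables, of sizes `κ 0, …, κ r`. -/
def consLinear (s r : ℕ) (κ : Fin (r + 1) → ℕ) :
    (Conf s (Fin (κ 0)) × Conf s (Σ j : Fin r, Fin (κ j.succ))) ≃ₗ[ℝ]
      Conf s (Σ j : Fin (r + 1), Fin (κ j)) where
  toFun p := WithLp.toLp 2 (fun a =>
    Fin.cases (motive := fun j => Fin (κ j) → Spacetime s)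
      (fun i => p.1 i) (fun j i => p.2 ⟨j, i⟩) a.1 a.2)
  invFun x := (WithLp.toLp 2 (fun i => x ⟨0, i⟩), WithLp.toLp 2 (fun a => x ⟨a.1.succ, a.2⟩))
  left_inv p := by
    refine Prod.ext (PiLp.ext fun i => ?_) (PiLp.ext fun i => ?_) <;> simp
  right_inv x := by
    refine PiLp.ext fun ⟨j, i⟩ => ?_
    induction j using Fin.cases <;> simp
  map_add' p q := by
    refine PiLp.ext fun ⟨j, i⟩ => ?_
    induction j using Fin.cases <;> simp
  map_smul' c p := by
    refine PiLp.ext fun ⟨j, i⟩ => ?_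
    induction j using Fin.cases <;> simp

/-- Splitting off the first of `r + 1` blocks of variables, of sizes `κ 0, …, κ r`. -/
def consEquiv (s r : ℕ) (κ : Fin (r + 1) → ℕ) :
    (Conf s (Fin (κ 0)) × Conf s (Σ j : Fin r, Fin (κ j.succ))) ≃L[ℝ]
      Conf s (Σ j : Fin (r + 1), Fin (κ j)) :=
  (consLinear s r κ).toContinuousLinearEquiv

/-- Renaming the variables of a configuration along a bijection. -/
def renameEquiv (s : ℕ) {ι κ : Type} [Fintype ι] [Fintype κ] (e : ι ≃ κ) :
    Conf s ι ≃L[ℝ] Conf s κ :=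
  (LinearIsometryEquiv.piLpCongrLeft 2 ℝ (Spacetime s) e).toContinuousLinearEquiv

@[simp] theorem renameEquiv_apply (s : ℕ) {ι κ : Type} [Fintype ι] [Fintype κ] (e : ι ≃ κ)
    (x : Conf s ι) (k : κ) : renameEquiv s e x k = x (e.symm k) := rfl

/-- Precomposition of a Schwartz function with a linear isomorphism. -/
abbrev pullback {V W : Type*} [NormedAddCommGroup V] [NormedSpace ℝ V] [NormedAddCommGroup W]
    [NormedSpace ℝ W] (e : V ≃L[ℝ] W) : 𝓢(W, ℂ) →L[ℂ] 𝓢(V, ℂ) :=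
  SchwartzMap.compCLMOfContinuousLinearEquiv ℂ e

/-- The image of a tempered distribution under a linear isomorphism. -/
def pushDist {V W : Type*} [NormedAddCommGroup V] [NormedSpace ℝ V] [NormedAddCommGroup W]
    [NormedSpace ℝ W] (e : V ≃L[ℝ] W) (T : 𝓢'(V, ℂ)) : 𝓢'(W, ℂ) :=
  PointwiseConvergenceCLM.precomp ℂ (pullback e) T

@[simp] theorem pushDist_apply {V W : Type*} [NormedAddCommGroup V] [NormedSpace ℝ V]
    [NormedAddCommGroup W] [NormedSpace ℝ W] (e : V ≃L[ℝ] W) (T : 𝓢'(V, ℂ)) (f : 𝓢(W, ℂ)) :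
    pushDist e T f = T (pullback e f) := rfl

/-! ### The Fourier transform with the Minkowski product -/

/-- The linear map `k ↦ a (k⁰, -𝐤)` in every variable. -/
def reflectScale (s n : ℕ) (a : ℝ) : Conf s (Fin n) →ₗ[ℝ] Conf s (Fin n) where
  toFun k := WithLp.toLp 2 (fun l => WithLp.toLp 2 (fun j => a * (if j = 0 then k l j else - k l j)))
  map_add' k q := by
    refine PiLp.ext fun l => PiLp.ext fun j => ?_
    by_cases h : j = 0 <;> simp [h] <;> ring
  map_smul' c k := by
    refine PiLp.ext fun l => PiLp.ext fun j => ?_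
    by_cases h : j = 0 <;> simp [h] <;> ring

theorem reflectScale_comp (s n : ℕ) (a b : ℝ) (h : a * b = 1) :
    reflectScale s n a ∘ₗ reflectScale s n b = LinearMap.id := by
  refine LinearMap.ext fun k => PiLp.ext fun l => PiLp.ext fun j => ?_
  by_cases hj : j = 0 <;> simp [hj, reflectScale, ← mul_assoc, h]

/-- The linear isomorphism `k ↦ (2π)⁻¹ (k⁰, -𝐤)` in every variable; it turns the Euclidean phase
`2π ⟨x, ·⟩` into the Minkowski phase `x · k`. -/
def phaseEquiv (s n : ℕ) : Conf s (Fin n) ≃L[ℝ] Conf s (Fin n) :=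
  (LinearEquiv.ofLinearMap (reflectScale s n (2 * Real.pi)⁻¹) (reflectScale s n (2 * Real.pi))
    (reflectScale_comp s n _ _ (inv_mul_cancel₀ Real.two_pi_pos.ne'))
    (reflectScale_comp s n _ _ (mul_inv_cancel₀ Real.two_pi_pos.ne'))).toContinuousLinearEquiv

/-- The normalization `(2π)^{-dn/2}`. -/
def fourierConst (s n : ℕ) : ℂ := (((2 * Real.pi) ^ (-(((s + 1) * n : ℕ) : ℝ) / 2) : ℝ) : ℂ)

/-- The Fourier transform
`𝓕 f (k₁,…,kₙ) = (2π)^{-dn/2} ∫ e^{-i (x₁·k₁ + ⋯ + xₙ·kₙ)} f (x₁,…,xₙ) dx₁⋯dxₙ`. -/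
def fourierM (s n : ℕ) : 𝓢(Conf s (Fin n), ℂ) →L[ℂ] 𝓢(Conf s (Fin n), ℂ) :=
  fourierConst s n • (pullback (phaseEquiv s n) ∘L fourierCLM ℂ 𝓢(Conf s (Fin n), ℂ))

/-- The inverse Fourier transform (phase `e^{+i (x₁·k₁ + ⋯ + xₙ·kₙ)}`). -/
def fourierMInv (s n : ℕ) : 𝓢(Conf s (Fin n), ℂ) →L[ℂ] 𝓢(Conf s (Fin n), ℂ) :=
  fourierConst s n • (pullback (phaseEquiv s n) ∘L fourierInvCLM ℂ 𝓢(Conf s (Fin n), ℂ))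

theorem inner_phaseEquiv {s n : ℕ} (x k : Conf s (Fin n)) :
    inner ℝ x (phaseEquiv s n k) = (2 * Real.pi)⁻¹ * ∑ l, mink (x l) (k l) := by
  have h : ∀ l j, (phaseEquiv s n k) l j =
      (2 * Real.pi)⁻¹ * (if j = 0 then k l j else - k l j) := fun _ _ => rfl
  rw [PiLp.inner_apply, Finset.mul_sum]
  refine Finset.sum_congr rfl fun l _ => ?_
  rw [PiLp.inner_apply, Fin.sum_univ_succ, mink]
  simp only [h, Fin.succ_ne_zero, if_true, if_false, RCLike.inner_apply, conj_trivial]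
  rw [mul_sub, Finset.mul_sum, sub_eq_add_neg, ← Finset.sum_neg_distrib]
  congr 1
  · ring
  · exact Finset.sum_congr rfl fun j _ => by ring

theorem fourierM_apply {s n : ℕ} (f : 𝓢(Conf s (Fin n), ℂ)) (k : Conf s (Fin n)) :
    fourierM s n f k = fourierConst s n *
      ∫ x : Conf s (Fin n), Complex.exp (-(Complex.I * (∑ l, mink (x l) (k l) : ℝ))) * f x := by
  have h : fourierM s n f k = fourierConst s n * 𝓕 (f : Conf s (Fin n) → ℂ) (phaseEquiv s n k) :=
    rfl
  rw [h, Real.fourier_eq']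
  congr 1
  refine integral_congr_ae (Filter.Eventually.of_forall fun x => ?_)
  have hpi : (Real.pi : ℂ) ≠ 0 := by exact_mod_cast Real.pi_ne_zero
  simp only [inner_phaseEquiv, smul_eq_mul]
  congr 2
  push_cast
  field_simp

/-! ### The Borchers algebra -/

/-- Degree `n` part of the Borchers algebra over `𝓢(ℝ^d, ℂ^C)`: Schwartz functions of `n` space-time
points with values in `(ℂ^C)^{⊗ n}`, given by their components. -/
abbrev TestFun (s : ℕ) (C : Type) (n : ℕ) : Type := (Fin n → C) → 𝓢(Conf s (Fin n), ℂ)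

/-- The Borchers algebra over `𝓢(ℝ^d, ℂ^C)`. For `C = Unit` this is the Borchers algebra over
`𝓢(ℝ^d)`. Degree `0` consists of the functions on a one-point space, i.e. of `ℂ`. -/
abbrev Borchers (s : ℕ) (C : Type) : Type := ⨁ n : ℕ, TestFun s C n

/-- The three labels of the extended Borchers algebra. -/
inductive Label where
  | inn : Label
  | loc : Label
  | out : Label
  deriving DecidableEq

instance : Fintype Label where
  elems := {Label.inn, Label.loc, Label.out}
  complete := fun a => by cases a <;> simp

/-- `(f ⊗ h)(x₁,…,x_{n+m}) = f (x₁,…,xₙ) h (x_{n+1},…,x_{n+m})`. -/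
def schwartzTensor {s n m : ℕ} (f : 𝓢(Conf s (Fin n), ℂ)) (h : 𝓢(Conf s (Fin m), ℂ)) :
    𝓢(Conf s (Fin (n + m)), ℂ) :=
  pullback (appendEquiv s n m).symm (tensorFun f h)

@[simp] theorem schwartzTensor_apply {s n m : ℕ} (f : 𝓢(Conf s (Fin n), ℂ))
    (h : 𝓢(Conf s (Fin m), ℂ)) (x : Conf s (Fin (n + m))) :
    schwartzTensor f h x = f (WithLp.toLp 2 (fun i => x (Fin.castAdd m i))) *
      h (WithLp.toLp 2 (fun i => x (Fin.natAdd n i))) := rfl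

/-- The product of homogeneous elements. -/
def tmulHom (s : ℕ) (C : Type) (n m : ℕ) :
    TestFun s C n →ₗ[ℂ] TestFun s C m →ₗ[ℂ] Borchers s C :=
  LinearMap.mk₂ ℂ (fun f h => DirectSum.lof ℂ ℕ (TestFun s C) (n + m) (fun w =>
      schwartzTensor (f (w ∘ Fin.castAdd m)) (h (w ∘ Fin.natAdd n))))
    (fun f f' h => by
      rw [← map_add]; congr 1; ext w x; simp [add_mul])
    (fun c f h => by
      rw [← map_smul]; congr 1; ext w x; simp [mul_assoc])
    (fun f h h' => by
      rw [← map_add]; congr 1; ext w x; simp [mul_add])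
    (fun c f h => by
      rw [← map_smul]; congr 1; ext w x; simp [mul_left_comm])

/-- The multiplication `f ⊗ h` of the Borchers algebra. -/
def tmul {s : ℕ} {C : Type} : Borchers s C →ₗ[ℂ] Borchers s C →ₗ[ℂ] Borchers s C :=
  DirectSum.toModule ℂ ℕ _ fun n =>
    (DirectSum.toModule ℂ ℕ _ fun m => (tmulHom s C n m).flip).flip

theorem tmul_lof {s : ℕ} {C : Type} {n m : ℕ} (f : TestFun s C n) (h : TestFun s C m) :
    tmul (DirectSum.lof ℂ ℕ (TestFun s C) n f) (DirectSum.lof ℂ ℕ (TestFun s C) m h) =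
      DirectSum.lof ℂ ℕ (TestFun s C) (n + m) (fun w =>
        schwartzTensor (f (w ∘ Fin.castAdd m)) (h (w ∘ Fin.natAdd n))) := by
  simp [tmul, tmulHom]

/-- `f* (x₁,…,xₙ) = conj (f (xₙ,…,x₁))`, with the order of the labels reversed as well. -/
def starHom (s : ℕ) (C : Type) (n : ℕ) : TestFun s C n →+ TestFun s C n where
  toFun f := fun w => (pullback (renameEquiv s Fin.revPerm) (f (w ∘ Fin.rev))).postcompCLM
    (Complex.conjCLE : ℂ →L[ℝ] ℂ)
  map_zero' := by ext w x; simp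
  map_add' f g := by ext w x; simp

@[simp] theorem starHom_apply (s : ℕ) (C : Type) (n : ℕ) (f : TestFun s C n) (w : Fin n → C)
    (x : Conf s (Fin n)) : starHom s C n f w x =
      (starRingEnd ℂ) (f (w ∘ Fin.rev) (WithLp.toLp 2 fun i => x i.rev)) := rfl

/-- The involution of the Borchers algebra. -/
def bstar {s : ℕ} {C : Type} : Borchers s C →+ Borchers s C := DirectSum.map (starHom s C)

/-! ### Wightman functionals -/

/-- The dual of the Borchers algebra over `𝓢(ℝ^d, ℂ^C)`: a continuous functional is a sequence of
tempered distributions, given by their components. For `C = Unit` these are the Wightman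
functionals. -/
abbrev Functional (s : ℕ) (C : Type) : Type := (n : ℕ) → (Fin n → C) → 𝓢'(Conf s (Fin n), ℂ)

/-- The value of a functional, as a linear form on the Borchers algebra. -/
def Functional.eval {s : ℕ} {C : Type} [Fintype C] (W : Functional s C) : Borchers s C →ₗ[ℂ] ℂ :=
  DirectSum.toModule ℂ ℕ ℂ fun n => ∑ w : Fin n → C, (W n w).toLinearMap ∘ₗ LinearMap.proj w

theorem Functional.eval_lof {s : ℕ} {C : Type} [Fintype C] (W : Functional s C) (n : ℕ)
    (f : TestFun s C n) : W.eval (DirectSum.lof ℂ ℕ (TestFun s C) n f) = ∑ w, W n w (f w) := by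
  simp [Functional.eval]
  rfl

/-! ### Truncation -/

/-- The tensor product of `r` tempered distributions in blocks of variables of sizes `κ j`.
The empty product is evaluation at the only point of the configuration space. -/
def tensorFamily (s : ℕ) : (r : ℕ) → (κ : Fin r → ℕ) → ((j : Fin r) → 𝓢'(Conf s (Fin (κ j)), ℂ)) →
    𝓢'(Conf s (Σ j : Fin r, Fin (κ j)), ℂ)
  | 0, _, _ => TemperedDistribution.delta 0
  | r + 1, κ, T => pushDist (consEquiv s r κ)
      (tensorDist (T 0) (tensorFamily s r (fun j => κ j.succ) (fun j => T j.succ)))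

/-- For a partition `c` of `(1,…,n)` into blocks `λ_j` (with the natural order in each block) and
distributions `T j` in `|λ_j|` variables: the product `∏_j T_j(x_{λ_j})`.
`OrderedFinpartition n` enumerates the set partitions of `{1,…,n}`, each exactly once. -/
def blockProduct {s n : ℕ} (c : OrderedFinpartition n)
    (T : (j : Fin c.length) → 𝓢'(Conf s (Fin (c.partSize j)), ℂ)) : 𝓢'(Conf s (Fin n), ℂ) :=
  pushDist (renameEquiv s c.equivSigma) (tensorFamily s c.length c.partSize T)

theorem partSize_lt_of_one_lt_length {n : ℕ} (c : OrderedFinpartition n) (h : 1 < c.length)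
    (j : Fin c.length) : c.partSize j < n := by
  have hsum : ∑ i, c.partSize i = n := by
    have := c.sum_sigma_eq_sum (fun _ => 1)
    simpa using this
  obtain ⟨i, hi⟩ : ∃ i : Fin c.length, i ≠ j :=
    haveI : Nontrivial (Fin c.length) := Fin.nontrivial_iff_two_le.2 h
    exists_ne j
  have h2 : c.partSize j + c.partSize i ≤ ∑ i, c.partSize i := by
    rw [← Finset.sum_pair hi.symm]
    exact Finset.sum_le_sum_of_subset (Finset.subset_univ _)
  have := c.partSize_pos i
  omega

/-- The truncated functional `W^T`: `W^T_0 = 0`, and `W^T_n` is obtained from `W_n` by subtracting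
the products of truncated functions over all partitions into at least two blocks. See
`Functional.eq_sum_trunc` for the defining relation. -/
def Functional.trunc {s : ℕ} {C : Type} (W : Functional s C) (n : ℕ) (w : Fin n → C) :
    𝓢'(Conf s (Fin n), ℂ) :=
  if n = 0 then 0 else
    W n w - ∑ c : {c : OrderedFinpartition n // 1 < c.length},
      blockProduct c.1 (fun j => W.trunc (c.1.partSize j) (w ∘ c.1.emb j))
termination_by n
decreasing_by exact partSize_lt_of_one_lt_length c.1 c.2 j

/-- The partition with a single block. -/
def singleBlock {n : ℕ} (hn : 0 < n) : OrderedFinpartition n where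
  length := 1
  partSize _ := n
  partSize_pos _ := hn
  emb _ i := i
  emb_strictMono _ := strictMono_id
  parts_strictMono := Subsingleton.strictMono _
  disjoint := fun i _ j _ h => (h (Subsingleton.elim i j)).elim
  cover x := ⟨0, x, rfl⟩

theorem eq_singleBlock {n : ℕ} (hn : 0 < n) (c : OrderedFinpartition n) (h : ¬ 1 < c.length) :
    c = singleBlock hn := by
  have h1 : c.length = 1 := by
    have := c.length_pos hn
    omega
  have hsum : ∑ i, c.partSize i = n := by
    have := c.sum_sigma_eq_sum (fun _ => 1)
    simpa using this
  obtain ⟨length, partSize, hp, emb, hm, hps, hd, hc⟩ := c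
  simp only at h1 hsum
  subst h1
  obtain rfl : partSize = fun _ => n := by
    funext i
    have : i = 0 := Subsingleton.elim _ _
    subst this
    simpa using hsum
  obtain rfl : emb = fun _ i => i := by
    funext i
    have hs : StrictMono (emb i) := hm i
    have hsurj : Function.Surjective (emb i) := Finite.surjective_of_injective hs.injective
    let e : Fin n ≃o Fin n := StrictMono.orderIsoOfSurjective _ hs hsurj
    have he : e = OrderIso.refl _ := Subsingleton.elim _ _
    funext a
    exact DFunLike.congr_fun he a
  rfl

theorem blockProduct_singleBlock {s n : ℕ} (hn : 0 < n) (T : 𝓢'(Conf s (Fin n), ℂ)) :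
    blockProduct (singleBlock hn) (fun _ => T) = T := by
  have hi : ∀ i, (singleBlock hn).equivSigma.symm i = ⟨(⟨0, Nat.one_pos⟩ : Fin 1), i⟩ := by
    intro i
    rw [Equiv.symm_apply_eq]; rfl
  have hx : ∀ y i, renameEquiv s (singleBlock hn).equivSigma y i =
      y ⟨(⟨0, Nat.one_pos⟩ : Fin 1), i⟩ := by
    intro y i
    rw [renameEquiv_apply, hi]
  ext f
  change T _ = T f
  refine congrArg T (SchwartzMap.ext fun x => congrArg f (PiLp.ext fun i => ?_))
  exact hx _ i

theorem sum_partitions_eq {s n : ℕ} (hn : 0 < n)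
    (T : (c : OrderedFinpartition n) → (j : Fin c.length) → 𝓢'(Conf s (Fin (c.partSize j)), ℂ)) :
    ∑ c : OrderedFinpartition n, blockProduct c (T c) =
      (∑ c : {c : OrderedFinpartition n // 1 < c.length}, blockProduct c.1 (T c.1)) +
        blockProduct (singleBlock hn) (T (singleBlock hn)) := by
  classical
  rw [← Fintype.sum_subtype_add_sum_subtype (fun c : OrderedFinpartition n => 1 < c.length)]
  congr 1
  let c₀ : {c : OrderedFinpartition n // ¬ 1 < c.length} :=
    ⟨singleBlock hn, by simp [singleBlock]⟩
  rw [Fintype.sum_eq_single c₀ (fun c hc => (hc (Subtype.ext (eq_singleBlock hn c.1 c.2))).elim)]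

/-- The defining relation `W(1,…,n) = ∑_{λ ∈ P(1,…,n)} ∏_l W^T(λ_l)` of truncation, `n ≥ 1`. -/
theorem Functional.eq_sum_trunc {s : ℕ} {C : Type} (W : Functional s C) {n : ℕ} (hn : 0 < n)
    (w : Fin n → C) : W n w = ∑ c : OrderedFinpartition n,
      blockProduct c (fun j => W.trunc (c.partSize j) (w ∘ c.emb j)) := by
  rw [sum_partitions_eq hn (fun c j => W.trunc (c.partSize j) (w ∘ c.emb j))]
  have h1 : blockProduct (singleBlock hn) (fun j => W.trunc ((singleBlock hn).partSize j)
      (w ∘ (singleBlock hn).emb j)) = W n w -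
        ∑ c : {c : OrderedFinpartition n // 1 < c.length},
          blockProduct c.1 (fun j => W.trunc (c.1.partSize j) (w ∘ c.1.emb j)) := by
    refine (blockProduct_singleBlock hn (W.trunc n w)).trans ?_
    rw [Functional.trunc, if_neg hn.ne']
  rw [h1]
  abel

theorem Functional.trunc_zero {s : ℕ} {C : Type} (W : Functional s C) (w : Fin 0 → C) :
    W.trunc 0 w = 0 := by
  rw [Functional.trunc]; simp

/-! ### Bilinear functionals and their truncation -/

/-- Continuous bilinear functionals on the Borchers algebra over `𝓢(ℝ^d)`, given by their kernels
`S_{n,m}`, tempered distributions in `n + m` variables. -/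
abbrev BiFunctional (s : ℕ) : Type := (n m : ℕ) → 𝓢'(Conf s (Fin (n + m)), ℂ)

/-- `S(f, g) = ∑_{n,m} S_{n,m}(f_n ⊗ g_m)`. -/
def BiFunctional.eval {s : ℕ} (S : BiFunctional s) :
    Borchers s Unit →ₗ[ℂ] Borchers s Unit →ₗ[ℂ] ℂ :=
  DirectSum.toModule ℂ ℕ _ fun n => (DirectSum.toModule ℂ ℕ _ fun m =>
    (LinearMap.mk₂ ℂ (fun (f : TestFun s Unit n) (h : TestFun s Unit m) =>
        S n m (schwartzTensor (f fun _ => ()) (h fun _ => ())))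
      (fun f f' h => by
        rw [← map_add]; congr 1; ext x; simp [add_mul])
      (fun c f h => by
        rw [← map_smul]; congr 1; ext x; simp [mul_assoc])
      (fun f h h' => by
        rw [← map_add]; congr 1; ext x; simp [mul_add])
      (fun c f h => by
        rw [← map_smul]; congr 1; ext x; simp [mul_left_comm])).flip).flip

theorem BiFunctional.eval_lof {s : ℕ} (S : BiFunctional s) {n m : ℕ} (f : TestFun s Unit n)
    (h : TestFun s Unit m) :
    S.eval (DirectSum.lof ℂ ℕ (TestFun s Unit) n f) (DirectSum.lof ℂ ℕ (TestFun s Unit) m h) =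
      S n m (schwartzTensor (f fun _ => ()) (h fun _ => ())) := by
  simp [BiFunctional.eval]

/-- For a partition of `(1,…,N)` into blocks `λ_j`: the number of elements of
`λ_j^< = λ_j ∩ (1,…,n)`. -/
def lowSize (n : ℕ) {N : ℕ} (c : OrderedFinpartition N) (j : Fin c.length) : ℕ :=
  (Finset.univ.filter fun i => (c.emb j i : ℕ) < n).card

/-- The number of elements of `λ_j^> = λ_j ∩ (n+1,…,N)`. -/
def highSize (n : ℕ) {N : ℕ} (c : OrderedFinpartition N) (j : Fin c.length) : ℕ :=
  (Finset.univ.filter fun i => ¬ (c.emb j i : ℕ) < n).card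

theorem lowSize_add_highSize (n : ℕ) {N : ℕ} (c : OrderedFinpartition N) (j : Fin c.length) :
    lowSize n c j + highSize n c j = c.partSize j := by
  rw [lowSize, highSize, Finset.card_filter_add_card_filter_not]
  simp

/-- The kernel `S_{q,r}` with `q = |λ_j^<|`, `r = |λ_j^>|`, as a distribution in the `q + r`
variables of `λ_j`; in the natural order of `λ_j`, those of `λ_j^<` come first. -/
def BiFunctional.onBlock {s : ℕ} (S : BiFunctional s) (n : ℕ) {N : ℕ} (c : OrderedFinpartition N)
    (j : Fin c.length) : 𝓢'(Conf s (Fin (c.partSize j)), ℂ) :=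
  pushDist (renameEquiv s (finCongr (lowSize_add_highSize n c j)))
    (S (lowSize n c j) (highSize n c j))

/-- The truncated bilinear functional `S^T`, with `S^T_{0,0} = 0`. See
`BiFunctional.eq_sum_trunc` for the defining relation. -/
def BiFunctional.trunc {s : ℕ} (S : BiFunctional s) (n m : ℕ) : 𝓢'(Conf s (Fin (n + m)), ℂ) :=
  if n + m = 0 then 0 else
    S n m - ∑ c : {c : OrderedFinpartition (n + m) // 1 < c.length},
      blockProduct c.1 (fun j => pushDist (renameEquiv s (finCongr (lowSize_add_highSize n c.1 j)))
        (S.trunc (lowSize n c.1 j) (highSize n c.1 j)))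
termination_by n + m
decreasing_by
  rw [lowSize_add_highSize n c.1 j]
  exact partSize_lt_of_one_lt_length c.1 c.2 j

/-- The defining relation
`S(1,…,n; n+1,…,n+m) = ∑_{λ ∈ P(1,…,n+m)} ∏_l S^T(λ_l^<, λ_l^>)`, `n + m ≥ 1`. -/
theorem BiFunctional.eq_sum_trunc {s : ℕ} (S : BiFunctional s) {n m : ℕ} (h : 0 < n + m) :
    S n m = ∑ c : OrderedFinpartition (n + m),
      blockProduct c (fun j => BiFunctional.onBlock S.trunc n c j) := by
  rw [sum_partitions_eq h (fun c j => BiFunctional.onBlock S.trunc n c j)]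
  have h0 : ∀ (a b : ℕ) (hab : a + b = n + m), a = n → b = m →
      pushDist (renameEquiv s (finCongr hab)) (S.trunc a b) = S.trunc n m := by
    intro a b hab ha hb
    subst ha hb
    rfl
  have hc : (Finset.univ.filter fun i : Fin (n + m) => (i : ℕ) < n).card = n := by
    rw [Fin.card_filter_val_lt]; omega
  have hl : lowSize n (singleBlock h) (⟨0, Nat.one_pos⟩ : Fin 1) = n := hc
  have hh : highSize n (singleBlock h) (⟨0, Nat.one_pos⟩ : Fin 1) = m := by
    have h2 := lowSize_add_highSize n (singleBlock h) (⟨0, Nat.one_pos⟩ : Fin 1)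
    rw [hl] at h2
    have h3 : (singleBlock h).partSize (⟨0, Nat.one_pos⟩ : Fin 1) = n + m := rfl
    omega
  have h1 : blockProduct (singleBlock h) (fun j => BiFunctional.onBlock S.trunc n (singleBlock h) j)
      = S n m - ∑ c : {c : OrderedFinpartition (n + m) // 1 < c.length},
          blockProduct c.1 (fun j => BiFunctional.onBlock S.trunc n c.1 j) := by
    have h2 : (fun j => BiFunctional.onBlock S.trunc n (singleBlock h) j) =
        fun _ => S.trunc n m := by
      funext j
      obtain rfl : j = (⟨0, Nat.one_pos⟩ : Fin 1) := Subsingleton.elim (α := Fin 1) _ _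
      exact h0 _ _ _ hl hh
    rw [h2]
    refine (blockProduct_singleBlock h (S.trunc n m)).trans ?_
    rw [BiFunctional.trunc, if_neg h.ne']
    rfl
  rw [h1]
  abel

/-! ### The Poincaré group -/

/-- A proper orthochronous Poincaré transformation `{Λ, a}`. The action of the covering group on
test functions factors through these. -/
structure Poincare (s : ℕ) where
  Λ : Spacetime s ≃ₗ[ℝ] Spacetime s
  a : Spacetime s
  isometry : ∀ x y, mink (Λ x) (Λ y) = mink x y
  proper : LinearMap.det (Λ : Spacetime s →ₗ[ℝ] Spacetime s) = 1
  orthochronous : 0 < Λ (EuclideanSpace.single 0 1) 0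

/-- The translation `{1, a}`. -/
def Poincare.translation {s : ℕ} (a : Spacetime s) : Poincare s where
  Λ := LinearEquiv.refl ℝ _
  a := a
  isometry _ _ := rfl
  proper := by simp
  orthochronous := by simp

/-- A linear map of space-time acting on every variable. -/
def diagLinear {s n : ℕ} (Λ : Spacetime s →ₗ[ℝ] Spacetime s) :
    Conf s (Fin n) →ₗ[ℝ] Conf s (Fin n) where
  toFun x := WithLp.toLp 2 (fun l => Λ (x l))
  map_add' x y := PiLp.ext fun l => by simp
  map_smul' c x := PiLp.ext fun l => by simp

/-- A linear isomorphism of space-time acting on every variable. -/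
def diagEquiv {s n : ℕ} (Λ : Spacetime s ≃ₗ[ℝ] Spacetime s) :
    Conf s (Fin n) ≃L[ℝ] Conf s (Fin n) :=
  (LinearEquiv.ofLinearMap (diagLinear (Λ : Spacetime s →ₗ[ℝ] Spacetime s))
    (diagLinear (Λ.symm : Spacetime s →ₗ[ℝ] Spacetime s))
    (LinearMap.ext fun x => PiLp.ext fun l => by simp [diagLinear])
    (LinearMap.ext fun x => PiLp.ext fun l => by simp [diagLinear])).toContinuousLinearEquiv

/-- `(α_{Λ,a} f)(x₁,…,xₙ) = f (Λ⁻¹(x₁ - a),…,Λ⁻¹(xₙ - a))`. -/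
def Poincare.act {s : ℕ} (P : Poincare s) (n : ℕ) :
    𝓢(Conf s (Fin n), ℂ) →L[ℂ] 𝓢(Conf s (Fin n), ℂ) :=
  SchwartzMap.compSubConstCLM ℂ (WithLp.toLp 2 fun _ => P.a) ∘L pullback (diagEquiv P.Λ.symm)

theorem Poincare.act_apply {s : ℕ} (P : Poincare s) {n : ℕ} (f : 𝓢(Conf s (Fin n), ℂ))
    (x : Conf s (Fin n)) :
    P.act n f x = f (WithLp.toLp 2 fun l => P.Λ.symm (x l - P.a)) := rfl

/-- The representation `α` on the Borchers algebra. -/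
def Poincare.alpha {s : ℕ} {C : Type} (P : Poincare s) : Borchers s C →ₗ[ℂ] Borchers s C :=
  DirectSum.lmap fun n => LinearMap.compLeft (P.act n).toLinearMap (Fin n → C)

/-! ### Properties of functionals -/

/-- `W_0 = 1`. -/
def Functional.IsNormalized {s : ℕ} {C : Type} (W : Functional s C) : Prop :=
  ∀ w, W 0 w = TemperedDistribution.delta 0

/-- Poincaré invariance. -/
def Functional.IsPoincareInvariant {s : ℕ} {C : Type} [Fintype C] (W : Functional s C) : Prop :=
  ∀ (P : Poincare s) (f : Borchers s C), W.eval (P.alpha f) = W.eval f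

/-- The left ideal generated by the homogeneous elements `f_n` with
`supp 𝓕 f_n ⊆ {k | k₁ + ⋯ + kₙ ∉ closed forward cone}`. -/
def spectralIdeal (s : ℕ) : Submodule ℂ (Borchers s Unit) :=
  Submodule.span ℂ {x | ∃ (g : Borchers s Unit) (n : ℕ) (f : TestFun s Unit n),
    (∀ w, tsupport (fourierM s n (f w)) ⊆ {k | ∑ l, k l ∉ closure (forwardCone s 0)}) ∧
      x = tmul g (DirectSum.lof ℂ ℕ (TestFun s Unit) n f)}

/-- The vector space generated by the homogeneous elements `f_n` with
`supp 𝓕 f_n ⊆ {k | ∃ j, 2 ≤ j ≤ n, k_j + ⋯ + kₙ ∉ closed forward cone of mass m₀}`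
(variables are numbered from `0` here). -/
def massGapSpace (s : ℕ) (m₀ : ℝ) : Submodule ℂ (Borchers s Unit) :=
  Submodule.span ℂ {x | ∃ (n : ℕ) (f : TestFun s Unit n),
    (∀ w, tsupport (fourierM s n (f w)) ⊆
      {k | ∃ j : Fin n, 1 ≤ (j : ℕ) ∧ ∑ l ∈ Finset.Ici j, k l ∉ closure (forwardCone s m₀)}) ∧
      x = DirectSum.lof ℂ ℕ (TestFun s Unit) n f}

/-- The element `(0, f, 0, …)` of the Borchers algebra. -/
def oneParticle {s : ℕ} (f : 𝓢(Conf s (Fin 1), ℂ)) : Borchers s Unit :=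
  DirectSum.lof ℂ ℕ (TestFun s Unit) 1 (fun _ => f)

/-- The two-sided ideal generated by the commutators `[f, h]` of `f, h ∈ 𝓢(ℝ^d)` with space-like
separated supports. -/
def localityIdeal (s : ℕ) : Submodule ℂ (Borchers s Unit) :=
  Submodule.span ℂ {x | ∃ (g g' : Borchers s Unit) (f h : 𝓢(Conf s (Fin 1), ℂ)),
    (∀ y ∈ tsupport f, ∀ z ∈ tsupport h, mink (y 0 - z 0) (y 0 - z 0) < 0) ∧
      x = tmul (tmul g (tmul (oneParticle f) (oneParticle h) -
        tmul (oneParticle h) (oneParticle f))) g'}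

/-- Hermiticity `W* = W`, i.e. `W(f*) = conj (W(f))`. -/
def Functional.IsHermitian {s : ℕ} {C : Type} [Fintype C] (W : Functional s C) : Prop :=
  ∀ f : Borchers s C, W.eval (bstar f) = (starRingEnd ℂ) (W.eval f)

/-- The Hilbert space structure condition: there is a Hilbert seminorm `p` on the Borchers algebra
(a seminorm which satisfies the parallelogram law and is continuous for the direct sum topology)
such that `|W(f* ⊗ g)| ≤ p(f) p(g)`. -/
def Functional.HSSC {s : ℕ} {C : Type} [Fintype C] (W : Functional s C) : Prop :=
  ∃ p : Seminorm ℂ (Borchers s C),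
    (∀ f g, p (f + g) ^ 2 + p (f - g) ^ 2 = 2 * (p f ^ 2 + p g ^ 2)) ∧
    (∀ n, Continuous fun f : TestFun s C n => p (DirectSum.lof ℂ ℕ (TestFun s C) n f)) ∧
    ∀ f g, ‖W.eval (tmul (bstar f) g)‖ ≤ p f * p g

/-- The Schwartz norm
`‖f‖_{K,L} = sup_{x, |β₁|,…,|βₙ| ≤ K} |∏_l (1 + |x_l|²)^{L/2} D^{β₁⋯βₙ} f (x₁,…,xₙ)|`.
The multi-indices `β₁,…,βₙ` are encoded by a list of pairs `(l, j)`, one for each derivative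
`∂/∂x_l^j`, in which every `l` occurs at most `K` times. -/
def schwartzNorm {s n : ℕ} (K L : ℕ) (f : 𝓢(Conf s (Fin n), ℂ)) : ℝ :=
  ⨆ β : {β : List (Fin n × Fin (s + 1)) // ∀ l, (β.map Prod.fst).count l ≤ K},
    ⨆ x : Conf s (Fin n), (∏ l, (1 + ‖x l‖ ^ 2) ^ ((L : ℝ) / 2)) *
      ‖iteratedFDeriv ℝ β.1.length f x (fun i => PiLp.single 2 (β.1.get i).1
        (EuclideanSpace.single (β.1.get i).2 (1 : ℝ)))‖

/-- The seminorms on the Borchers algebra whose restriction to every degree is bounded by a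
multiple of `‖·‖_{K,L}`. -/
def gammaSeminorms (s : ℕ) (C : Type) [Fintype C] (K L : ℕ) : Set (Seminorm ℂ (Borchers s C)) :=
  {p | ∀ n, ∃ M : ℝ, ∀ f : TestFun s C n,
    p (DirectSum.lof ℂ ℕ (TestFun s C) n f) ≤ M * ∑ w, schwartzNorm K L (f w)}

instance (s : ℕ) (C : Type) [Fintype C] (K L : ℕ) : Nonempty (gammaSeminorms s C K L) :=
  ⟨⟨0, fun n => ⟨0, fun f => by simp⟩⟩⟩

/-- The strongest locally convex topology `γ_{K,L}` on the Borchers algebra which restricts to the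
topology of the norm `‖·‖_{K,L}` in every degree. -/
@[reducible] def gammaKL (s : ℕ) (C : Type) [Fintype C] (K L : ℕ) : TopologicalSpace (Borchers s C) :=
  (SeminormFamily.moduleFilterBasis
    (fun p : gammaSeminorms s C K L => (p : Seminorm ℂ (Borchers s C)))).topology

/-- The topology `γ` generated by all the topologies `γ_{K,L}`. -/
@[reducible] def gammaTopology (s : ℕ) (C : Type) [Fintype C] : TopologicalSpace (Borchers s C) :=
  ⨅ K : ℕ, ⨅ L : ℕ, gammaKL s C K L

/-- `γ`-continuity. -/
def Functional.IsGammaContinuous {s : ℕ} {C : Type} [Fintype C] (W : Functional s C) : Prop :=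
  Continuous[gammaTopology s C, inferInstance] W.eval

/-- The modified Wightman axioms of quantum field theory with indefinite metric. -/
structure WightmanAxioms {s : ℕ} (W : Functional s Unit) : Prop where
  normalized : W.IsNormalized
  poincare : W.IsPoincareInvariant
  spectral : spectralIdeal s ≤ LinearMap.ker W.eval
  locality : localityIdeal s ≤ LinearMap.ker W.eval
  hilbert : W.HSSC
  cluster : ∀ (f g : Borchers s Unit) (a : Spacetime s), mink a a < 0 →
    Tendsto (fun t : ℝ => W.eval (tmul f ((Poincare.translation (t • a)).alpha g))) atTop
      (𝓝 (W.eval f * W.eval g))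
  hermitian : W.IsHermitian

/-- The axioms transcribed to truncated Wightman functionals. -/
structure TruncatedAxioms {s : ℕ} (W : Functional s Unit) : Prop where
  zero : ∀ w, W 0 w = 0
  poincare : W.IsPoincareInvariant
  spectral : spectralIdeal s ≤ LinearMap.ker W.eval
  locality : localityIdeal s ≤ LinearMap.ker W.eval
  gamma : W.IsGammaContinuous
  cluster : ∀ (f g : Borchers s Unit) (a : Spacetime s), f 0 = 0 → g 0 = 0 → mink a a < 0 →
    Tendsto (fun t : ℝ => W.eval (tmul f ((Poincare.translation (t • a)).alpha g))) atTop (𝓝 0)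
  hermitian : W.IsHermitian

/-- Mass gap `m₀` of a truncated functional. -/
def HasMassGap {s : ℕ} (m₀ : ℝ) (WT : Functional s Unit) : Prop :=
  massGapSpace s m₀ ≤ LinearMap.ker WT.eval

/-! ### The two-point function -/

/-- The point `(-ω_μ, 𝐤)` of the backward mass shell of mass `μ`. -/
def backwardShell {s : ℕ} (μ : ℝ) (p : EuclideanSpace ℝ (Fin s)) : Spacetime s :=
  WithLp.toLp 2 (Fin.cons (-√(‖p‖ ^ 2 + μ ^ 2)) (fun j => p j))

/-- The distribution `δ_μ^-(k₁) δ(k₁ + k₂)`, `δ_μ^-(k) = θ(-k⁰) δ(k² - μ²)`, evaluated at `h`: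
`∫ h (k, -k)|_{k = (-ω_μ, 𝐤)} d𝐤 / (2 ω_μ)`. -/
def shellIntegral {s : ℕ} (μ : ℝ) (h : 𝓢(Conf s (Fin 2), ℂ)) : ℂ :=
  ∫ p : EuclideanSpace ℝ (Fin s), ((2 * √(‖p‖ ^ 2 + μ ^ 2) : ℝ) : ℂ)⁻¹ *
    h (WithLp.toLp 2 ![backwardShell μ p, -backwardShell μ p])

/-- The Fourier transform of the truncated two-point function is
`[δ_m^-(k₁) + ∫_{m₀}^∞ δ_μ^-(k₁) ρ(μ) dμ] δ(k₁ + k₂)` with a positive, polynomially bounded, locally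
integrable density `ρ`. The Fourier transform acts on functionals by `Ŵ(h) = W(𝓕⁻¹ h)`. -/
def HasTwoPointForm {s : ℕ} (m m₀ : ℝ) (WT : Functional s Unit) : Prop :=
  ∃ ρ : ℝ → ℝ, (∀ μ, m₀ ≤ μ → 0 ≤ ρ μ) ∧ (∃ (A : ℝ) (N : ℕ), ∀ μ, m₀ ≤ μ → ρ μ ≤ A * (1 + μ) ^ N) ∧
    LocallyIntegrableOn ρ (Set.Ici m₀) ∧
    ∀ (w : Fin 2 → Unit) (h : 𝓢(Conf s (Fin 2), ℂ)), WT 2 w (fourierMInv s 2 h) =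
      shellIntegral m h + ∫ μ in Set.Ioi m₀, shellIntegral μ h * (ρ μ : ℂ)

/-! ### Wave operators, form factor functional and scattering matrix -/

/-- The injection `J^a` of the Borchers algebra into the component `a` of the extended one. -/
def J {s : ℕ} (a : Label) : Borchers s Unit →ₗ[ℂ] Borchers s Label :=
  DirectSum.lmap fun _ => LinearMap.pi fun w =>
    if w = fun _ => a then LinearMap.proj (fun _ => ()) else 0

/-- The projection of the extended Borchers algebra, induced by
`(f^in, f^loc, f^out) ↦ f^in + f^loc + f^out`. -/
def Jsum {s : ℕ} : Borchers s Label →ₗ[ℂ] Borchers s Unit :=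
  DirectSum.lmap fun n => LinearMap.pi fun _ => ∑ w : Fin n → Label, LinearMap.proj w

/-- `χ^+(k) = θ(k⁰) φ(k² - m²)`. -/
def chiPlus {s : ℕ} (m : ℝ) (φ : ℝ → ℝ) (k : Spacetime s) : ℝ :=
  if 0 < k 0 then φ (mink k k - m ^ 2) else 0

/-- `χ^-(k) = θ(-k⁰) φ(k² - m²)`. -/
def chiMinus {s : ℕ} (m : ℝ) (φ : ℝ → ℝ) (k : Spacetime s) : ℝ :=
  if k 0 < 0 then φ (mink k k - m ^ 2) else 0

/-- The multiplier `χ_t(a, k)`. -/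
def chi {s : ℕ} (m : ℝ) (φ : ℝ → ℝ) (t : ℝ) (a : Label) (k : Spacetime s) : ℂ :=
  match a with
  | Label.inn =>
    chiPlus m φ k * Complex.exp (-(Complex.I * ((k 0 - energy m k) * t : ℝ))) +
      chiMinus m φ k * Complex.exp (-(Complex.I * ((k 0 + energy m k) * t : ℝ)))
  | Label.loc => 1
  | Label.out =>
    chiPlus m φ k * Complex.exp (Complex.I * ((k 0 - energy m k) * t : ℝ)) +
      chiMinus m φ k * Complex.exp (Complex.I * ((k 0 + energy m k) * t : ℝ))

/-- The component of `Ω_{n,t} = Ω_{t¹} ⊗ ⋯ ⊗ Ω_{tⁿ}` with labels `w = (a₁,…,aₙ)`: multiplication by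
`∏_l χ_{t^l}(a_l, k_l)` in momentum space. (For `m > 0`, `φ` smooth and supported in `(-ε, ε)` with
`ε < m²` this is a smooth function of temperate growth, so that the multiplication is defined.) -/
def omegaComp {s : ℕ} (m : ℝ) (φ : ℝ → ℝ) {n : ℕ} (t : Fin n → ℝ) (w : Fin n → Label) :
    𝓢(Conf s (Fin n), ℂ) →L[ℂ] 𝓢(Conf s (Fin n), ℂ) :=
  fourierMInv s n ∘L
    SchwartzMap.smulLeftCLM ℂ (fun k : Conf s (Fin n) => ∏ l, chi m φ (t l) (w l) (k l)) ∘L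
    fourierM s n

/-- The finite times wave operator `Ω_t = J ∘ ⨁ₙ Ω_{n,tₙ}`. -/
def waveOperator {s : ℕ} (m : ℝ) (φ : ℝ → ℝ) (t : (n : ℕ) → Fin n → ℝ) :
    Borchers s Label →ₗ[ℂ] Borchers s Unit :=
  Jsum ∘ₗ DirectSum.lmap fun n => LinearMap.pi fun w =>
    (omegaComp m φ (t n) w).toLinearMap ∘ₗ LinearMap.proj w

/-- The component of degree `n` with labels `w` of the functional `W ∘ Ω_t`; it depends on the
times `tₙ = (tₙ¹,…,tₙⁿ)` only. -/
def Functional.compOmega {s : ℕ} (m : ℝ) (φ : ℝ → ℝ) (W : Functional s Unit) {n : ℕ}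
    (w : Fin n → Label) (t : Fin n → ℝ) : 𝓢'(Conf s (Fin n), ℂ) :=
  PointwiseConvergenceCLM.precomp ℂ (omegaComp m φ t w) (W n fun _ => ())

theorem Functional.eval_waveOperator {s : ℕ} (m : ℝ) (φ : ℝ → ℝ) (W : Functional s Unit)
    (t : (n : ℕ) → Fin n → ℝ) (f : Borchers s Label) :
    W.eval (waveOperator m φ t f) =
      Functional.eval (fun n w => W.compOmega m φ w (t n)) f := by
  induction f using DirectSum.induction_on with
  | zero => simp
  | add f g hf hg => rw [map_add, map_add, map_add, hf, hg]
  | of n f =>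
    rw [← DirectSum.lof_eq_of ℂ, Functional.eval_lof, waveOperator, Jsum, LinearMap.comp_apply,
      DirectSum.lmap_lof, DirectSum.lmap_lof, Functional.eval_lof, Fintype.sum_unique]
    simp [Functional.compOmega]
    rfl

/-- `HasIterLim [i₁,…,i_r] g L`: the iterated limit of `g(t)`, in which first `t_{i₁} → +∞`, then
`t_{i₂} → +∞`, and so on, exists and equals `L`. -/
def HasIterLim {ι X : Type*} [DecidableEq ι] [TopologicalSpace X] :
    List ι → ((ι → ℝ) → X) → X → Prop
  | [], g, L => ∀ t, g t = L
  | i :: is, g, L => ∃ h : (ι → ℝ) → X,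
      (∀ t, Tendsto (fun r : ℝ => g (Function.update t i r)) atTop (𝓝 (h t))) ∧ HasIterLim is h L

/-- `F = lim_{t → +∞} W ∘ Ω_t` in the dual of the extended Borchers algebra: for every degree and
every order of the times, the iterated limit exists and is given by `F`. -/
def IsFormFactor {s : ℕ} (m : ℝ) (φ : ℝ → ℝ) (W : Functional s Unit) (F : Functional s Label) :
    Prop :=
  ∀ (n : ℕ) (w : Fin n → Label) (order : List (Fin n)), order.Perm (List.finRange n) →
    HasIterLim order (fun t => W.compOmega m φ w t) (F n w)

/-- The scattering matrix `S(f, g) = F(J^in f ⊗ J^out g)`, given by its kernels. -/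
def scatteringMatrix {s : ℕ} (F : Functional s Label) : BiFunctional s :=
  fun n m => F (n + m) (Fin.append (fun _ => Label.inn) (fun _ => Label.out))

theorem scatteringMatrix_eval {s : ℕ} (F : Functional s Label) (f g : Borchers s Unit) :
    (scatteringMatrix F).eval f g = F.eval (tmul (J Label.inn f) (J Label.out g)) := by
  induction f using DirectSum.induction_on with
  | zero => simp
  | add f f' hf hf' => simp only [map_add, LinearMap.add_apply, hf, hf']
  | of n f =>
    induction g using DirectSum.induction_on with
    | zero => simp
    | add g g' hg hg' => simp only [map_add, hg, hg']
    | of k g =>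
      rw [← DirectSum.lof_eq_of ℂ, ← DirectSum.lof_eq_of ℂ, BiFunctional.eval_lof, J, J,
        DirectSum.lmap_lof, DirectSum.lmap_lof, tmul_lof, Functional.eval_lof]
      rw [Fintype.sum_eq_single (Fin.append (fun _ : Fin n => Label.inn) (fun _ => Label.out))]
      · have h1 : (Fin.append (fun _ : Fin n => Label.inn) (fun _ : Fin k => Label.out)) ∘
            Fin.castAdd k = fun _ => Label.inn := by ext; simp
        have h2 : (Fin.append (fun _ : Fin n => Label.inn) (fun _ : Fin k => Label.out)) ∘
            Fin.natAdd n = fun _ => Label.out := by ext; simp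
        simp [h1, h2, scatteringMatrix]
      · intro w hw
        have h3 : w ∘ Fin.castAdd k ≠ (fun _ => Label.inn) ∨
            w ∘ Fin.natAdd n ≠ (fun _ => Label.out) := by
          by_contra hcon
          push Not at hcon
          apply hw
          ext i
          refine Fin.addCases (fun i => ?_) (fun i => ?_) i
          · simpa using congrFun hcon.1 i
          · simpa using congrFun hcon.2 i
        have h4 : (schwartzTensor
            ((LinearMap.pi fun w : Fin n → Label => if w = fun _ => Label.inn then
              (LinearMap.proj (R := ℂ) (φ := fun _ : Fin n → Unit => 𝓢(Conf s (Fin n), ℂ))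
                fun _ => ()) else 0) f (w ∘ Fin.castAdd k))
            ((LinearMap.pi fun w : Fin k → Label => if w = fun _ => Label.out then
              (LinearMap.proj (R := ℂ) (φ := fun _ : Fin k → Unit => 𝓢(Conf s (Fin k), ℂ))
                fun _ => ()) else 0) g (w ∘ Fin.natAdd n))) = 0 := by
          ext x
          rcases h3 with h3 | h3 <;> simp [h3]
        rw [h4, map_zero]

/-- The conditions on a Wightman functional under which in- and out-states are constructed:
(s1) the modified Wightman axioms and a mass gap `m₀`, (s2) the form of the truncated two-point
function, (s3) the form factor functional exists, is Poincaré invariant and fulfills the Hilbert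
space structure condition. -/
structure ScatteringCondition {s : ℕ} (m m₀ : ℝ) (φ : ℝ → ℝ) (W : Functional s Unit) : Prop where
  wightman : WightmanAxioms W
  massGap : HasMassGap m₀ W.trunc
  twoPoint : HasTwoPointForm m m₀ W.trunc
  formFactor : ∃ F : Functional s Label, IsFormFactor m φ W F ∧ F.IsPoincareInvariant ∧ F.HSSC

end

end WightmanScattering

open WightmanScattering

/-! Truncation expresses the full functional as a sum over partitions of products of truncated
functionals in the blocks. On a product of one-particle functions (`prodFun`) the blocks decouple
and this becomes the moment-cumulant formula for numbers (`trunc_prodFun`). Most of the proof is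
carried out on such products, partition by partition. The passage to arbitrary test functions uses a
frame: a cell decomposition of the line, with Poisson summation in each cell, and its tensor powers
give expansions with rapidly decreasing coefficients and vectors of polynomial growth. Continuous
functionals are therefore determined by their values on products, and bounds and limits on products
extend through absolutely convergent series.

Form factors: the multiplier of a wave operator is a product over the momenta, so wave operators act
block by block (`compOmega_blockProduct`). Each time belongs to exactly one block, and a product of
distributions in separate variables is continuous in each factor, so iterated limits are taken
factor by factor (`HasIterLim.blockProduct`). One direction of the equivalence is then the partition
sum, the other is induction on the degree. For the scattering matrix, the labels in…in out…out keep
this form when restricted to a block, so both truncation recursions coincide.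

Axioms: invariance holds factor by factor. For hermiticity and locality, the reversal and the
adjacent transpositions permute the partitions. The spectral property holds because the closed
forward cone is stable under addition: if the total momentum is outside, the momentum of some block
is. For clustering, the partitions with a block on both sides of the split vanish in the limit and
the remaining sum factorizes; the uniform bounds needed to pass from products to all functions come
from a Baire argument.

Hilbert space structure condition: γ-continuity bounds a functional on products by a product of one
Schwartz norm whose order is the same in all degrees (`ProductBounded`). This property survives the
partition sum. It implies the condition: weighted `ℓ¹` norms of frame coefficients are dominated by
weighted `ℓ²` norms, and the constants of the degrees are absorbed by rescaling each degree. The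
argument applies to `W` and to its form factor alike. -/

namespace WightmanScattering

noncomputable section

/-! ### Seminorms on Schwartz space -/

section Seminorms

variable {E F : Type*} [NormedAddCommGroup E] [NormedSpace ℝ E]
  [NormedAddCommGroup F] [NormedSpace ℝ F]

/-- The maximum of the Schwartz seminorms with both indices at most `N`. -/
def supSeminorm (E : Type*) [NormedAddCommGroup E] [NormedSpace ℝ E] (N : ℕ) :
    Seminorm ℂ 𝓢(E, ℂ) :=
  (Finset.Iic (N, N)).sup (schwartzSeminormFamily ℂ E ℂ)

theorem seminorm_le_supSeminorm {k l N : ℕ} (hk : k ≤ N) (hl : l ≤ N) (f : 𝓢(E, ℂ)) :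
    SchwartzMap.seminorm ℂ k l f ≤ supSeminorm E N f :=
  (Finset.le_sup (f := schwartzSeminormFamily ℂ E ℂ)
    (Finset.mem_Iic.2 (Prod.mk_le_mk.2 ⟨hk, hl⟩))) f

theorem supSeminorm_le {N : ℕ} {f : 𝓢(E, ℂ)} {M : ℝ} (hM : 0 ≤ M)
    (h : ∀ k l, k ≤ N → l ≤ N → SchwartzMap.seminorm ℂ k l f ≤ M) : supSeminorm E N f ≤ M :=
  Seminorm.finset_sup_apply_le hM fun i hi =>
    h i.1 i.2 (Prod.mk_le_mk.1 (Finset.mem_Iic.1 hi)).1 (Prod.mk_le_mk.1 (Finset.mem_Iic.1 hi)).2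

theorem supSeminorm_mono {N N' : ℕ} (h : N ≤ N') (f : 𝓢(E, ℂ)) :
    supSeminorm E N f ≤ supSeminorm E N' f :=
  supSeminorm_le (apply_nonneg _ _) fun _ _ hk hl =>
    seminorm_le_supSeminorm (hk.trans h) (hl.trans h) f

theorem norm_apply_le_supSeminorm (N : ℕ) (f : 𝓢(E, ℂ)) (x : E) : ‖f x‖ ≤ supSeminorm E N f :=
  (SchwartzMap.norm_le_seminorm ℂ f x).trans (seminorm_le_supSeminorm (Nat.zero_le _) (Nat.zero_le _) f)

theorem continuous_supSeminorm (N : ℕ) : Continuous (supSeminorm E N) := by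
  refine Seminorm.continuous_of_continuousAt_zero ?_
  have h : ∀ i : ℕ × ℕ, Continuous (schwartzSeminormFamily ℂ E ℂ i) :=
    (schwartz_withSeminorms ℂ E ℂ).continuous_seminorm
  have h2 : Continuous fun f => ∑ i ∈ Finset.Iic (N, N), schwartzSeminormFamily ℂ E ℂ i f :=
    continuous_finsetSum _ fun i _ => h i
  rw [ContinuousAt, map_zero]
  have h3 := h2.tendsto 0
  simp only [map_zero, Finset.sum_const_zero] at h3
  refine squeeze_zero (fun f => apply_nonneg _ _) (fun f => ?_) h3
  refine Seminorm.finset_sup_apply_le (Finset.sum_nonneg fun _ _ => apply_nonneg _ _) fun i hi => ?_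
  exact Finset.single_le_sum (f := fun i => schwartzSeminormFamily ℂ E ℂ i f)
    (fun _ _ => apply_nonneg _ _) hi

theorem exists_le_supSeminorm (q : Seminorm ℂ 𝓢(E, ℂ)) (hq : Continuous q) :
    ∃ (N : ℕ) (C : ℝ), 0 ≤ C ∧ ∀ f, q f ≤ C * supSeminorm E N f := by
  obtain ⟨s, C, -, h⟩ := Seminorm.bound_of_continuous (schwartz_withSeminorms ℂ E ℂ) q hq
  obtain ⟨N, hN⟩ : ∃ N : ℕ, ∀ i ∈ s, i.1 ≤ N ∧ i.2 ≤ N := by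
    refine ⟨s.sup fun i => max i.1 i.2, fun i hi => ?_⟩
    have := Finset.le_sup (f := fun i : ℕ × ℕ => max i.1 i.2) hi
    exact ⟨(le_max_left _ _).trans this, (le_max_right _ _).trans this⟩
  refine ⟨N, C, C.2, fun f => (h f).trans ?_⟩
  rw [smul_apply, NNReal.smul_def, smul_eq_mul]
  gcongr
  exact Seminorm.finset_sup_apply_le (apply_nonneg _ _) fun i hi =>
    seminorm_le_supSeminorm (hN i hi).1 (hN i hi).2 f

theorem exists_clm_bound (A : 𝓢(E, ℂ) →L[ℂ] 𝓢(F, ℂ)) (N : ℕ) :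
    ∃ (N' : ℕ) (C : ℝ), 0 ≤ C ∧ ∀ f, supSeminorm F N (A f) ≤ C * supSeminorm E N' f :=
  exists_le_supSeminorm ((supSeminorm F N).comp A.toLinearMap)
    ((continuous_supSeminorm N).comp A.continuous)

theorem tendsto_schwartz_iff {ι : Type*} {l : Filter ι} {u : ι → 𝓢(E, ℂ)} {f : 𝓢(E, ℂ)} :
    Tendsto u l (𝓝 f) ↔ ∀ N, Tendsto (fun i => supSeminorm E N (u i - f)) l (𝓝 0) := by
  constructor
  · intro h N
    have h1 : Tendsto (fun i => u i - f) l (𝓝 0) := by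
      simpa using h.sub_const f
    have h2 := ((continuous_supSeminorm N).tendsto 0).comp h1
    rwa [map_zero] at h2
  · intro h
    rw [(schwartz_withSeminorms ℂ E ℂ).tendsto_nhds]
    intro i ε hε
    filter_upwards [(h (max i.1 i.2)).eventually_lt_const hε] with x hx
    exact (seminorm_le_supSeminorm (le_max_left _ _) (le_max_right _ _) _).trans_lt hx

/-- A series of Schwartz functions which converges absolutely in every Schwartz seminorm has
a sum. -/
theorem exists_hasSum_schwartz {ι : Type*} (f : ι → 𝓢(E, ℂ))
    (hf : ∀ N, Summable fun i => supSeminorm E N (f i)) :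
    ∃ h : 𝓢(E, ℂ), (∀ x, HasSum (fun i => f i x) (h x)) ∧ HasSum f h := by
  have hb : ∀ (k n : ℕ) i x, ‖x‖ ^ k * ‖iteratedFDeriv ℝ n (f i) x‖ ≤ supSeminorm E (max k n) (f i) :=
    fun k n i x => (SchwartzMap.le_seminorm ℂ k n (f i) x).trans
      (seminorm_le_supSeminorm (le_max_left _ _) (le_max_right _ _) _)
  have hb0 : ∀ (n : ℕ) i x, ‖iteratedFDeriv ℝ n (f i) x‖ ≤ supSeminorm E n (f i) := fun n i x => by
    simpa using hb 0 n i x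
  have hsm : ∀ i, ContDiff ℝ (⊤ : ℕ∞) (f i) := fun i => (f i).smooth ⊤
  have hsum : ∀ n : ℕ, (n : ℕ∞) ≤ ⊤ → Summable fun i => supSeminorm E n (f i) := fun n _ => hf n
  have hsmooth : ContDiff ℝ (⊤ : ℕ∞) fun x => ∑' i, f i x :=
    contDiff_tsum hsm (fun n hn => hsum n hn) fun n i x _ => hb0 n i x
  have hder : ∀ n : ℕ, iteratedFDeriv ℝ n (fun x => ∑' i, f i x) =
      fun x => ∑' i, iteratedFDeriv ℝ n (f i) x := fun n =>
    iteratedFDeriv_tsum hsm (fun n hn => hsum n hn) (fun n i x _ => hb0 n i x) (by exact_mod_cast le_top)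
  have hdec : ∀ (s : Set ι) (k n : ℕ) x, ‖x‖ ^ k * ‖∑' i : s, iteratedFDeriv ℝ n (f i) x‖ ≤
      ∑' i : s, supSeminorm E (max k n) (f i) := by
    intro s k n x
    have h1 : Summable fun i : s => ‖iteratedFDeriv ℝ n (f i) x‖ :=
      Summable.of_nonneg_of_le (fun _ => norm_nonneg _) (fun i => hb0 n i x) ((hf n).subtype s)
    calc _ ≤ ‖x‖ ^ k * ∑' i : s, ‖iteratedFDeriv ℝ n (f i) x‖ := by
          gcongr; exact norm_tsum_le_tsum_norm h1
      _ = ∑' i : s, ‖x‖ ^ k * ‖iteratedFDeriv ℝ n (f i) x‖ := tsum_mul_left.symm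
      _ ≤ _ := Summable.tsum_le_tsum (fun i => hb k n i x) (h1.mul_left _) ((hf _).subtype s)
  let h : 𝓢(E, ℂ) :=
    { toFun := fun x => ∑' i, f i x
      smooth' := hsmooth
      decay' := fun k n => ⟨∑' i : (Set.univ : Set ι), supSeminorm E (max k n) (f i), fun x => by
        rw [hder n]
        refine le_trans (le_of_eq ?_) (hdec Set.univ k n x)
        rw [tsum_univ (fun i => iteratedFDeriv ℝ n (f i) x)]⟩ }
  have hpt : ∀ x, HasSum (fun i => f i x) (h x) := fun x =>
    (Summable.of_norm_bounded (hf 0) fun i => norm_apply_le_supSeminorm 0 (f i) x).hasSum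
  refine ⟨h, hpt, ?_⟩
  rw [HasSum, SummationFilter.unconditional_filter, tendsto_schwartz_iff]
  intro N
  have hN : Tendsto (fun s : Finset ι => ∑' i : ((s : Set ι)ᶜ : Set ι), supSeminorm E N (f i)) atTop (𝓝 0) :=
    tendsto_tsum_compl_atTop_zero fun i => supSeminorm E N (f i)
  refine squeeze_zero (fun _ => apply_nonneg _ _) (fun s => ?_) hN
  refine supSeminorm_le (tsum_nonneg fun _ => apply_nonneg _ _) fun k n hk hn => ?_
  refine SchwartzMap.seminorm_le_bound ℂ k n _ (tsum_nonneg fun _ => apply_nonneg _ _) fun x => ?_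
  -- Differentiation is termwise, so the derivatives of the error are minus the tail of the series,
  -- and the tail of the seminorms bounds them uniformly in `x`.
  have e : iteratedFDeriv ℝ n (∑ i ∈ s, f i - h : 𝓢(E, ℂ)) x =
      - ∑' i : ((s : Set ι)ᶜ : Set ι), iteratedFDeriv ℝ n (f i) x := by
    have e1 : (⇑(∑ i ∈ s, f i - h : 𝓢(E, ℂ)) : E → ℂ) = (fun y => ∑ i ∈ s, f i y) - ⇑h := by
      ext y; simp
    have c1 : ContDiffAt ℝ n (fun y => ∑ i ∈ s, f i y) x :=
      ContDiffAt.sum fun i _ => (f i).contDiffAt n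
    have e2 : iteratedFDeriv ℝ n h x = ∑' i, iteratedFDeriv ℝ n (f i) x := congrFun (hder n) x
    rw [e1, iteratedFDeriv_sub_apply c1 (h.contDiffAt n), e2,
      show (fun y => ∑ i ∈ s, f i y) = ∑ i ∈ s, ⇑(f i) by ext y; simp,
      iteratedFDeriv_sum_apply fun i _ => (f i).contDiffAt n]
    have hs : Summable fun i => iteratedFDeriv ℝ n (f i) x :=
      Summable.of_norm_bounded (hf n) fun i => hb0 n i x
    rw [← hs.sum_add_tsum_compl (s := s)]
    abel
  rw [e, norm_neg]
  refine (hdec _ k n x).trans (Summable.tsum_le_tsum (fun i => ?_) ((hf _).subtype _) ((hf N).subtype _))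
  exact supSeminorm_mono (max_le hk hn) _

theorem hasSum_schwartz {ι : Type*} {f : ι → 𝓢(E, ℂ)} {h : 𝓢(E, ℂ)}
    (hf : ∀ N, Summable fun i => supSeminorm E N (f i))
    (hp : ∀ x, HasSum (fun i => f i x) (h x)) : HasSum f h := by
  obtain ⟨h', h1, h2⟩ := exists_hasSum_schwartz f hf
  obtain rfl : h' = h := SchwartzMap.ext fun x => (h1 x).unique (hp x)
  exact h2

/-- The uniformity is countably generated, so it suffices to treat sequences whose `N`-th step is
below `2⁻¹ ^ N`; their increments form a series which converges absolutely in every seminorm.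
Completeness gives the Baire property behind the uniform boundedness principles. -/
instance : CompleteSpace 𝓢(E, ℂ) := by
  let U : ℕ → Set (𝓢(E, ℂ) × 𝓢(E, ℂ)) := fun N => {p | supSeminorm E N (p.2 - p.1) < 2⁻¹ ^ N}
  have hU : ∀ N, U N ∈ uniformity 𝓢(E, ℂ) := by
    intro N
    rw [uniformity_eq_comap_nhds_zero]
    refine ⟨{f | supSeminorm E N f < 2⁻¹ ^ N}, ?_, fun p hp => hp⟩
    refine (isOpen_lt (continuous_supSeminorm N) continuous_const).mem_nhds ?_
    simp
  have : IsCountablyGenerated (uniformity 𝓢(E, ℂ)) := IsUniformAddGroup.uniformity_countably_generated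
  refine UniformSpace.complete_of_convergent_controlled_sequences U hU fun u hu => ?_
  have hs : ∀ N, Summable fun n => supSeminorm E N (u (n + 1) - u n) := by
    intro N
    rw [← summable_nat_add_iff N]
    refine Summable.of_nonneg_of_le (fun _ => apply_nonneg _ _) (fun n => ?_)
      (summable_geometric_of_lt_one (r := (2⁻¹ : ℝ)) (by norm_num) (by norm_num))
    have h1 : supSeminorm E (n + N) (u (n + N + 1) - u (n + N)) < 2⁻¹ ^ (n + N) :=
      hu (n + N) (n + N) (n + N + 1) le_rfl (Nat.le_succ _)
    calc _ ≤ supSeminorm E (n + N) (u (n + N + 1) - u (n + N)) :=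
          supSeminorm_mono (Nat.le_add_left _ _) _
      _ ≤ 2⁻¹ ^ (n + N) := h1.le
      _ ≤ _ := pow_le_pow_of_le_one (by norm_num) (by norm_num) (Nat.le_add_right _ _)
  obtain ⟨h, -, hh⟩ := exists_hasSum_schwartz _ hs
  refine ⟨h + u 0, ?_⟩
  have h2 := hh.tendsto_sum_nat.add_const (u 0)
  refine h2.congr fun n => ?_
  rw [Finset.sum_range_sub]
  abel

instance : BaireSpace 𝓢(E, ℂ) :=
  have : IsCountablyGenerated (uniformity 𝓢(E, ℂ)) := IsUniformAddGroup.uniformity_countably_generated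
  inferInstance

/-- Uniform boundedness for tempered distributions. -/
theorem uniform_bound_of_pointwise {ι : Type*} (T : ι → 𝓢(E, ℂ) →L[ℂ] ℂ)
    (h : ∀ f, ∃ C, ∀ i, ‖T i f‖ ≤ C) :
    ∃ (N : ℕ) (C : ℝ), 0 ≤ C ∧ ∀ i f, ‖T i f‖ ≤ C * supSeminorm E N f := by
  have h1 : UniformEquicontinuous ((↑) ∘ T) :=
    (norm_withSeminorms ℂ ℂ).banach_steinhaus fun _ f => by
      obtain ⟨C, hC⟩ := h f
      exact ⟨C, by rintro _ ⟨i, rfl⟩; exact hC i⟩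
  have h2 := ((norm_withSeminorms ℂ ℂ).uniformEquicontinuous_iff_exists_continuous_seminorm
    (fun i => (T i).toLinearMap)).1 h1 0
  obtain ⟨p, hp, h3⟩ := h2
  obtain ⟨N, C, hC, h4⟩ := exists_le_supSeminorm p hp
  exact ⟨N, C, hC, fun i f => (h3 i f).trans (h4 f)⟩

/-- Uniform boundedness for bilinear forms on Schwartz space. -/
theorem uniform_bound_bilinear {ι : Type*} (B : ι → 𝓢(E, ℂ) → 𝓢(F, ℂ) →L[ℂ] ℂ)
    (hadd : ∀ i f f' g, B i (f + f') g = B i f g + B i f' g)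
    (hsmul : ∀ i (c : ℂ) f g, B i (c • f) g = c * B i f g)
    (hcont : ∀ i g, Continuous fun f => B i f g) (h : ∀ f g, ∃ C, ∀ i, ‖B i f g‖ ≤ C) :
    ∃ (N N' : ℕ) (C : ℝ), 0 ≤ C ∧
      ∀ i f g, ‖B i f g‖ ≤ C * supSeminorm E N f * supSeminorm F N' g := by
  -- Baire category in `f`. One number `M` serves as constant and as order, so countably many closed
  -- sets suffice; they cover the space by the uniform boundedness principle in `g` alone.
  let A : ℕ → Set 𝓢(E, ℂ) := fun M => {f | ∀ i g, ‖B i f g‖ ≤ M * supSeminorm F M g}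
  have hA : ∀ M, IsClosed (A M) := by
    intro M
    simp only [A, Set.ofPred_forall]
    exact isClosed_iInter fun i => isClosed_iInter fun g =>
      isClosed_le (hcont i g).norm continuous_const
  have hU : ⋃ M, A M = Set.univ := by
    refine Set.eq_univ_of_forall fun f => ?_
    obtain ⟨N, C, hC, h1⟩ := uniform_bound_of_pointwise (fun i => B i f) (h f)
    obtain ⟨M, hM⟩ := exists_nat_ge (max C N)
    refine Set.mem_iUnion.2 ⟨M, fun i g => (h1 i g).trans ?_⟩
    gcongr
    · exact (le_max_left _ _).trans hM
    · exact_mod_cast supSeminorm_mono (Nat.cast_le.1 ((le_max_right C (N : ℝ)).trans hM)) g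
  obtain ⟨M, f₀, hf₀⟩ := nonempty_interior_of_iUnion_of_closed hA hU
  rw [mem_interior_iff_mem_nhds] at hf₀
  obtain ⟨s, r, hr, hball⟩ := ((schwartz_withSeminorms ℂ E ℂ).mem_nhds_iff _ _).1 hf₀
  obtain ⟨N, hN⟩ : ∃ N, ∀ f, s.sup (schwartzSeminormFamily ℂ E ℂ) f ≤ supSeminorm E N f := by
    refine ⟨s.sup fun i => max i.1 i.2, fun f => ?_⟩
    refine Seminorm.finset_sup_apply_le (apply_nonneg _ _) fun i hi => ?_
    have := Finset.le_sup (f := fun i : ℕ × ℕ => max i.1 i.2) hi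
    exact seminorm_le_supSeminorm ((le_max_left _ _).trans this) ((le_max_right _ _).trans this) f
  -- Subtracting the value at the centre `f₀` moves the bound from a ball around `f₀` to a ball
  -- around `0`.
  have hsmall : ∀ f, supSeminorm E N f < r → ∀ i g, ‖B i f g‖ ≤ 2 * M * supSeminorm F M g := by
    intro f hf i g
    have h1 : f₀ + f ∈ A M := by
      refine hball ?_
      rw [Seminorm.mem_ball, add_sub_cancel_left]
      exact (hN f).trans_lt hf
    have h2 : f₀ ∈ A M := mem_of_mem_nhds hf₀
    have e : B i f g = B i (f₀ + f) g - B i f₀ g := by rw [hadd]; ring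
    rw [e]
    refine (norm_sub_le _ _).trans ((add_le_add (h1 i g) (h2 i g)).trans (le_of_eq (by ring)))
  refine ⟨N, M, 4 * M / r, by positivity, fun i f g => ?_⟩
  refine le_of_forall_pos_le_add fun δ hδ => ?_
  set q := supSeminorm F M g
  have hq : 0 ≤ q := apply_nonneg _ _
  have hp : 0 ≤ supSeminorm E N f := apply_nonneg _ _
  -- `supSeminorm E N f` may vanish, so `f` is rescaled by `r / (2 * a)` with `a` larger by `η`,
  -- which is chosen such that the resulting error stays below `δ`.
  obtain ⟨η, hη, hη2⟩ : ∃ η : ℝ, 0 < η ∧ 4 * M / r * η * q ≤ δ := by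
    refine ⟨δ / (4 * M / r * q + 1), by positivity, ?_⟩
    have h3 : 0 ≤ 4 * M / r * q := by positivity
    calc _ = δ * ((4 * M / r * q) / (4 * M / r * q + 1)) := by ring
      _ ≤ δ * 1 := by
          gcongr
          rw [div_le_one (by positivity)]
          linarith
      _ = δ := mul_one _
  set a := supSeminorm E N f + η
  have ha : 0 < a := by positivity
  have h5 := hsmall (((r / (2 * a) : ℝ) : ℂ) • f) (by
    rw [map_smul_eq_mul, Complex.norm_of_nonneg (by positivity), div_mul_eq_mul_div,
      div_lt_iff₀ (by positivity)]
    nlinarith) i g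
  rw [hsmul, norm_mul, Complex.norm_of_nonneg (by positivity), div_mul_eq_mul_div,
    div_le_iff₀ (by positivity)] at h5
  calc ‖B i f g‖ ≤ (2 * M * q * (2 * a)) / r := by
        rw [le_div_iff₀ hr]; linarith
    _ = 4 * M / r * supSeminorm E N f * q + 4 * M / r * η * q := by
        simp only [a]; ring
    _ ≤ _ := by gcongr

end Seminorms

end

noncomputable section

/-! ### Seminorm bounds for tensor products and translations -/

section TensorBounds

variable {E F : Type*} [NormedAddCommGroup E] [NormedSpace ℝ E]
  [NormedAddCommGroup F] [NormedSpace ℝ F]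

theorem supSeminorm_tensorFun_le (N : ℕ) (f : 𝓢(E, ℂ)) (g : 𝓢(F, ℂ)) :
    supSeminorm (E × F) N (tensorFun f g) ≤
      2 ^ (N + 1) * (supSeminorm E N f * supSeminorm F N g) := by
  refine supSeminorm_le (by positivity) fun k n hk hn => ?_
  refine SchwartzMap.seminorm_le_bound ℂ k n _ (by positivity) fun z => ?_
  have h := norm_iteratedFDeriv_mul_le (𝕜 := ℝ) (N := ∞) (n := n)
    (f := fun z : E × F => f z.1) (g := fun z : E × F => g z.2)
    ((f.smooth ⊤).comp contDiff_fst) ((g.smooth ⊤).comp contDiff_snd) z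
    (by exact_mod_cast le_top)
  have hz : ‖z‖ ^ k ≤ ‖z.1‖ ^ k + ‖z.2‖ ^ k := by
    rcases max_cases ‖z.1‖ ‖z.2‖ with ⟨h, -⟩ | ⟨h, -⟩ <;>
      rw [Prod.norm_def, h] <;> simp
  have hf : ∀ a i, a ≤ N → i ≤ N → ‖z.1‖ ^ a * ‖iteratedFDeriv ℝ i f z.1‖ ≤ supSeminorm E N f :=
    fun a i ha hi => (SchwartzMap.le_seminorm ℂ a i f z.1).trans (seminorm_le_supSeminorm ha hi f)
  have hg : ∀ a i, a ≤ N → i ≤ N → ‖z.2‖ ^ a * ‖iteratedFDeriv ℝ i g z.2‖ ≤ supSeminorm F N g :=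
    fun a i ha hi => (SchwartzMap.le_seminorm ℂ a i g z.2).trans (seminorm_le_supSeminorm ha hi g)
  calc _ ≤ (‖z.1‖ ^ k + ‖z.2‖ ^ k) * ∑ i ∈ Finset.range (n + 1), (n.choose i : ℝ) *
          ‖iteratedFDeriv ℝ i (fun z : E × F => f z.1) z‖ *
          ‖iteratedFDeriv ℝ (n - i) (fun z : E × F => g z.2) z‖ := by gcongr; exact h
    _ ≤ (‖z.1‖ ^ k + ‖z.2‖ ^ k) * ∑ i ∈ Finset.range (n + 1), (n.choose i : ℝ) *
          ‖iteratedFDeriv ℝ i f z.1‖ * ‖iteratedFDeriv ℝ (n - i) g z.2‖ := by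
        gcongr
        · exact norm_iteratedFDeriv_comp_fst_le _ _ _
        · exact norm_iteratedFDeriv_comp_snd_le _ _ _
    _ = ∑ i ∈ Finset.range (n + 1), (n.choose i : ℝ) *
          ((‖z.1‖ ^ k * ‖iteratedFDeriv ℝ i f z.1‖) *
            (‖z.2‖ ^ 0 * ‖iteratedFDeriv ℝ (n - i) g z.2‖) +
           (‖z.1‖ ^ 0 * ‖iteratedFDeriv ℝ i f z.1‖) *
            (‖z.2‖ ^ k * ‖iteratedFDeriv ℝ (n - i) g z.2‖)) := by
        rw [Finset.mul_sum]
        exact Finset.sum_congr rfl fun i _ => by ring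
    _ ≤ ∑ i ∈ Finset.range (n + 1), (n.choose i : ℝ) *
          (supSeminorm E N f * supSeminorm F N g + supSeminorm E N f * supSeminorm F N g) := by
        refine Finset.sum_le_sum fun i hi => ?_
        have hi' : i ≤ n := Nat.lt_succ_iff.1 (Finset.mem_range.1 hi)
        gcongr
        · exact hf k i hk (hi'.trans hn)
        · exact hg 0 (n - i) (Nat.zero_le _) ((Nat.sub_le _ _).trans hn)
        · exact hf 0 i (Nat.zero_le _) (hi'.trans hn)
        · exact hg k (n - i) hk ((Nat.sub_le _ _).trans hn)
    _ = 2 ^ n * (2 * (supSeminorm E N f * supSeminorm F N g)) := by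
        rw [← Finset.sum_mul, ← two_mul]
        congr 1
        exact_mod_cast Nat.sum_range_choose n
    _ ≤ 2 ^ N * (2 * (supSeminorm E N f * supSeminorm F N g)) := by
        gcongr
        norm_num
    _ = _ := by ring

/-- The tensor product with a fixed second factor, as a continuous linear map. -/
def tensorLeft (g : 𝓢(F, ℂ)) : 𝓢(E, ℂ) →L[ℂ] 𝓢(E × F, ℂ) where
  toFun f := tensorFun f g
  map_add' f f' := by ext z; simp [add_mul]
  map_smul' c f := by ext z; simp [mul_assoc]
  cont := by
    refine continuous_iff_continuousAt.2 fun f => tendsto_schwartz_iff.2 fun N => ?_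
    have h := ((tendsto_schwartz_iff.1 (tendsto_id (α := 𝓢(E, ℂ)) (x := 𝓝 f)) N).mul_const
      (supSeminorm F N g)).const_mul (2 ^ (N + 1))
    rw [zero_mul, mul_zero] at h
    refine squeeze_zero (fun _ => apply_nonneg _ _) (fun f' => ?_) h
    have e : tensorFun f' g - tensorFun f g = tensorFun (f' - f) g := by ext z; simp [sub_mul]
    simp only [e]
    exact supSeminorm_tensorFun_le N _ _

@[simp] theorem tensorLeft_apply (g : 𝓢(F, ℂ)) (f : 𝓢(E, ℂ)) : tensorLeft g f = tensorFun f g := rfl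

/-- The tensor product with a fixed first factor, as a continuous linear map. -/
def tensorRight (f : 𝓢(E, ℂ)) : 𝓢(F, ℂ) →L[ℂ] 𝓢(E × F, ℂ) where
  toFun g := tensorFun f g
  map_add' f f' := by ext z; simp [mul_add]
  map_smul' c f := by ext z; simp [mul_left_comm]
  cont := by
    refine continuous_iff_continuousAt.2 fun g => tendsto_schwartz_iff.2 fun N => ?_
    have h := ((tendsto_schwartz_iff.1 (tendsto_id (α := 𝓢(F, ℂ)) (x := 𝓝 g)) N).const_mul
      (supSeminorm E N f)).const_mul (2 ^ (N + 1))
    rw [mul_zero, mul_zero] at h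
    refine squeeze_zero (fun _ => apply_nonneg _ _) (fun g' => ?_) h
    have e : tensorFun f g' - tensorFun f g = tensorFun f (g' - g) := by ext z; simp [mul_sub]
    simp only [e]
    exact supSeminorm_tensorFun_le N _ _

@[simp] theorem tensorRight_apply (f : 𝓢(E, ℂ)) (g : 𝓢(F, ℂ)) : tensorRight f g = tensorFun f g :=
  rfl

theorem supSeminorm_slice_le (x : E) (f : 𝓢(E × F, ℂ)) (k N : ℕ) :
    ‖x‖ ^ k * supSeminorm F N (slice x f) ≤ supSeminorm (E × F) (k + N) f := by
  have hx : (0 : ℝ) ≤ ‖x‖ ^ k := by positivity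
  rw [show ‖x‖ ^ k * supSeminorm F N (slice x f) =
    supSeminorm F N (((‖x‖ ^ k : ℝ) : ℂ) • slice x f) by
      rw [map_smul_eq_mul, Complex.norm_of_nonneg hx]]
  refine supSeminorm_le (apply_nonneg _ _) fun a b ha hb => ?_
  rw [map_smul_eq_mul, Complex.norm_of_nonneg hx]
  exact (seminorm_slice_le x f k a b).trans
    (seminorm_le_supSeminorm (by omega) (by omega) f)

/-- Derivatives pass to the test function and powers of `‖x‖` are absorbed by the slice, so the
bound of `S` enters only through the factor `A` and the order depends on `M` and `N` alone. Decay of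
`S` in a parameter is thus inherited, which is how the coefficients of a product frame decay in both
weights. -/
theorem supSeminorm_partialEval_le [FiniteDimensional ℝ E] (S : 𝓢'(F, ℂ)) {A : ℝ} {N : ℕ}
    (hA : 0 ≤ A) (hS : ∀ g, ‖S g‖ ≤ A * supSeminorm F N g) (M : ℕ) (f : 𝓢(E × F, ℂ)) :
    supSeminorm E M (partialEval S f) ≤ A * supSeminorm (E × F) (M + M + N) f := by
  refine supSeminorm_le (by positivity) fun k n hk hn => ?_
  refine SchwartzMap.seminorm_le_bound ℂ k n _ (by positivity) fun x => ?_
  have hx : (0 : ℝ) ≤ ‖x‖ ^ k := by positivity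
  have hf : (⇑(partialEval S f) : E → ℂ) = fun x => S (slice x f) := rfl
  rw [hf, ← Real.norm_of_nonneg hx, ← norm_smul]
  refine ContinuousMultilinearMap.opNorm_le_bound (by positivity) fun m => ?_
  rw [smul_apply, norm_smul, Real.norm_of_nonneg hx, iteratedFDeriv_pairing]
  set g : 𝓢(E × F, ℂ) := ∂^{fun i => ((m i, 0) : E × F)} f with hg
  have h2 : (∏ j, ‖((m j, 0) : E × F)‖) = ∏ j, ‖m j‖ := by simp
  have h1 : supSeminorm (E × F) (k + N) (∂^{fun i => ((m i, 0) : E × F)} f) ≤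
      (∏ j, ‖m j‖) * supSeminorm (E × F) (M + M + N) f := by
    refine supSeminorm_le (by positivity) fun a b ha hb => ?_
    refine (seminorm_iteratedLineDeriv_le a n f b _).trans ?_
    rw [h2]
    exact mul_le_mul_of_nonneg_left (seminorm_le_supSeminorm (by omega) (by omega) f)
      (by positivity)
  calc ‖x‖ ^ k * ‖S (slice x g)‖ ≤ ‖x‖ ^ k * (A * supSeminorm F N (slice x g)) := by
        gcongr; exact hS _
    _ = A * (‖x‖ ^ k * supSeminorm F N (slice x g)) := by ring
    _ ≤ A * ((∏ j, ‖m j‖) * supSeminorm (E × F) (M + M + N) f) := by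
        exact mul_le_mul_of_nonneg_left ((supSeminorm_slice_le x g k N).trans h1) hA
    _ = _ := by ring

theorem supSeminorm_translate_le (N : ℕ) (a : E) (f : 𝓢(E, ℂ)) :
    supSeminorm E N (f.compSubConstCLM ℂ a) ≤ 2 ^ N * (1 + ‖a‖) ^ N * supSeminorm E N f := by
  refine supSeminorm_le (by positivity) fun k n hk hn => ?_
  refine SchwartzMap.seminorm_le_bound ℂ k n _ (by positivity) fun x => ?_
  have e : (⇑(f.compSubConstCLM ℂ a) : E → ℂ) = fun x => f (x - a) := rfl
  rw [e, iteratedFDeriv_comp_sub]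
  have h1 := SchwartzMap.one_add_le_sup_seminorm_apply (𝕜 := ℂ) (m := (N, N)) hk hn f (x - a)
  have h2 : ‖x‖ ≤ (1 + ‖a‖) * (1 + ‖x - a‖) := by
    have := norm_add_le (x - a) a
    rw [sub_add_cancel] at this
    nlinarith [norm_nonneg a, norm_nonneg (x - a)]
  calc _ ≤ ((1 + ‖a‖) * (1 + ‖x - a‖)) ^ k * ‖iteratedFDeriv ℝ n f (x - a)‖ := by gcongr
    _ = (1 + ‖a‖) ^ k * ((1 + ‖x - a‖) ^ k * ‖iteratedFDeriv ℝ n f (x - a)‖) := by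
        rw [mul_pow]; ring
    _ ≤ (1 + ‖a‖) ^ N * (2 ^ N * supSeminorm E N f) := by
        refine mul_le_mul (pow_le_pow_right₀ (by simp) hk) h1 (by positivity) (by positivity)
    _ = _ := by ring

end TensorBounds

/-! ### Frames in Schwartz space -/

/-- A countable family of Schwartz functions and of tempered distributions with weights: the
coefficients given by the distributions decrease faster than all powers of the weights, and the Schwartz seminorms of the
members of the family are bounded by powers of the weights. -/
structure PreFrame (E : Type*) [NormedAddCommGroup E] [NormedSpace ℝ E] where
  /-- the index set -/
  Index : Type
  /-- the weights -/
  weight : Index → ℝ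
  one_le_weight : ∀ i, 1 ≤ weight i
  summable : ∃ N : ℕ, Summable fun i => (weight i ^ N)⁻¹
  /-- the family of functions -/
  vec : Index → 𝓢(E, ℂ)
  /-- the coefficients -/
  coef : Index → 𝓢'(E, ℂ)
  vec_bound : ∀ N, ∃ (M : ℕ) (C : ℝ), 0 ≤ C ∧ ∀ i, supSeminorm E N (vec i) ≤ C * weight i ^ M
  coef_bound : ∀ M : ℕ, ∃ (N : ℕ) (C : ℝ), 0 ≤ C ∧
    ∀ i f, weight i ^ M * ‖coef i f‖ ≤ C * supSeminorm E N f

/-- A family into which all Schwartz functions can be expanded. -/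
structure Frame (E : Type*) [NormedAddCommGroup E] [NormedSpace ℝ E] extends PreFrame E where
  expand : ∀ f x, HasSum (fun i => coef i f * vec i x) (f x)

namespace PreFrame

variable {E F : Type*} [NormedAddCommGroup E] [NormedSpace ℝ E]
  [NormedAddCommGroup F] [NormedSpace ℝ F]

theorem weight_pos (Φ : PreFrame E) (i : Φ.Index) : 0 < Φ.weight i :=
  zero_lt_one.trans_le (Φ.one_le_weight i)

theorem summable_weight_of_le (Φ : PreFrame E) : ∃ N₀ : ℕ, ∀ N, N₀ ≤ N →
    Summable fun i => (Φ.weight i ^ N)⁻¹ := by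
  obtain ⟨N₀, h⟩ := Φ.summable
  refine ⟨N₀, fun N hN => Summable.of_nonneg_of_le
    (fun i => inv_nonneg.2 (pow_nonneg (Φ.weight_pos i).le _)) (fun i => ?_) h⟩
  have := Φ.weight_pos i
  gcongr
  exact Φ.one_le_weight i

/-- Of the decay available in the coefficients, `N₀` powers are spent on the summability of the
inverse weights. -/
theorem summable_coef (Φ : PreFrame E) (M : ℕ) (f : 𝓢(E, ℂ)) :
    Summable fun i => ‖Φ.coef i f‖ * Φ.weight i ^ M := by
  obtain ⟨N₀, h⟩ := Φ.summable
  obtain ⟨N, C, hC, hb⟩ := Φ.coef_bound (M + N₀)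
  refine Summable.of_nonneg_of_le
    (fun i => mul_nonneg (norm_nonneg _) (pow_nonneg (Φ.weight_pos i).le _)) (fun i => ?_)
    (h.mul_left (C * supSeminorm E N f))
  have hw := Φ.weight_pos i
  rw [← div_eq_mul_inv, le_div_iff₀ (by positivity)]
  refine le_trans (le_of_eq ?_) (hb i f)
  ring

theorem summable_supSeminorm (Φ : PreFrame E) (f : 𝓢(E, ℂ)) (N : ℕ) :
    Summable fun i => supSeminorm E N (Φ.coef i f • Φ.vec i) := by
  obtain ⟨M, C, hC, hb⟩ := Φ.vec_bound N
  refine Summable.of_nonneg_of_le (fun _ => apply_nonneg _ _) (fun i => ?_)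
    ((Φ.summable_coef M f).mul_left C)
  rw [map_smul_eq_mul]
  calc _ ≤ ‖Φ.coef i f‖ * (C * Φ.weight i ^ M) := by gcongr; exact hb i
    _ = _ := by ring

/-- The family of tensor products. -/
def prod [FiniteDimensional ℝ E] (Φ : PreFrame E) (Ψ : PreFrame F) : PreFrame (E × F) where
  Index := Φ.Index × Ψ.Index
  weight p := Φ.weight p.1 * Ψ.weight p.2
  one_le_weight p := one_le_mul_of_one_le_of_one_le (Φ.one_le_weight _) (Ψ.one_le_weight _)
  summable := by
    obtain ⟨N, h⟩ := Φ.summable_weight_of_le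
    obtain ⟨N', h'⟩ := Ψ.summable_weight_of_le
    refine ⟨max N N', ?_⟩
    have := (h _ (le_max_left N N')).mul_of_nonneg (h' _ (le_max_right N N'))
      (fun i => inv_nonneg.2 (pow_nonneg (Φ.weight_pos i).le _))
      (fun i => inv_nonneg.2 (pow_nonneg (Ψ.weight_pos i).le _))
    refine this.congr fun p => ?_
    rw [mul_pow, mul_inv]
  vec p := tensorFun (Φ.vec p.1) (Ψ.vec p.2)
  coef p := tensorDist (Φ.coef p.1) (Ψ.coef p.2)
  vec_bound N := by
    obtain ⟨M, C, hC, h⟩ := Φ.vec_bound N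
    obtain ⟨M', C', hC', h'⟩ := Ψ.vec_bound N
    refine ⟨max M M', 2 ^ (N + 1) * (C * C'), by positivity, fun p => ?_⟩
    have h1 := Φ.weight_pos p.1
    have h2 := Ψ.weight_pos p.2
    calc _ ≤ _ := supSeminorm_tensorFun_le N _ _
      _ ≤ 2 ^ (N + 1) * ((C * Φ.weight p.1 ^ M) * (C' * Ψ.weight p.2 ^ M')) := by
        gcongr
        · exact h _
        · exact h' _
      _ ≤ 2 ^ (N + 1) * ((C * Φ.weight p.1 ^ (max M M')) * (C' * Ψ.weight p.2 ^ (max M M'))) := by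
        gcongr
        · exact Φ.one_le_weight _
        · exact le_max_left _ _
        · exact Ψ.one_le_weight _
        · exact le_max_right _ _
      _ = _ := by rw [mul_pow]; ring
  coef_bound M := by
    obtain ⟨N, C, hC, h⟩ := Φ.coef_bound M
    obtain ⟨N', C', hC', h'⟩ := Ψ.coef_bound M
    refine ⟨N + N + N', C * C', by positivity, fun p f => ?_⟩
    have h1 := Φ.weight_pos p.1
    have h2 := Ψ.weight_pos p.2
    -- The decay of the second coefficient is carried through the partial evaluation as the factor
    -- `C' / weight ^ M`.
    have h3 : supSeminorm E N (partialEval (Ψ.coef p.2) f) ≤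
        C' / Ψ.weight p.2 ^ M * supSeminorm (E × F) (N + N + N') f := by
      refine supSeminorm_partialEval_le _ (by positivity) (fun g => ?_) N f
      rw [div_mul_eq_mul_div, le_div_iff₀ (by positivity), mul_comm]
      exact h' p.2 g
    calc _ = Ψ.weight p.2 ^ M *
          (Φ.weight p.1 ^ M * ‖Φ.coef p.1 (partialEval (Ψ.coef p.2) f)‖) := by
          rw [mul_pow, tensorDist_apply]; ring
      _ ≤ Ψ.weight p.2 ^ M * (C * (C' / Ψ.weight p.2 ^ M * supSeminorm (E × F) (N + N + N') f)) := by
          refine mul_le_mul_of_nonneg_left ?_ (by positivity)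
          exact (h p.1 _).trans (mul_le_mul_of_nonneg_left h3 hC)
      _ = _ := by field_simp
end PreFrame

namespace Frame

variable {E F : Type*} [NormedAddCommGroup E] [NormedSpace ℝ E]
  [NormedAddCommGroup F] [NormedSpace ℝ F]

theorem hasSum_smul (Φ : Frame E) (f : 𝓢(E, ℂ)) : HasSum (fun i => Φ.coef i f • Φ.vec i) f :=
  hasSum_schwartz (Φ.summable_supSeminorm f) fun x => by simpa using Φ.expand f x

theorem hasSum_apply (Φ : Frame E) (T : 𝓢(E, ℂ) →L[ℂ] ℂ) (f : 𝓢(E, ℂ)) :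
    HasSum (fun i => Φ.coef i f * T (Φ.vec i)) (T f) := by
  simpa [Function.comp_def] using (Φ.hasSum_smul f).mapL T

/-- The frame of tensor products. -/
def prod [FiniteDimensional ℝ E] (Φ : Frame E) (Ψ : Frame F) : Frame (E × F) where
  toPreFrame := Φ.toPreFrame.prod Ψ.toPreFrame
  expand f z := by
    -- The index sets are exchanged because the coefficient of `Ψ` is evaluated first: for a fixed
    -- index `j` of `Ψ` the sum over `Φ` reproduces the partial evaluation at `z.1`, and the sum
    -- over `j` then expands the slice.
    have hb : Summable fun p : Ψ.Index × Φ.Index =>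
        tensorDist (Φ.coef p.2) (Ψ.coef p.1) f * tensorFun (Φ.vec p.2) (Ψ.vec p.1) z := by
      have h := (Φ.toPreFrame.prod Ψ.toPreFrame).summable_supSeminorm f 0
      have h2 : Summable fun p : Φ.Index × Ψ.Index =>
          tensorDist (Φ.coef p.1) (Ψ.coef p.2) f * tensorFun (Φ.vec p.1) (Ψ.vec p.2) z := by
        refine Summable.of_norm_bounded h fun p => ?_
        exact norm_apply_le_supSeminorm 0
          (tensorDist (Φ.coef p.1) (Ψ.coef p.2) f • tensorFun (Φ.vec p.1) (Ψ.vec p.2)) z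
      exact h2.prod_symm
    have h1 : ∀ j, HasSum (fun i => tensorDist (Φ.coef i) (Ψ.coef j) f *
        tensorFun (Φ.vec i) (Ψ.vec j) z) (Ψ.coef j (slice z.1 f) * Ψ.vec j z.2) := fun j => by
      have := (Φ.expand (partialEval (Ψ.coef j) f) z.1).mul_right (Ψ.vec j z.2)
      simpa [mul_assoc] using this
    have h2 := hb.hasSum
    have h3 := (h2.prod_fiberwise h1).unique (Ψ.expand (slice z.1 f) z.2)
    rw [h3] at h2
    exact (Equiv.prodComm Φ.Index Ψ.Index).hasSum_iff.2 h2

/-- Transport of a frame along a linear isomorphism. -/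
def congr (e : E ≃L[ℝ] F) (Φ : Frame F) : Frame E where
  Index := Φ.Index
  weight := Φ.weight
  one_le_weight := Φ.one_le_weight
  summable := Φ.summable
  vec i := pullback e (Φ.vec i)
  coef i := pushDist e.symm (Φ.coef i)
  vec_bound N := by
    obtain ⟨N', C', hC', h'⟩ := exists_clm_bound (pullback e) N
    obtain ⟨M, C, hC, h⟩ := Φ.vec_bound N'
    refine ⟨M, C' * C, by positivity, fun i => (h' _).trans ?_⟩
    rw [mul_assoc]
    exact mul_le_mul_of_nonneg_left (h i) hC'
  coef_bound M := by
    obtain ⟨N, C, hC, h⟩ := Φ.coef_bound M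
    obtain ⟨N', C', hC', h'⟩ := exists_clm_bound (pullback e.symm) N
    refine ⟨N', C * C', by positivity, fun i f => (h i _).trans ?_⟩
    rw [mul_assoc]
    exact mul_le_mul_of_nonneg_left (h' f) hC
  expand f x := by
    have := Φ.expand (pullback e.symm f) (e x)
    simpa using this

/-- The function `1` on a point. -/
def constOne (E : Type*) [NormedAddCommGroup E] [NormedSpace ℝ E] [Subsingleton E] : 𝓢(E, ℂ) :=
  HasCompactSupport.toSchwartzMap (f := fun _ : E => (1 : ℂ))
    (HasCompactSupport.of_compactSpace _) contDiff_const

@[simp] theorem constOne_apply [Subsingleton E] (x : E) : constOne E x = 1 := rfl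

/-- The frame on a point. -/
def point (E : Type*) [NormedAddCommGroup E] [NormedSpace ℝ E] [Subsingleton E] : Frame E where
  Index := Unit
  weight _ := 1
  one_le_weight _ := le_rfl
  summable := ⟨0, Summable.of_finite⟩
  vec _ := constOne E
  coef _ := TemperedDistribution.delta 0
  vec_bound N := ⟨0, supSeminorm E N (constOne E), apply_nonneg _ _, fun i => by simp⟩
  coef_bound M := ⟨0, 1, zero_le_one, fun i f => by
    simpa using norm_apply_le_supSeminorm 0 f 0⟩
  expand f x := by
    rw [Subsingleton.elim x 0]
    simp

end Frame

end

noncomputable section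

/-! ### The frame on the line -/

namespace LineFrame

/-- A smooth function with support in `[-1/4, 1/4]` whose translates by `ℤ/4` add up to `1`. -/
def cellFun (t : ℝ) : ℝ := Real.smoothTransition (4 * t + 1) - Real.smoothTransition (4 * t)

theorem cellFun_eq_zero {t : ℝ} (ht : 1 / 4 ≤ |t|) : cellFun t = 0 := by
  rcases le_abs.1 ht with h | h
  · rw [cellFun, Real.smoothTransition.one_of_one_le (by linarith),
      Real.smoothTransition.one_of_one_le (by linarith), sub_self]
  · rw [cellFun, Real.smoothTransition.zero_of_nonpos (by linarith),
      Real.smoothTransition.zero_of_nonpos (by linarith), sub_self]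

/-- A smooth function which is `1` on `[-1/4, 1/4]` and has support in `[-1/2, 1/2]`. -/
def plateauFun (t : ℝ) : ℝ := Real.smoothTransition (4 * t + 2) * Real.smoothTransition (2 - 4 * t)

theorem plateauFun_eq_zero {t : ℝ} (ht : 1 / 2 ≤ |t|) : plateauFun t = 0 := by
  rcases le_abs.1 ht with h | h
  · rw [plateauFun, Real.smoothTransition.zero_of_nonpos (x := 2 - 4 * t) (by linarith), mul_zero]
  · rw [plateauFun, Real.smoothTransition.zero_of_nonpos (by linarith), zero_mul]

theorem plateauFun_eq_one {t : ℝ} (ht : |t| ≤ 1 / 4) : plateauFun t = 1 := by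
  rw [abs_le] at ht
  rw [plateauFun, Real.smoothTransition.one_of_one_le (by linarith),
    Real.smoothTransition.one_of_one_le (by linarith), one_mul]

theorem contDiff_cellFun : ContDiff ℝ ∞ cellFun :=
  (Real.smoothTransition.contDiff.comp (by fun_prop)).sub
    (Real.smoothTransition.contDiff.comp (by fun_prop))

theorem contDiff_plateauFun : ContDiff ℝ ∞ plateauFun :=
  (Real.smoothTransition.contDiff.comp (by fun_prop)).mul
    (Real.smoothTransition.contDiff.comp (by fun_prop))

theorem hasCompactSupport_of_abs {f : ℝ → ℝ} {r : ℝ} (h : ∀ t, r ≤ |t| → f t = 0) :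
    HasCompactSupport fun t => (f t : ℂ) := by
  refine HasCompactSupport.of_support_subset_isCompact (isCompact_Icc (a := -r) (b := r)) ?_
  intro t ht
  rw [Function.mem_support, Complex.ofReal_ne_zero] at ht
  have := not_le.1 fun h' => ht (h t h')
  rw [abs_lt] at this
  exact ⟨this.1.le, this.2.le⟩

/-- `cellFun` as a Schwartz function. -/
def cell : 𝓢(ℝ, ℂ) :=
  (hasCompactSupport_of_abs fun _ => cellFun_eq_zero).toSchwartzMap
    (Complex.ofRealCLM.contDiff.comp contDiff_cellFun)

/-- `plateauFun` as a Schwartz function. -/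
def plateau : 𝓢(ℝ, ℂ) :=
  (hasCompactSupport_of_abs fun _ => plateauFun_eq_zero).toSchwartzMap
    (Complex.ofRealCLM.contDiff.comp contDiff_plateauFun)

theorem cell_apply (t : ℝ) : cell t = cellFun t := rfl

theorem plateau_apply (t : ℝ) : plateau t = plateauFun t := rfl

/-- The differences of the smooth step telescope: at `x` only `z = ⌊4x⌋` and `z = ⌊4x⌋ + 1`
contribute, and the common term of the two cells cancels. -/
theorem hasSum_cell (x : ℝ) : HasSum (fun z : ℤ => cell (x - z / 4)) 1 := by
  set n : ℤ := ⌊4 * x⌋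
  have h1 : (n : ℝ) ≤ 4 * x := Int.floor_le _
  have h2 : 4 * x < n + 1 := Int.lt_floor_add_one _
  have h3 : ∑ z ∈ ({n, n + 1} : Finset ℤ), cell (x - z / 4) = 1 := by
    rw [Finset.sum_pair (by omega), cell_apply, cell_apply, cellFun, cellFun]
    push_cast
    rw [Real.smoothTransition.one_of_one_le (x := 4 * (x - n / 4) + 1) (by linarith),
      Real.smoothTransition.zero_of_nonpos (x := 4 * (x - (n + 1) / 4)) (by linarith),
      show 4 * (x - (n + 1) / 4) + 1 = 4 * (x - n / 4) by ring]
    push_cast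
    ring
  rw [← h3]
  refine hasSum_sum_of_ne_finset_zero fun z hz => ?_
  rw [cell_apply, Complex.ofReal_eq_zero]
  refine cellFun_eq_zero ?_
  simp only [Finset.mem_insert, Finset.mem_singleton, not_or] at hz
  rw [le_abs]
  rcases lt_or_ge z n with h | h
  · left
    have : (z : ℝ) ≤ n - 1 := by exact_mod_cast (show z ≤ n - 1 by omega)
    linarith
  · right
    have : (n : ℝ) + 2 ≤ z := by exact_mod_cast (show n + 2 ≤ z by omega)
    linarith

/-- The function `x ↦ e^{2πikx} χ (x - a)`. -/
def wave (a k : ℝ) : 𝓢(ℝ, ℂ) :=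
  𝓕⁻ ((𝓕 (plateau.compSubConstCLM ℂ a)).compSubConstCLM ℂ k)

theorem wave_apply (a k x : ℝ) :
    wave a k x = Complex.exp (2 * Real.pi * Complex.I * k * x) * plateau (x - a) := by
  set g : 𝓢(ℝ, ℂ) := 𝓕 (plateau.compSubConstCLM ℂ a) with hg
  have h1 : 𝓕⁻ (g : ℝ → ℂ) x = plateau (x - a) := by
    rw [← SchwartzMap.fourierInv_coe, hg, FourierTransform.fourierInv_fourier_eq]
    rfl
  rw [wave, SchwartzMap.fourierInv_coe, ← h1, Real.fourierInv_eq', Real.fourierInv_eq',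
    ← integral_sub_right_eq_self (fun v : ℝ =>
      Complex.exp (((2 * Real.pi * inner ℝ v x : ℝ) : ℂ) * Complex.I) • g v) k,
    ← integral_const_mul]
  refine integral_congr_ae (Filter.Eventually.of_forall fun v => ?_)
  simp only [SchwartzMap.compSubConstCLM_apply, smul_eq_mul, ← mul_assoc, ← Complex.exp_add]
  congr 2
  simp only [RCLike.inner_apply, conj_trivial]
  push_cast
  ring

/-- Multiplication by the translate of `cell`. -/
def localize (a : ℝ) : 𝓢(ℝ, ℂ) →L[ℂ] 𝓢(ℝ, ℂ) :=
  SchwartzMap.smulLeftCLM ℂ (cell.compSubConstCLM ℂ a)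

theorem localize_apply (a : ℝ) (f : 𝓢(ℝ, ℂ)) (x : ℝ) : localize a f x = cell (x - a) * f x := by
  rw [localize, SchwartzMap.smulLeftCLM_apply_apply (SchwartzMap.hasTemperateGrowth _)]
  rfl

/-- The linear isomorphism `(t, x) ↦ (x, x - t)`. -/
def shear : (ℝ × ℝ) ≃L[ℝ] (ℝ × ℝ) :=
  (LinearEquiv.ofLinearMap
    ((LinearMap.snd ℝ ℝ ℝ).prod (LinearMap.snd ℝ ℝ ℝ - LinearMap.fst ℝ ℝ ℝ))
    ((LinearMap.fst ℝ ℝ ℝ - LinearMap.snd ℝ ℝ ℝ).prod (LinearMap.fst ℝ ℝ ℝ))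
    (by ext <;> simp) (by ext <;> simp)).toContinuousLinearEquiv

/-- The whole family in `a` consists of slices of one Schwartz function of two variables, whose
decay in the first variable is the decay of `localize a f` in `a`. -/
theorem localize_eq_slice (a : ℝ) (f : 𝓢(ℝ, ℂ)) :
    localize a f = slice a (pullback shear (tensorFun f cell)) := by
  ext x
  rw [localize_apply, mul_comm]
  rfl

theorem one_add_pow_le (a : ℝ) (ha : 0 ≤ a) (k : ℕ) : (1 + a) ^ k ≤ 2 ^ k * (1 + a ^ k) := by
  calc (1 + a) ^ k ≤ 2 ^ (k - 1) * (1 ^ k + a ^ k) := add_pow_le zero_le_one ha k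
    _ ≤ 2 ^ k * (1 + a ^ k) := by
      rw [one_pow]
      gcongr
      · norm_num
      · omega

theorem localize_bound (N M : ℕ) : ∃ (N' : ℕ) (C : ℝ), 0 ≤ C ∧ ∀ a f,
    (1 + |a|) ^ M * supSeminorm ℝ N (localize a f) ≤ C * supSeminorm ℝ N' f := by
  obtain ⟨N', C, hC, h⟩ := exists_clm_bound (pullback shear) (M + N)
  refine ⟨N', 2 ^ M * (2 * (C * (2 ^ (N' + 1) * supSeminorm ℝ N' cell))), by positivity,
    fun a f => ?_⟩
  set H := pullback shear (tensorFun f cell)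
  have h1 : supSeminorm (ℝ × ℝ) (M + N) H ≤ C * (2 ^ (N' + 1) *
      (supSeminorm ℝ N' f * supSeminorm ℝ N' cell)) :=
    (h _).trans (mul_le_mul_of_nonneg_left (supSeminorm_tensorFun_le _ _ _) hC)
  have h2 := supSeminorm_slice_le a H M N
  have h3 := supSeminorm_slice_le a H 0 N
  rw [pow_zero, one_mul, zero_add] at h3
  have h4 := h3.trans (supSeminorm_mono (Nat.le_add_left N M) H)
  rw [localize_eq_slice]
  calc _ ≤ 2 ^ M * (1 + |a| ^ M) * supSeminorm ℝ N (slice a H) :=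
        mul_le_mul_of_nonneg_right (one_add_pow_le _ (abs_nonneg a) M) (apply_nonneg _ _)
    _ = 2 ^ M * (supSeminorm ℝ N (slice a H) + ‖a‖ ^ M * supSeminorm ℝ N (slice a H)) := by
        rw [Real.norm_eq_abs]; ring
    _ ≤ 2 ^ M * (supSeminorm (ℝ × ℝ) (M + N) H + supSeminorm (ℝ × ℝ) (M + N) H) := by
        gcongr
    _ = 2 ^ M * (2 * supSeminorm (ℝ × ℝ) (M + N) H) := by ring
    _ ≤ 2 ^ M * (2 * (C * (2 ^ (N' + 1) * (supSeminorm ℝ N' f * supSeminorm ℝ N' cell)))) := by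
        gcongr
    _ = _ := by ring

theorem fourier_bound (M : ℕ) : ∃ (N : ℕ) (C : ℝ), 0 ≤ C ∧ ∀ (g : 𝓢(ℝ, ℂ)) (k : ℝ),
    (1 + |k|) ^ M * ‖(𝓕 g : 𝓢(ℝ, ℂ)) k‖ ≤ C * supSeminorm ℝ N g := by
  obtain ⟨N, C, hC, h⟩ := exists_clm_bound (fourierCLM ℂ 𝓢(ℝ, ℂ)) M
  refine ⟨N, 2 ^ M * C, by positivity, fun g k => ?_⟩
  have h1 := SchwartzMap.one_add_le_sup_seminorm_apply (𝕜 := ℂ) (m := (M, M)) (k := M) (n := 0)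
    le_rfl (Nat.zero_le _) (𝓕 g) k
  rw [norm_iteratedFDeriv_zero, Real.norm_eq_abs] at h1
  rw [mul_assoc]
  exact h1.trans (mul_le_mul_of_nonneg_left (h g) (by positivity))

/-- A `wave` arises by one translation in space and one in frequency. Each costs a power of the
shift, while the Fourier transforms cost only a constant and a change of order. -/
theorem wave_bound (N : ℕ) : ∃ (M : ℕ) (C : ℝ), 0 ≤ C ∧ ∀ a k : ℝ,
    supSeminorm ℝ N (wave a k) ≤ C * ((1 + |a|) * (1 + |k|)) ^ M := by
  obtain ⟨N', C, hC, h⟩ := exists_clm_bound (fourierInvCLM ℂ 𝓢(ℝ, ℂ)) N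
  obtain ⟨N'', C', hC', h'⟩ := exists_clm_bound (fourierCLM ℂ 𝓢(ℝ, ℂ)) N'
  refine ⟨max N' N'', C * (2 ^ N' * (C' * (2 ^ N'' * supSeminorm ℝ N'' plateau))), by positivity,
    fun a k => ?_⟩
  have h1 : (1 + |a|) ^ N'' ≤ (1 + |a|) ^ (max N' N'') :=
    pow_le_pow_right₀ (by simp) (le_max_right _ _)
  have h2 : (1 + |k|) ^ N' ≤ (1 + |k|) ^ (max N' N'') :=
    pow_le_pow_right₀ (by simp) (le_max_left _ _)
  have e1 : supSeminorm ℝ N'' (plateau.compSubConstCLM ℂ a) ≤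
      2 ^ N'' * (1 + |a|) ^ (max N' N'') * supSeminorm ℝ N'' plateau :=
    (supSeminorm_translate_le N'' a plateau).trans (by rw [Real.norm_eq_abs]; gcongr)
  have e2 : supSeminorm ℝ N' (𝓕 (plateau.compSubConstCLM ℂ a)) ≤
      C' * (2 ^ N'' * (1 + |a|) ^ (max N' N'') * supSeminorm ℝ N'' plateau) :=
    (h' _).trans (mul_le_mul_of_nonneg_left e1 hC')
  have e3 : supSeminorm ℝ N' ((𝓕 (plateau.compSubConstCLM ℂ a)).compSubConstCLM ℂ k) ≤
      2 ^ N' * (1 + |k|) ^ (max N' N'') *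
        (C' * (2 ^ N'' * (1 + |a|) ^ (max N' N'') * supSeminorm ℝ N'' plateau)) := by
    refine (supSeminorm_translate_le N' k _).trans ?_
    rw [Real.norm_eq_abs]
    gcongr
  refine (h _).trans ((mul_le_mul_of_nonneg_left e3 hC).trans (le_of_eq ?_))
  rw [mul_pow]
  ring

/-- The weights. -/
def weight (p : ℤ × ℤ) : ℝ := (1 + |(p.1 : ℝ)|) * (1 + |(p.2 : ℝ)|)

theorem summable_one_add_abs : Summable fun n : ℤ => ((1 + |(n : ℝ)|) ^ 2)⁻¹ := by
  have h : Summable fun n : ℤ => |(n : ℝ)| ^ (-2 : ℝ) := Real.summable_abs_int_rpow (by norm_num)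
  refine (Finset.summable_compl_iff {0}).1 ?_
  refine Summable.of_nonneg_of_le (fun _ => by positivity) (fun n => ?_)
    (h.subtype {n | n ∉ ({0} : Finset ℤ)})
  have hn : (n : ℤ) ≠ 0 := by simpa using n.2
  have h0 : (0 : ℝ) < |((n : ℤ) : ℝ)| := by positivity
  simp only [Function.comp_apply]
  rw [Real.rpow_neg h0.le, Real.rpow_two]
  gcongr
  linarith

/-- The periodization of `localize a f` with period `1` has the Fourier coefficients `𝓕 (localize a
f) k`. The plateau has half-width `1/2` and is `1` on the cell of half-width `1/4`, so
multiplication by it removes every translate but the original one. -/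
theorem poisson (f : 𝓢(ℝ, ℂ)) (a x : ℝ) :
    HasSum (fun k : ℤ => (𝓕 (localize a f) : 𝓢(ℝ, ℂ)) k * wave a k x) (cell (x - a) * f x) := by
  have hw : ∀ k : ℤ, (𝓕 (localize a f) : 𝓢(ℝ, ℂ)) k * wave a k x =
      (𝓕 (localize a f) : 𝓢(ℝ, ℂ)) k * fourier k (x : UnitAddCircle) * plateau (x - a) := by
    intro k
    rw [wave_apply, fourier_coe_apply]
    push_cast
    rw [div_one]
    ring
  simp_rw [hw]
  have hs : Summable fun k : ℤ => (𝓕 (localize a f) : 𝓢(ℝ, ℂ)) k * fourier k (x : UnitAddCircle) := by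
    obtain ⟨N, C, hC, h⟩ := fourier_bound 2
    refine Summable.of_norm_bounded (summable_one_add_abs.mul_left (C * supSeminorm ℝ N (localize a f)))
      fun k => ?_
    rw [norm_mul, fourier_apply, Circle.norm_coe, mul_one, ← div_eq_mul_inv,
      le_div_iff₀ (by positivity), mul_comm]
    exact h _ _
  have hp := hs.hasSum.mul_right (plateau (x - a))
  have hP := SchwartzMap.tsum_eq_tsum_fourier (localize a f) x
  rw [← hP] at hp
  suffices key : cell (x - a) * f x =
      (∑' n : ℤ, localize a f (x + n)) * plateau (x - a) by
    rw [key]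
    exact hp
  rcases le_or_gt (1 / 2) |x - a| with h | h
  · rw [plateau_apply, plateauFun_eq_zero h, cell_apply, cellFun_eq_zero (by linarith)]
    simp
  · rw [tsum_eq_single 0]
    · rw [localize_apply]
      rcases le_or_gt |x - a| (1 / 4) with h' | h'
      · rw [plateau_apply, plateauFun_eq_one h']
        simp
      · rw [Int.cast_zero, add_zero, cell_apply, cellFun_eq_zero h'.le]
        simp
    -- The two distances satisfy `|x + n - a| + |x - a| ≥ 1`, and `|x - a| < 1/2`, so `x + n` lies
    -- outside the cell.
    · intro n hn
      rw [localize_apply, cell_apply, cellFun_eq_zero, Complex.ofReal_zero, zero_mul]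
      have h1 : (1 : ℝ) ≤ |(n : ℝ)| := by exact_mod_cast Int.one_le_abs hn
      have h2 : |(n : ℝ)| ≤ |x + n - a| + |x - a| := by
        calc |(n : ℝ)| = |(x + n - a) - (x - a)| := by ring_nf
          _ ≤ _ := abs_sub _ _
      linarith

end LineFrame

open LineFrame in
/-- The vectors and functionals of the frame on the line. -/
def linePreFrame : PreFrame ℝ where
  Index := ℤ × ℤ
  weight := LineFrame.weight
  one_le_weight p := one_le_mul_of_one_le_of_one_le (by simp) (by simp)
  summable := by
    refine ⟨2, ?_⟩
    have := summable_one_add_abs.mul_of_nonneg summable_one_add_abs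
      (fun _ => by positivity) (fun _ => by positivity)
    refine this.congr fun p => ?_
    rw [LineFrame.weight, mul_pow, mul_inv]
  vec p := wave (p.1 / 4) p.2
  coef p := PointwiseConvergenceCLM.precomp ℂ (fourierCLM ℂ 𝓢(ℝ, ℂ) ∘L localize (p.1 / 4))
    (TemperedDistribution.delta (p.2 : ℝ))
  vec_bound N := by
    obtain ⟨M, C, hC, h⟩ := wave_bound N
    refine ⟨M, C, hC, fun p => (h _ _).trans ?_⟩
    rw [LineFrame.weight]
    have h1 : |(p.1 : ℝ) / 4| ≤ |(p.1 : ℝ)| := by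
      rw [abs_div]
      exact div_le_self (abs_nonneg _) (by norm_num)
    gcongr
  coef_bound M := by
    obtain ⟨N, C, hC, h⟩ := fourier_bound M
    obtain ⟨N', C', hC', h'⟩ := localize_bound N M
    refine ⟨N', 4 ^ M * (C * C'), by positivity, fun p f => ?_⟩
    have e : PointwiseConvergenceCLM.precomp ℂ (fourierCLM ℂ 𝓢(ℝ, ℂ) ∘L localize (p.1 / 4))
        (TemperedDistribution.delta (p.2 : ℝ)) f = (𝓕 (localize (p.1 / 4) f) : 𝓢(ℝ, ℂ)) p.2 := rfl
    rw [e, LineFrame.weight]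
    -- The cells have spacing `1/4`; the factor `4` converts decay in the position `p.1 / 4` into
    -- decay in the weight.
    have h1 : 1 + |(p.1 : ℝ)| ≤ 4 * (1 + |(p.1 : ℝ) / 4|) := by
      rw [abs_div, abs_of_pos (show (0 : ℝ) < 4 by norm_num)]
      linarith [abs_nonneg (p.1 : ℝ)]
    calc _ ≤ (4 * (1 + |(p.1 : ℝ) / 4|) * (1 + |(p.2 : ℝ)|)) ^ M *
          ‖(𝓕 (localize (p.1 / 4) f) : 𝓢(ℝ, ℂ)) p.2‖ := by gcongr
      _ = 4 ^ M * ((1 + |(p.1 : ℝ) / 4|) ^ M *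
          ((1 + |(p.2 : ℝ)|) ^ M * ‖(𝓕 (localize (p.1 / 4) f) : 𝓢(ℝ, ℂ)) p.2‖)) := by
          rw [mul_pow, mul_pow]; ring
      _ ≤ 4 ^ M * ((1 + |(p.1 : ℝ) / 4|) ^ M *
          (C * supSeminorm ℝ N (localize (p.1 / 4) f))) := by
          refine mul_le_mul_of_nonneg_left (mul_le_mul_of_nonneg_left (h _ _) ?_) ?_ <;> positivity
      _ = 4 ^ M * (C * ((1 + |(p.1 : ℝ) / 4|) ^ M * supSeminorm ℝ N (localize (p.1 / 4) f))) := by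
          ring
      _ ≤ 4 ^ M * (C * (C' * supSeminorm ℝ N' f)) := by
          refine mul_le_mul_of_nonneg_left (mul_le_mul_of_nonneg_left (h' _ _) hC) ?_
          positivity
      _ = _ := by ring

open LineFrame in
/-- The frame on the line. -/
def lineFrame : Frame ℝ where
  toPreFrame := linePreFrame
  expand f x := by
    have hs : Summable fun p : ℤ × ℤ => linePreFrame.coef p f * linePreFrame.vec p x :=
      Summable.of_norm_bounded (linePreFrame.summable_supSeminorm f 0) fun p => by
        rw [norm_mul]
        rw [map_smul_eq_mul]
        exact mul_le_mul_of_nonneg_left (norm_apply_le_supSeminorm 0 _ x) (norm_nonneg _)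
    have h1 : ∀ z : ℤ, HasSum (fun k : ℤ => linePreFrame.coef (z, k) f * linePreFrame.vec (z, k) x)
        (cell (x - z / 4) * f x) := fun z => poisson f (z / 4) x
    -- Frequencies are summed first, by Poisson summation in each cell; then the cells add up to `f
    -- x`.
    have h2 := hs.hasSum.prod_fiberwise h1
    have h3 := (hasSum_cell x).mul_right (f x)
    rw [one_mul] at h3
    rw [← h2.unique h3]
    exact hs.hasSum

theorem nonempty_frame_pi (n : ℕ) : Nonempty (Frame (Fin n → ℝ)) := by
  induction n with
  | zero => exact ⟨Frame.point _⟩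
  | succ n ih =>
    obtain ⟨Φ⟩ := ih
    exact ⟨Frame.congr (ContinuousLinearEquiv.ofFinrankEq (by simp [add_comm])) (lineFrame.prod Φ)⟩

theorem nonempty_frame (E : Type*) [NormedAddCommGroup E] [NormedSpace ℝ E]
    [FiniteDimensional ℝ E] : Nonempty (Frame E) := by
  obtain ⟨Φ⟩ := nonempty_frame_pi (Module.finrank ℝ E)
  exact ⟨Frame.congr (ContinuousLinearEquiv.ofFinrankEq (by simp)) Φ⟩

/-! ### Tensor products of distributions: uniqueness and exchange of factors. -/

section Fubini

variable {E F : Type*} [NormedAddCommGroup E] [NormedSpace ℝ E] [FiniteDimensional ℝ E]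
  [NormedAddCommGroup F] [NormedSpace ℝ F]

theorem partialEval_tensorFun (S : 𝓢'(F, ℂ)) (f : 𝓢(E, ℂ)) (g : 𝓢(F, ℂ)) :
    partialEval S (tensorFun f g) = S g • f := by
  ext x
  have : slice x (tensorFun f g) = f x • g := by ext y; simp
  rw [partialEval_apply, this, map_smul]
  simp [mul_comm]

theorem tensorDist_tensorFun (T : 𝓢'(E, ℂ)) (S : 𝓢'(F, ℂ)) (f : 𝓢(E, ℂ)) (g : 𝓢(F, ℂ)) :
    tensorDist T S (tensorFun f g) = T f * S g := by
  rw [tensorDist_apply, partialEval_tensorFun, map_smul, smul_eq_mul, mul_comm]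

variable [FiniteDimensional ℝ F]

/-- Tempered distributions which agree on the products of Schwartz functions are equal. -/
theorem distribution_ext_tensorFun {T S : 𝓢'(E × F, ℂ)}
    (h : ∀ f g, T (tensorFun f g) = S (tensorFun f g)) : T = S := by
  obtain ⟨Φ⟩ := nonempty_frame E
  obtain ⟨Ψ⟩ := nonempty_frame F
  ext f
  have h1 := (Φ.prod Ψ).hasSum_apply T f
  have h2 := (Φ.prod Ψ).hasSum_apply S f
  have e : (fun i => (Φ.prod Ψ).coef i f * T ((Φ.prod Ψ).vec i)) =
      fun i => (Φ.prod Ψ).coef i f * S ((Φ.prod Ψ).vec i) :=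
    funext fun i => congrArg (_ * ·) (h _ _)
  exact h1.unique ((congrArg (fun u => HasSum u (S f)) e).mpr h2)

/-- Both orders of evaluation give distributions with the same values on products. Either factor can
therefore be the one evaluated last. -/
theorem tensorDist_eq_swap (T : 𝓢'(E, ℂ)) (S : 𝓢'(F, ℂ)) (f : 𝓢(E × F, ℂ)) :
    tensorDist T S f =
      tensorDist S T (pullback (ContinuousLinearEquiv.prodComm ℝ F E) f) := by
  have : tensorDist T S = pushDist (ContinuousLinearEquiv.prodComm ℝ F E) (tensorDist S T) := by
    refine distribution_ext_tensorFun fun f g => ?_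
    have e : pullback (ContinuousLinearEquiv.prodComm ℝ F E) (tensorFun f g) = tensorFun g f := by
      ext x
      exact mul_comm _ _
    rw [pushDist_apply, e, tensorDist_tensorFun, tensorDist_tensorFun, mul_comm]
  exact DFunLike.congr_fun this f

end Fubini

end

noncomputable section

/-! ### Products of one-particle functions -/

/-- Splitting off the first point of a configuration. -/
def confCons (s n : ℕ) : Conf s (Fin (n + 1)) ≃L[ℝ] Spacetime s × Conf s (Fin n) :=
  LinearEquiv.toContinuousLinearEquiv
    { toFun := fun x => (x 0, WithLp.toLp 2 fun i => x i.succ)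
      invFun := fun p => WithLp.toLp 2 (Fin.cons p.1 fun i => p.2 i)
      map_add' := fun x y => rfl
      map_smul' := fun c x => rfl
      left_inv := fun x => by
        refine PiLp.ext fun i => ?_
        induction i using Fin.cases <;> simp
      right_inv := fun p => by
        refine Prod.ext ?_ (PiLp.ext fun i => ?_) <;> simp }

theorem exists_prodFun_fin (s n : ℕ) (u : Fin n → 𝓢(Spacetime s, ℂ)) :
    ∃ g : 𝓢(Conf s (Fin n), ℂ), ∀ x, g x = ∏ i, u i (x i) := by
  induction n with
  | zero => exact ⟨Frame.constOne _, fun x => by simp⟩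
  | succ n ih =>
    obtain ⟨g, hg⟩ := ih (fun i => u i.succ)
    refine ⟨pullback (confCons s n) (tensorFun (u 0) g), fun x => ?_⟩
    rw [Fin.prod_univ_succ]
    change u 0 (x 0) * g (WithLp.toLp 2 fun i => x i.succ) = _
    rw [hg]

variable {s : ℕ} {ι κ : Type} [Fintype ι] [Fintype κ]

theorem exists_prodFun (u : ι → 𝓢(Spacetime s, ℂ)) :
    ∃ g : 𝓢(Conf s ι, ℂ), ∀ x, g x = ∏ i, u i (x i) := by
  obtain ⟨g, hg⟩ := exists_prodFun_fin s _ (u ∘ (Fintype.equivFin ι).symm)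
  refine ⟨pullback (renameEquiv s (Fintype.equivFin ι)) g, fun x => ?_⟩
  have h : pullback (renameEquiv s (Fintype.equivFin ι)) g x =
    g (renameEquiv s (Fintype.equivFin ι) x) := rfl
  rw [h, hg]
  exact Fintype.prod_equiv (Fintype.equivFin ι).symm _ _ fun i => by simp

/-- The product `x ↦ ∏ i, u i (x i)` of one-particle functions. -/
def prodFun (u : ι → 𝓢(Spacetime s, ℂ)) : 𝓢(Conf s ι, ℂ) := (exists_prodFun u).choose

@[simp] theorem prodFun_apply (u : ι → 𝓢(Spacetime s, ℂ)) (x : Conf s ι) :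
    prodFun u x = ∏ i, u i (x i) := (exists_prodFun u).choose_spec x

theorem prodFun_succ {n : ℕ} (u : Fin (n + 1) → 𝓢(Spacetime s, ℂ)) :
    prodFun u = pullback (confCons s n) (tensorFun (u 0) (prodFun fun i : Fin n => u i.succ)) := by
  ext x
  change _ = u 0 (x 0) * prodFun (fun i : Fin n => u i.succ) (WithLp.toLp 2 fun i => x i.succ)
  simp [Fin.prod_univ_succ]

theorem pullback_rename_prodFun (e : ι ≃ κ) (u : κ → 𝓢(Spacetime s, ℂ)) :
    pullback (renameEquiv s e) (prodFun u) = prodFun (u ∘ e) := by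
  ext x
  change prodFun u (renameEquiv s e x) = _
  rw [prodFun_apply, prodFun_apply]
  exact Fintype.prod_equiv e.symm _ _ fun i => by simp

theorem schwartzTensor_prodFun {n m : ℕ} (u : Fin n → 𝓢(Spacetime s, ℂ))
    (v : Fin m → 𝓢(Spacetime s, ℂ)) :
    schwartzTensor (prodFun u) (prodFun v) = prodFun (Fin.append u v) := by
  ext x
  simp [Fin.prod_univ_add]

theorem act_prodFun (P : Poincare s) {n : ℕ} (u : Fin n → 𝓢(Spacetime s, ℂ)) :
    ∀ x, P.act n (prodFun u) x = ∏ l, u l (P.Λ.symm (x l - P.a)) := fun x => by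
  rw [Poincare.act_apply, prodFun_apply]

/-- Turns bounds by Schwartz norms in all variables into bounds of product form, with a common order
for all factors. -/
theorem prodFun_bound_fin (s n N : ℕ) : ∃ (N' : ℕ) (C : ℝ), 0 ≤ C ∧
    ∀ u : Fin n → 𝓢(Spacetime s, ℂ),
      supSeminorm (Conf s (Fin n)) N (prodFun u) ≤ C * ∏ i, supSeminorm (Spacetime s) N' (u i) := by
  induction n generalizing N with
  | zero =>
    refine ⟨0, supSeminorm _ N (prodFun (s := s) (fun i : Fin 0 => i.elim0)), apply_nonneg _ _,
      fun u => ?_⟩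
    rw [Subsingleton.elim u fun i : Fin 0 => i.elim0]
    simp
  | succ n ih =>
    obtain ⟨N₁, C₁, hC₁, h₁⟩ := exists_clm_bound (pullback (confCons s n)) N
    obtain ⟨N₂, C₂, hC₂, h₂⟩ := ih N₁
    refine ⟨max N₁ N₂, C₁ * (2 ^ (N₁ + 1) * C₂), by positivity, fun u => ?_⟩
    have h3 := h₂ (fun i => u i.succ)
    have h4 : ∏ i : Fin n, supSeminorm (Spacetime s) N₂ (u i.succ) ≤
        ∏ i : Fin n, supSeminorm (Spacetime s) (max N₁ N₂) (u i.succ) :=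
      Finset.prod_le_prod (fun _ _ => apply_nonneg _ _)
        fun _ _ => supSeminorm_mono (le_max_right _ _) _
    have h5 := supSeminorm_mono (le_max_left N₁ N₂) (u 0)
    have h6 : supSeminorm (Conf s (Fin n)) N₁ (prodFun fun i => u i.succ) ≤
        C₂ * ∏ i : Fin n, supSeminorm (Spacetime s) (max N₁ N₂) (u i.succ) :=
      h3.trans (mul_le_mul_of_nonneg_left h4 hC₂)
    rw [prodFun_succ, Fin.prod_univ_succ]
    calc _ ≤ C₁ * supSeminorm (Spacetime s × Conf s (Fin n)) N₁
          (tensorFun (u 0) (prodFun fun i => u i.succ)) := h₁ _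
      _ ≤ C₁ * (2 ^ (N₁ + 1) * (supSeminorm (Spacetime s) N₁ (u 0) *
          supSeminorm (Conf s (Fin n)) N₁ (prodFun fun i => u i.succ))) :=
        mul_le_mul_of_nonneg_left (supSeminorm_tensorFun_le _ _ _) hC₁
      _ ≤ C₁ * (2 ^ (N₁ + 1) * (supSeminorm (Spacetime s) (max N₁ N₂) (u 0) *
          (C₂ * ∏ i : Fin n, supSeminorm (Spacetime s) (max N₁ N₂) (u i.succ)))) := by
        refine mul_le_mul_of_nonneg_left (mul_le_mul_of_nonneg_left ?_ (by positivity)) hC₁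
        exact mul_le_mul h5 h6 (apply_nonneg _ _) (apply_nonneg _ _)
      _ = _ := by ring

/-! ### The frame of products -/

/-- Iterated tensor products have nested pairs as indices. The bijection with multi-indices makes
the vectors and the weights explicit products; the coefficients need no explicit form. -/
theorem exists_confFrame (Φ : Frame (Spacetime s)) (n : ℕ) :
    ∃ (Ψ : Frame (Conf s (Fin n))) (e : (Fin n → Φ.Index) ≃ Ψ.Index),
      (∀ J, Ψ.vec (e J) = prodFun (Φ.vec ∘ J)) ∧ ∀ J, Ψ.weight (e J) = ∏ i, Φ.weight (J i) := by
  induction n with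
  | zero =>
    refine ⟨Frame.point _, (Equiv.equivPUnit _ : (Fin 0 → Φ.Index) ≃ Unit), fun J => ?_,
      fun J => ?_⟩
    · ext x
      simp [Frame.point]
    · simp [Frame.point]
  | succ n ih =>
    obtain ⟨Ψ, e, h1, h2⟩ := ih
    refine ⟨Frame.congr (confCons s n) (Φ.prod Ψ),
      (Fin.consEquiv fun _ : Fin (n + 1) => Φ.Index).symm.trans ((Equiv.refl _).prodCongr e),
      fun J => ?_, fun J => ?_⟩
    · rw [prodFun_succ]
      change pullback (confCons s n) (tensorFun (Φ.vec (J 0)) (Ψ.vec (e (Fin.tail J)))) = _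
      rw [h1]
      rfl
    · rw [Fin.prod_univ_succ]
      change Φ.weight (J 0) * Ψ.weight (e (Fin.tail J)) = _
      rw [h2]
      rfl

/-- The frame of products of vectors of a one-particle frame. -/
def confFrame (Φ : Frame (Spacetime s)) (n : ℕ) : Frame (Conf s (Fin n)) :=
  let Ψ := (exists_confFrame Φ n).choose
  let e := (exists_confFrame Φ n).choose_spec.choose
  have h := (exists_confFrame Φ n).choose_spec.choose_spec
  { Index := Fin n → Φ.Index
    weight := fun J => ∏ i, Φ.weight (J i)
    one_le_weight := fun J => by rw [← h.2]; exact Ψ.one_le_weight _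
    summable := by
      obtain ⟨N, hN⟩ := Ψ.summable
      exact ⟨N, (e.summable_iff.2 hN).congr fun J => by rw [← h.2]; rfl⟩
    vec := fun J => prodFun (Φ.vec ∘ J)
    coef := fun J => Ψ.coef (e J)
    vec_bound := fun N => by
      obtain ⟨M, C, hC, hb⟩ := Ψ.vec_bound N
      exact ⟨M, C, hC, fun J => by rw [← h.1, ← h.2]; exact hb _⟩
    coef_bound := fun M => by
      obtain ⟨N, C, hC, hb⟩ := Ψ.coef_bound M
      exact ⟨N, C, hC, fun J f => by rw [← h.2]; exact hb _ _⟩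
    expand := fun f x => by
      have := e.hasSum_iff.2 (Ψ.expand f x)
      refine (congrArg (fun u => HasSum u (f x)) (funext fun J => ?_)).mp this
      rw [← h.1]
      rfl }

/-- A fixed frame of one-particle functions. -/
def oneFrame (s : ℕ) : Frame (Spacetime s) := (nonempty_frame _).some

theorem hasSum_prodFun {n : ℕ} (T : 𝓢(Conf s (Fin n), ℂ) →L[ℂ] ℂ) (f : 𝓢(Conf s (Fin n), ℂ)) :
    HasSum (fun J : Fin n → (oneFrame s).Index => (confFrame (oneFrame s) n).coef J f *
      T (prodFun ((oneFrame s).vec ∘ J))) (T f) :=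
  (confFrame (oneFrame s) n).hasSum_apply T f

/-- The vectors of the frame are products of one-particle functions, and the expansion converges
under every continuous functional. -/
theorem clm_ext_prodFun {n : ℕ} {T S : 𝓢(Conf s (Fin n), ℂ) →L[ℂ] ℂ}
    (h : ∀ u, T (prodFun u) = S (prodFun u)) (f : 𝓢(Conf s (Fin n), ℂ)) : T f = S f := by
  have h1 := hasSum_prodFun T f
  simp_rw [h] at h1
  exact h1.unique (hasSum_prodFun S f)

/-- Tempered distributions which agree on products of one-particle functions are equal. -/
theorem distribution_ext_prodFun {n : ℕ} {T S : 𝓢'(Conf s (Fin n), ℂ)}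
    (h : ∀ u, T (prodFun u) = S (prodFun u)) : T = S :=
  ContinuousLinearMap.ext fun f => clm_ext_prodFun (T := T) (S := S) h f

/-! ### Products over blocks -/

theorem pullback_consEquiv_prodFun (r : ℕ) (κ : Fin (r + 1) → ℕ)
    (u : (Σ j : Fin (r + 1), Fin (κ j)) → 𝓢(Spacetime s, ℂ)) :
    pullback (consEquiv s r κ) (prodFun u) =
      tensorFun (prodFun fun i => u ⟨0, i⟩) (prodFun fun a => u ⟨a.1.succ, a.2⟩) := by
  ext p
  change prodFun u (consEquiv s r κ p) = _
  rw [prodFun_apply, tensorFun_apply, prodFun_apply, prodFun_apply, Fintype.prod_sigma,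
    Fin.prod_univ_succ, Fintype.prod_sigma]
  rfl

theorem tensorFamily_prodFun : ∀ (r : ℕ) (κ : Fin r → ℕ)
    (T : (j : Fin r) → 𝓢'(Conf s (Fin (κ j)), ℂ))
    (u : (Σ j : Fin r, Fin (κ j)) → 𝓢(Spacetime s, ℂ)),
    tensorFamily s r κ T (prodFun u) = ∏ j, T j (prodFun fun i => u ⟨j, i⟩) := by
  intro r
  induction r with
  | zero =>
    intro κ T u
    change prodFun u 0 = _
    simp
  | succ r ih =>
    intro κ T u
    rw [tensorFamily, pushDist_apply, pullback_consEquiv_prodFun, tensorDist_tensorFun, ih,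
      Fin.prod_univ_succ]

theorem blockProduct_prodFun {n : ℕ} (c : OrderedFinpartition n)
    (T : (j : Fin c.length) → 𝓢'(Conf s (Fin (c.partSize j)), ℂ))
    (u : Fin n → 𝓢(Spacetime s, ℂ)) :
    blockProduct c T (prodFun u) = ∏ j, T j (prodFun (u ∘ c.emb j)) := by
  rw [blockProduct, pushDist_apply, pullback_rename_prodFun, tensorFamily_prodFun]
  rfl

/-- Evaluating all factors but the `j`-th on `f` leaves a test function in the variables of the
`j`-th block; the exchange of factors brings this block into the outer position. In this form
continuity in each single factor, for pointwise convergence, is immediate. -/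
theorem exists_tensorFamily_update : ∀ (r : ℕ) (κ : Fin r → ℕ)
    (T : (j : Fin r) → 𝓢'(Conf s (Fin (κ j)), ℂ)) (j : Fin r)
    (f : 𝓢(Conf s (Σ j : Fin r, Fin (κ j)), ℂ)),
    ∃ g, ∀ X, tensorFamily s r κ (Function.update T j X) f = X g := by
  intro r
  induction r with
  | zero => exact fun κ T j => j.elim0
  | succ r ih =>
    intro κ T j f
    induction j using Fin.cases with
    | zero =>
      refine ⟨partialEval (tensorFamily s r (fun j : Fin r => κ j.succ) (fun j : Fin r => T j.succ))
        (pullback (consEquiv s r κ) f), fun X => ?_⟩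
      rw [tensorFamily, pushDist_apply, tensorDist_apply, Function.update_self]
      have : (fun j : Fin r => Function.update T 0 X j.succ) =
          fun j : Fin r => T j.succ := by
        funext j
        rw [Function.update_of_ne (Fin.succ_ne_zero j)]
      rw [this]
    | succ j =>
      obtain ⟨g, hg⟩ := ih (fun j : Fin r => κ j.succ) (fun j : Fin r => T j.succ) j
        (partialEval (T 0) (pullback (ContinuousLinearEquiv.prodComm ℝ _ _)
          (pullback (consEquiv s r κ) f)))
      refine ⟨g, fun X => ?_⟩
      rw [tensorFamily, pushDist_apply, tensorDist_eq_swap, tensorDist_apply,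
        Function.update_of_ne (Fin.succ_ne_zero j).symm, ← hg]
      congr 2
      funext i
      by_cases h : i = j
      · subst h
        rw [Function.update_self, Function.update_self]
      · rw [Function.update_of_ne h, Function.update_of_ne (fun h' => h (Fin.succ_inj.1 h'))]

/-- The product over blocks is continuous in every factor. -/
theorem exists_blockProduct_update {n : ℕ} (c : OrderedFinpartition n)
    (T : (j : Fin c.length) → 𝓢'(Conf s (Fin (c.partSize j)), ℂ)) (j : Fin c.length)
    (f : 𝓢(Conf s (Fin n), ℂ)) :
    ∃ g, ∀ X, blockProduct c (Function.update T j X) f = X g :=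
  exists_tensorFamily_update _ _ T j _

/-- The moment-cumulant formula for numbers: distributions in different blocks decouple on products.
-/
theorem trunc_prodFun {C : Type} (W : Functional s C) {n : ℕ} (hn : 0 < n) (w : Fin n → C)
    (u : Fin n → 𝓢(Spacetime s, ℂ)) :
    W n w (prodFun u) = ∑ c : OrderedFinpartition n,
      ∏ j, W.trunc (c.partSize j) (w ∘ c.emb j) (prodFun (u ∘ c.emb j)) := by
  rw [W.eq_sum_trunc hn]
  simp only [← blockProduct_prodFun]
  exact sum_apply _ _ _

end

noncomputable section

/-! ### Inversion of the Fourier transform -/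

section Scaling

variable {E : Type*} [NormedAddCommGroup E] [InnerProductSpace ℝ E]

theorem inner_scaled (R : E ≃ₗᵢ[ℝ] E) (A : E ≃L[ℝ] E) (hR : ∀ x y, inner ℝ (R x) y = inner ℝ x (R y))
    (hA : ∀ x, A x = (2 * Real.pi)⁻¹ • R x) (x k : E) : inner ℝ x (A k) = inner ℝ (A x) k := by
  rw [hA, hA, inner_smul_left, inner_smul_right, hR]
  rfl

variable [FiniteDimensional ℝ E] [MeasurableSpace E] [BorelSpace E]

theorem integral_comp_scaled (R : E ≃ₗᵢ[ℝ] E) (A : E ≃L[ℝ] E)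
    (hA : ∀ x, A x = (2 * Real.pi)⁻¹ • R x) (G : E → ℂ) :
    ∫ x, G (A x) = ((2 * Real.pi) ^ Module.finrank ℝ E : ℝ) * ∫ x, G x := by
  have h1 : ∫ x, G (A x) = ∫ x, G ((2 * Real.pi)⁻¹ • x) := by
    simp_rw [hA]
    exact R.measurePreserving.integral_comp R.toHomeomorph.measurableEmbedding
      fun y => G ((2 * Real.pi)⁻¹ • y)
  rw [h1, Measure.integral_comp_smul, inv_pow, inv_inv, abs_of_pos (by positivity),
    Complex.real_smul]

/-- `A` is symmetric, so the phase `⟨x, A k⟩` equals `⟨A x, k⟩`, and the substitution `y = A x`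
reduces the claim to ordinary inversion. The Jacobian is the factor on the right. -/
theorem fourier_scaled_inv (R : E ≃ₗᵢ[ℝ] E) (A : E ≃L[ℝ] E)
    (hR : ∀ x y, inner ℝ (R x) y = inner ℝ x (R y))
    (hA : ∀ x, A x = (2 * Real.pi)⁻¹ • R x) (f : 𝓢(E, ℂ)) :
    pullback A (𝓕 (pullback A (𝓕⁻ f))) =
      ((2 * Real.pi) ^ Module.finrank ℝ E : ℝ) • f := by
  ext k
  have h1 : pullback A (𝓕 (pullback A (𝓕⁻ f))) k =
      𝓕 (pullback A (𝓕⁻ f) : E → ℂ) (A k) := by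
    rw [← SchwartzMap.fourier_coe]
    rfl
  have h2 : 𝓕 (𝓕⁻ f : 𝓢(E, ℂ)) = f := FourierTransform.fourier_fourierInv_eq f
  have h3 := congrArg (fun g : 𝓢(E, ℂ) => g k) h2
  simp only [SchwartzMap.fourier_coe] at h3
  rw [h1, smul_apply, Complex.real_smul, ← h3, Real.fourier_eq', Real.fourier_eq',
    ← integral_comp_scaled R A hA]
  refine integral_congr_ae (Filter.Eventually.of_forall fun x => ?_)
  simp only [inner_scaled R A hR hA]
  rfl

theorem fourierInv_scaled (R : E ≃ₗᵢ[ℝ] E) (A : E ≃L[ℝ] E)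
    (hR : ∀ x y, inner ℝ (R x) y = inner ℝ x (R y))
    (hA : ∀ x, A x = (2 * Real.pi)⁻¹ • R x) (f : 𝓢(E, ℂ)) :
    pullback A (𝓕⁻ (pullback A (𝓕 f))) =
      ((2 * Real.pi) ^ Module.finrank ℝ E : ℝ) • f := by
  ext k
  have h1 : pullback A (𝓕⁻ (pullback A (𝓕 f))) k =
      𝓕⁻ (pullback A (𝓕 f) : E → ℂ) (A k) := by
    rw [← SchwartzMap.fourierInv_coe]
    rfl
  have h2 : 𝓕⁻ (𝓕 f : 𝓢(E, ℂ)) = f := FourierTransform.fourierInv_fourier_eq f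
  have h3 := congrArg (fun g : 𝓢(E, ℂ) => g k) h2
  simp only [SchwartzMap.fourierInv_coe] at h3
  rw [h1, smul_apply, Complex.real_smul, ← h3, Real.fourierInv_eq', Real.fourierInv_eq',
    ← integral_comp_scaled R A hA]
  refine integral_congr_ae (Filter.Eventually.of_forall fun x => ?_)
  simp only [inner_scaled R A hR hA]
  rfl

end Scaling

/-- The reflection `(k⁰, 𝐤) ↦ (k⁰, -𝐤)`. -/
def reflect (s : ℕ) : Spacetime s ≃ₗᵢ[ℝ] Spacetime s :=
  LinearIsometryEquiv.piLpCongrRight 2 fun j : Fin (s + 1) =>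
    if j = 0 then LinearIsometryEquiv.refl ℝ ℝ else LinearIsometryEquiv.neg ℝ

theorem reflect_apply {s : ℕ} (k : Spacetime s) (j : Fin (s + 1)) :
    reflect s k j = if j = 0 then k j else - k j := by
  rw [reflect, LinearIsometryEquiv.piLpCongrRight_apply]
  by_cases h : j = 0 <;> simp [h]

theorem inner_reflect {s : ℕ} (x k : Spacetime s) :
    inner ℝ (reflect s x) k = inner ℝ x (reflect s k) := by
  rw [PiLp.inner_apply, PiLp.inner_apply]
  refine Finset.sum_congr rfl fun j _ => ?_
  rw [reflect_apply, reflect_apply]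
  by_cases h : j = 0 <;> simp [h]

/-- The reflection of every variable. -/
def reflectConf (s n : ℕ) : Conf s (Fin n) ≃ₗᵢ[ℝ] Conf s (Fin n) :=
  LinearIsometryEquiv.piLpCongrRight 2 fun _ => reflect s

theorem inner_reflectConf {s n : ℕ} (x k : Conf s (Fin n)) :
    inner ℝ (reflectConf s n x) k = inner ℝ x (reflectConf s n k) := by
  rw [PiLp.inner_apply, PiLp.inner_apply]
  exact Finset.sum_congr rfl fun j _ => inner_reflect _ _

theorem phaseEquiv_eq {s n : ℕ} (k : Conf s (Fin n)) :
    phaseEquiv s n k = (2 * Real.pi)⁻¹ • reflectConf s n k := by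
  refine PiLp.ext fun l => PiLp.ext fun j => ?_
  change (2 * Real.pi)⁻¹ * (if j = 0 then k l j else - k l j) = (2 * Real.pi)⁻¹ * reflect s (k l) j
  rw [reflect_apply]

/-- The normalization cancels the Jacobian of the Minkowski phase: the exponents `-dn/2`, `-dn/2`
and `dn` of `2π` add up to `0`. -/
theorem fourierConst_mul_self (s n : ℕ) :
    fourierConst s n * fourierConst s n *
      (((2 * Real.pi) ^ Module.finrank ℝ (Conf s (Fin n)) : ℝ) : ℂ) = 1 := by
  have h : Module.finrank ℝ (Conf s (Fin n)) = (s + 1) * n := by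
    rw [LinearEquiv.finrank_eq (WithLp.linearEquiv 2 ℝ (Fin n → Spacetime s)),
      Module.finrank_pi_fintype]
    simp [mul_comm]
  rw [h, fourierConst, ← Complex.ofReal_mul, ← Complex.ofReal_mul, ← Real.rpow_add Real.two_pi_pos,
    ← Real.rpow_natCast, ← Real.rpow_add Real.two_pi_pos]
  push_cast
  ring_nf
  simp

theorem fourierMInv_fourierM {s n : ℕ} (f : 𝓢(Conf s (Fin n), ℂ)) :
    fourierMInv s n (fourierM s n f) = f := by
  have h := fourierInv_scaled (reflectConf s n) (phaseEquiv s n) inner_reflectConf phaseEquiv_eq f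
  have e : fourierMInv s n (fourierM s n f) = (fourierConst s n * fourierConst s n) •
      pullback (phaseEquiv s n) (𝓕⁻ (pullback (phaseEquiv s n) (𝓕 f))) := by
    rw [mul_smul, ← map_smul, ← FourierTransform.fourierInv_smul, ← map_smul]
    rfl
  rw [e, h]
  ext x
  have := fourierConst_mul_self s n
  simp only [smul_apply, smul_eq_mul, Complex.real_smul]
  rw [← mul_assoc, this, one_mul]

/-! ### The Fourier transform of products -/

/-- The volume of the configuration space and the product of the volumes are Haar measures, hence
proportional. The factor is left undetermined; `multiplier_prodFun` later removes the resulting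
constant by a test case. -/
theorem exists_integral_prod (s n : ℕ) : ∃ c : ℂ, ∀ u : Fin n → Spacetime s → ℂ,
    ∫ x : Conf s (Fin n), ∏ i, u i (x i) = c * ∏ i, ∫ x, u i x := by
  induction n with
  | zero =>
    refine ⟨∫ x : Conf s (Fin 0), 1, fun u => by simp⟩
  | succ n ih =>
    obtain ⟨c, hc⟩ := ih
    let e := confCons s n
    let ν : Measure (Spacetime s × Conf s (Fin n)) :=
      (volume : Measure (Spacetime s)).prod (volume : Measure (Conf s (Fin n)))
    have : (Measure.map e (volume : Measure (Conf s (Fin (n + 1))))).IsAddHaarMeasure :=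
      e.isAddHaarMeasure_map _
    have : ν.IsAddHaarMeasure := Measure.prod.instIsAddHaarMeasure _ _
    obtain ⟨a, ha⟩ : ∃ a : NNReal,
        Measure.map e (volume : Measure (Conf s (Fin (n + 1)))) = a • ν :=
      ⟨_, Measure.isAddLeftInvariant_eq_smul _ _⟩
    refine ⟨(a : ℂ) * c, fun u => ?_⟩
    have h1 : ∫ x : Conf s (Fin (n + 1)), ∏ i, u i (x i) =
        ∫ p, u 0 p.1 * ∏ i : Fin n, u i.succ (p.2 i)
          ∂(Measure.map e (volume : Measure (Conf s (Fin (n + 1))))) := by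
      refine Eq.trans ?_ (MeasurableEmbedding.integral_map (f := e)
        e.toHomeomorph.measurableEmbedding _).symm
      refine integral_congr_ae (Filter.Eventually.of_forall fun x => ?_)
      exact Fin.prod_univ_succ _
    rw [h1, ha, integral_smul_nnreal_measure, Fin.prod_univ_succ]
    have h2 := integral_prod_mul (μ := (volume : Measure (Spacetime s)))
      (ν := (volume : Measure (Conf s (Fin n)))) (u 0) (fun y => ∏ i : Fin n, u i.succ (y i))
    rw [h2, hc, NNReal.smul_def, Complex.real_smul]
    ring

/-- The map `k ↦ (2π)⁻¹ (k⁰, -𝐤)`. -/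
def onePhase (s : ℕ) : Spacetime s ≃L[ℝ] Spacetime s :=
  (reflect s).toContinuousLinearEquiv.trans
    (ContinuousLinearEquiv.smulLeft (Units.mk0 (2 * Real.pi)⁻¹ (by positivity)))

theorem onePhase_apply {s : ℕ} (k : Spacetime s) : onePhase s k = (2 * Real.pi)⁻¹ • reflect s k := rfl

/-- The one-particle Fourier transform, without normalization. -/
def oneFourier (s : ℕ) : 𝓢(Spacetime s, ℂ) →L[ℂ] 𝓢(Spacetime s, ℂ) :=
  pullback (onePhase s) ∘L fourierCLM ℂ 𝓢(Spacetime s, ℂ)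

/-- The inverse of `oneFourier`. -/
def oneFourierInv (s : ℕ) : 𝓢(Spacetime s, ℂ) →L[ℂ] 𝓢(Spacetime s, ℂ) :=
  ((((2 * Real.pi) ^ Module.finrank ℝ (Spacetime s) : ℝ) : ℂ)⁻¹) •
    (pullback (onePhase s) ∘L fourierInvCLM ℂ 𝓢(Spacetime s, ℂ))

theorem oneFourierInv_oneFourier {s : ℕ} (f : 𝓢(Spacetime s, ℂ)) :
    oneFourierInv s (oneFourier s f) = f := by
  have h := fourierInv_scaled (reflect s) (onePhase s) inner_reflect onePhase_apply f
  have e : oneFourierInv s (oneFourier s f) =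
      ((((2 * Real.pi) ^ Module.finrank ℝ (Spacetime s) : ℝ) : ℂ)⁻¹) •
      pullback (onePhase s) (𝓕⁻ (pullback (onePhase s) (𝓕 f))) := rfl
  rw [e, h]
  ext x
  simp only [smul_apply, smul_eq_mul, Complex.real_smul]
  rw [← mul_assoc, inv_mul_cancel₀, one_mul]
  exact Complex.ofReal_ne_zero.2 (pow_pos Real.two_pi_pos _).ne'

theorem inner_phaseEquiv_eq_sum {s n : ℕ} (x k : Conf s (Fin n)) :
    inner ℝ x (phaseEquiv s n k) = ∑ l, inner ℝ (x l) (onePhase s (k l)) := by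
  rw [PiLp.inner_apply]
  refine Finset.sum_congr rfl fun l _ => ?_
  rw [phaseEquiv_eq, onePhase_apply]
  rfl

theorem exists_fourierM_prodFun (s n : ℕ) : ∃ c : ℂ, ∀ u : Fin n → 𝓢(Spacetime s, ℂ),
    fourierM s n (prodFun u) = c • prodFun fun l => oneFourier s (u l) := by
  obtain ⟨c, hc⟩ := exists_integral_prod s n
  refine ⟨fourierConst s n * c, fun u => ?_⟩
  ext k
  have h1 : fourierM s n (prodFun u) k =
      fourierConst s n * 𝓕 (prodFun u : Conf s (Fin n) → ℂ) (phaseEquiv s n k) := rfl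
  have h2 : ∀ l, oneFourier s (u l) (k l) = 𝓕 (u l : Spacetime s → ℂ) (onePhase s (k l)) :=
    fun l => rfl
  rw [h1, smul_apply, prodFun_apply]
  simp_rw [h2]
  simp only [Real.fourier_eq', smul_eq_mul]
  rw [mul_assoc, ← hc]
  congr 1
  refine integral_congr_ae (Filter.Eventually.of_forall fun x => ?_)
  simp only [inner_phaseEquiv_eq_sum, prodFun_apply, Finset.prod_mul_distrib, ← Complex.exp_sum]
  congr 2
  push_cast
  rw [Finset.mul_sum, Finset.sum_mul]

theorem exists_fourierMInv_prodFun (s n : ℕ) : ∃ c : ℂ, ∀ u : Fin n → 𝓢(Spacetime s, ℂ),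
    fourierMInv s n (prodFun u) = c • prodFun fun l => oneFourierInv s (u l) := by
  obtain ⟨c, hc⟩ := exists_integral_prod s n
  set a : ℂ := (((2 * Real.pi) ^ Module.finrank ℝ (Spacetime s) : ℝ) : ℂ) with ha
  have ha0 : a ≠ 0 := Complex.ofReal_ne_zero.2 (pow_pos Real.two_pi_pos _).ne'
  refine ⟨fourierConst s n * c * a ^ n, fun u => ?_⟩
  ext k
  have h1 : fourierMInv s n (prodFun u) k =
      fourierConst s n * 𝓕⁻ (prodFun u : Conf s (Fin n) → ℂ) (phaseEquiv s n k) := by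
    rw [← SchwartzMap.fourierInv_coe]
    rfl
  have h2 : ∀ l, oneFourierInv s (u l) (k l) = a⁻¹ * 𝓕⁻ (u l : Spacetime s → ℂ) (onePhase s (k l)) :=
    fun l => by
      rw [← SchwartzMap.fourierInv_coe]
      rfl
  rw [h1, smul_apply, prodFun_apply]
  simp_rw [h2]
  rw [Finset.prod_mul_distrib, Finset.prod_const, Finset.card_univ, Fintype.card_fin, smul_eq_mul,
    show ∀ z, fourierConst s n * c * a ^ n * (a⁻¹ ^ n * z) = fourierConst s n * (c * z) by
      intro z
      rw [inv_pow]
      field_simp]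
  simp only [Real.fourierInv_eq', smul_eq_mul]
  rw [← hc]
  congr 1
  refine integral_congr_ae (Filter.Eventually.of_forall fun x => ?_)
  simp only [inner_phaseEquiv_eq_sum, prodFun_apply, Finset.prod_mul_distrib, ← Complex.exp_sum]
  congr 2
  push_cast
  rw [Finset.mul_sum, Finset.sum_mul]

theorem hasTemperateGrowth_prod {s n : ℕ} {g : Fin n → Spacetime s → ℂ}
    (hg : ∀ l, (g l).HasTemperateGrowth) :
    Function.HasTemperateGrowth fun k : Conf s (Fin n) => ∏ l, g l (k l) := by
  have h1 : ∀ l, Function.HasTemperateGrowth fun k : Conf s (Fin n) => g l (k l) := fun l =>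
    (hg l).comp (PiLp.proj 2 (𝕜 := ℝ) (fun _ : Fin n => Spacetime s) l).hasTemperateGrowth
  have h2 : ∀ t : Finset (Fin n),
      Function.HasTemperateGrowth fun k : Conf s (Fin n) => ∏ l ∈ t, g l (k l) := by
    intro t
    induction t using Finset.cons_induction with
    | empty => simp
    | cons a t ha ih =>
      simp only [Finset.prod_cons]
      exact (h1 a).mul ih
  exact h2 _

theorem smulLeftCLM_prodFun {s n : ℕ} {g : Fin n → Spacetime s → ℂ}
    (hg : ∀ l, (g l).HasTemperateGrowth) (u : Fin n → 𝓢(Spacetime s, ℂ)) :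
    SchwartzMap.smulLeftCLM ℂ (fun k : Conf s (Fin n) => ∏ l, g l (k l)) (prodFun u) =
      prodFun fun l => SchwartzMap.smulLeftCLM ℂ (g l) (u l) := by
  ext k
  rw [SchwartzMap.smulLeftCLM_apply_apply (hasTemperateGrowth_prod hg), prodFun_apply, prodFun_apply, smul_eq_mul,
    ← Finset.prod_mul_distrib]
  exact Finset.prod_congr rfl fun l _ => by
    rw [SchwartzMap.smulLeftCLM_apply_apply (hg l), smul_eq_mul]

/-- The one-particle version of the multiplication by `g` in momentum space. -/
def oneMultiplier {s : ℕ} (g : Spacetime s → ℂ) : 𝓢(Spacetime s, ℂ) →L[ℂ] 𝓢(Spacetime s, ℂ) :=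
  oneFourierInv s ∘L SchwartzMap.smulLeftCLM ℂ g ∘L oneFourier s

theorem exists_multiplier_const (s n : ℕ) : ∃ c : ℂ, ∀ (g : Fin n → Spacetime s → ℂ),
    (∀ l, (g l).HasTemperateGrowth) → ∀ u : Fin n → 𝓢(Spacetime s, ℂ),
    fourierMInv s n (SchwartzMap.smulLeftCLM ℂ (fun k : Conf s (Fin n) => ∏ l, g l (k l))
      (fourierM s n (prodFun u))) = c • prodFun fun l => oneMultiplier (g l) (u l) := by
  obtain ⟨a, ha⟩ := exists_fourierM_prodFun s n
  obtain ⟨b, hb⟩ := exists_fourierMInv_prodFun s n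
  refine ⟨a * b, fun g hg u => ?_⟩
  rw [ha, map_smul, map_smul, smulLeftCLM_prodFun hg, hb, smul_smul]
  rfl

theorem exists_ne_zero_schwartz (s : ℕ) : ∃ (f : 𝓢(Spacetime s, ℂ)) (x : Spacetime s), f x ≠ 0 := by
  obtain ⟨f, -, hc, hd, -, h1⟩ := exists_contDiff_tsupport_subset (n := ⊤)
    (s := (Set.univ : Set (Spacetime s))) (x := 0) Filter.univ_mem
  refine ⟨HasCompactSupport.toSchwartzMap (f := fun x => ((f x : ℝ) : ℂ))
    (hc.comp_left Complex.ofReal_zero) (Complex.ofRealCLM.contDiff.comp hd), 0, ?_⟩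
  change ((f 0 : ℝ) : ℂ) ≠ 0
  rw [h1]
  simp

/-- The constant `c` of `exists_multiplier_const` does not depend on the multipliers. For
multipliers equal to `1` Fourier inversion applies on both sides, and a function which is non-zero
somewhere forces `c = 1`. -/
theorem multiplier_prodFun {s n : ℕ} {g : Fin n → Spacetime s → ℂ}
    (hg : ∀ l, (g l).HasTemperateGrowth) (u : Fin n → 𝓢(Spacetime s, ℂ)) :
    fourierMInv s n (SchwartzMap.smulLeftCLM ℂ (fun k : Conf s (Fin n) => ∏ l, g l (k l))
      (fourierM s n (prodFun u))) = prodFun fun l => oneMultiplier (g l) (u l) := by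
  obtain ⟨c, hc⟩ := exists_multiplier_const s n
  suffices h1 : c = 1 by rw [hc g hg, h1, one_smul]
  obtain ⟨f, x, hx⟩ := exists_ne_zero_schwartz s
  have h2 := hc (fun _ _ => 1) (fun _ => Function.HasTemperateGrowth.const 1) (fun _ => f)
  have h3 : ∀ (E : Type) [NormedAddCommGroup E] [NormedSpace ℝ E] (f : 𝓢(E, ℂ)),
      SchwartzMap.smulLeftCLM ℂ (fun _ : E => (1 : ℂ)) f = f := fun E _ _ f => by
    ext y
    rw [SchwartzMap.smulLeftCLM_apply_apply (Function.HasTemperateGrowth.const 1)]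
    simp
  have h4 : oneMultiplier (fun _ : Spacetime s => (1 : ℂ)) f = f := by
    change oneFourierInv s (SchwartzMap.smulLeftCLM ℂ (fun _ => (1 : ℂ)) (oneFourier s f)) = f
    rw [h3, oneFourierInv_oneFourier]
  simp only [Finset.prod_const_one, h3, fourierMInv_fourierM, h4] at h2
  have h5 := congrArg (fun h : 𝓢(Conf s (Fin n), ℂ) => h (WithLp.toLp 2 fun _ => x)) h2
  simp only [prodFun_apply, smul_apply, smul_eq_mul, Finset.prod_const] at h5
  have h6 : f x ^ (Finset.univ : Finset (Fin n)).card ≠ 0 := pow_ne_zero _ hx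
  exact (mul_right_cancel₀ h6 (by rw [one_mul]; exact h5)).symm

/-! ### The multipliers of the wave operators -/

theorem hasTemperateGrowth_cexp : Function.HasTemperateGrowth fun x : ℝ => Complex.exp (Complex.I * x) := by
  have hd : ∀ x : ℝ, HasDerivAt (fun x : ℝ => Complex.exp (Complex.I * x))
      (Complex.I * Complex.exp (Complex.I * x)) x := fun x => by
    have := ((Complex.ofRealCLM.hasDerivAt (x := x)).const_mul Complex.I).cexp
    simpa [mul_comm] using this
  have h : ∀ n : ℕ, iteratedDeriv n (fun x : ℝ => Complex.exp (Complex.I * x)) =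
      fun x : ℝ => Complex.I ^ n * Complex.exp (Complex.I * x) := by
    intro n
    induction n with
    | zero => simp
    | succ n ih =>
      rw [iteratedDeriv_succ, ih]
      funext x
      rw [((hd x).const_mul _).deriv]
      ring
  refine ⟨?_, fun n => ⟨0, 1, fun x => ?_⟩⟩
  · exact Complex.contDiff_exp.comp (contDiff_const.mul Complex.ofRealCLM.contDiff)
  · rw [norm_iteratedFDeriv_eq_norm_iteratedDeriv, h, norm_mul, norm_pow, Complex.norm_I, mul_comm,
      mul_comm Complex.I, Complex.norm_exp_ofReal_mul_I]
    simp

/-- The function is bounded and its derivative is supported in `[0, 1]`. -/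
theorem hasTemperateGrowth_smoothTransition : Function.HasTemperateGrowth Real.smoothTransition := by
  refine Function.HasTemperateGrowth.of_fderiv (k := 0) (C := 1) ?_
    (Real.smoothTransition.contDiff.differentiable (n := 1) (by simp)) fun x => ?_
  · refine HasCompactSupport.hasTemperateGrowth ?_
      (Real.smoothTransition.contDiff.fderiv_right (n := (⊤ : ℕ∞)) (by exact_mod_cast le_top))
    refine HasCompactSupport.of_support_subset_isCompact (isCompact_Icc (a := (0 : ℝ)) (b := 1)) ?_
    intro x hx
    by_contra hcon
    refine hx ?_
    rw [Set.mem_Icc, not_and_or, not_le, not_le] at hcon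
    rcases hcon with h | h
    · have : Real.smoothTransition =ᶠ[𝓝 x] fun _ => 0 := by
        filter_upwards [Iio_mem_nhds h] with y hy
        exact Real.smoothTransition.zero_of_nonpos (le_of_lt hy)
      rw [this.fderiv_eq, fderiv_fun_const]
      rfl
    · have : Real.smoothTransition =ᶠ[𝓝 x] fun _ => 1 := by
        filter_upwards [Ioi_mem_nhds h] with y hy
        exact Real.smoothTransition.one_of_one_le (le_of_lt hy)
      rw [this.fderiv_eq, fderiv_fun_const]
      rfl
  · rw [pow_zero, mul_one, Real.norm_of_nonneg (Real.smoothTransition.nonneg x)]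
    exact Real.smoothTransition.le_one x

theorem hasTemperateGrowth_coord {s : ℕ} (j : Fin (s + 1)) :
    Function.HasTemperateGrowth fun k : Spacetime s => k j :=
  (EuclideanSpace.proj (𝕜 := ℝ) j).hasTemperateGrowth

theorem hasTemperateGrowth_mink {s : ℕ} :
    Function.HasTemperateGrowth fun k : Spacetime s => mink k k := by
  unfold mink
  refine ((hasTemperateGrowth_coord 0).mul (hasTemperateGrowth_coord 0)).sub
    (Function.HasTemperateGrowth.sum fun j _ => ?_)
  exact (hasTemperateGrowth_coord j.succ).mul (hasTemperateGrowth_coord j.succ)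

/-- `ω = m (1 + |𝐤 / m|²)^{1/2}`, where the base of the power stays away from `0`; this needs `m >
0`. -/
theorem hasTemperateGrowth_energy {s : ℕ} {m : ℝ} (hm : 0 < m) :
    Function.HasTemperateGrowth fun k : Spacetime s => energy m k := by
  let A : Spacetime s →ₗ[ℝ] EuclideanSpace ℝ (Fin s) :=
    { toFun := fun k => WithLp.toLp 2 fun j => m⁻¹ * k j.succ
      map_add' := fun x y => PiLp.ext fun j => by simp [mul_add]
      map_smul' := fun c x => PiLp.ext fun j => by simp; ring }
  have h := (Function.HasTemperateGrowth.const m).mul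
    ((Function.hasTemperateGrowth_one_add_norm_sq_rpow (H := EuclideanSpace ℝ (Fin s)) (1 / 2)).comp
      (LinearMap.toContinuousLinearMap A).hasTemperateGrowth)
  refine (congrArg Function.HasTemperateGrowth (funext fun k => ?_)).mp h
  have h1 : ‖A k‖ ^ 2 = (m ^ 2)⁻¹ * ∑ j : Fin s, k j.succ ^ 2 := by
    rw [EuclideanSpace.norm_sq_eq, Finset.mul_sum]
    refine Finset.sum_congr rfl fun j _ => ?_
    change ‖m⁻¹ * k j.succ‖ ^ 2 = _
    rw [Real.norm_eq_abs, sq_abs, mul_pow, inv_pow]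
  change m * (1 + ‖A k‖ ^ 2) ^ (1 / 2 : ℝ) = energy m k
  rw [h1, ← Real.sqrt_eq_rpow, energy]
  nth_rewrite 1 [← Real.sqrt_sq hm.le]
  rw [← Real.sqrt_mul (sq_nonneg m)]
  congr 1
  field_simp
  ring

section Chi

variable {s : ℕ} {m ε : ℝ} {φ : ℝ → ℝ}

/-- Where `φ (k² - m²) ≠ 0` one has `(k⁰)² ≥ k² > m² - ε > 0`. The jump of `θ(k⁰)` thus lies off the
support, and a smooth step which is `1` from `√(m² - ε)` on has the same effect. This makes the
cutoff smooth. -/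
theorem chiPlus_eq (hεm : ε < m ^ 2)
    (hsupp : tsupport φ ⊆ Set.Ioo (-ε) ε) (k : Spacetime s) : chiPlus m φ k =
    Real.smoothTransition ((√(m ^ 2 - ε))⁻¹ * k 0) * φ (mink k k - m ^ 2) := by
  have hc : 0 < √(m ^ 2 - ε) := Real.sqrt_pos.2 (by linarith)
  rw [chiPlus]
  split_ifs with h
  · by_cases h0 : φ (mink k k - m ^ 2) = 0
    · rw [h0, mul_zero]
    · have h1 := hsupp (subset_tsupport φ h0)
      have h2 : mink k k ≤ k 0 ^ 2 := by
        rw [mink]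
        have : 0 ≤ ∑ j : Fin s, k j.succ * k j.succ :=
          Finset.sum_nonneg fun j _ => mul_self_nonneg _
        linarith [sq (k 0)]
      have h3 : √(m ^ 2 - ε) ≤ k 0 := by
        rw [Real.sqrt_le_left h.le]
        linarith [h1.1]
      rw [Real.smoothTransition.one_of_one_le, one_mul]
      rwa [inv_mul_eq_div, le_div_iff₀ hc, one_mul]
  · rw [Real.smoothTransition.zero_of_nonpos, zero_mul]
    exact mul_nonpos_of_nonneg_of_nonpos (by positivity) (not_lt.1 h)

theorem hasTemperateGrowth_chiPlus (hεm : ε < m ^ 2) (hφ : ContDiff ℝ ∞ φ)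
    (hsupp : tsupport φ ⊆ Set.Ioo (-ε) ε) :
    Function.HasTemperateGrowth (chiPlus (s := s) m φ) := by
  have hc : HasCompactSupport φ :=
    IsCompact.of_isClosed_subset (isCompact_Icc (a := -ε) (b := ε)) (isClosed_tsupport φ)
      (hsupp.trans Set.Ioo_subset_Icc_self)
  rw [funext (chiPlus_eq hεm hsupp)]
  refine (hasTemperateGrowth_smoothTransition.comp ((Function.HasTemperateGrowth.const _).mul
    (hasTemperateGrowth_coord 0))).mul ?_
  exact (hc.hasTemperateGrowth hφ).comp (hasTemperateGrowth_mink.sub (.const _))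

theorem chiMinus_eq (k : Spacetime s) : chiMinus m φ k = chiPlus m φ (-k) := by
  simp [chiMinus, chiPlus, mink]

theorem hasTemperateGrowth_chiMinus (hεm : ε < m ^ 2) (hφ : ContDiff ℝ ∞ φ)
    (hsupp : tsupport φ ⊆ Set.Ioo (-ε) ε) :
    Function.HasTemperateGrowth (chiMinus (s := s) m φ) := by
  rw [funext chiMinus_eq]
  exact (hasTemperateGrowth_chiPlus hεm hφ hsupp).comp
    (ContinuousLinearEquiv.neg ℝ (M := Spacetime s)).hasTemperateGrowth

theorem hasTemperateGrowth_chi (hm : 0 < m) (hεm : ε < m ^ 2) (hφ : ContDiff ℝ ∞ φ)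
    (hsupp : tsupport φ ⊆ Set.Ioo (-ε) ε) (t : ℝ) (a : Label) :
    Function.HasTemperateGrowth (chi (s := s) m φ t a) := by
  have hexp : ∀ {g : Spacetime s → ℝ}, g.HasTemperateGrowth →
      Function.HasTemperateGrowth fun k => Complex.exp (Complex.I * (g k : ℝ)) :=
    fun hg => hasTemperateGrowth_cexp.comp hg
  have h1 := Function.Complex.hasTemperateGrowth_ofReal.comp
    (hasTemperateGrowth_chiPlus (s := s) hεm hφ hsupp)
  have h2 := Function.Complex.hasTemperateGrowth_ofReal.comp
    (hasTemperateGrowth_chiMinus (s := s) hεm hφ hsupp)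
  have h3 : Function.HasTemperateGrowth fun k : Spacetime s => (k 0 - energy m k) * t :=
    ((hasTemperateGrowth_coord 0).sub (hasTemperateGrowth_energy hm)).mul (.const t)
  have h4 : Function.HasTemperateGrowth fun k : Spacetime s => (k 0 + energy m k) * t :=
    ((hasTemperateGrowth_coord 0).add (hasTemperateGrowth_energy hm)).mul (.const t)
  cases a with
  | inn =>
    have := (h1.mul (hexp h3.neg)).add (h2.mul (hexp h4.neg))
    refine (congrArg Function.HasTemperateGrowth (funext fun k => ?_)).mp this
    simp [chi]
  | loc => exact .const 1
  | out => exact (h1.mul (hexp h3)).add (h2.mul (hexp h4))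

/-- The multiplier is a product of functions of single momenta, so the finite-time wave operator
acts on every factor separately. Its compatibility with truncation rests on this. -/
theorem omegaComp_prodFun (hm : 0 < m) (hεm : ε < m ^ 2) (hφ : ContDiff ℝ ∞ φ)
    (hsupp : tsupport φ ⊆ Set.Ioo (-ε) ε) {n : ℕ} (t : Fin n → ℝ) (w : Fin n → Label)
    (u : Fin n → 𝓢(Spacetime s, ℂ)) :
    omegaComp m φ t w (prodFun u) = prodFun fun l => oneMultiplier (chi m φ (t l) (w l)) (u l) :=
  multiplier_prodFun (g := fun l => chi m φ (t l) (w l))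
    (fun _ => hasTemperateGrowth_chi hm hεm hφ hsupp _ _) u

end Chi

end

noncomputable section

/-! ### Iterated limits -/

section IterLim

variable {ι X : Type*} [DecidableEq ι] [TopologicalSpace X]

theorem HasIterLim.unique [T2Space X] {l : List ι} {g : (ι → ℝ) → X} {L L' : X}
    (h : HasIterLim l g L) (h' : HasIterLim l g L') : L = L' := by
  induction l generalizing g with
  | nil => exact (h 0).symm.trans (h' 0)
  | cons i l ih =>
    obtain ⟨k, hk, h⟩ := h
    obtain ⟨k', hk', h'⟩ := h'
    obtain rfl : k = k' := funext fun t => tendsto_nhds_unique (hk t) (hk' t)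
    exact ih h h'

theorem HasIterLim.sub [AddGroup X] [IsTopologicalAddGroup X] {l : List ι}
    {g g' : (ι → ℝ) → X} {L L' : X} (h : HasIterLim l g L) (h' : HasIterLim l g' L') :
    HasIterLim l (fun t => g t - g' t) (L - L') := by
  induction l generalizing g g' with
  | nil => exact fun t => congrArg₂ _ (h t) (h' t)
  | cons i l ih =>
    obtain ⟨k, hk, h⟩ := h
    obtain ⟨k', hk', h'⟩ := h'
    exact ⟨fun t => k t - k' t, fun t => (hk t).sub (hk' t), ih h h'⟩

theorem HasIterLim.sum [AddCommMonoid X] [ContinuousAdd X] {A : Type*} {S : Finset A} {l : List ι}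
    {g : A → (ι → ℝ) → X} {L : A → X} (h : ∀ a ∈ S, HasIterLim l (g a) (L a)) :
    HasIterLim l (fun t => ∑ a ∈ S, g a t) (∑ a ∈ S, L a) := by
  induction l generalizing g with
  | nil => exact fun t => Finset.sum_congr rfl fun a ha => h a ha t
  | cons i l ih =>
    choose! k hk h using h
    exact ⟨fun t => ∑ a ∈ S, k a t, fun t => tendsto_finsetSum _ fun a ha => hk a ha t, ih h⟩

end IterLim

variable {s : ℕ}

/-- A time occurs in exactly one block, so each single limit concerns one factor and separate
continuity suffices. Filtering the list by the partial inverse of a block embedding gives the order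
in which the times of this block go to infinity. -/
theorem HasIterLim.blockProduct {n : ℕ} (c : OrderedFinpartition n) (l : List (Fin n)) :
    ∀ {X : (j : Fin c.length) → (Fin (c.partSize j) → ℝ) → 𝓢'(Conf s (Fin (c.partSize j)), ℂ)}
      {L : (j : Fin c.length) → 𝓢'(Conf s (Fin (c.partSize j)), ℂ)},
      (∀ j, HasIterLim (l.filterMap (Function.partialInv (c.emb j))) (X j) (L j)) →
      HasIterLim l (fun t => WightmanScattering.blockProduct c fun j => X j (t ∘ c.emb j))
        (WightmanScattering.blockProduct c L) := by
  induction l with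
  | nil =>
    intro X L h t
    exact congrArg _ (funext fun j => h j _)
  | cons i l ih =>
    intro X L h
    obtain ⟨j₀, k, hik⟩ := c.cover i
    have hj₀ : Function.partialInv (c.emb j₀) i = some k := by
      rw [← hik]
      exact Function.partialInv_left (c.emb_strictMono j₀).injective k
    have hne : ∀ j, j ≠ j₀ → ∀ a, c.emb j a ≠ i := fun j hj a ha =>
      Set.disjoint_left.1 (c.disjoint (Set.mem_univ j) (Set.mem_univ j₀) hj)
        ⟨a, rfl⟩ ⟨k, hik.trans ha.symm⟩
    have hj : ∀ j, j ≠ j₀ → Function.partialInv (c.emb j) i = none := fun j hj => by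
      rw [Option.eq_none_iff_forall_ne_some]
      intro a ha
      exact hne j hj a ((Function.Injective.isPartialInv (c.emb_strictMono j).injective a i).1 ha)
    have h0 := h j₀
    rw [List.filterMap_cons_some hj₀] at h0
    obtain ⟨H, hH, h0⟩ := h0
    -- After the limit in `t i` the family of the block `j₀` is replaced by its limit `H`; the other
    -- blocks do not contain `i` and stay unchanged.
    refine ⟨fun t => WightmanScattering.blockProduct c fun j =>
      Function.update X j₀ H j (t ∘ c.emb j), fun t => ?_, ih fun j => ?_⟩
    · refine PointwiseConvergenceCLM.tendsto_iff_forall_tendsto.2 fun f => ?_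
      obtain ⟨g, hg⟩ := exists_blockProduct_update c (fun j => X j (t ∘ c.emb j)) j₀ f
      have e1 : ∀ r, (fun j => X j (Function.update t i r ∘ c.emb j)) =
          Function.update (fun j => X j (t ∘ c.emb j)) j₀
            (X j₀ (Function.update (t ∘ c.emb j₀) k r)) := by
        intro r
        funext j
        by_cases hjj : j = j₀
        · subst hjj
          rw [Function.update_self, ← Function.update_comp_eq_of_injective _ (c.emb_strictMono _).injective,
            hik]
        · rw [Function.update_of_ne hjj, Function.update_comp_eq_of_forall_ne _ _ (hne j hjj)]
      have e2 : (fun j => Function.update X j₀ H j (t ∘ c.emb j)) =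
          Function.update (fun j => X j (t ∘ c.emb j)) j₀ (H (t ∘ c.emb j₀)) := by
        funext j
        by_cases hjj : j = j₀
        · subst hjj
          rw [Function.update_self, Function.update_self]
        · rw [Function.update_of_ne hjj, Function.update_of_ne hjj]
      simp only [e1, e2, hg]
      exact PointwiseConvergenceCLM.tendsto_iff_forall_tendsto.1 (hH (t ∘ c.emb j₀)) g
    · by_cases hjj : j = j₀
      · subst hjj
        rw [Function.update_self]
        exact h0
      · rw [Function.update_of_ne hjj]
        have := h j
        rwa [List.filterMap_cons_none (hj j hjj)] at this

/-- An order of all times induces a complete order of the times in each block, so a hypothesis on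
all orders in lower degrees covers every block. -/
theorem perm_filterMap_partialInv {n k : ℕ} {e : Fin k → Fin n} (he : Function.Injective e)
    {l : List (Fin n)} (hl : l.Perm (List.finRange n)) :
    (l.filterMap (Function.partialInv e)).Perm (List.finRange k) := by
  refine (List.perm_ext_iff_of_nodup ?_ (List.nodup_finRange k)).2 fun a => ?_
  · refine List.Nodup.filterMap (fun a a' b hb hb' => ?_)
      (hl.nodup_iff.2 (List.nodup_finRange n))
    have h1 := (Function.Injective.isPartialInv he b a).1 hb
    have h2 := (Function.Injective.isPartialInv he b a').1 hb'
    exact h1.symm.trans h2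
  · simp only [List.mem_filterMap, List.mem_finRange, iff_true]
    exact ⟨e a, hl.mem_iff.2 (List.mem_finRange _), Function.partialInv_left he a⟩

/-! ### Truncation and the limits of large times -/

section FormFactor

variable {m ε : ℝ} {φ : ℝ → ℝ}

/-- On products the wave operator distributes over the factors, and the factors distribute over the
blocks. -/
theorem compOmega_blockProduct (hm : 0 < m) (hεm : ε < m ^ 2) (hφ : ContDiff ℝ ∞ φ)
    (hsupp : tsupport φ ⊆ Set.Ioo (-ε) ε) (V : Functional s Unit) {n : ℕ}
    (c : OrderedFinpartition n) (w : Fin n → Label) (t : Fin n → ℝ) :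
    PointwiseConvergenceCLM.precomp ℂ (omegaComp m φ t w)
        (blockProduct c fun j => V (c.partSize j) fun _ => ()) =
      blockProduct c fun j => V.compOmega m φ (w ∘ c.emb j) (t ∘ c.emb j) := by
  refine distribution_ext_prodFun fun u => ?_
  rw [blockProduct_prodFun]
  change blockProduct c (fun j => V (c.partSize j) fun _ => ()) (omegaComp m φ t w (prodFun u)) = _
  rw [omegaComp_prodFun hm hεm hφ hsupp, blockProduct_prodFun]
  refine Finset.prod_congr rfl fun j _ => ?_
  change _ = V (c.partSize j) (fun _ => ())
    (omegaComp m φ (t ∘ c.emb j) (w ∘ c.emb j) (prodFun (u ∘ c.emb j)))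
  rw [omegaComp_prodFun hm hεm hφ hsupp]
  rfl

theorem compOmega_eq_sum_trunc (hm : 0 < m) (hεm : ε < m ^ 2) (hφ : ContDiff ℝ ∞ φ)
    (hsupp : tsupport φ ⊆ Set.Ioo (-ε) ε) (W : Functional s Unit) {n : ℕ} (hn : 0 < n)
    (w : Fin n → Label) (t : Fin n → ℝ) :
    W.compOmega m φ w t = ∑ c : OrderedFinpartition n,
      blockProduct c fun j => Functional.compOmega m φ W.trunc (w ∘ c.emb j) (t ∘ c.emb j) := by
  simp only [← compOmega_blockProduct hm hεm hφ hsupp W.trunc]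
  rw [Functional.compOmega, W.eq_sum_trunc hn, map_sum]

theorem compOmega_trunc_eq (hm : 0 < m) (hεm : ε < m ^ 2) (hφ : ContDiff ℝ ∞ φ)
    (hsupp : tsupport φ ⊆ Set.Ioo (-ε) ε) (W : Functional s Unit) {n : ℕ} (hn : 0 < n)
    (w : Fin n → Label) (t : Fin n → ℝ) :
    Functional.compOmega m φ W.trunc w t = W.compOmega m φ w t -
      ∑ c : {c : OrderedFinpartition n // 1 < c.length},
        blockProduct c.1 fun j => Functional.compOmega m φ W.trunc (w ∘ c.1.emb j) (t ∘ c.1.emb j) := by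
  simp only [← compOmega_blockProduct hm hεm hφ hsupp W.trunc]
  rw [Functional.compOmega, Functional.trunc, if_neg hn.ne', map_sub, map_sum]
  rfl

/-- The truncated function of degree `n` is the full one minus products over blocks of size below
`n`, whose limits are known by induction; the same recursion defines `F.trunc`. -/
theorem IsFormFactor.trunc (hm : 0 < m) (hεm : ε < m ^ 2) (hφ : ContDiff ℝ ∞ φ)
    (hsupp : tsupport φ ⊆ Set.Ioo (-ε) ε) {W : Functional s Unit} {F : Functional s Label}
    (h : IsFormFactor m φ W F) : IsFormFactor m φ W.trunc F.trunc := by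
  intro n
  induction n using Nat.strong_induction_on with
  | _ n ih =>
    intro w order ho
    rcases Nat.eq_zero_or_pos n with rfl | hn
    · have : order = [] := by simpa using ho
      subst this
      intro t
      beta_reduce
      rw [F.trunc_zero, Functional.compOmega, W.trunc_zero, map_zero]
    · rw [Functional.trunc, if_neg hn.ne']
      simp only [compOmega_trunc_eq hm hεm hφ hsupp W hn]
      refine (h n w order ho).sub (HasIterLim.sum fun c _ => ?_)
      exact HasIterLim.blockProduct c.1 order fun j =>
        ih _ (partSize_lt_of_one_lt_length c.1 c.2 j) _ _
          (perm_filterMap_partialInv (c.1.emb_strictMono j).injective ho)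

theorem IsFormFactor.unique {W : Functional s Unit} {F F' : Functional s Label}
    (h : IsFormFactor m φ W F) (h' : IsFormFactor m φ W F') : F = F' := by
  funext n w
  exact (h n w _ (List.Perm.refl _)).unique (h' n w _ (List.Perm.refl _))

theorem exists_isFormFactor_of_trunc (hm : 0 < m) (hεm : ε < m ^ 2) (hφ : ContDiff ℝ ∞ φ)
    (hsupp : tsupport φ ⊆ Set.Ioo (-ε) ε) {W : Functional s Unit} {F' : Functional s Label}
    (h : IsFormFactor m φ W.trunc F') : ∃ F : Functional s Label, IsFormFactor m φ W F := by
  -- In degree `0` the truncated functional carries no information on `W`. As there are no times,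
  -- the value is taken from `W` itself.
  refine ⟨fun n w => if n = 0 then W.compOmega m φ w (fun _ => 0) else
    ∑ c : OrderedFinpartition n, blockProduct c fun j => F' (c.partSize j) (w ∘ c.emb j), ?_⟩
  intro n w order ho
  rcases Nat.eq_zero_or_pos n with rfl | hn
  · have : order = [] := by simpa using ho
    subst this
    intro t
    beta_reduce
    rw [if_pos rfl, Subsingleton.elim t fun _ => 0]
  · simp only [compOmega_eq_sum_trunc hm hεm hφ hsupp W hn, if_neg hn.ne']
    exact HasIterLim.sum fun c _ => HasIterLim.blockProduct c order fun j =>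
      h _ _ _ (perm_filterMap_partialInv (c.emb_strictMono j).injective ho)

end FormFactor

/-! ### Truncation of the scattering matrix -/

/-- Since `f` is increasing, the indices with value below `n` form an initial segment, which is
determined by its cardinality. -/
theorem lt_card_filter_iff {k N n : ℕ} {f : Fin k → Fin N} (hf : StrictMono f) (i : Fin k) :
    (i : ℕ) < (Finset.univ.filter fun i => (f i : ℕ) < n).card ↔ (f i : ℕ) < n := by
  constructor
  · intro h
    by_contra hcon
    have h1 : (Finset.univ.filter fun i => (f i : ℕ) < n) ⊆ Finset.Iio i := by
      intro a ha
      rw [Finset.mem_filter] at ha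
      rw [Finset.mem_Iio, ← hf.lt_iff_lt, Fin.lt_def]
      omega
    have h2 := Finset.card_le_card h1
    rw [Fin.card_Iio] at h2
    omega
  · intro h
    have h1 : Finset.Iic i ⊆ (Finset.univ.filter fun i => (f i : ℕ) < n) := by
      intro a ha
      rw [Finset.mem_filter]
      have : f a ≤ f i := hf.monotone (Finset.mem_Iic.1 ha)
      exact ⟨Finset.mem_univ _, lt_of_le_of_lt this h⟩
    have h2 := Finset.card_le_card h1
    rw [Fin.card_Iic] at h2
    omega

theorem append_labels_apply {n m : ℕ} (i : Fin (n + m)) :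
    Fin.append (fun _ : Fin n => Label.inn) (fun _ : Fin m => Label.out) i =
      if (i : ℕ) < n then Label.inn else Label.out := by
  refine Fin.addCases (fun i => ?_) (fun i => ?_) i <;> simp

theorem pushDist_finCongr {C : Type} (G : Functional s C) {a b : ℕ} (h : a = b) (w : Fin a → C) :
    pushDist (renameEquiv s (finCongr h)) (G a w) = G b (w ∘ Fin.cast h.symm) := by
  subst h
  rfl

/-- In the natural order of a block the in-variables precede the out-variables, and their numbers
are `lowSize` and `highSize`. The labels of a block are thus again in…in out…out, and the two
recursions agree term by term. -/
theorem scatteringMatrix_trunc (F : Functional s Label) :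
    BiFunctional.trunc (scatteringMatrix F) = scatteringMatrix F.trunc := by
  suffices h : ∀ N n m, n + m = N →
      BiFunctional.trunc (scatteringMatrix F) n m = scatteringMatrix F.trunc n m from
    funext fun n => funext fun m => h _ n m rfl
  intro N
  induction N using Nat.strong_induction_on with
  | _ N ih =>
    intro n m hN
    rw [BiFunctional.trunc, scatteringMatrix, scatteringMatrix, Functional.trunc]
    split_ifs with h0
    · rfl
    · congr 1
      refine Finset.sum_congr rfl fun c _ => congrArg _ (funext fun j => ?_)
      rw [ih (lowSize n c.1 j + highSize n c.1 j) _ _ _ rfl, scatteringMatrix, pushDist_finCongr]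
      · congr 1
        funext i
        rw [Function.comp_apply, Function.comp_apply, append_labels_apply, append_labels_apply]
        have := lt_card_filter_iff (n := n) (c.1.emb_strictMono j) i
        change (i : ℕ) < lowSize n c.1 j ↔ _ at this
        simp only [Fin.val_cast, this]
      · rw [lowSize_add_highSize, ← hN]
        exact partSize_lt_of_one_lt_length c.1 c.2 j

end

noncomputable section

/-! ### Functionals bounded on products -/

/-- Bounds on products of one-particle functions by products of a fixed Schwartz norm. -/
def Functional.ProductBounded {s : ℕ} {C : Type} (R : Functional s C) : Prop :=
  ∃ N, ∀ n, ∃ M : ℝ, 0 ≤ M ∧ ∀ (w : Fin n → C) (u : Fin n → 𝓢(Spacetime s, ℂ)),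
    ‖R n w (prodFun u)‖ ≤ M * ∏ l, supSeminorm (Spacetime s) N (u l)

variable {s : ℕ}

theorem lineDeriv_prodFun {n : ℕ} (u : Fin n → 𝓢(Spacetime s, ℂ)) (l : Fin n) (e : Spacetime s) :
    ∂_{(PiLp.single 2 l e : Conf s (Fin n))} (prodFun u) =
      prodFun (Function.update u l (∂_{e} (u l))) := by
  ext x
  rw [SchwartzMap.lineDerivOp_apply, lineDeriv, prodFun_apply,
    ← Finset.mul_prod_erase _ _ (Finset.mem_univ l), Function.update_self,
    SchwartzMap.lineDerivOp_apply, lineDeriv]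
  have h1 : (fun t : ℝ => prodFun u (x + t • (PiLp.single 2 l e : Conf s (Fin n)))) =
      fun t => u l (x l + t • e) * ∏ i ∈ Finset.univ.erase l, u i (x i) := by
    funext t
    rw [prodFun_apply, ← Finset.mul_prod_erase _ _ (Finset.mem_univ l)]
    congr 1
    · simp
    · refine Finset.prod_congr rfl fun i hi => ?_
      have := Finset.ne_of_mem_erase hi
      simp [this]
  rw [h1, deriv_mul_const_field]
  congr 1
  refine Finset.prod_congr rfl fun i hi => ?_
  rw [Function.update_of_ne (Finset.ne_of_mem_erase hi)]

/-- A derivative in the `l`-th variable hits the `l`-th factor only, so this factor is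
differentiated as often as `l` occurs in the list, whatever the total number of derivatives. -/
theorem exists_iteratedLineDeriv_prodFun {n : ℕ} (u : Fin n → 𝓢(Spacetime s, ℂ))
    (β : List (Fin n × Fin (s + 1))) : ∃ u' : Fin n → 𝓢(Spacetime s, ℂ),
      ∂^{fun i => (PiLp.single 2 (β.get i).1 (EuclideanSpace.single (β.get i).2 (1 : ℝ)) :
        Conf s (Fin n))} (prodFun u) = prodFun u' ∧
      ∀ l k j, SchwartzMap.seminorm ℂ k j (u' l) ≤
        SchwartzMap.seminorm ℂ k (j + (β.map Prod.fst).count l) (u l) := by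
  induction β with
  | nil => exact ⟨u, rfl, fun l k j => le_rfl⟩
  | cons b β ih =>
    obtain ⟨u', h1, h2⟩ := ih
    refine ⟨Function.update u' b.1 (∂_{EuclideanSpace.single b.2 (1 : ℝ)} (u' b.1)), ?_,
      fun l k j => ?_⟩
    · rw [← lineDeriv_prodFun, ← h1]
      exact iteratedLineDerivOp_succ_left _ _
    · rw [List.map_cons, List.count_cons]
      by_cases h : l = b.1
      · subst h
        rw [Function.update_self]
        refine (seminorm_lineDeriv_le _ _ _ _).trans ?_
        rw [PiLp.norm_single, norm_one, one_mul]
        refine (h2 _ _ _).trans (le_of_eq ?_)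
        simp only [beq_self_eq_true, if_true]
        rw [add_assoc, add_comm 1]
      · rw [Function.update_of_ne h]
        simpa [Ne.symm h] using h2 l k j

/-- The norm grants `K` derivatives and `L` powers to each variable separately, so the order `L + K`
does not grow with the number of variables. This uniformity in the degree is what γ-continuity
contributes. -/
theorem schwartzNorm_prodFun_le {n : ℕ} (K L : ℕ) (u : Fin n → 𝓢(Spacetime s, ℂ)) :
    schwartzNorm K L (prodFun u) ≤
      ∏ l, (2 ^ (L + 1) * supSeminorm (Spacetime s) (L + K) (u l)) := by
  have h0 : 0 ≤ ∏ l, (2 ^ (L + 1) * supSeminorm (Spacetime s) (L + K) (u l)) :=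
    Finset.prod_nonneg fun l _ => mul_nonneg (by positivity) (apply_nonneg _ _)
  refine Real.iSup_le (fun β => Real.iSup_le (fun x => ?_) h0) h0
  obtain ⟨u', h1, h2⟩ := exists_iteratedLineDeriv_prodFun u β.1
  rw [← SchwartzMap.iteratedLineDerivOp_eq_iteratedFDeriv, h1, prodFun_apply, norm_prod,
    ← Finset.prod_mul_distrib]
  refine Finset.prod_le_prod (fun l _ => by positivity) fun l _ => ?_
  have h3 : (1 + ‖x l‖ ^ 2) ^ ((L : ℝ) / 2) ≤ 2 ^ L * (1 + ‖x l‖ ^ L) := by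
    refine le_trans ?_ (LineFrame.one_add_pow_le ‖x l‖ (norm_nonneg _) L)
    calc (1 + ‖x l‖ ^ 2) ^ ((L : ℝ) / 2) ≤ ((1 + ‖x l‖) ^ 2) ^ ((L : ℝ) / 2) := by
          refine Real.rpow_le_rpow (by positivity) ?_ (by positivity)
          nlinarith [norm_nonneg (x l)]
      _ = (1 + ‖x l‖) ^ L := by
          rw [← Real.rpow_natCast_mul (by positivity), ← Real.rpow_natCast]
          congr 1
          push_cast
          ring
  have hc : (β.1.map Prod.fst).count l ≤ K := β.2 l
  have h4 : ∀ k ≤ L, ‖x l‖ ^ k * ‖u' l (x l)‖ ≤ supSeminorm (Spacetime s) (L + K) (u l) :=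
    fun k hk => (SchwartzMap.norm_pow_mul_le_seminorm ℂ (u' l) k (x l)).trans
      ((h2 l k 0).trans (seminorm_le_supSeminorm (by omega) (by omega) _))
  have h5 := h4 0 (Nat.zero_le _)
  have h6 := h4 L le_rfl
  rw [pow_zero, one_mul] at h5
  calc _ ≤ 2 ^ L * (1 + ‖x l‖ ^ L) * ‖u' l (x l)‖ :=
        mul_le_mul_of_nonneg_right h3 (norm_nonneg _)
    _ = 2 ^ L * (‖u' l (x l)‖ + ‖x l‖ ^ L * ‖u' l (x l)‖) := by ring
    _ ≤ 2 ^ L * (supSeminorm (Spacetime s) (L + K) (u l) +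
          supSeminorm (Spacetime s) (L + K) (u l)) := by gcongr
    _ = _ := by ring

theorem schwartzNorm_zero {n : ℕ} (K L : ℕ) :
    schwartzNorm K L (0 : 𝓢(Conf s (Fin n), ℂ)) ≤ 0 := by
  refine Real.iSup_le (fun β => Real.iSup_le (fun x => ?_) le_rfl) le_rfl
  rw [← SchwartzMap.iteratedLineDerivOp_eq_iteratedFDeriv, iteratedLineDerivOp_zero]
  simp

theorem withSeminorms_gamma (s : ℕ) (C : Type) [Fintype C] :
    WithSeminorms (topology := gammaTopology s C)
      (SeminormFamily.sigma fun K : ℕ => SeminormFamily.sigma fun L : ℕ =>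
        fun p : gammaSeminorms s C K L => (p : Seminorm ℂ (Borchers s C))) := by
  refine withSeminorms_iInf fun K => withSeminorms_iInf fun L => ?_
  exact @WithSeminorms.mk _ _ _ _ _ _ _ (gammaKL s C K L) rfl

/-- A continuous functional is dominated by finitely many of the seminorms which generate γ, in all
degrees at once. Finitely many pairs `(K, L)` occur, and their largest sum is the common order. -/
theorem productBounded_of_gamma {C : Type} [Fintype C] {R : Functional s C}
    (h : R.IsGammaContinuous) : R.ProductBounded := by
  classical
  let _ := gammaTopology s C
  obtain ⟨S, A, -, hA⟩ := Seminorm.bound_of_continuous (withSeminorms_gamma s C)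
    ((normSeminorm ℂ ℂ).comp R.eval) (continuous_norm.comp h)
  set N := S.sup fun i => i.2.1 + i.1
  refine ⟨N, fun n => ?_⟩
  have hM : ∀ i : (Σ K : ℕ, Σ L : ℕ, gammaSeminorms s C K L), ∃ M : ℝ, 0 ≤ M ∧
      ∀ f : TestFun s C n, (i.2.2 : Seminorm ℂ (Borchers s C))
        (DirectSum.lof ℂ ℕ (TestFun s C) n f) ≤ M * ∑ w, schwartzNorm i.1 i.2.1 (f w) := by
    intro i
    obtain ⟨M, hM⟩ := i.2.2.2 n
    refine ⟨max M 0, le_max_right _ _, fun f => (hM f).trans ?_⟩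
    refine mul_le_mul_of_nonneg_right (le_max_left _ _) (Finset.sum_nonneg fun w _ => ?_)
    exact Real.iSup_nonneg fun β => Real.iSup_nonneg fun x => by positivity
  choose M hM0 hM using hM
  refine ⟨A * ∑ i ∈ S, M i * (2 ^ (i.2.1 + 1)) ^ n, ?_, fun w u => ?_⟩
  · exact mul_nonneg A.2 (Finset.sum_nonneg fun i _ => mul_nonneg (hM0 i) (by positivity))
  · set f : TestFun s C n := Pi.single w (prodFun u)
    have hfw : f w = prodFun u := Pi.single_eq_same _ _
    have hfw' : ∀ w', w' ≠ w → f w' = 0 := fun w' h => Pi.single_eq_of_ne h _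
    have h1 : R n w (prodFun u) = R.eval (DirectSum.lof ℂ ℕ (TestFun s C) n f) := by
      rw [Functional.eval_lof, Fintype.sum_eq_single w]
      · rw [hfw]
      · intro w' hw'
        rw [hfw' w' hw', map_zero]
    rw [h1]
    refine (hA _).trans ?_
    rw [smul_apply, NNReal.smul_def, smul_eq_mul, mul_assoc]
    refine mul_le_mul_of_nonneg_left ?_ A.2
    have hpos : ∀ i : (Σ K : ℕ, Σ L : ℕ, gammaSeminorms s C K L),
        0 ≤ M i * (2 ^ (i.2.1 + 1)) ^ n * ∏ l, supSeminorm (Spacetime s) N (u l) := fun i =>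
      mul_nonneg (mul_nonneg (hM0 i) (by positivity)) (Finset.prod_nonneg fun l _ => apply_nonneg _ _)
    rw [Finset.sum_mul]
    refine Seminorm.finset_sup_apply_le (Finset.sum_nonneg fun i _ => hpos i) fun i hi => ?_
    refine le_trans ?_ (Finset.single_le_sum (f := fun i : (Σ K : ℕ, Σ L : ℕ, gammaSeminorms s C K L) =>
      M i * (2 ^ (i.2.1 + 1)) ^ n * ∏ l, supSeminorm (Spacetime s) N (u l)) (fun i _ => hpos i) hi)
    refine (hM i f).trans ?_
    rw [mul_assoc]
    refine mul_le_mul_of_nonneg_left ?_ (hM0 i)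
    have h2 : ∑ w', schwartzNorm i.1 i.2.1 (f w') ≤ schwartzNorm i.1 i.2.1 (prodFun u) := by
      rw [← Finset.add_sum_erase _ _ (Finset.mem_univ w)]
      have h4 : ∑ w' ∈ Finset.univ.erase w, schwartzNorm i.1 i.2.1 (f w') ≤ 0 := by
        refine Finset.sum_nonpos fun w' hw' => ?_
        rw [hfw' w' (Finset.ne_of_mem_erase hw')]
        exact schwartzNorm_zero _ _
      rw [hfw]
      linarith
    refine h2.trans ((schwartzNorm_prodFun_le _ _ _).trans ?_)
    rw [Finset.prod_mul_distrib, Finset.prod_const, Finset.card_univ, Fintype.card_fin]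
    refine mul_le_mul_of_nonneg_left ?_ (by positivity)
    refine Finset.prod_le_prod (fun _ _ => apply_nonneg _ _) fun l _ => supSeminorm_mono ?_ _
    exact Finset.le_sup (f := fun i : (Σ K : ℕ, Σ L : ℕ, gammaSeminorms s C K L) => i.2.1 + i.1) hi

theorem prod_blocks {n : ℕ} {M : Type*} [CommMonoid M] (c : OrderedFinpartition n) (f : Fin n → M) :
    ∏ j, ∏ i, f (c.emb j i) = ∏ l, f l := by
  rw [← Fintype.prod_sigma' (fun j i => f (c.emb j i))]
  exact Fintype.prod_equiv c.equivSigma _ _ fun _ => rfl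

/-- The blocks exhaust the variables, so the bounds of the blocks multiply to a product over all
variables with the same order; only the constants depend on the degree. -/
theorem ProductBounded.of_trunc {C : Type} [Fintype C] {R : Functional s C}
    (h : Functional.ProductBounded R.trunc) : R.ProductBounded := by
  obtain ⟨N, h⟩ := h
  choose M hM0 hM using h
  refine ⟨N, fun n => ?_⟩
  rcases Nat.eq_zero_or_pos n with rfl | hn
  · refine ⟨∑ w, ‖R 0 w (prodFun fun i : Fin 0 => i.elim0)‖,
      Finset.sum_nonneg fun _ _ => norm_nonneg _, fun w u => ?_⟩
    rw [Subsingleton.elim u fun i : Fin 0 => i.elim0]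
    simp only [Finset.univ_eq_empty, Finset.prod_empty, mul_one]
    exact Finset.single_le_sum (f := fun w => ‖R 0 w (prodFun fun i : Fin 0 => i.elim0)‖)
      (fun _ _ => norm_nonneg _) (Finset.mem_univ w)
  · refine ⟨∑ c : OrderedFinpartition n, ∏ j, M (c.partSize j),
      Finset.sum_nonneg fun c _ => Finset.prod_nonneg fun j _ => hM0 _, fun w u => ?_⟩
    rw [trunc_prodFun R hn, Finset.sum_mul]
    refine (norm_sum_le _ _).trans (Finset.sum_le_sum fun c _ => ?_)
    rw [norm_prod, ← prod_blocks c, ← Finset.prod_mul_distrib]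
    exact Finset.prod_le_prod (fun _ _ => norm_nonneg _) fun j _ => hM _ _ _

end

noncomputable section

/-! ### The Hilbert space structure condition -/

variable {s : ℕ}

/-- Complex conjugation of Schwartz functions. -/
def conjFun {E : Type*} [NormedAddCommGroup E] [NormedSpace ℝ E] (f : 𝓢(E, ℂ)) : 𝓢(E, ℂ) :=
  f.postcompCLM (Complex.conjCLE : ℂ →L[ℝ] ℂ)

@[simp] theorem conjFun_apply {E : Type*} [NormedAddCommGroup E] [NormedSpace ℝ E] (f : 𝓢(E, ℂ))
    (x : E) : conjFun f x = (starRingEnd ℂ) (f x) := rfl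

theorem supSeminorm_conjFun {E : Type*} [NormedAddCommGroup E] [NormedSpace ℝ E] (N : ℕ)
    (f : 𝓢(E, ℂ)) : supSeminorm E N (conjFun f) = supSeminorm E N f := by
  have h : ∀ g : 𝓢(E, ℂ), supSeminorm E N (conjFun g) ≤ supSeminorm E N g := fun g =>
    supSeminorm_le (apply_nonneg _ _) fun k l hk hl => by
      refine (SchwartzMap.seminorm_le_bound ℂ k l _ (apply_nonneg _ _) fun x => ?_).trans
        (seminorm_le_supSeminorm hk hl g)
      have e : ⇑(conjFun g) = Complex.conjLIE ∘ ⇑g := rfl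
      rw [e, LinearIsometryEquiv.norm_iteratedFDeriv_comp_left]
      exact SchwartzMap.le_seminorm ℂ k l g x
  refine le_antisymm (h f) ?_
  have := h (conjFun f)
  rwa [show conjFun (conjFun f) = f by ext x; simp] at this

/-- The involution on homogeneous elements. -/
def starFun {n : ℕ} : 𝓢(Conf s (Fin n), ℂ) →+ 𝓢(Conf s (Fin n), ℂ) where
  toFun f := conjFun (pullback (renameEquiv s Fin.revPerm) f)
  map_zero' := by ext x; simp
  map_add' f g := by ext x; simp

theorem starFun_apply {n : ℕ} (f : 𝓢(Conf s (Fin n), ℂ)) (x : Conf s (Fin n)) :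
    starFun f x = (starRingEnd ℂ) (f (WithLp.toLp 2 fun i => x i.rev)) := rfl

theorem continuous_starFun {n : ℕ} : Continuous (starFun (s := s) (n := n)) :=
  (SchwartzMap.postcompCLM (Complex.conjCLE : ℂ →L[ℝ] ℂ)).continuous.comp
    (pullback (renameEquiv s Fin.revPerm)).continuous

theorem starFun_smul {n : ℕ} (c : ℂ) (f : 𝓢(Conf s (Fin n), ℂ)) :
    starFun (c • f) = (starRingEnd ℂ) c • starFun f := by
  ext x
  simp [starFun_apply]

theorem starFun_prodFun {n : ℕ} (u : Fin n → 𝓢(Spacetime s, ℂ)) :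
    starFun (prodFun u) = prodFun fun l => conjFun (u l.rev) := by
  ext x
  rw [starFun_apply, prodFun_apply, prodFun_apply, map_prod]
  exact Fintype.prod_equiv Fin.revPerm _ _ fun i => by simp

/-- The tensor product with a fixed first factor. -/
def schwartzTensorRight {n m : ℕ} (f : 𝓢(Conf s (Fin n), ℂ)) :
    𝓢(Conf s (Fin m), ℂ) →L[ℂ] 𝓢(Conf s (Fin (n + m)), ℂ) :=
  pullback (appendEquiv s n m).symm ∘L tensorRight f

theorem schwartzTensorRight_apply {n m : ℕ} (f : 𝓢(Conf s (Fin n), ℂ)) (g : 𝓢(Conf s (Fin m), ℂ)) :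
    schwartzTensorRight f g = schwartzTensor f g := rfl

/-- The tensor product with a fixed second factor. -/
def schwartzTensorLeft {n m : ℕ} (g : 𝓢(Conf s (Fin m), ℂ)) :
    𝓢(Conf s (Fin n), ℂ) →L[ℂ] 𝓢(Conf s (Fin (n + m)), ℂ) :=
  pullback (appendEquiv s n m).symm ∘L tensorLeft g

/-- The weighted `ℓ¹` norm of the coefficients with respect to the frame of products. -/
def coefNorm (k : ℕ) {n : ℕ} (f : 𝓢(Conf s (Fin n), ℂ)) : ℝ :=
  ∑' J, ‖(confFrame (oneFrame s) n).coef J f‖ * (confFrame (oneFrame s) n).weight J ^ k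

theorem hasSum_coefNorm (k : ℕ) {n : ℕ} (f : 𝓢(Conf s (Fin n), ℂ)) :
    HasSum (fun J => ‖(confFrame (oneFrame s) n).coef J f‖ *
      (confFrame (oneFrame s) n).weight J ^ k) (coefNorm k f) :=
  ((confFrame (oneFrame s) n).summable_coef k f).hasSum

theorem coefNorm_nonneg (k : ℕ) {n : ℕ} (f : 𝓢(Conf s (Fin n), ℂ)) : 0 ≤ coefNorm k f :=
  tsum_nonneg fun J => mul_nonneg (norm_nonneg _)
    (pow_nonneg ((confFrame (oneFrame s) n).weight_pos J).le _)

/-- Both arguments are expanded in the frame of products, where the product bound applies to the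
vectors. Weights multiply along tensor products, so `k` is the exponent of the one-particle frame,
the same for all degrees. -/
theorem Functional.ProductBounded.norm_star_tensor_le {C : Type} {R : Functional s C}
    (hR : R.ProductBounded) : ∃ (k : ℕ) (M : ℕ → ℝ), (∀ n, 0 ≤ M n) ∧
      ∀ (n m : ℕ) (w : Fin (n + m) → C) (f : 𝓢(Conf s (Fin n), ℂ)) (g : 𝓢(Conf s (Fin m), ℂ)),
        ‖R (n + m) w (schwartzTensor (starFun f) g)‖ ≤
          M (n + m) * (coefNorm k f * coefNorm k g) := by
  obtain ⟨N, hR⟩ := hR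
  choose M hM0 hM using hR
  obtain ⟨k, A, hA, hv⟩ := (oneFrame s).vec_bound N
  refine ⟨k, fun n => M n * A ^ n, fun n => mul_nonneg (hM0 n) (pow_nonneg hA _),
    fun n m w f g => ?_⟩
  set Φ := confFrame (oneFrame s) n
  set Ψ := confFrame (oneFrame s) m
  set B := M (n + m) * A ^ (n + m)
  have hB : 0 ≤ B := mul_nonneg (hM0 _) (pow_nonneg hA _)
  have hv' : ∀ {q : ℕ} (J : Fin q → (oneFrame s).Index),
      ∏ l, supSeminorm (Spacetime s) N ((oneFrame s).vec (J l)) ≤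
        A ^ q * (∏ l, (oneFrame s).weight (J l)) ^ k := by
    intro q J
    refine (Finset.prod_le_prod (fun _ _ => apply_nonneg _ _) fun l _ => hv (J l)).trans
      (le_of_eq ?_)
    rw [Finset.prod_mul_distrib, Finset.prod_const, Finset.card_univ, Fintype.card_fin,
      Finset.prod_pow]
  have h0 : ∀ (J : Fin n → (oneFrame s).Index) (J' : Fin m → (oneFrame s).Index),
      ‖R (n + m) w (schwartzTensor (starFun (prodFun ((oneFrame s).vec ∘ J)))
        (prodFun ((oneFrame s).vec ∘ J')))‖ ≤
        B * ((∏ l, (oneFrame s).weight (J l)) ^ k * (∏ l, (oneFrame s).weight (J' l)) ^ k) := by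
    intro J J'
    rw [starFun_prodFun, schwartzTensor_prodFun]
    refine (hM _ _ _).trans ?_
    rw [Fin.prod_univ_add]
    simp only [Fin.append_left, Fin.append_right, supSeminorm_conjFun, Function.comp_apply]
    have e1 : ∏ l : Fin n, supSeminorm (Spacetime s) N ((oneFrame s).vec (J l.rev)) =
        ∏ l : Fin n, supSeminorm (Spacetime s) N ((oneFrame s).vec (J l)) :=
      Fintype.prod_equiv Fin.revPerm _ _ fun i => by simp
    rw [e1]
    have hJ : 0 ≤ ∏ l, (oneFrame s).weight (J l) :=
      Finset.prod_nonneg fun l _ => ((oneFrame s).weight_pos _).le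
    calc _ ≤ M (n + m) * ((A ^ n * (∏ l, (oneFrame s).weight (J l)) ^ k) *
            (A ^ m * (∏ l, (oneFrame s).weight (J' l)) ^ k)) := by
          refine mul_le_mul_of_nonneg_left ?_ (hM0 _)
          exact mul_le_mul (hv' J) (hv' J') (Finset.prod_nonneg fun _ _ => apply_nonneg _ _)
            (mul_nonneg (pow_nonneg hA _) (pow_nonneg hJ _))
      _ = M (n + m) * (A ^ n * A ^ m) * ((∏ l, (oneFrame s).weight (J l)) ^ k *
            (∏ l, (oneFrame s).weight (J' l)) ^ k) := by ring
      _ = _ := by rw [← pow_add]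
  have h1 : ∀ (J : Φ.Index) (J' : Ψ.Index),
      ‖R (n + m) w (schwartzTensor (starFun (Φ.vec J)) (Ψ.vec J'))‖ ≤
        B * (Φ.weight J ^ k * Ψ.weight J' ^ k) := h0
  have h2 : ∀ J', ‖R (n + m) w (schwartzTensor (starFun f) (Ψ.vec J'))‖ ≤
      coefNorm k f * (B * Ψ.weight J' ^ k) := by
    intro J'
    -- The dependence on `f` is antilinear, so the expansion is summed through an additive map.
    let L : 𝓢(Conf s (Fin n), ℂ) →+ ℂ :=
      ((R (n + m) w).toLinearMap ∘ₗ (schwartzTensorLeft (Ψ.vec J')).toLinearMap).toAddMonoidHom.comp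
        starFun
    have hL : Continuous L := (R (n + m) w).continuous.comp
      ((schwartzTensorLeft (Ψ.vec J')).continuous.comp continuous_starFun)
    have h3 := (Φ.hasSum_smul f).map L hL
    refine h3.norm_le_of_bounded ((hasSum_coefNorm k f).mul_right _) fun J => ?_
    have h4 : (L ∘ fun i => Φ.coef i f • Φ.vec i) J = (starRingEnd ℂ) (Φ.coef J f) *
        R (n + m) w (schwartzTensor (starFun (Φ.vec J)) (Ψ.vec J')) := by
      change R (n + m) w (schwartzTensorLeft (Ψ.vec J') (starFun (Φ.coef J f • Φ.vec J))) = _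
      rw [starFun_smul, map_smul, map_smul]
      rfl
    rw [h4, norm_mul, RCLike.norm_conj]
    refine (mul_le_mul_of_nonneg_left (h1 J J') (norm_nonneg _)).trans (le_of_eq ?_)
    ring
  have h5 := Ψ.hasSum_apply
    (((R (n + m) w : 𝓢(Conf s (Fin (n + m)), ℂ) →L[ℂ] ℂ)) ∘L schwartzTensorRight (starFun f)) g
  have h6 := h5.norm_le_of_bounded ((hasSum_coefNorm k g).mul_right (coefNorm k f * B)) fun J' => by
    rw [norm_mul]
    refine (mul_le_mul_of_nonneg_left (h2 J') (norm_nonneg _)).trans (le_of_eq ?_)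
    ring
  refine (show ‖R (n + m) w (schwartzTensor (starFun f) g)‖ ≤ _ from h6).trans (le_of_eq ?_)
  ring

/-- The Hilbert space of coefficients in degree `n`. -/
abbrev CoefSpace (s : ℕ) (C : Type) (n : ℕ) : Type :=
  lp (fun _ : (Fin n → C) × (confFrame (oneFrame s) n).Index => ℂ) 2

/-- Replaces a weighted `ℓ¹` norm by a Hilbert norm: `Σ |c_J| w_J ^ k` is at most `Σ w_J ^ (-N₀)`
times the supremum of `|c_J| w_J ^ (k + N₀)`, and the supremum is at most the `ℓ²` norm. -/
theorem exists_coefMap (s : ℕ) (C : Type) [Fintype C] (k n : ℕ) :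
    ∃ Θ : TestFun s C n →ₗ[ℂ] CoefSpace s C n, (Continuous fun f => ‖Θ f‖) ∧
      ∀ f w, coefNorm k (f w) ≤ ‖Θ f‖ := by
  set Φ := confFrame (oneFrame s) n
  obtain ⟨N₀, hN₀⟩ := Φ.summable
  -- One `N₀` pays for the passage from `ℓ¹` to `ℓ²`, the other for the square summability of the
  -- weighted coefficients.
  obtain ⟨N, A, hA, hb⟩ := Φ.coef_bound (k + N₀ + N₀)
  set D := ∑' J, (Φ.weight J ^ N₀)⁻¹
  have hD : 0 ≤ D := tsum_nonneg fun J => inv_nonneg.2 (pow_nonneg (Φ.weight_pos J).le _)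
  have hc : ∀ (J : Φ.Index) g, Φ.weight J ^ (k + N₀) * ‖Φ.coef J g‖ ≤
      A * supSeminorm _ N g * (Φ.weight J ^ N₀)⁻¹ := by
    intro J g
    have := Φ.weight_pos J
    rw [← div_eq_mul_inv, le_div_iff₀ (by positivity)]
    refine le_trans (le_of_eq ?_) (hb J g)
    rw [pow_add _ (k + N₀)]
    ring
  let q : TestFun s C n → ℝ := fun f => A * ∑ w, supSeminorm _ N (f w)
  have hq : ∀ f w, A * supSeminorm _ N (f w) ≤ q f := fun f w =>
    mul_le_mul_of_nonneg_left (Finset.single_le_sum (f := fun w => supSeminorm _ N (f w))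
      (fun _ _ => apply_nonneg _ _) (Finset.mem_univ w)) hA
  have hq0 : ∀ f, 0 ≤ q f := fun f =>
    mul_nonneg hA (Finset.sum_nonneg fun _ _ => apply_nonneg _ _)
  let x : TestFun s C n → (Fin n → C) × (confFrame (oneFrame s) n).Index → ℂ :=
    fun f p => (Φ.weight p.2 : ℂ) ^ (k + N₀) * Φ.coef p.2 (f p.1)
  have hx : ∀ f p, ‖x f p‖ = Φ.weight p.2 ^ (k + N₀) * ‖Φ.coef p.2 (f p.1)‖ := fun f p => by
    simp only [x]
    rw [norm_mul, norm_pow, Complex.norm_of_nonneg (Φ.weight_pos _).le]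
  have hw1 : ∀ J : Φ.Index, (Φ.weight J ^ N₀)⁻¹ ≤ 1 := fun J =>
    inv_le_one_of_one_le₀ (one_le_pow₀ (Φ.one_le_weight J))
  have hw0 : ∀ J : Φ.Index, 0 ≤ (Φ.weight J ^ N₀)⁻¹ := fun J =>
    inv_nonneg.2 (pow_nonneg (Φ.weight_pos J).le _)
  have hx2 : ∀ f p, ‖x f p‖ ^ 2 ≤ q f ^ 2 * (Φ.weight p.2 ^ N₀)⁻¹ := by
    intro f p
    have h1 : ‖x f p‖ ≤ q f * (Φ.weight p.2 ^ N₀)⁻¹ := by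
      rw [hx]
      exact (hc _ _).trans (mul_le_mul_of_nonneg_right (hq f _) (hw0 _))
    calc ‖x f p‖ ^ 2 ≤ (q f * (Φ.weight p.2 ^ N₀)⁻¹) ^ 2 := by gcongr
      _ = q f ^ 2 * ((Φ.weight p.2 ^ N₀)⁻¹ * (Φ.weight p.2 ^ N₀)⁻¹) := by ring
      _ ≤ q f ^ 2 * ((Φ.weight p.2 ^ N₀)⁻¹ * 1) := by
        refine mul_le_mul_of_nonneg_left (mul_le_mul_of_nonneg_left (hw1 _) (hw0 _)) (sq_nonneg _)
      _ = _ := by ring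
  set E := ∑' p : (Fin n → C) × (confFrame (oneFrame s) n).Index, (Φ.weight p.2 ^ N₀)⁻¹
  have hsE : Summable fun p : (Fin n → C) × (confFrame (oneFrame s) n).Index =>
      (Φ.weight p.2 ^ N₀)⁻¹ := by
    have h1 : Summable fun _ : Fin n → C => (1 : ℝ) := Summable.of_finite
    refine (h1.mul_of_nonneg hN₀ (fun _ => zero_le_one) hw0).congr fun p => one_mul _
  have hE : 0 ≤ E := tsum_nonneg fun p => hw0 _
  have hs : ∀ f, Summable fun p => ‖x f p‖ ^ 2 := fun f =>
    Summable.of_nonneg_of_le (fun _ => by positivity) (hx2 f) (hsE.mul_left _)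
  have hmem : ∀ f, Memℓp (x f) 2 := fun f => by
    refine memℓp_gen ?_
    simpa using hs f
  let Θ : TestFun s C n →ₗ[ℂ] CoefSpace s C n :=
    { toFun := fun f => ⟨x f, hmem f⟩
      map_add' := fun f g => by
        ext p
        change x (f + g) p = x f p + x g p
        simp only [x, Pi.add_apply, map_add, mul_add]
      map_smul' := fun c f => by
        ext p
        change x (c • f) p = c * x f p
        simp only [x, Pi.smul_apply, map_smul, smul_eq_mul]
        ring }
  have hΘ : ∀ f, ‖Θ f‖ ≤ √E * q f := by
    intro f
    refine lp.norm_le_of_tsum_le (by simp) (mul_nonneg (Real.sqrt_nonneg _) (hq0 f)) ?_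
    have h1 : ∑' p, ‖x f p‖ ^ 2 ≤ q f ^ 2 * E := by
      rw [← tsum_mul_left]
      exact (hs f).tsum_le_tsum (hx2 f) (hsE.mul_left _)
    have h2 : (√E * q f) ^ 2 = q f ^ 2 * E := by
      rw [mul_pow, Real.sq_sqrt hE, mul_comm]
    rw [← h2] at h1
    simpa using (show ∑' p, ‖Θ f p‖ ^ 2 ≤ _ from h1)
  have hΘx : ∀ f p, ‖x f p‖ ≤ ‖Θ f‖ := fun f p => lp.norm_apply_le_norm (by simp) (Θ f) p
  refine ⟨(D : ℂ) • Θ, ?_, fun f w => ?_⟩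
  · let p : Seminorm ℂ (TestFun s C n) := (normSeminorm ℂ (CoefSpace s C n)).comp ((D : ℂ) • Θ)
    change Continuous p
    refine Seminorm.continuous_of_continuousAt_zero (p := p) ?_
    have hq1 : Continuous fun f => D * (√E * q f) := by
      refine continuous_const.mul (continuous_const.mul (continuous_const.mul ?_))
      exact continuous_finsetSum _ fun w _ => (continuous_supSeminorm N).comp (continuous_apply w)
    have hq2 := hq1.tendsto 0
    simp only [q, Pi.zero_apply, map_zero, Finset.sum_const_zero, mul_zero] at hq2
    rw [ContinuousAt, map_zero]
    refine squeeze_zero (fun _ => apply_nonneg _ _) (fun f => ?_) hq2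
    change ‖(D : ℂ) • Θ f‖ ≤ _
    rw [norm_smul, Complex.norm_of_nonneg hD]
    exact mul_le_mul_of_nonneg_left (hΘ f) hD
  · rw [LinearMap.smul_apply, norm_smul, Complex.norm_of_nonneg hD, ← tsum_mul_right]
    refine (Φ.summable_coef k (f w)).tsum_le_tsum (fun J => ?_) (hN₀.mul_right _)
    have h1 := hΘx f (w, J)
    rw [hx, pow_add] at h1
    have := Φ.weight_pos J
    rw [inv_mul_eq_div, le_div_iff₀ (by positivity)]
    refine le_trans (le_of_eq ?_) h1
    ring

end

noncomputable section

variable {s : ℕ}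

/-- A submultiplicative majorant: `M (n + m) ≤ a n * a m`. -/
theorem exists_submultiplicative (M : ℕ → ℝ) : ∃ a : ℕ → ℝ, (∀ n, 0 ≤ a n) ∧
    ∀ n m, M (n + m) ≤ a n * a m := by
  -- The range reaches `2 * n` because `n + m` is at most twice the larger of the two; the summand
  -- `1` makes the other factor harmless.
  let a : ℕ → ℝ := fun n => 1 + ∑ k ∈ Finset.range (2 * n + 1), |M k|
  have h1 : ∀ n, 1 ≤ a n := fun n =>
    le_add_of_nonneg_right (Finset.sum_nonneg fun _ _ => abs_nonneg _)
  have h2 : ∀ k n, k ≤ 2 * n → M k ≤ a n := fun k n hk => by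
    have := Finset.single_le_sum (f := fun k => |M k|) (fun _ _ => abs_nonneg _)
      (Finset.mem_range.2 (show k < 2 * n + 1 by omega))
    have h3 := le_abs_self (M k)
    simp only [a]
    linarith
  refine ⟨a, fun n => zero_le_one.trans (h1 n), fun n m => ?_⟩
  rcases le_total n m with h | h
  · calc M (n + m) ≤ a m := h2 _ _ (by omega)
      _ ≤ a n * a m := le_mul_of_one_le_left (zero_le_one.trans (h1 m)) (h1 n)
  · calc M (n + m) ≤ a n := h2 _ _ (by omega)
      _ ≤ a n * a m := le_mul_of_one_le_right (zero_le_one.trans (h1 n)) (h1 m)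

theorem sum_half_pow_le (S : Finset ℕ) : ∑ n ∈ S, ((1 : ℝ) / 2) ^ (n + 1) ≤ 1 := by
  have h : HasSum (fun n : ℕ => ((1 : ℝ) / 2) ^ (n + 1)) 1 := by
    have := hasSum_geometric_two.mul_left (1 / 2 : ℝ)
    rw [show (1 / 2 : ℝ) * 2 = 1 by norm_num] at this
    exact (congrArg (fun u => HasSum u (1 : ℝ)) (funext fun n => by ring)).mp this
  exact sum_le_hasSum S (fun n _ => by positivity) h

theorem bstar_lof {C : Type} (n : ℕ) (f : TestFun s C n) :
    bstar (DirectSum.lof ℂ ℕ (TestFun s C) n f) =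
      DirectSum.lof ℂ ℕ (TestFun s C) n (starHom s C n f) :=
  DirectSum.map_of _ _ _

/-- The seminorm is pulled back from a Hilbert sum of the coefficient spaces, hence satisfies the
parallelogram law. Degree `n` is scaled by `2 ^ (n + 1) * a n`: `a` splits the constant of degree `n
+ m` into factors, and the powers of `2` make the double sum over degrees converge. -/
theorem Functional.ProductBounded.hssc {C : Type} [Fintype C] {R : Functional s C}
    (hR : R.ProductBounded) : R.HSSC := by
  classical
  obtain ⟨k, M, hM0, hM⟩ := hR.norm_star_tensor_le
  choose Θ hΘc hΘ using exists_coefMap s C k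
  -- The number of label strings enters because the evaluation sums over all components.
  obtain ⟨a, ha0, ha⟩ := exists_submultiplicative fun n => Fintype.card (Fin n → C) * M n
  let b : ℕ → ℂ := fun n => ((2 ^ (n + 1) * a n : ℝ) : ℂ)
  have hb : ∀ n, ‖b n‖ = 2 ^ (n + 1) * a n := fun n =>
    Complex.norm_of_nonneg (mul_nonneg (by positivity) (ha0 n))
  let Ξ : Borchers s C →ₗ[ℂ] lp (fun n => CoefSpace s C n) 2 :=
    DirectSum.toModule ℂ ℕ _ fun n => lp.lsingle 2 n ∘ₗ (b n • Θ n)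
  have hΞlof : ∀ n f, Ξ (DirectSum.lof ℂ ℕ (TestFun s C) n f) = lp.single 2 n (b n • Θ n f) :=
    fun n f => by
      simp only [Ξ, DirectSum.toModule_lof]
      rfl
  have hΞ : ∀ (f : Borchers s C) n, Ξ f n = b n • Θ n (f n) := by
    intro f n
    induction f using DirectSum.induction_on with
    | zero => simp
    | add f g hf hg =>
      rw [map_add, lp.coeFn_add, Pi.add_apply, hf, hg, DirectSum.add_apply, map_add, smul_add]
    | of i f =>
      rw [← DirectSum.lof_eq_of ℂ, hΞlof, lp.coeFn_single]
      by_cases h : n = i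
      · subst h
        rw [Pi.single_eq_same, DirectSum.lof_apply]
      · rw [Pi.single_eq_of_ne h, DirectSum.lof_eq_of, DirectSum.of_eq_of_ne _ _ _ h, map_zero,
          smul_zero]
  let p : Seminorm ℂ (Borchers s C) := (normSeminorm ℂ _).comp Ξ
  have hp : ∀ f, p f = ‖Ξ f‖ := fun f => rfl
  have hΘp : ∀ f n, a n * ‖Θ n (f n)‖ ≤ (1 / 2) ^ (n + 1) * p f := by
    intro f n
    have h1 : ‖Ξ f n‖ ≤ ‖Ξ f‖ := lp.norm_apply_le_norm (by simp) _ _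
    rw [hΞ, norm_smul, hb, ← hp] at h1
    have h2 : (0 : ℝ) < 2 ^ (n + 1) := by positivity
    rw [one_div, inv_pow, inv_mul_eq_div, le_div_iff₀ h2]
    refine le_trans (le_of_eq ?_) h1
    ring
  refine ⟨p, fun f g => ?_, fun n => ?_, fun f g => ?_⟩
  · rw [hp, hp, hp, hp, map_add, map_sub]
    have := parallelogram_law_with_norm ℂ (Ξ f) (Ξ g)
    simpa only [sq] using this
  · have : (fun f : TestFun s C n => p (DirectSum.lof ℂ ℕ (TestFun s C) n f)) =
        fun f => ‖b n‖ * ‖Θ n f‖ := by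
      funext f
      rw [hp, hΞlof, lp.norm_single (by simp), norm_smul]
    rw [this]
    exact continuous_const.mul (hΘc n)
  · have hterm : ∀ (n m : ℕ) (x : TestFun s C n) (y : TestFun s C m),
        ‖R.eval (tmul (bstar (DirectSum.lof ℂ ℕ (TestFun s C) n x))
          (DirectSum.lof ℂ ℕ (TestFun s C) m y))‖ ≤ (a n * ‖Θ n x‖) * (a m * ‖Θ m y‖) := by
      intro n m x y
      rw [bstar_lof, tmul_lof, Functional.eval_lof]
      calc _ ≤ ∑ w : Fin (n + m) → C, ‖R (n + m) w (schwartzTensor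
              (starHom s C n x (w ∘ Fin.castAdd m)) (y (w ∘ Fin.natAdd n)))‖ := norm_sum_le _ _
        _ ≤ ∑ w : Fin (n + m) → C, M (n + m) * (‖Θ n x‖ * ‖Θ m y‖) := by
            refine Finset.sum_le_sum fun w _ => (hM n m w _ _).trans ?_
            refine mul_le_mul_of_nonneg_left ?_ (hM0 _)
            exact mul_le_mul (hΘ n x _) (hΘ m y _) (coefNorm_nonneg _ _) (norm_nonneg _)
        _ = (Fintype.card (Fin (n + m) → C) * M (n + m)) * (‖Θ n x‖ * ‖Θ m y‖) := by
            rw [Finset.sum_const, nsmul_eq_mul, Finset.card_univ]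
            ring
        _ ≤ (a n * a m) * (‖Θ n x‖ * ‖Θ m y‖) :=
            mul_le_mul_of_nonneg_right (ha n m) (by positivity)
        _ = _ := by ring
    have hf := DirectSum.sum_support_of f
    have hg := DirectSum.sum_support_of g
    have hsum : R.eval (tmul (bstar f) g) = ∑ n ∈ DFinsupp.support f, ∑ m ∈ DFinsupp.support g,
        R.eval (tmul (bstar (DirectSum.lof ℂ ℕ (TestFun s C) n (f n)))
          (DirectSum.lof ℂ ℕ (TestFun s C) m (g m))) := by
      conv_lhs => rw [← hf, ← hg]
      simp only [map_sum, LinearMap.sum_apply, DirectSum.lof_eq_of]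
      exact Finset.sum_comm
    rw [hsum]
    calc _ ≤ ∑ n ∈ DFinsupp.support f, ∑ m ∈ DFinsupp.support g,
          ‖R.eval (tmul (bstar (DirectSum.lof ℂ ℕ (TestFun s C) n (f n)))
          (DirectSum.lof ℂ ℕ (TestFun s C) m (g m)))‖ :=
          (norm_sum_le _ _).trans (Finset.sum_le_sum fun _ _ => norm_sum_le _ _)
      _ ≤ ∑ n ∈ DFinsupp.support f, ∑ m ∈ DFinsupp.support g,
          ((1 / 2) ^ (n + 1) * p f) * ((1 / 2) ^ (m + 1) * p g) := by
          refine Finset.sum_le_sum fun n _ => Finset.sum_le_sum fun m _ => (hterm _ _ _ _).trans ?_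
          exact mul_le_mul (hΘp f n) (hΘp g m) (mul_nonneg (ha0 _) (norm_nonneg _))
            (mul_nonneg (by positivity) (apply_nonneg _ _))
      _ = (∑ n ∈ DFinsupp.support f, (1 / 2 : ℝ) ^ (n + 1)) *
          (∑ m ∈ DFinsupp.support g, (1 / 2 : ℝ) ^ (m + 1)) * (p f * p g) := by
          rw [Finset.sum_mul_sum, Finset.sum_mul]
          refine Finset.sum_congr rfl fun n _ => ?_
          rw [Finset.sum_mul]
          exact Finset.sum_congr rfl fun m _ => by ring
      _ ≤ 1 * (p f * p g) := by
          refine mul_le_mul_of_nonneg_right ?_ (mul_nonneg (apply_nonneg _ _) (apply_nonneg _ _))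
          exact mul_le_one₀ (sum_half_pow_le _)
            (Finset.sum_nonneg fun _ _ => by positivity) (sum_half_pow_le _)
      _ = _ := one_mul _

end

noncomputable section

/-! ### Sums over set partitions. -/

section Partitions

variable {α β γ : Type*}

/-- `P` is a partition of the finite type `α`. -/
def IsPartition (P : Finset (Finset α)) : Prop :=
  ∅ ∉ P ∧ ∀ x, ∃! B, B ∈ P ∧ x ∈ B

open Classical in
/-- The partitions of a finite type. -/
def partitions (α : Type*) [Fintype α] [DecidableEq α] : Finset (Finset (Finset α)) :=
  Finset.univ.filter IsPartition

theorem mem_partitions [Fintype α] [DecidableEq α] {P : Finset (Finset α)} : P ∈ partitions α ↔ IsPartition P := by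
  simp [partitions]

theorem IsPartition.eq_of_mem {P : Finset (Finset α)} (hP : IsPartition P) {A B : Finset α}
    (hA : A ∈ P) (hB : B ∈ P) {x : α} (hxA : x ∈ A) (hxB : x ∈ B) : A = B :=
  (hP.2 x).unique ⟨hA, hxA⟩ ⟨hB, hxB⟩

theorem IsPartition.image [DecidableEq β] {P : Finset (Finset α)} (hP : IsPartition P) (σ : α ≃ β) :
    IsPartition (P.image fun B => B.map σ.toEmbedding) := by
  refine ⟨?_, fun y => ?_⟩
  · simp only [Finset.mem_image, not_exists, not_and]
    intro B hB h
    exact hP.1 (by rwa [← Finset.map_eq_empty.1 h])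
  · obtain ⟨B, ⟨hB, hx⟩, huniq⟩ := hP.2 (σ.symm y)
    refine ⟨B.map σ.toEmbedding, ⟨Finset.mem_image_of_mem _ hB, by simpa using hx⟩, ?_⟩
    rintro A ⟨hA, hy⟩
    obtain ⟨B', hB', rfl⟩ := Finset.mem_image.1 hA
    rw [huniq B' ⟨hB', by simpa using hy⟩]

variable [Fintype α] [Fintype β] [Fintype γ] [DecidableEq α] [DecidableEq β] [DecidableEq γ]

/-- A bijection permutes the partitions. Used for the reversal of the variables (hermiticity) and
for adjacent transpositions (locality). -/
theorem sum_partitions_map (σ : α ≃ β) (κ : Finset β → ℂ) :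
    ∑ P ∈ partitions α, ∏ B ∈ P, κ (B.map σ.toEmbedding) = ∑ P ∈ partitions β, ∏ B ∈ P, κ B := by
  refine Finset.sum_bij' (fun P _ => P.image fun B => B.map σ.toEmbedding)
    (fun P _ => P.image fun B => B.map σ.symm.toEmbedding) ?_ ?_ ?_ ?_ ?_
  · exact fun P hP => mem_partitions.2 ((mem_partitions.1 hP).image σ)
  · exact fun P hP => mem_partitions.2 ((mem_partitions.1 hP).image σ.symm)
  · intro P _
    have h : (fun B : Finset α => B.map σ.toEmbedding |>.map σ.symm.toEmbedding) = id := by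
      funext B; ext x; simp
    rw [Finset.image_image, Function.comp_def, h, Finset.image_id]
  · intro P _
    have h : (fun B : Finset β => B.map σ.symm.toEmbedding |>.map σ.toEmbedding) = id := by
      funext B; ext x; simp
    rw [Finset.image_image, Function.comp_def, h, Finset.image_id]
  · intro P _
    rw [Finset.prod_image]
    exact fun A _ B _ h => Finset.map_injective _ h

/-- A set is mixed if it meets the ranges of both `i` and `j`. -/
def IsMixed (i : α ↪ γ) (j : β ↪ γ) (B : Finset γ) : Prop := (∃ x, i x ∈ B) ∧ ∃ y, j y ∈ B

/-- The sum over the partitions without mixed blocks factorizes. -/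
theorem sum_partitions_not_mixed (i : α ↪ γ) (j : β ↪ γ) (hdisj : ∀ x y, i x ≠ j y)
    (hcov : ∀ z, (∃ x, i x = z) ∨ ∃ y, j y = z) (κ : Finset γ → ℂ)
    (hκ : ∀ B, IsMixed i j B → κ B = 0) :
    ∑ P ∈ partitions γ, ∏ B ∈ P, κ B =
      (∑ P ∈ partitions α, ∏ B ∈ P, κ (B.map i)) * ∑ Q ∈ partitions β, ∏ B ∈ Q, κ (B.map j) := by
  classical
  rw [Finset.sum_mul_sum, ← Finset.sum_product']
  have hdisj' : ∀ (A : Finset α) (B : Finset β), A ≠ ∅ → A.map i ≠ B.map j := by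
    intro A B hA h
    obtain ⟨x, hx⟩ := Finset.nonempty_iff_ne_empty.2 hA
    have : i x ∈ B.map j := h ▸ Finset.mem_map_of_mem i hx
    obtain ⟨y, _, hy⟩ := Finset.mem_map.1 this
    exact hdisj x y hy.symm
  have hmi : ∀ A : Finset α, Finset.univ.filter (fun x => i x ∈ A.map i) = A := fun A => by
    ext x; simp
  symm
  -- A pair of partitions of the two parts is sent to the union of its blocks. This is injective
  -- because no non-empty set lies in both parts.
  refine Finset.sum_of_injOn
    (fun p => p.1.image (fun B => B.map i) ∪ p.2.image fun B => B.map j) ?_ ?_ ?_ ?_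
  · rintro ⟨P, Q⟩ hPQ ⟨P', Q'⟩ hPQ' h
    simp only [Finset.coe_product, Set.mem_prod, Finset.mem_coe, mem_partitions] at hPQ hPQ'
    simp only at h
    have key : ∀ (P P' : Finset (Finset α)) (Q Q' : Finset (Finset β)), IsPartition P →
        P.image (fun B => B.map i) ∪ Q.image (fun B => B.map j) =
          P'.image (fun B => B.map i) ∪ Q'.image (fun B => B.map j) → P ⊆ P' := by
      intro P P' Q Q' hP h B hB
      have h1 : B.map i ∈ P'.image (fun B => B.map i) ∪ Q'.image (fun B => B.map j) :=
        h ▸ Finset.mem_union_left _ (Finset.mem_image_of_mem _ hB)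
      rcases Finset.mem_union.1 h1 with h1 | h1
      · obtain ⟨B', hB', e⟩ := Finset.mem_image.1 h1
        rwa [← Finset.map_injective _ e]
      · obtain ⟨B', hB', e⟩ := Finset.mem_image.1 h1
        exact (hdisj' B B' (fun h => hP.1 (h ▸ hB)) e.symm).elim
    have key' : ∀ (P P' : Finset (Finset α)) (Q Q' : Finset (Finset β)), IsPartition Q →
        IsPartition P' →
        P.image (fun B => B.map i) ∪ Q.image (fun B => B.map j) =
          P'.image (fun B => B.map i) ∪ Q'.image (fun B => B.map j) → Q ⊆ Q' := by
      intro P P' Q Q' hQ hP' h B hB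
      have h1 : B.map j ∈ P'.image (fun B => B.map i) ∪ Q'.image (fun B => B.map j) :=
        h ▸ Finset.mem_union_right _ (Finset.mem_image_of_mem _ hB)
      rcases Finset.mem_union.1 h1 with h1 | h1
      · obtain ⟨B', hB', e⟩ := Finset.mem_image.1 h1
        exact (hdisj' B' B (fun h => hP'.1 (h ▸ hB')) e).elim
      · obtain ⟨B', hB', e⟩ := Finset.mem_image.1 h1
        rwa [← Finset.map_injective _ e]
    rw [Prod.mk.injEq]
    exact ⟨(key P P' Q Q' hPQ.1 h).antisymm (key P' P Q' Q hPQ'.1 h.symm),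
      (key' P P' Q Q' hPQ.2 hPQ'.1 h).antisymm (key' P' P Q' Q hPQ'.2 hPQ.1 h.symm)⟩
  · rintro ⟨P, Q⟩ hPQ
    simp only [Finset.coe_product, Set.mem_prod, Finset.mem_coe, mem_partitions] at hPQ
    rw [Finset.mem_coe, mem_partitions]
    refine ⟨?_, fun z => ?_⟩
    · simp only [Finset.mem_union, Finset.mem_image, Finset.map_eq_empty, not_or, not_exists,
        not_and]
      exact ⟨fun B hB h => hPQ.1.1 (h ▸ hB), fun B hB h => hPQ.2.1 (h ▸ hB)⟩
    · rcases hcov z with ⟨x, rfl⟩ | ⟨y, rfl⟩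
      · obtain ⟨B, ⟨hB, hx⟩, huniq⟩ := hPQ.1.2 x
        refine ⟨B.map i, ⟨Finset.mem_union_left _ (Finset.mem_image_of_mem _ hB),
          Finset.mem_map_of_mem i hx⟩, ?_⟩
        rintro A ⟨hA, hxA⟩
        rcases Finset.mem_union.1 hA with h1 | h1
        · obtain ⟨B', hB', rfl⟩ := Finset.mem_image.1 h1
          rw [huniq B' ⟨hB', by simpa using hxA⟩]
        · obtain ⟨B', hB', rfl⟩ := Finset.mem_image.1 h1
          obtain ⟨y, _, hy⟩ := Finset.mem_map.1 hxA
          exact (hdisj x y hy.symm).elim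
      · obtain ⟨B, ⟨hB, hx⟩, huniq⟩ := hPQ.2.2 y
        refine ⟨B.map j, ⟨Finset.mem_union_right _ (Finset.mem_image_of_mem _ hB),
          Finset.mem_map_of_mem j hx⟩, ?_⟩
        rintro A ⟨hA, hxA⟩
        rcases Finset.mem_union.1 hA with h1 | h1
        · obtain ⟨B', hB', rfl⟩ := Finset.mem_image.1 h1
          obtain ⟨x, _, hy⟩ := Finset.mem_map.1 hxA
          exact (hdisj x y hy).elim
        · obtain ⟨B', hB', rfl⟩ := Finset.mem_image.1 h1
          rw [huniq B' ⟨hB', by simpa using hxA⟩]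
  · intro P hP hnot
    rw [mem_partitions] at hP
    by_contra hne
    -- A non-vanishing term has no mixed block, so each block lies in one part and the partition
    -- comes from a pair after all.
    have hnm : ∀ B ∈ P, ¬ IsMixed i j B := fun B hB hm => hne (Finset.prod_eq_zero hB (hκ B hm))
    have hpre : ∀ B ∈ P, (∃ x, i x ∈ B) → B = (Finset.univ.filter fun x => i x ∈ B).map i := by
      intro B hB hx
      ext z
      simp only [Finset.mem_map, Finset.mem_filter, Finset.mem_univ, true_and]
      refine ⟨fun hz => ?_, fun ⟨x, hx, e⟩ => e ▸ hx⟩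
      rcases hcov z with ⟨x, rfl⟩ | ⟨y, rfl⟩
      · exact ⟨x, hz, rfl⟩
      · exact (hnm B hB ⟨hx, y, hz⟩).elim
    have hpre' : ∀ B ∈ P, (∃ x, j x ∈ B) → B = (Finset.univ.filter fun x => j x ∈ B).map j := by
      intro B hB hx
      ext z
      simp only [Finset.mem_map, Finset.mem_filter, Finset.mem_univ, true_and]
      refine ⟨fun hz => ?_, fun ⟨x, hx, e⟩ => e ▸ hx⟩
      rcases hcov z with ⟨y, rfl⟩ | ⟨x, rfl⟩
      · exact (hnm B hB ⟨⟨y, hz⟩, hx⟩).elim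
      · exact ⟨x, hz, rfl⟩
    refine hnot ⟨(Finset.univ.filter fun B => B.map i ∈ P, Finset.univ.filter fun B => B.map j ∈ P),
      ?_, ?_⟩
    · simp only [Finset.coe_product, Set.mem_prod, Finset.mem_coe, mem_partitions]
      refine ⟨⟨fun h => hP.1 (by simpa using h), fun x => ?_⟩,
        ⟨fun h => hP.1 (by simpa using h), fun x => ?_⟩⟩
      · obtain ⟨B, ⟨hB, hx⟩, -⟩ := hP.2 (i x)
        have hB' := hpre B hB ⟨x, hx⟩
        refine ⟨Finset.univ.filter fun x => i x ∈ B, ⟨?_, by simpa using hx⟩, ?_⟩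
        · simpa [← hB'] using hB
        · rintro A ⟨hA, hxA⟩
          have : A.map i = B := hP.eq_of_mem (by simpa using hA) hB (Finset.mem_map_of_mem i hxA) hx
          ext z; simp [← this]
      · obtain ⟨B, ⟨hB, hx⟩, -⟩ := hP.2 (j x)
        have hB' := hpre' B hB ⟨x, hx⟩
        refine ⟨Finset.univ.filter fun x => j x ∈ B, ⟨?_, by simpa using hx⟩, ?_⟩
        · simpa [← hB'] using hB
        · rintro A ⟨hA, hxA⟩
          have : A.map j = B := hP.eq_of_mem (by simpa using hA) hB (Finset.mem_map_of_mem j hxA) hx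
          ext z; simp [← this]
    · ext B
      simp only [Finset.mem_union, Finset.mem_image, Finset.mem_filter, Finset.mem_univ, true_and]
      constructor
      · rintro (⟨A, hA, rfl⟩ | ⟨A, hA, rfl⟩) <;> exact hA
      · intro hB
        obtain ⟨z, hz⟩ : B.Nonempty := Finset.nonempty_iff_ne_empty.2 fun h => hP.1 (h ▸ hB)
        rcases hcov z with ⟨x, rfl⟩ | ⟨y, rfl⟩
        · exact Or.inl ⟨_, by rw [← hpre B hB ⟨x, hz⟩]; exact hB, (hpre B hB ⟨x, hz⟩).symm⟩
        · exact Or.inr ⟨_, by rw [← hpre' B hB ⟨y, hz⟩]; exact hB, (hpre' B hB ⟨y, hz⟩).symm⟩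
  · rintro ⟨P, Q⟩ hPQ
    simp only [Finset.mem_product, mem_partitions] at hPQ
    rw [Finset.prod_union, Finset.prod_image fun A _ B _ h => Finset.map_injective _ h,
      Finset.prod_image fun A _ B _ h => Finset.map_injective _ h]
    rw [Finset.disjoint_left]
    intro A hA hA'
    obtain ⟨B, hB, rfl⟩ := Finset.mem_image.1 hA
    obtain ⟨B', hB', e⟩ := Finset.mem_image.1 hA'
    exact hdisj' B B' (fun h => hPQ.1.1 (h ▸ hB)) e.symm

end Partitions

/-! ### Ordered partitions as set partitions, and truncation in terms of blocks. -/

section Ordered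

variable {n : ℕ}

/-- The blocks of an ordered partition, as finite sets. -/
def blockSet (c : OrderedFinpartition n) (j : Fin c.length) : Finset (Fin n) :=
  Finset.univ.map ⟨c.emb j, (c.emb_strictMono j).injective⟩

theorem mem_blockSet {c : OrderedFinpartition n} {j : Fin c.length} {x : Fin n} :
    x ∈ blockSet c j ↔ ∃ i, c.emb j i = x := by
  simp [blockSet]

theorem card_blockSet (c : OrderedFinpartition n) (j : Fin c.length) :
    (blockSet c j).card = c.partSize j := by simp [blockSet]

/-- The last element of a block. -/
def blockLast (c : OrderedFinpartition n) (j : Fin c.length) : Fin n :=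
  c.emb j ⟨c.partSize j - 1, Nat.sub_one_lt_of_lt (c.partSize_pos j)⟩

theorem blockLast_mem (c : OrderedFinpartition n) (j : Fin c.length) :
    blockLast c j ∈ blockSet c j := mem_blockSet.2 ⟨_, rfl⟩

theorem le_blockLast {c : OrderedFinpartition n} {j : Fin c.length} {x : Fin n}
    (hx : x ∈ blockSet c j) : x ≤ blockLast c j := by
  obtain ⟨i, rfl⟩ := mem_blockSet.1 hx
  exact (c.emb_strictMono j).monotone (Fin.le_def.2 (by have := i.2; simp only; omega))

theorem blockSet_eq_of_mem {c : OrderedFinpartition n} {j j' : Fin c.length} {x : Fin n}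
    (h : x ∈ blockSet c j) (h' : x ∈ blockSet c j') : j = j' := by
  by_contra hne
  obtain ⟨i, rfl⟩ := mem_blockSet.1 h
  obtain ⟨i', hi'⟩ := mem_blockSet.1 h'
  exact Set.disjoint_left.1 (c.disjoint (Set.mem_univ j) (Set.mem_univ j') hne)
    ⟨i, rfl⟩ ⟨i', hi'⟩

theorem blockSet_injective (c : OrderedFinpartition n) : Function.Injective (blockSet c) :=
  fun j j' h => blockSet_eq_of_mem (blockLast_mem c j) (h ▸ blockLast_mem c j)

theorem isPartition_blockSet (c : OrderedFinpartition n) :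
    IsPartition (Finset.univ.image (blockSet c)) := by
  refine ⟨?_, fun x => ?_⟩
  · simp only [Finset.mem_image, Finset.mem_univ, true_and, not_exists]
    intro j h
    have := blockLast_mem c j
    rw [h] at this
    simp at this
  · obtain ⟨j, i, hi⟩ := c.cover x
    refine ⟨blockSet c j, ⟨Finset.mem_image_of_mem _ (Finset.mem_univ j), mem_blockSet.2 ⟨i, hi⟩⟩, ?_⟩
    rintro B ⟨hB, hx⟩
    obtain ⟨j', -, rfl⟩ := Finset.mem_image.1 hB
    rw [blockSet_eq_of_mem hx (mem_blockSet.2 ⟨i, hi⟩)]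

theorem orderedFinpartition_ext {c c' : OrderedFinpartition n} (hl : c.length = c'.length)
    (h : ∀ j, blockSet c j = blockSet c' (Fin.cast hl j)) : c = c' := by
  obtain ⟨l, p, hp, e, he, hs, hd, hc⟩ := c
  obtain ⟨l', p', hp', e', he', hs', hd', hc'⟩ := c'
  simp only at hl
  subst hl
  obtain rfl : p = p' := by
    funext j
    have := congrArg Finset.card (h j)
    rwa [card_blockSet, card_blockSet] at this
  obtain rfl : e = e' := by
    funext j
    refine ((he j).range_inj (he' j)).1 ?_
    ext x
    have := Finset.ext_iff.1 (h j) x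
    rw [mem_blockSet, mem_blockSet] at this
    exact this
  rfl

/-- Blocks are numbered by their last elements, and increasing maps with the same range coincide;
hence the unordered set of blocks fixes the numbering. -/
theorem blockSet_image_injective {c c' : OrderedFinpartition n}
    (h : Finset.univ.image (blockSet c) = Finset.univ.image (blockSet c')) : c = c' := by
  have hl : c.length = c'.length := by
    have := congrArg Finset.card h
    rwa [Finset.card_image_of_injective _ (blockSet_injective c),
      Finset.card_image_of_injective _ (blockSet_injective c'), Finset.card_univ, Finset.card_univ,
      Fintype.card_fin, Fintype.card_fin] at this
  have hsub : ∀ {c c' : OrderedFinpartition n},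
      Finset.univ.image (blockSet c) = Finset.univ.image (blockSet c') →
      ∀ j, ∃ j', blockSet c j = blockSet c' j' ∧ blockLast c j = blockLast c' j' := by
    intro c c' h j
    obtain ⟨j', -, hj'⟩ := Finset.mem_image.1 (h ▸ Finset.mem_image_of_mem _ (Finset.mem_univ j))
    refine ⟨j', hj'.symm, le_antisymm (le_blockLast (hj' ▸ blockLast_mem c j)) ?_⟩
    exact le_blockLast (hj' ▸ blockLast_mem c' j')
  have hmono : ∀ c : OrderedFinpartition n, StrictMono (blockLast c) := fun c => c.parts_strictMono
  have hlast : blockLast c = blockLast c' ∘ Fin.cast hl := by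
    refine ((hmono c).range_inj ((hmono c').comp (Fin.cast_strictMono hl))).1 ?_
    ext x
    constructor
    · rintro ⟨j, rfl⟩
      obtain ⟨j', -, e⟩ := hsub h j
      exact ⟨Fin.cast hl.symm j', by simp [e]⟩
    · rintro ⟨j, rfl⟩
      obtain ⟨j', -, e⟩ := hsub h.symm (Fin.cast hl j)
      exact ⟨j', e.symm⟩
  refine orderedFinpartition_ext hl fun j => ?_
  obtain ⟨j', e, e'⟩ := hsub h j
  have : j' = Fin.cast hl j := (hmono c').injective (by rw [← e', hlast]; rfl)
  rw [e, this]

theorem exists_orderedFinpartition {P : Finset (Finset (Fin n))} (hP : IsPartition P) :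
    ∃ c : OrderedFinpartition n, Finset.univ.image (blockSet c) = P := by
  classical
  have hne : ∀ B ∈ P, B.Nonempty := fun B hB =>
    Finset.nonempty_iff_ne_empty.2 fun h => hP.1 (h ▸ hB)
  -- Blocks are listed by increasing maxima: `M` is the set of maxima, `o` its enumeration and `b x`
  -- the block which contains `x`.
  let M : Finset (Fin n) := P.attach.image fun B => B.1.max' (hne B.1 B.2)
  let r := M.card
  choose b hb hbu using fun x => hP.2 x
  let o : Fin r ↪o Fin n := M.orderEmbOfFin rfl
  have hmax : ∀ j : Fin r, ∃ h : (b (o j)).Nonempty, (b (o j)).max' h = o j := by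
    intro j
    have : o j ∈ M := M.orderEmbOfFin_mem rfl j
    obtain ⟨B, -, hB⟩ := Finset.mem_image.1 this
    have e : B.1 = b (o j) := hbu (o j) _ ⟨B.2, hB ▸ Finset.max'_mem _ _⟩
    exact ⟨⟨o j, (hb _).2⟩, by simp only [← e]; exact hB⟩
  have hpos : ∀ j : Fin r, 0 < (b (o j)).card := fun j => Finset.card_pos.2 ⟨o j, (hb _).2⟩
  have hlast : ∀ j : Fin r, (b (o j)).orderEmbOfFin rfl ⟨(b (o j)).card - 1,
      Nat.sub_one_lt_of_lt (hpos j)⟩ = o j := fun j => by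
    rw [Finset.orderEmbOfFin_last rfl (hpos j)]
    exact (hmax j).2
  let c : OrderedFinpartition n :=
    { length := r
      partSize := fun j => (b (o j)).card
      partSize_pos := hpos
      emb := fun j => (b (o j)).orderEmbOfFin rfl
      emb_strictMono := fun j => ((b (o j)).orderEmbOfFin rfl).strictMono
      parts_strictMono := by
        intro j j' hjj'
        simp only [hlast]
        exact o.strictMono hjj'
      disjoint := by
        intro j _ j' _ hjj'
        rw [Function.onFun, Set.disjoint_left]
        rintro x ⟨i, rfl⟩ ⟨i', hi'⟩
        have h1 := Finset.orderEmbOfFin_mem (b (o j)) rfl i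
        have h2 := Finset.orderEmbOfFin_mem (b (o j')) rfl i'
        rw [hi'] at h2
        have e := hP.eq_of_mem (hb (o j)).1 (hb (o j')).1 h1 h2
        apply hjj'
        apply o.injective
        obtain ⟨p, hp⟩ := hmax j
        obtain ⟨p', hp'⟩ := hmax j'
        rw [← hp, ← hp']
        simp only [e]
      cover := by
        intro x
        have hM : (b x).max' ⟨x, (hb x).2⟩ ∈ M :=
          Finset.mem_image.2 ⟨⟨b x, (hb x).1⟩, Finset.mem_attach _ _, rfl⟩
        rw [← Finset.mem_coe, ← Finset.range_orderEmbOfFin M rfl] at hM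
        obtain ⟨j, hj⟩ := hM
        have e : b x = b (o j) := hbu (o j) (b x) ⟨(hb x).1, by
          change o j = _ at hj
          rw [hj]; exact Finset.max'_mem _ _⟩
        refine ⟨j, ?_⟩
        rw [Finset.range_orderEmbOfFin, Finset.mem_coe, ← e]
        exact (hb x).2 }
  have hcb : ∀ j, blockSet c j = b (o j) := by
    intro j
    ext x
    rw [mem_blockSet, ← Finset.mem_coe, ← Finset.range_orderEmbOfFin (b (o j)) rfl]
    rfl
  refine ⟨c, ?_⟩
  ext B
  simp only [Finset.mem_image, Finset.mem_univ, true_and]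
  constructor
  · rintro ⟨j, rfl⟩
    rw [hcb]
    exact (hb _).1
  · intro hB
    obtain ⟨x, hx⟩ := hne B hB
    obtain ⟨j, i, hi⟩ := c.cover x
    exact ⟨j, hP.eq_of_mem (hcb j ▸ (hb _).1) hB (mem_blockSet.2 ⟨i, hi⟩) hx⟩

/-- A relabelling disturbs the numbering of the blocks of an ordered partition, whereas it simply
permutes set partitions. Products over blocks do not depend on the numbering. -/
theorem sum_orderedFinpartition (κ : Finset (Fin n) → ℂ) :
    ∑ c : OrderedFinpartition n, ∏ j, κ (blockSet c j) =
      ∑ P ∈ partitions (Fin n), ∏ B ∈ P, κ B := by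
  refine Finset.sum_bij (fun c _ => Finset.univ.image (blockSet c)) ?_ ?_ ?_ ?_
  · exact fun c _ => mem_partitions.2 (isPartition_blockSet c)
  · exact fun c _ c' _ h => blockSet_image_injective h
  · intro P hP
    obtain ⟨c, hc⟩ := exists_orderedFinpartition (mem_partitions.1 hP)
    exact ⟨c, Finset.mem_univ _, hc⟩
  · intro c _
    rw [Finset.prod_image fun A _ B _ h => blockSet_injective c h]

variable {s : ℕ} {C : Type}

/-- The value of a functional on the variables of a block. -/
def Functional.onBlock (R : Functional s C) (w : Fin n → C) (u : Fin n → 𝓢(Spacetime s, ℂ))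
    (B : Finset (Fin n)) : ℂ :=
  R B.card (w ∘ B.orderEmbOfFin rfl) (prodFun (u ∘ B.orderEmbOfFin rfl))

/-- A finite set has only one increasing enumeration, so any one at hand computes the value. -/
theorem Functional.onBlock_eq (R : Functional s C) (w : Fin n → C) (u : Fin n → 𝓢(Spacetime s, ℂ))
    {B : Finset (Fin n)} {k : ℕ} {e : Fin k → Fin n} (he : StrictMono e)
    (hB : ∀ x, x ∈ B ↔ ∃ i, e i = x) : R.onBlock w u B = R k (w ∘ e) (prodFun (u ∘ e)) := by
  have hk : B.card = k := by
    have : B = Finset.univ.map ⟨e, he.injective⟩ := by ext x; simp [hB]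
    rw [this]; simp
  subst hk
  have : e = B.orderEmbOfFin rfl := Finset.orderEmbOfFin_unique rfl (fun x => (hB _).2 ⟨x, rfl⟩) he
  rw [this]
  rfl

theorem Functional.onBlock_card (R : Functional s C) (w : Fin n → C)
    (u : Fin n → 𝓢(Spacetime s, ℂ)) (B : Finset (Fin n)) :
    R.onBlock w u B = R B.card (w ∘ B.orderEmbOfFin rfl) (prodFun (u ∘ B.orderEmbOfFin rfl)) := rfl

theorem sum_onBlock_trunc (W : Functional s C) (hn : 0 < n) (w : Fin n → C)
    (u : Fin n → 𝓢(Spacetime s, ℂ)) :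
    W n w (prodFun u) = ∑ P ∈ partitions (Fin n), ∏ B ∈ P, Functional.onBlock W.trunc w u B := by
  rw [trunc_prodFun W hn, ← sum_orderedFinpartition]
  refine Finset.sum_congr rfl fun c _ => Finset.prod_congr rfl fun j _ => ?_
  exact (Functional.onBlock_eq _ w u (c.emb_strictMono j) fun x => mem_blockSet).symm

/-- In degree `0` the only partition is the empty one, with product `1`; the normalization of `W` is
exactly what makes the formula hold there. -/
theorem sum_onBlock_trunc_of_normalized [Fintype C] (W : Functional s C) (hW : W.IsNormalized)
    (w : Fin n → C) (u : Fin n → 𝓢(Spacetime s, ℂ)) :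
    W n w (prodFun u) = ∑ P ∈ partitions (Fin n), ∏ B ∈ P, Functional.onBlock W.trunc w u B := by
  rcases Nat.eq_zero_or_pos n with rfl | hn
  · have : partitions (Fin 0) = {∅} := by
      ext P
      rw [mem_partitions, Finset.mem_singleton]
      constructor
      · intro h
        rw [Finset.eq_empty_iff_forall_notMem]
        intro B hB
        exact h.1 (by rwa [← Finset.eq_empty_of_isEmpty B])
      · rintro rfl
        exact ⟨by simp, fun x => x.elim0⟩
    rw [this, hW w]
    simp
  · exact sum_onBlock_trunc W hn w u

end Ordered

end

noncomputable section

/-! ### Poincaré invariance and hermiticity. -/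

section Components

variable {s : ℕ}

theorem Functional.eval_single {C : Type} [Fintype C] (W : Functional s C) {n : ℕ}
    [DecidableEq (Fin n → C)] (w : Fin n → C) (f : 𝓢(Conf s (Fin n), ℂ)) :
    W.eval (DirectSum.lof ℂ ℕ (TestFun s C) n (Pi.single w f)) = W n w f := by
  rw [Functional.eval_lof, Fintype.sum_eq_single w]
  · rw [Pi.single_eq_same]
  · intro w' hw'
    rw [Pi.single_eq_of_ne hw', map_zero]

theorem Functional.eval_lof_unit (W : Functional s Unit) {n : ℕ} (f : TestFun s Unit n)
    (w : Fin n → Unit) :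
    W.eval (DirectSum.lof ℂ ℕ (TestFun s Unit) n f) = W n w (f w) := by
  rw [Functional.eval_lof, Fintype.sum_unique]
  rfl

theorem alpha_lof {C : Type} (P : Poincare s) {n : ℕ} (f : TestFun s C n) :
    P.alpha (DirectSum.lof ℂ ℕ (TestFun s C) n f) =
      DirectSum.lof ℂ ℕ (TestFun s C) n (fun w => P.act n (f w)) :=
  DirectSum.lmap_lof _ _ _

theorem isPoincareInvariant_iff {C : Type} [Fintype C] {W : Functional s C} :
    W.IsPoincareInvariant ↔ ∀ (P : Poincare s) (n : ℕ) (w : Fin n → C) (f : 𝓢(Conf s (Fin n), ℂ)),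
      W n w (P.act n f) = W n w f := by
  classical
  constructor
  · intro h P n w f
    have := h P (DirectSum.lof ℂ ℕ (TestFun s C) n (Pi.single w f))
    rw [alpha_lof, Functional.eval_single] at this
    rw [← this, ← Functional.eval_single W w]
    congr 2
    funext w'
    by_cases hw : w' = w
    · subst hw; simp
    · simp [hw]
  · intro h P f
    induction f using DirectSum.induction_on with
    | zero => simp
    | add f g hf hg => rw [map_add, map_add, map_add, hf, hg]
    | of n f =>
      rw [← DirectSum.lof_eq_of ℂ, alpha_lof, Functional.eval_lof, Functional.eval_lof]
      exact Finset.sum_congr rfl fun w _ => h P n w (f w)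

/-- The action of the Poincaré group on one-particle functions. -/
def Poincare.actOne (P : Poincare s) : 𝓢(Spacetime s, ℂ) →L[ℂ] 𝓢(Spacetime s, ℂ) :=
  SchwartzMap.compSubConstCLM ℂ P.a ∘L pullback P.Λ.symm.toContinuousLinearEquiv

theorem act_prodFun_eq (P : Poincare s) {n : ℕ} (u : Fin n → 𝓢(Spacetime s, ℂ)) :
    P.act n (prodFun u) = prodFun (P.actOne ∘ u) := by
  ext x
  rw [act_prodFun, prodFun_apply]
  rfl

/-- Poincaré invariance is inherited from the truncated functional. -/
theorem IsPoincareInvariant.of_trunc {C : Type} [Fintype C] {W : Functional s C}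
    (h : Functional.IsPoincareInvariant W.trunc) : W.IsPoincareInvariant := by
  rw [isPoincareInvariant_iff] at h ⊢
  intro P n w f
  rcases Nat.eq_zero_or_pos n with rfl | hn
  · congr 1
    ext x
    rw [Poincare.act_apply]
    exact congrArg f (PiLp.ext fun l => l.elim0)
  · let T : 𝓢(Conf s (Fin n), ℂ) →L[ℂ] ℂ := W n w
    refine clm_ext_prodFun (T := T ∘L P.act n) (S := T) (fun u => ?_) f
    change W n w (P.act n (prodFun u)) = W n w (prodFun u)
    rw [act_prodFun_eq, trunc_prodFun W hn, trunc_prodFun W hn]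
    refine Finset.sum_congr rfl fun c _ => Finset.prod_congr rfl fun j _ => ?_
    rw [Function.comp_assoc, ← act_prodFun_eq, h]

theorem isHermitian_iff {W : Functional s Unit} :
    W.IsHermitian ↔ ∀ (n : ℕ) (w : Fin n → Unit) (f : 𝓢(Conf s (Fin n), ℂ)),
      W n w (starFun f) = (starRingEnd ℂ) (W n w f) := by
  constructor
  · intro h n w f
    have := h (DirectSum.lof ℂ ℕ (TestFun s Unit) n fun _ => f)
    rwa [bstar_lof, W.eval_lof_unit _ w, W.eval_lof_unit _ w] at this
  · intro h f
    induction f using DirectSum.induction_on with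
    | zero => simp
    | add f g hf hg => rw [map_add, map_add, map_add, map_add, hf, hg]
    | of n f =>
      rw [← DirectSum.lof_eq_of ℂ, bstar_lof, W.eval_lof_unit _ fun _ => (),
        W.eval_lof_unit _ fun _ => ()]
      exact h n _ _

/-- The conjugate `f ↦ conj (T (f*))` of a continuous functional. -/
def conjDual {n : ℕ} (T : 𝓢(Conf s (Fin n), ℂ) →L[ℂ] ℂ) : 𝓢(Conf s (Fin n), ℂ) →L[ℂ] ℂ where
  toFun f := (starRingEnd ℂ) (T (starFun f))
  map_add' f g := by simp
  map_smul' c f := by simp [starFun_smul]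
  cont := Complex.continuous_conj.comp (T.continuous.comp continuous_starFun)

/-- Reversing the variables carries partitions to partitions, and the increasing enumeration of a
reversed block is the block's own enumeration conjugated by the reversal. Each block then needs one
use of hermiticity of `W.trunc`. -/
theorem IsHermitian.of_trunc {W : Functional s Unit} (hW : W.IsNormalized)
    (h : Functional.IsHermitian W.trunc) : W.IsHermitian := by
  rw [isHermitian_iff] at h ⊢
  intro n w f
  -- Both sides are antilinear in `f`; conjugation gives linear functionals, which can be compared
  -- on products.
  have hT := clm_ext_prodFun (T := conjDual (s := s) (n := n) (W n w)) (S := W n w) (fun u => ?_) f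
  · exact (Complex.conj_conj _).symm.trans (congrArg _ hT)
  change (starRingEnd ℂ) (W n w (starFun (prodFun u))) = W n w (prodFun u)
  rw [starFun_prodFun, sum_onBlock_trunc_of_normalized W hW, sum_onBlock_trunc_of_normalized W hW,
    map_sum, ← sum_partitions_map Fin.revPerm]
  refine Finset.sum_congr rfl fun P _ => ?_
  rw [map_prod]
  refine Finset.prod_congr rfl fun B _ => ?_
  let e := B.orderEmbOfFin rfl
  have he : StrictMono fun i : Fin B.card => (e i.rev).rev := fun i j hij =>
    Fin.rev_lt_rev.2 (e.strictMono (Fin.rev_lt_rev.2 hij))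
  have hmem : ∀ x, x ∈ B.map Fin.revPerm.toEmbedding ↔ ∃ i : Fin B.card, (e i.rev).rev = x := by
    intro x
    have : x.rev ∈ B ↔ ∃ i, e i = x.rev := by
      rw [← Finset.mem_coe, ← Finset.range_orderEmbOfFin B rfl]; rfl
    rw [show x ∈ B.map Fin.revPerm.toEmbedding ↔ x.rev ∈ B by
      rw [Finset.mem_map_equiv]; rfl, this]
    constructor
    · rintro ⟨i, hi⟩; exact ⟨i.rev, by rw [Fin.rev_rev, hi, Fin.rev_rev]⟩
    · rintro ⟨i, hi⟩; exact ⟨i.rev, by rw [← hi, Fin.rev_rev]⟩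
  rw [Functional.onBlock_eq _ w u he hmem, Functional.onBlock_card]
  have := h B.card (w ∘ e) (prodFun (fun i : Fin B.card => u (e i.rev).rev))
  rw [starFun_prodFun] at this
  simp only [Function.comp_def, Fin.rev_rev] at this
  exact (congrArg (starRingEnd ℂ) this).trans (Complex.conj_conj _)

end Components

/-! ### Locality. -/

section Locality

variable {s : ℕ}

/-- Functions with space-like separated supports. -/
def SpacelikeSep (f h : 𝓢(Spacetime s, ℂ)) : Prop :=
  ∀ y ∈ tsupport f, ∀ z ∈ tsupport h, mink (y - z) (y - z) < 0

theorem exists_eq_prodFun_one (f : 𝓢(Conf s (Fin 1), ℂ)) :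
    ∃ g : 𝓢(Spacetime s, ℂ), f = prodFun (fun _ => g) ∧
      ∀ x ∈ tsupport g, WithLp.toLp 2 (fun _ => x) ∈ tsupport f := by
  let e : Spacetime s ≃ₗ[ℝ] Conf s (Fin 1) :=
    { toFun := fun x => WithLp.toLp 2 fun _ => x
      invFun := fun y => y 0
      map_add' := fun x y => PiLp.ext fun l => by simp
      map_smul' := fun c x => PiLp.ext fun l => by simp
      left_inv := fun x => rfl
      right_inv := fun y => PiLp.ext fun l => by rw [Subsingleton.elim l 0] }
  let e' := e.toContinuousLinearEquiv
  refine ⟨pullback e' f, ?_, ?_⟩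
  · ext x
    rw [prodFun_apply, Fin.prod_univ_one]
    exact congrArg f (PiLp.ext fun l => by rw [Subsingleton.elim l 0]; rfl)
  · intro x hx
    exact tsupport_comp_subset_preimage (⇑f) e'.continuous hx

theorem tsupport_prodFun_subset {n : ℕ} (u : Fin n → 𝓢(Spacetime s, ℂ)) (l : Fin n) :
    tsupport (prodFun u) ⊆ {x | x l ∈ tsupport (u l)} := by
  refine closure_minimal (fun x hx => ?_) ((isClosed_tsupport (u l)).preimage (by fun_prop))
  refine subset_tsupport _ fun h => hx ?_
  rw [prodFun_apply]
  exact Finset.prod_eq_zero (Finset.mem_univ l) h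

theorem forall_fin_append {a b : ℕ} {P : Fin (a + (1 + 1) + b) → Prop}
    (h₁ : ∀ l : Fin a, P (Fin.castAdd b (Fin.castAdd (1 + 1) l)))
    (h₂ : P (Fin.castAdd b (Fin.natAdd a (Fin.castAdd 1 0))))
    (h₃ : P (Fin.castAdd b (Fin.natAdd a (Fin.natAdd 1 0))))
    (h₄ : ∀ l : Fin b, P (Fin.natAdd (a + (1 + 1)) l)) (l : Fin (a + (1 + 1) + b)) : P l := by
  induction l using Fin.addCases with
  | right l => exact h₄ l
  | left l =>
    induction l using Fin.addCases with
    | left l => exact h₁ l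
    | right l =>
      induction l using Fin.addCases with
      | left l => rw [Subsingleton.elim l 0]; exact h₂
      | right l => rw [Subsingleton.elim l 0]; exact h₃

theorem append_comp_swap {X : Type*} {a b : ℕ} (p : Fin a → X) (q : Fin b → X) (f h : X) :
    Fin.append (Fin.append p (Fin.append (fun _ : Fin 1 => f) fun _ : Fin 1 => h)) q ∘
        Equiv.swap (Fin.castAdd b (Fin.natAdd a (Fin.castAdd 1 0)))
          (Fin.castAdd b (Fin.natAdd a (Fin.natAdd 1 0))) =
      Fin.append (Fin.append p (Fin.append (fun _ : Fin 1 => h) fun _ : Fin 1 => f)) q := by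
  funext l
  revert l
  refine forall_fin_append (fun l => ?_) ?_ ?_ fun l => ?_
  · rw [Function.comp_apply, Equiv.swap_apply_of_ne_of_ne]
    · simp only [Fin.append_left]
    · simp only [ne_eq, Fin.ext_iff, Fin.val_castAdd, Fin.val_natAdd]; omega
    · simp only [ne_eq, Fin.ext_iff, Fin.val_castAdd, Fin.val_natAdd]; omega
  · rw [Function.comp_apply, Equiv.swap_apply_left]
    simp only [Fin.append_left, Fin.append_right]
  · rw [Function.comp_apply, Equiv.swap_apply_right]
    simp only [Fin.append_left, Fin.append_right]
  · rw [Function.comp_apply, Equiv.swap_apply_of_ne_of_ne]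
    · simp only [Fin.append_right]
    · simp only [ne_eq, Fin.ext_iff, Fin.val_castAdd, Fin.val_natAdd, Fin.val_zero]; omega
    · simp only [ne_eq, Fin.ext_iff, Fin.val_castAdd, Fin.val_natAdd, Fin.val_zero]; omega

theorem localityIdeal_append {R : Functional s Unit} (hR : localityIdeal s ≤ LinearMap.ker R.eval)
    {a b : ℕ} (p : Fin a → 𝓢(Spacetime s, ℂ)) (q : Fin b → 𝓢(Spacetime s, ℂ))
    {f h : 𝓢(Spacetime s, ℂ)} (hs : SpacelikeSep f h) (w : Fin (a + (1 + 1) + b) → Unit) :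
    R _ w (prodFun (Fin.append (Fin.append p (Fin.append (fun _ : Fin 1 => f) fun _ : Fin 1 => h)) q))
      = R _ w (prodFun
        (Fin.append (Fin.append p (Fin.append (fun _ : Fin 1 => h) fun _ : Fin 1 => f)) q)) := by
  have key : tmul (tmul (DirectSum.lof ℂ ℕ (TestFun s Unit) a fun _ => prodFun p)
      (tmul (oneParticle (prodFun fun _ => f)) (oneParticle (prodFun fun _ => h)) -
        tmul (oneParticle (prodFun fun _ => h)) (oneParticle (prodFun fun _ => f))))
      (DirectSum.lof ℂ ℕ (TestFun s Unit) b fun _ => prodFun q) ∈ LinearMap.ker R.eval :=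
    hR (Submodule.subset_span ⟨_, _, _, _, fun y hy z hz =>
      hs _ (tsupport_prodFun_subset (fun _ => f) 0 hy) _ (tsupport_prodFun_subset (fun _ => h) 0 hz), rfl⟩)
  rw [LinearMap.mem_ker, map_sub, map_sub, LinearMap.sub_apply, map_sub, sub_eq_zero, oneParticle,
    oneParticle, tmul_lof, tmul_lof, tmul_lof, tmul_lof, tmul_lof, tmul_lof, R.eval_lof_unit _ w,
    R.eval_lof_unit _ w] at key
  simpa only [schwartzTensor_prodFun] using key

/-- The variables are split as `a + (1 + 1) + b` around the neighbouring pair, the shape in which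
the generators of the locality ideal appear. -/
theorem locality_swap {R : Functional s Unit} (hR : localityIdeal s ≤ LinearMap.ker R.eval)
    {k : ℕ} (v : Fin k → 𝓢(Spacetime s, ℂ)) {i j : Fin k} (hij : (j : ℕ) = i + 1)
    (hs : SpacelikeSep (v i) (v j)) (w : Fin k → Unit) :
    R k w (prodFun (v ∘ Equiv.swap i j)) = R k w (prodFun v) := by
  obtain ⟨a, ha⟩ := i
  obtain ⟨a', ha'⟩ := j
  simp only at hij
  subst hij
  obtain ⟨b, rfl⟩ : ∃ b, k = a + (1 + 1) + b := ⟨k - (a + 2), by omega⟩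
  rw [show (⟨a, ha⟩ : Fin (a + (1 + 1) + b)) = Fin.castAdd b (Fin.natAdd a (Fin.castAdd 1 0)) from
      Fin.ext (by simp),
    show (⟨a + 1, ha'⟩ : Fin (a + (1 + 1) + b)) = Fin.castAdd b (Fin.natAdd a (Fin.natAdd 1 0)) from
      Fin.ext (by simp)] at hs ⊢
  obtain ⟨p, q, f, h, rfl⟩ : ∃ (p : Fin a → 𝓢(Spacetime s, ℂ)) (q : Fin b → 𝓢(Spacetime s, ℂ))
      (f h : 𝓢(Spacetime s, ℂ)), v =
        Fin.append (Fin.append p (Fin.append (fun _ : Fin 1 => f) fun _ : Fin 1 => h)) q := by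
    refine ⟨fun l => v (Fin.castAdd b (Fin.castAdd (1 + 1) l)), fun l => v (Fin.natAdd _ l),
      v (Fin.castAdd b (Fin.natAdd a (Fin.castAdd 1 0))),
      v (Fin.castAdd b (Fin.natAdd a (Fin.natAdd 1 0))), funext fun l => ?_⟩
    revert l
    refine forall_fin_append (fun l => ?_) ?_ ?_ fun l => ?_ <;>
      simp only [Fin.append_left, Fin.append_right]
  rw [append_comp_swap]
  simp only [Fin.append_left, Fin.append_right] at hs
  exact (localityIdeal_append hR p q hs w).symm

/-- The transposition of neighbours permutes the partitions. A block with both of them has them as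
neighbours, and locality of `W.trunc` applies; on any other block the transposition preserves the
order and the factors agree. -/
theorem swap_trunc {W : Functional s Unit} (hW : W.IsNormalized)
    (hR : localityIdeal s ≤ LinearMap.ker (Functional.eval W.trunc))
    {n : ℕ} (u : Fin n → 𝓢(Spacetime s, ℂ)) {i j : Fin n} (hij : (j : ℕ) = i + 1)
    (hs : SpacelikeSep (u i) (u j)) (w : Fin n → Unit) :
    W n w (prodFun (u ∘ Equiv.swap i j)) = W n w (prodFun u) := by
  rw [sum_onBlock_trunc_of_normalized W hW, sum_onBlock_trunc_of_normalized W hW]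
  conv_rhs => rw [← sum_partitions_map (Equiv.swap i j)]
  refine Finset.sum_congr rfl fun P _ => Finset.prod_congr rfl fun B _ => ?_
  let e := B.orderEmbOfFin rfl
  have hmem : ∀ x, x ∈ B ↔ ∃ a, e a = x := fun x => by
    rw [← Finset.mem_coe, ← Finset.range_orderEmbOfFin B rfl]; rfl
  by_cases hB : i ∈ B ∧ j ∈ B
  · have hBσ : B.map (Equiv.swap i j).toEmbedding = B := by
      ext x
      rw [Finset.mem_map_equiv, Equiv.symm_swap, Equiv.swap_apply_def]
      split_ifs with h1 h2
      · simp [h1, hB]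
      · simp [h2, hB]
      · rfl
    rw [hBσ, Functional.onBlock_card, Functional.onBlock_card]
    obtain ⟨a, ha⟩ := (hmem i).1 hB.1
    obtain ⟨a', ha'⟩ := (hmem j).1 hB.2
    have h1 : a < a' := e.lt_iff_lt.1 (by rw [ha, ha', Fin.lt_def]; omega)
    -- No element of the block can lie strictly between two consecutive numbers.
    have h2 : (a' : ℕ) = a + 1 := by
      by_contra hne
      have h3 : (a : ℕ) + 1 < a' := by have := Fin.lt_def.1 h1; omega
      have h4 := e.strictMono (show a < ⟨a + 1, h3.trans a'.2⟩ from Fin.lt_def.2 (by simp))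
      have h5 := e.strictMono (show (⟨a + 1, h3.trans a'.2⟩ : Fin B.card) < a' from Fin.lt_def.2 h3)
      rw [ha, Fin.lt_def] at h4
      rw [ha', Fin.lt_def] at h5
      omega
    have h6 : (u ∘ Equiv.swap i j) ∘ e = (u ∘ e) ∘ Equiv.swap a a' := by
      funext x
      simp only [Function.comp_apply]
      rw [← ha, ← ha', e.injective.swap_apply]
    have h7 := locality_swap hR (u ∘ e) h2 (by simpa [ha, ha'] using hs) (w ∘ e)
    rw [← h6] at h7
    exact h7
  -- An adjacent transposition reverses the order of the pair `(i, j)` only, and this pair is not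
  -- contained in the block.
  · have he : StrictMono fun a => Equiv.swap i j (e a) := by
      intro a b hab
      have h1 := Fin.lt_def.1 (e.strictMono hab)
      have h2 : ¬ (e a = i ∧ e b = j) := fun h =>
        hB ⟨(hmem _).2 ⟨a, h.1⟩, (hmem _).2 ⟨b, h.2⟩⟩
      simp only [Fin.ext_iff] at h2
      simp only [Equiv.swap_apply_def, Fin.lt_def]
      split_ifs with h3 h4 h5 h6 h7 <;> simp only [Fin.ext_iff] at * <;> omega
    rw [Functional.onBlock_card, Functional.onBlock_eq (B := B.map (Equiv.swap i j).toEmbedding) _ w u he]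
    · rfl
    · intro x
      rw [Finset.mem_map_equiv, Equiv.symm_swap, hmem]
      exact exists_congr fun a => (Equiv.swap i j).injective.eq_iff.symm.trans (by simp)

/-- Linearity reduces `g` and `g'` to homogeneous elements, and continuity in each of them to
products, for which the commutator is a transposition of neighbours. -/
theorem locality_of_trunc {W : Functional s Unit} (hW : W.IsNormalized)
    (hR : localityIdeal s ≤ LinearMap.ker (Functional.eval W.trunc)) :
    localityIdeal s ≤ LinearMap.ker W.eval := by
  refine Submodule.span_le.2 ?_
  rintro x ⟨g, g', f, h, hsep, rfl⟩
  rw [SetLike.mem_coe, LinearMap.mem_ker]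
  obtain ⟨f, rfl, hf⟩ := exists_eq_prodFun_one f
  obtain ⟨h, rfl, hh⟩ := exists_eq_prodFun_one h
  have hs : SpacelikeSep f h := fun y hy z hz => hsep _ (hf y hy) _ (hh z hz)
  induction g using DirectSum.induction_on with
  | zero => simp
  | add g₁ g₂ h₁ h₂ => simp only [map_add, LinearMap.add_apply, h₁, h₂, add_zero]
  | of a g =>
    induction g' using DirectSum.induction_on with
    | zero => simp
    | add g₁ g₂ h₁ h₂ => simp only [map_add, h₁, h₂, add_zero]
    | of b g' =>
      rw [← DirectSum.lof_eq_of ℂ, ← DirectSum.lof_eq_of ℂ, map_sub, map_sub, LinearMap.sub_apply,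
        map_sub, sub_eq_zero, oneParticle, oneParticle, tmul_lof, tmul_lof, tmul_lof, tmul_lof,
        tmul_lof, tmul_lof, W.eval_lof_unit _ fun _ => (), W.eval_lof_unit _ fun _ => ()]
      simp only [schwartzTensor_prodFun]
      generalize g _ = g
      generalize g' _ = g'
      let T : 𝓢(Conf s (Fin (a + (1 + 1) + b)), ℂ) →L[ℂ] ℂ := W _ fun _ => ()
      let fh : 𝓢(Conf s (Fin (1 + 1)), ℂ) :=
        prodFun (Fin.append (fun _ : Fin 1 => f) fun _ : Fin 1 => h)
      let hf : 𝓢(Conf s (Fin (1 + 1)), ℂ) :=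
        prodFun (Fin.append (fun _ : Fin 1 => h) fun _ : Fin 1 => f)
      refine clm_ext_prodFun
        (T := T ∘L schwartzTensorLeft g' ∘L schwartzTensorLeft fh)
        (S := T ∘L schwartzTensorLeft g' ∘L schwartzTensorLeft hf) (fun p => ?_) g
      refine clm_ext_prodFun
        (T := T ∘L schwartzTensorRight (schwartzTensor (prodFun p) fh))
        (S := T ∘L schwartzTensorRight (schwartzTensor (prodFun p) hf)) (fun q => ?_) g'
      change W _ _ (schwartzTensor (schwartzTensor (prodFun p) fh) (prodFun q)) =
        W _ _ (schwartzTensor (schwartzTensor (prodFun p) hf) (prodFun q))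
      simp only [fh, hf, schwartzTensor_prodFun]
      have hsw := swap_trunc hW hR
        (Fin.append (Fin.append p (Fin.append (fun _ : Fin 1 => f) fun _ : Fin 1 => h)) q)
        (i := Fin.castAdd b (Fin.natAdd a (Fin.castAdd 1 0)))
        (j := Fin.castAdd b (Fin.natAdd a (Fin.natAdd 1 0))) (by simp) (by
          simpa only [Fin.append_left, Fin.append_right] using hs) fun _ => ()
      rw [append_comp_swap] at hsw
      exact hsw.symm

end Locality

end

noncomputable section

/-! ### Cutoffs and localization of supports. -/

section Cutoff

variable {E : Type*} [NormedAddCommGroup E] [NormedSpace ℝ E]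

/-- If `g` is `1` on the ball of radius `R` and has bounded derivatives, then multiplication by `g`
changes a Schwartz function by an amount of order `1 / R`. -/
theorem supSeminorm_sub_smulLeft_le (N : ℕ) {A R : ℝ} (hA : 0 ≤ A) (hR : 0 < R) {g : E → ℂ}
    (hg : g.HasTemperateGrowth) (h1 : ∀ x, ‖x‖ < R → g x = 1)
    (hb : ∀ i ≤ N, ∀ x, ‖iteratedFDeriv ℝ i g x‖ ≤ A) (h : 𝓢(E, ℂ)) :
    supSeminorm E N (h - SchwartzMap.smulLeftCLM ℂ g h) ≤
      R⁻¹ * ((1 + 2 ^ N * A) * supSeminorm E (N + 1) h) := by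
  refine supSeminorm_le (by positivity) fun k l hk hl => ?_
  refine SchwartzMap.seminorm_le_bound ℂ k l _ (by positivity) fun x => ?_
  have hfun : (⇑(h - SchwartzMap.smulLeftCLM ℂ g h) : E → ℂ) = ⇑h - fun x => g x * h x := by
    funext y
    simp [SchwartzMap.smulLeftCLM_apply_apply hg]
  rcases lt_or_ge ‖x‖ R with hx | hx
  · have hev : (⇑(h - SchwartzMap.smulLeftCLM ℂ g h) : E → ℂ) =ᶠ[𝓝 x] fun _ => 0 := by
      have : ∀ᶠ y in 𝓝 x, ‖y‖ < R := (continuous_norm.tendsto x).eventually (gt_mem_nhds hx)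
      filter_upwards [this] with y hy
      rw [hfun, Pi.sub_apply, h1 y hy, one_mul, sub_self]
    rw [(hev.iteratedFDeriv ℝ l).eq_of_nhds]
    simp only [iteratedFDeriv_fun_zero, Pi.zero_apply, norm_zero, mul_zero]
    positivity
  · have hgc : ContDiff ℝ l g := hg.1.of_le (by exact_mod_cast le_top)
    have hS : ∀ j ≤ l, ‖x‖ ^ (k + 1) * ‖iteratedFDeriv ℝ j h x‖ ≤ supSeminorm E (N + 1) h :=
      fun j hj => (SchwartzMap.le_seminorm ℂ (k + 1) j h x).trans
        (seminorm_le_supSeminorm (by omega) (by omega) h)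
    have hsub : ‖iteratedFDeriv ℝ l (⇑h - fun x => g x * h x) x‖ ≤
        ‖iteratedFDeriv ℝ l h x‖ + ∑ i ∈ Finset.range (l + 1), (l.choose i : ℝ) *
          ‖iteratedFDeriv ℝ i g x‖ * ‖iteratedFDeriv ℝ (l - i) h x‖ := by
      rw [iteratedFDeriv_sub_apply (h.smooth l).contDiffAt (hgc.mul (h.smooth l)).contDiffAt]
      exact (norm_sub_le _ _).trans (add_le_add le_rfl
        (norm_iteratedFDeriv_mul_le hgc (h.smooth l) x le_rfl))
    rw [hfun]
    -- Outside the ball one power of `‖x‖` buys the factor `R⁻¹`, at the cost of raising the order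
    -- to `N + 1`.
    have hRx : 1 ≤ R⁻¹ * ‖x‖ := by rw [inv_mul_eq_div, le_div_iff₀ hR]; simpa using hx
    calc _ ≤ (R⁻¹ * ‖x‖) * (‖x‖ ^ k * (‖iteratedFDeriv ℝ l h x‖ +
          ∑ i ∈ Finset.range (l + 1), (l.choose i : ℝ) *
          ‖iteratedFDeriv ℝ i g x‖ * ‖iteratedFDeriv ℝ (l - i) h x‖)) := by
          refine le_trans ?_ (le_mul_of_one_le_left (by positivity) hRx)
          gcongr
      _ = R⁻¹ * (‖x‖ ^ (k + 1) * ‖iteratedFDeriv ℝ l h x‖ +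
          ∑ i ∈ Finset.range (l + 1), (l.choose i : ℝ) *
          ‖iteratedFDeriv ℝ i g x‖ * (‖x‖ ^ (k + 1) * ‖iteratedFDeriv ℝ (l - i) h x‖)) := by
          rw [mul_add, mul_add, mul_add, Finset.mul_sum, Finset.mul_sum, Finset.mul_sum]
          congr 1
          · ring
          · exact Finset.sum_congr rfl fun i _ => by ring
      _ ≤ R⁻¹ * (supSeminorm E (N + 1) h +
          ∑ i ∈ Finset.range (l + 1), (l.choose i : ℝ) * A * supSeminorm E (N + 1) h) := by
          have : ∀ i ∈ Finset.range (l + 1), ‖iteratedFDeriv ℝ i g x‖ ≤ A := fun i hi =>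
            hb i (by have := Finset.mem_range.1 hi; omega) x
          gcongr with i hi
          · exact hS l le_rfl
          · exact this i hi
          · exact hS _ (by omega)
      _ = R⁻¹ * ((1 + 2 ^ l * A) * supSeminorm E (N + 1) h) := by
          rw [← Finset.sum_mul, ← Finset.sum_mul]
          have := Nat.sum_range_choose l
          rw [show (∑ i ∈ Finset.range (l + 1), (l.choose i : ℝ)) = 2 ^ l by exact_mod_cast this]
          ring
      _ ≤ _ := by
          gcongr
          norm_num

/-- Compactly supported functions are dense in Schwartz space. -/
theorem exists_cutoff [FiniteDimensional ℝ E] : ∃ g : ℕ → E → ℂ,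
    (∀ r, HasCompactSupport (g r)) ∧ (∀ r, (g r).HasTemperateGrowth) ∧
    ∀ h : 𝓢(E, ℂ), Tendsto (fun r => SchwartzMap.smulLeftCLM ℂ (g r) h) atTop (𝓝 h) := by
  let b : ContDiffBump (0 : E) := ⟨1, 2, one_pos, one_lt_two⟩
  let B : E → ℂ := fun x => ((b x : ℝ) : ℂ)
  have hBs : HasCompactSupport B := b.hasCompactSupport.comp_left Complex.ofReal_zero
  have hBd : ContDiff ℝ ∞ B := Complex.ofRealCLM.contDiff.comp b.contDiff
  have hc : ∀ r : ℕ, (0 : ℝ) < ((r : ℝ) + 1)⁻¹ := fun r => by positivity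
  let g : ℕ → E → ℂ := fun r x => B (((r : ℝ) + 1)⁻¹ • x)
  have hgs : ∀ r, HasCompactSupport (g r) := fun r =>
    hBs.comp_homeomorph (Homeomorph.smulOfNeZero _ (hc r).ne')
  have hgd : ∀ r, ContDiff ℝ ∞ (g r) := fun r => hBd.comp (contDiff_const_smul _)
  have hgt : ∀ r, (g r).HasTemperateGrowth := fun r => (hgs r).hasTemperateGrowth (hgd r)
  refine ⟨g, hgs, hgt, fun h => tendsto_schwartz_iff.2 fun N => ?_⟩
  let β : 𝓢(E, ℂ) := hBs.toSchwartzMap hBd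
  have hbound : ∀ r, ∀ i ≤ N, ∀ x, ‖iteratedFDeriv ℝ i (g r) x‖ ≤ supSeminorm E N β := by
    intro r i hi x
    rw [iteratedFDeriv_comp_const_smul _ (hBd.of_le (by exact_mod_cast le_top)), norm_smul]
    have h1 : ‖((r : ℝ) + 1)⁻¹ ^ i‖ ≤ 1 := by
      rw [norm_pow, Real.norm_of_nonneg (hc r).le]
      exact pow_le_one₀ (hc r).le (inv_le_one_of_one_le₀ (by linarith [Nat.cast_nonneg (α := ℝ) r]))
    have h2 : ‖iteratedFDeriv ℝ i B (((r : ℝ) + 1)⁻¹ • x)‖ ≤ supSeminorm E N β := by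
      have := SchwartzMap.le_seminorm ℂ 0 i β (((r : ℝ) + 1)⁻¹ • x)
      rw [pow_zero, one_mul] at this
      exact this.trans (seminorm_le_supSeminorm (Nat.zero_le _) hi β)
    calc _ ≤ 1 * supSeminorm E N β := by gcongr
      _ = _ := one_mul _
  have hone : ∀ (r : ℕ) x, ‖x‖ < (r : ℝ) + 1 → g r x = 1 := by
    intro r x hx
    have : ((r : ℝ) + 1)⁻¹ • x ∈ Metric.closedBall (0 : E) 1 := by
      rw [mem_closedBall_zero_iff, norm_smul, Real.norm_of_nonneg (hc r).le, inv_mul_eq_div,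
        div_le_one (by positivity)]
      exact hx.le
    have h2 := b.one_of_mem_closedBall this
    change ((b _ : ℝ) : ℂ) = 1
    rw [h2, Complex.ofReal_one]
  have hle := fun r : ℕ => supSeminorm_sub_smulLeft_le N (apply_nonneg (supSeminorm E N) β)
    (show (0 : ℝ) < r + 1 by positivity) (hgt r) (hone r) (hbound r) h
  refine squeeze_zero (fun _ => apply_nonneg _ _) (fun r => ?_)
    (g := fun r : ℕ => ((r : ℝ) + 1)⁻¹ * ((1 + 2 ^ N * supSeminorm E N β) * supSeminorm E (N + 1) h)) ?_
  · rw [map_sub_rev]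
    exact hle r
  · have := (tendsto_one_div_add_atTop_nhds_zero_nat (𝕜 := ℝ)).mul_const
      ((1 + 2 ^ N * supSeminorm E N β) * supSeminorm E (N + 1) h)
    simpa only [one_div, zero_mul] using this

/-- A continuous functional on Schwartz space which vanishes locally on an open set vanishes on the
functions with support in this set. -/
theorem eq_zero_of_locally [FiniteDimensional ℝ E] (T : 𝓢(E, ℂ) →L[ℂ] ℂ) {U : Set E}
    (hT : ∀ x ∈ U, ∃ g : E → ℂ, g.HasTemperateGrowth ∧ (∀ᶠ y in 𝓝 x, g y = 1) ∧
      ∀ h, T (SchwartzMap.smulLeftCLM ℂ g h) = 0)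
    {h : 𝓢(E, ℂ)} (hh : tsupport h ⊆ U) : T h = 0 := by
  have hcomp : ∀ h : 𝓢(E, ℂ), HasCompactSupport h → tsupport h ⊆ U → T h = 0 := by
    intro h hc hh
    choose! g hgt hg1 hgT using hT
    obtain ⟨t, htU, ht⟩ := hc.isCompact.elim_nhds_subcover (fun x => {y | g x y = 1})
      fun x hx => hg1 x (hh hx)
    -- Replacing `h'` by `h' - g x * h'` does not change the value of `T`, keeps all zeros and adds
    -- those where `g x = 1`. Finitely many steps lead to `0`.
    have key : ∀ l : List E, (∀ x ∈ l, x ∈ U) → ∃ h' : 𝓢(E, ℂ), T h' = T h ∧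
        ∀ y, (h y = 0 → h' y = 0) ∧ ((∃ x ∈ l, g x y = 1) → h' y = 0) := by
      intro l
      induction l with
      | nil => exact fun _ => ⟨h, rfl, fun y => ⟨id, fun ⟨x, hx, _⟩ => by simp at hx⟩⟩
      | cons x l ih =>
        intro hl
        obtain ⟨h', e, hy⟩ := ih fun x hx => hl x (List.mem_cons_of_mem _ hx)
        refine ⟨h' - SchwartzMap.smulLeftCLM ℂ (g x) h', ?_, fun y => ?_⟩
        · rw [map_sub, hgT x (hl x List.mem_cons_self), sub_zero, e]
        · have hval : (h' - SchwartzMap.smulLeftCLM ℂ (g x) h') y = h' y - g x y * h' y := by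
            simp [SchwartzMap.smulLeftCLM_apply_apply (hgt x (hl x List.mem_cons_self))]
          rw [hval]
          refine ⟨fun h0 => by rw [(hy y).1 h0, mul_zero, sub_zero], ?_⟩
          rintro ⟨z, hz, hz1⟩
          rcases List.mem_cons.1 hz with rfl | hz
          · rw [hz1, one_mul, sub_self]
          · rw [(hy y).2 ⟨z, hz, hz1⟩, mul_zero, sub_zero]
    obtain ⟨h', e, hy⟩ := key t.toList fun x hx => hh (htU x (Finset.mem_toList.1 hx))
    rw [← e, show h' = 0 from ?_, map_zero]
    ext y
    by_cases hys : y ∈ tsupport h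
    · obtain ⟨x, hx, hxy⟩ := Set.mem_iUnion₂.1 (ht hys)
      exact (hy y).2 ⟨x, Finset.mem_toList.2 hx, hxy⟩
    · exact (hy y).1 (image_eq_zero_of_notMem_tsupport hys)
  -- Cutting off does not enlarge the support, so density of the compactly supported functions
  -- removes the compactness assumption.
  obtain ⟨g, hgs, hgt, hg⟩ := exists_cutoff (E := E)
  have hz : ∀ r, T (SchwartzMap.smulLeftCLM ℂ (g r) h) = 0 := by
    intro r
    have hfun : (⇑(SchwartzMap.smulLeftCLM ℂ (g r) h) : E → ℂ) = fun x => g r x * h x := by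
      funext x; simp [SchwartzMap.smulLeftCLM_apply_apply (hgt r)]
    refine hcomp _ ?_ ?_
    · rw [hfun]; exact (hgs r).mul_right
    · rw [hfun]; exact (tsupport_mul_subset_right).trans hh
  have := (T.continuous.tendsto h).comp (hg h)
  refine tendsto_nhds_unique this ?_
  simp only [Function.comp_def, hz]
  exact tendsto_const_nhds

end Cutoff

/-! ### The forward cone. -/

section Cone

variable {s : ℕ}

/-- In the form `|𝐤| < k⁰` the cone is stable under addition by the triangle inequality. -/
theorem mem_forwardCone_zero_iff (x : Spacetime s) :
    x ∈ forwardCone s 0 ↔ ‖(WithLp.toLp 2 fun j : Fin s => x j.succ : EuclideanSpace ℝ (Fin s))‖ < x 0 := by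
  set y : EuclideanSpace ℝ (Fin s) := WithLp.toLp 2 fun j : Fin s => x j.succ
  have hy : ‖y‖ ^ 2 = ∑ j : Fin s, x j.succ * x j.succ := by
    rw [EuclideanSpace.real_norm_sq_eq]
    exact Finset.sum_congr rfl fun j _ => sq _
  have e : mink x x = x 0 ^ 2 - ‖y‖ ^ 2 := by rw [mink, hy, sq]
  change (0 : ℝ) ^ 2 < mink x x ∧ 0 < x 0 ↔ _
  rw [e]
  constructor
  · rintro ⟨h1, h2⟩
    exact lt_of_pow_lt_pow_left₀ 2 h2.le (by linarith)
  · intro h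
    have h2 : 0 < x 0 := (norm_nonneg _).trans_lt h
    exact ⟨by have := pow_lt_pow_left₀ h (norm_nonneg y) two_ne_zero; linarith, h2⟩

theorem add_mem_forwardCone {x y : Spacetime s} (hx : x ∈ forwardCone s 0)
    (hy : y ∈ forwardCone s 0) : x + y ∈ forwardCone s 0 := by
  rw [mem_forwardCone_zero_iff] at *
  exact (norm_add_le (WithLp.toLp 2 fun j : Fin s => x j.succ : EuclideanSpace ℝ (Fin s))
    (WithLp.toLp 2 fun j : Fin s => y j.succ)).trans_lt (add_lt_add hx hy)

/-- The closed forward cone, as an additive submonoid. -/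
def closedCone (s : ℕ) : AddSubmonoid (Spacetime s) where
  carrier := closure (forwardCone s 0)
  add_mem' := fun hx hy => map_mem_closure₂ continuous_add hx hy fun _ ha _ hb =>
    add_mem_forwardCone ha hb
  zero_mem' := by
    have h : Tendsto (fun t : ℝ => t • (EuclideanSpace.single 0 1 : Spacetime s)) (𝓝[>] 0) (𝓝 0) := by
      have : Tendsto (fun t : ℝ => t • (EuclideanSpace.single 0 1 : Spacetime s)) (𝓝 0)
          (𝓝 ((0 : ℝ) • EuclideanSpace.single 0 1)) :=
        (continuous_id.smul continuous_const).tendsto 0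
      rw [zero_smul] at this
      exact this.mono_left nhdsWithin_le_nhds
    refine mem_closure_of_tendsto h ?_
    filter_upwards [self_mem_nhdsWithin] with t ht
    have ht' : (0 : ℝ) < t := ht
    constructor <;> simp [mink, ht']

end Cone

/-! ### The spectral property. -/

section Spectral

variable {s : ℕ}

theorem oneFourier_oneFourierInv (f : 𝓢(Spacetime s, ℂ)) :
    oneFourier s (oneFourierInv s f) = f := by
  have h := fourier_scaled_inv (reflect s) (onePhase s) inner_reflect onePhase_apply f
  have e : oneFourier s (oneFourierInv s f) =
      ((((2 * Real.pi) ^ Module.finrank ℝ (Spacetime s) : ℝ) : ℂ)⁻¹) •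
      pullback (onePhase s) (𝓕 (pullback (onePhase s) (𝓕⁻ f))) := by
    have : oneFourierInv s f = ((((2 * Real.pi) ^ Module.finrank ℝ (Spacetime s) : ℝ) : ℂ)⁻¹) •
      pullback (onePhase s) (𝓕⁻ f) := rfl
    rw [this, map_smul]
    rfl
  have h0 : (((2 * Real.pi) ^ Module.finrank ℝ (Spacetime s) : ℝ) : ℂ) ≠ 0 :=
    Complex.ofReal_ne_zero.2 (pow_pos Real.two_pi_pos _).ne'
  rw [e, h]
  ext x
  simp only [smul_apply, smul_eq_mul, Complex.real_smul]
  rw [inv_mul_cancel_left₀ h0]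

/-- Inverse transforms turn a support condition on the momentum functions `v'` into membership in
the left ideal; the undetermined constant of the Fourier transform does not enlarge supports. -/
theorem spectral_append {R : Functional s Unit} (hR : spectralIdeal s ≤ LinearMap.ker R.eval)
    {q r : ℕ} (v : Fin q → 𝓢(Spacetime s, ℂ)) (v' : Fin r → 𝓢(Spacetime s, ℂ))
    (hv : tsupport (prodFun v') ⊆ {k | ∑ l, k l ∉ closure (forwardCone s 0)})
    (w : Fin (q + r) → Unit) :
    R (q + r) w (prodFun (Fin.append v fun l => oneFourierInv s (v' l))) = 0 := by
  obtain ⟨c, hc⟩ := exists_fourierM_prodFun s r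
  have key : tmul (DirectSum.lof ℂ ℕ (TestFun s Unit) q fun _ => prodFun v)
      (DirectSum.lof ℂ ℕ (TestFun s Unit) r fun _ => prodFun fun l => oneFourierInv s (v' l)) ∈
      LinearMap.ker R.eval := by
    refine hR (Submodule.subset_span ⟨_, _, _, fun _ => ?_, rfl⟩)
    rw [hc]
    simp only [oneFourier_oneFourierInv]
    exact (tsupport_smul_subset_right (fun _ => c) (prodFun v')).trans hv
  rw [LinearMap.mem_ker, tmul_lof, R.eval_lof_unit _ w, schwartzTensor_prodFun] at key
  exact key

/-- An increasing map into `Fin (m + n)` first takes values below `m`, then values above. -/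
theorem exists_split {k m n : ℕ} {e : Fin k → Fin (m + n)} (he : StrictMono e) :
    ∃ (q r : ℕ) (h : q + r = k) (a : Fin q → Fin m) (b : Fin r → Fin n),
      (∀ i, e (Fin.cast h (Fin.castAdd r i)) = Fin.castAdd n (a i)) ∧
        ∀ i, e (Fin.cast h (Fin.natAdd q i)) = Fin.natAdd m (b i) := by
  obtain ⟨q, r, rfl, hq⟩ : ∃ q r, ∃ _ : q + r = k, ∀ i : Fin k, (i : ℕ) < q ↔ (e i : ℕ) < m := by
    refine ⟨(Finset.univ.filter fun i => (e i : ℕ) < m).card,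
      k - (Finset.univ.filter fun i => (e i : ℕ) < m).card, ?_, fun i => lt_card_filter_iff he i⟩
    have := Finset.card_filter_le (Finset.univ : Finset (Fin k)) fun i => (e i : ℕ) < m
    rw [Finset.card_univ, Fintype.card_fin] at this
    omega
  have hlow : ∀ i : Fin q, ∃ a : Fin m, e (Fin.castAdd r i) = Fin.castAdd n a := fun i =>
    ⟨⟨e (Fin.castAdd r i), (hq _).1 (by simp)⟩, Fin.ext rfl⟩
  have hhigh : ∀ i : Fin r, ∃ a : Fin n, e (Fin.natAdd q i) = Fin.natAdd m a := fun i => by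
    have h1 : ¬ (e (Fin.natAdd q i) : ℕ) < m := fun h => by
      have := (hq _).2 h
      simp at this
    have h2 := (e (Fin.natAdd q i)).2
    exact ⟨⟨e (Fin.natAdd q i) - m, by omega⟩, Fin.ext (by simp; omega)⟩
  choose a ha using hlow
  choose b hb using hhigh
  exact ⟨q, r, rfl, a, b, ha, hb⟩

/-- The enumeration of the block is increasing, so the variables of the right factor come last, as
the left ideal requires. Those of the left factor are unrestricted and enter the momentum sum as
`0`. -/
theorem spectral_block {R : Functional s Unit} (hR : spectralIdeal s ≤ LinearMap.ker R.eval)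
    {m n k : ℕ} (p : Fin m → 𝓢(Spacetime s, ℂ)) (v : Fin n → 𝓢(Spacetime s, ℂ))
    {Q : Fin n → Set (Spacetime s)} (hne : ∀ l, (Q l).Nonempty) (hQ : ∀ l, tsupport (v l) ⊆ Q l)
    {e : Fin k → Fin (m + n)} (he : StrictMono e)
    (hsum : ∀ x : Fin n → Spacetime s, (∀ l, x l ∈ Q l) →
      ∑ i, Fin.append (fun _ => 0) x (e i) ∉ closure (forwardCone s 0)) (w : Fin k → Unit) :
    R k w (prodFun (Fin.append p (fun l => oneFourierInv s (v l)) ∘ e)) = 0 := by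
  obtain ⟨q, r, rfl, a, b, ha, hb⟩ := exists_split he
  have hbinj : Function.Injective b := fun i j hij => by
    have := Fin.cast_injective _ <| he.injective ((hb i).trans ((congrArg (Fin.natAdd m) hij).trans (hb j).symm))
    exact Fin.natAdd_injective _ _ this
  have heq : Fin.append p (fun l => oneFourierInv s (v l)) ∘ e =
      Fin.append (p ∘ a) fun l => oneFourierInv s ((v ∘ b) l) := by
    funext i
    refine Fin.addCases (fun i => ?_) (fun i => ?_) i
    · exact (congrArg _ (ha i)).trans (by rw [Fin.append_left, Fin.append_left]; rfl)
    · exact (congrArg _ (hb i)).trans (by rw [Fin.append_right, Fin.append_right]; rfl)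
  rw [heq]
  refine spectral_append hR _ _ (fun y hy => ?_) w
  -- Momenta outside the block do not enter the sum, so arbitrary points of the sets `Q l` complete
  -- the choice.
  choose x₀ hx₀ using hne
  have := hsum (Function.extend b (fun i => y i) x₀) (fun l => by
    by_cases hl : ∃ i, b i = l
    · obtain ⟨i, rfl⟩ := hl
      rw [hbinj.extend_apply]
      exact hQ _ (tsupport_prodFun_subset (v ∘ b) i hy)
    · rw [Function.extend_apply' _ _ _ hl]
      exact hx₀ l)
  rw [Fin.sum_univ_add] at this
  simp only [Fin.cast_eq_self] at ha hb
  simp only [ha, hb, Fin.append_left, Fin.append_right, hbinj.extend_apply, Finset.sum_const_zero,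
    zero_add] at this
  exact this

theorem spectral_local {W : Functional s Unit}
    (hR : spectralIdeal s ≤ LinearMap.ker (Functional.eval W.trunc)) {m n : ℕ} (hmn : 0 < m + n)
    (p : Fin m → 𝓢(Spacetime s, ℂ)) {k₀ : Fin n → Spacetime s}
    (hk₀ : ∑ l, k₀ l ∉ closure (forwardCone s 0)) (w : Fin (m + n) → Unit) :
    ∃ δ > 0, ∀ v : Fin n → 𝓢(Spacetime s, ℂ),
      (∀ l, tsupport (v l) ⊆ Metric.closedBall (k₀ l) δ) →
        W (m + n) w (prodFun (Fin.append p fun l => oneFourierInv s (v l))) = 0 := by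
  have hev : ∀ᶠ δ in 𝓝[>] (0 : ℝ), ∀ c : OrderedFinpartition (m + n), ∃ j,
      ∀ x : Fin n → Spacetime s, (∀ l, x l ∈ Metric.closedBall (k₀ l) δ) →
        ∑ i, Fin.append (fun _ => 0) x (c.emb j i) ∉ closure (forwardCone s 0) := by
    rw [eventually_all]
    intro c
    obtain ⟨j, hj⟩ : ∃ j, ∑ i, Fin.append (fun _ => 0) k₀ (c.emb j i) ∉
        closure (forwardCone s 0) := by
      by_contra! hcon
      have h1 : ∑ j, ∑ i, Fin.append (fun _ : Fin m => (0 : Spacetime s)) k₀ (c.emb j i) ∈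
          closedCone s := sum_mem fun j _ => hcon j
      rw [c.sum_sigma_eq_sum, Fin.sum_univ_add] at h1
      simp only [Fin.append_left, Fin.append_right, Finset.sum_const_zero, zero_add] at h1
      exact hk₀ h1
    obtain ⟨η, hη, hball⟩ := Metric.isOpen_iff.1 (isClosed_closure (s := forwardCone s 0)).isOpen_compl _ hj
    have hlt : ∀ᶠ δ in 𝓝[>] (0 : ℝ), (c.partSize j : ℝ) * δ < η := by
      have : Tendsto (fun δ : ℝ => (c.partSize j : ℝ) * δ) (𝓝 0) (𝓝 ((c.partSize j : ℝ) * 0)) :=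
        (continuous_const.mul continuous_id).tendsto 0
      rw [mul_zero] at this
      exact (this.mono_left nhdsWithin_le_nhds).eventually (gt_mem_nhds hη)
    filter_upwards [hlt, self_mem_nhdsWithin] with δ hδ hδ0
    refine ⟨j, fun x hx => hball ?_⟩
    rw [mem_ball_iff_norm, ← Finset.sum_sub_distrib]
    have hterm : ∀ i : Fin (m + n), ‖Fin.append (fun _ => 0) x i - Fin.append (fun _ => 0) k₀ i‖ ≤ δ := by
      intro i
      refine Fin.addCases (fun i => ?_) (fun i => ?_) i
      · rw [Fin.append_left, Fin.append_left, sub_self, norm_zero]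
        exact le_of_lt hδ0
      · rw [Fin.append_right, Fin.append_right]
        exact mem_closedBall_iff_norm.1 (hx i)
    calc _ ≤ ∑ i : Fin (c.partSize j), δ :=
          (norm_sum_le _ _).trans (Finset.sum_le_sum fun i _ => hterm _)
      _ = (c.partSize j : ℝ) * δ := by simp
      _ < η := hδ
  obtain ⟨δ, hδ, hδ0⟩ := (hev.and self_mem_nhdsWithin).exists
  have hδ0' : (0 : ℝ) < δ := hδ0
  refine ⟨δ, hδ0', fun v hv => ?_⟩
  rw [trunc_prodFun W hmn]
  refine Finset.sum_eq_zero fun c _ => ?_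
  obtain ⟨j, hj⟩ := hδ c
  refine Finset.prod_eq_zero (Finset.mem_univ j) ?_
  exact spectral_block hR p v (fun l => ⟨k₀ l, Metric.mem_closedBall_self hδ0'.le⟩) hv
    (c.emb_strictMono j) hj _

/-- The support condition concerns a sum of momenta and does not factorize, so it is localized: near
each point allowed by it, a product of bump functions confines every single momentum to a small
ball, where products of one-particle functions suffice. -/
theorem spectral_of_trunc {W : Functional s Unit}
    (hR : spectralIdeal s ≤ LinearMap.ker (Functional.eval W.trunc)) :
    spectralIdeal s ≤ LinearMap.ker W.eval := by
  refine Submodule.span_le.2 ?_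
  rintro x ⟨g, n, f, hf, rfl⟩
  rw [SetLike.mem_coe, LinearMap.mem_ker]
  induction g using DirectSum.induction_on with
  | zero => simp
  | add g₁ g₂ h₁ h₂ => simp only [map_add, LinearMap.add_apply, h₁, h₂, add_zero]
  | of m g =>
    rw [← DirectSum.lof_eq_of ℂ, tmul_lof, W.eval_lof_unit _ fun _ => ()]
    have hf' := hf ((fun _ : Fin (m + n) => ()) ∘ Fin.natAdd m)
    generalize f _ = f at hf'
    generalize g _ = g
    let Tw : 𝓢(Conf s (Fin (m + n)), ℂ) →L[ℂ] ℂ := W _ fun _ => ()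
    rcases Nat.eq_zero_or_pos n with rfl | hn
    -- The empty momentum sum is `0`, which lies in the closed cone, so the support condition leaves
    -- only `f = 0`.
    · have h0 : f = 0 := by
        rw [← fourierMInv_fourierM f, show fourierM s 0 f = 0 from ?_, map_zero]
        ext x
        refine image_eq_zero_of_notMem_tsupport fun hx => hf' hx ?_
        rw [Finset.univ_eq_empty, Finset.sum_empty]
        exact (closedCone s).zero_mem
      rw [h0, ← schwartzTensorRight_apply, map_zero, map_zero]
    refine (clm_ext_prodFun (T := Tw ∘L schwartzTensorLeft f) (S := 0) (fun p => ?_) g).trans rfl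
    let T : 𝓢(Conf s (Fin n), ℂ) →L[ℂ] ℂ := Tw ∘L schwartzTensorRight (prodFun p) ∘L fourierMInv s n
    have hT : T (fourierM s n f) = 0 := by
      refine eq_zero_of_locally T (U := {k | ∑ l, k l ∉ closure (forwardCone s 0)})
        (fun k₀ hk₀ => ?_) hf'
      obtain ⟨δ, hδ, hv⟩ := spectral_local hR (by omega : 0 < m + n) p hk₀ fun _ => ()
      let b : (l : Fin n) → ContDiffBump (k₀ l) := fun l => ⟨δ / 2, δ, half_pos hδ, half_lt_self hδ⟩
      let B : Fin n → Spacetime s → ℂ := fun l x => ((b l x : ℝ) : ℂ)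
      have hBs : ∀ l, HasCompactSupport (B l) := fun l =>
        (b l).hasCompactSupport.comp_left Complex.ofReal_zero
      have hBd : ∀ l, ContDiff ℝ ∞ (B l) := fun l => Complex.ofRealCLM.contDiff.comp (b l).contDiff
      have hBt : ∀ l, (B l).HasTemperateGrowth := fun l => (hBs l).hasTemperateGrowth (hBd l)
      have hgt : Function.HasTemperateGrowth fun k : Conf s (Fin n) => ∏ l, B l (k l) :=
        hasTemperateGrowth_prod hBt
      refine ⟨fun k => ∏ l, B l (k l), hgt, ?_, fun h => ?_⟩
      · have : ∀ l, ∀ᶠ y : Conf s (Fin n) in 𝓝 k₀, B l (y l) = 1 := by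
          intro l
          have hc : Continuous fun y : Conf s (Fin n) => y l := by fun_prop
          filter_upwards [(hc.tendsto k₀).eventually
            (Metric.ball_mem_nhds (k₀ l) (half_pos hδ))] with y hy
          have := (b l).one_of_mem_closedBall (Metric.ball_subset_closedBall hy)
          change ((b l (y l) : ℝ) : ℂ) = 1
          rw [this, Complex.ofReal_one]
        filter_upwards [eventually_all.2 this] with y hy
        exact Finset.prod_eq_one fun l _ => hy l
      · refine (clm_ext_prodFun (T := T ∘L SchwartzMap.smulLeftCLM ℂ fun k => ∏ l, B l (k l))
          (S := 0) (fun u => ?_) h).trans rfl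
        obtain ⟨c, hc⟩ := exists_fourierMInv_prodFun s n
        change W _ _ (schwartzTensor (prodFun p) (fourierMInv s n (SchwartzMap.smulLeftCLM ℂ
          (fun k : Conf s (Fin n) => ∏ l, B l (k l)) (prodFun u)))) = 0
        rw [smulLeftCLM_prodFun hBt, hc, ← schwartzTensorRight_apply, map_smul, map_smul,
          schwartzTensorRight_apply, schwartzTensor_prodFun, hv, smul_zero]
        intro l
        have hfun : (⇑(SchwartzMap.smulLeftCLM ℂ (B l) (u l)) : Spacetime s → ℂ) =
            fun x => B l x * u l x := by
          funext x; simp [SchwartzMap.smulLeftCLM_apply_apply (hBt l)]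
        rw [hfun]
        refine (tsupport_mul_subset_left).trans ?_
        refine (tsupport_comp_subset Complex.ofReal_zero (b l)).trans ?_
        rw [(b l).tsupport_eq]
    have : T (fourierM s n f) = Tw (schwartzTensor (prodFun p) f) := by
      change Tw (schwartzTensor (prodFun p) (fourierMInv s n (fourierM s n f))) = _
      rw [fourierMInv_fourierM]
    exact this.symm.trans hT

end Spectral

end

noncomputable section

/-! ### Limits of functionals, controlled on products. -/

section FrameLimits

variable {s : ℕ}

/-- The norms of the frame vectors grow at most polynomially in the weights. -/
theorem exists_prod_vec_bound (s n N : ℕ) : ∃ (k : ℕ) (A : ℝ), 0 ≤ A ∧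
    ∀ J : Fin n → (oneFrame s).Index, ∏ l, supSeminorm (Spacetime s) N ((oneFrame s).vec (J l)) ≤
      A * (∏ l, (oneFrame s).weight (J l)) ^ k := by
  obtain ⟨k, A, hA, hv⟩ := (oneFrame s).vec_bound N
  refine ⟨k, A ^ n, pow_nonneg hA _, fun J => ?_⟩
  refine (Finset.prod_le_prod (fun _ _ => apply_nonneg _ _) fun l _ => hv (J l)).trans (le_of_eq ?_)
  rw [Finset.prod_mul_distrib, Finset.prod_const, Finset.card_univ, Fintype.card_fin,
    Finset.prod_pow]

/-- Convergence on products of one-particle functions with a uniform product bound implies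
pointwise convergence. -/
theorem tendsto_of_prodFun (s n N : ℕ) : ∃ S : 𝓢(Conf s (Fin n), ℂ) → ℝ, (∀ f, 0 ≤ S f) ∧
    ∀ (T : ℕ → 𝓢(Conf s (Fin n), ℂ) →L[ℂ] ℂ) (T' : 𝓢(Conf s (Fin n), ℂ) →L[ℂ] ℂ) (C : ℝ), 0 ≤ C →
      (∀ i u, ‖T i (prodFun u)‖ ≤ C * ∏ l, supSeminorm (Spacetime s) N (u l)) →
      (∀ u, Tendsto (fun i => T i (prodFun u)) atTop (𝓝 (T' (prodFun u)))) →
      ∀ f, (∀ i, ‖T i f‖ ≤ C * S f) ∧ Tendsto (fun i => T i f) atTop (𝓝 (T' f)) := by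
  obtain ⟨k, A, hA, hv⟩ := exists_prod_vec_bound s n N
  refine ⟨fun f => A * coefNorm k f, fun f => mul_nonneg hA (coefNorm_nonneg k f),
    fun T T' C hC hb hT f => ?_⟩
  have hS : HasSum (fun J : Fin n → (oneFrame s).Index => C * A *
      (‖(confFrame (oneFrame s) n).coef J f‖ * (∏ l, (oneFrame s).weight (J l)) ^ k))
      (C * A * coefNorm k f) := (hasSum_coefNorm k f).mul_left _
  have hterm : ∀ i (J : Fin n → (oneFrame s).Index),
      ‖(confFrame (oneFrame s) n).coef J f * T i (prodFun ((oneFrame s).vec ∘ J))‖ ≤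
      C * A * (‖(confFrame (oneFrame s) n).coef J f‖ * (∏ l, (oneFrame s).weight (J l)) ^ k) := by
    intro i J
    rw [norm_mul]
    calc _ ≤ ‖(confFrame (oneFrame s) n).coef J f‖ *
          (C * (A * (∏ l, (oneFrame s).weight (J l)) ^ k)) := by
          refine mul_le_mul_of_nonneg_left ((hb i _).trans ?_) (norm_nonneg _)
          exact mul_le_mul_of_nonneg_left (hv J) hC
      _ = _ := by ring
  constructor
  · intro i
    refine ((hasSum_prodFun (T i) f).norm_le_of_bounded hS (hterm i)).trans (le_of_eq (by ring))
  -- Dominated convergence in the frame expansion: the product bound and the decay of the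
  -- coefficients give a summable majorant independent of `i`.
  · have : Tendsto (fun i => ∑' J : Fin n → (oneFrame s).Index,
        (confFrame (oneFrame s) n).coef J f * T i (prodFun ((oneFrame s).vec ∘ J))) atTop
        (𝓝 (∑' J : Fin n → (oneFrame s).Index,
          (confFrame (oneFrame s) n).coef J f * T' (prodFun ((oneFrame s).vec ∘ J)))) :=
      tendsto_tsum_of_dominated_convergence hS.summable
      (fun J => (hT ((oneFrame s).vec ∘ J)).const_mul ((confFrame (oneFrame s) n).coef J f))
      (Eventually.of_forall fun i J => hterm i J)
    rw [(hasSum_prodFun T' f).tsum_eq] at this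
    refine this.congr fun i => (hasSum_prodFun (T i) f).tsum_eq

end FrameLimits

/-! ### The cluster property. -/

section Cluster

variable {s : ℕ}

theorem tendsto_mixed {R : Functional s Unit}
    (hR : ∀ (f g : Borchers s Unit) (a : Spacetime s), f 0 = 0 → g 0 = 0 → mink a a < 0 →
      Tendsto (fun t : ℝ => R.eval (tmul f ((Poincare.translation (t • a)).alpha g))) atTop (𝓝 0))
    {q r : ℕ} (hq : 0 < q) (hr : 0 < r) {a : Spacetime s} (ha : mink a a < 0)
    (f : 𝓢(Conf s (Fin q), ℂ)) (g : 𝓢(Conf s (Fin r), ℂ)) (w : Fin (q + r) → Unit) :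
    Tendsto (fun t : ℝ => R (q + r) w
      (schwartzTensor f ((Poincare.translation (t • a)).act r g))) atTop (𝓝 0) := by
  have h0 : ∀ {n : ℕ} (f : TestFun s Unit n), 0 < n →
      (DirectSum.lof ℂ ℕ (TestFun s Unit) n f) 0 = 0 := fun f hn =>
    DirectSum.of_eq_of_ne _ _ _ hn.ne
  refine (hR (DirectSum.lof ℂ ℕ (TestFun s Unit) q fun _ => f)
    (DirectSum.lof ℂ ℕ (TestFun s Unit) r fun _ => g) a (h0 _ hq) (h0 _ hr) ha).congr fun t => ?_
  rw [alpha_lof, tmul_lof, R.eval_lof_unit _ w]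

/-- A bound uniform in the translations is needed, whereas bounds of Schwartz norms grow with the
translation. Clustering itself supplies it: along a sequence the values converge, hence are bounded
for each pair of functions, and the uniform boundedness principle for bilinear forms applies. -/
theorem mixed_bound {R : Functional s Unit}
    (hR : ∀ (f g : Borchers s Unit) (a : Spacetime s), f 0 = 0 → g 0 = 0 → mink a a < 0 →
      Tendsto (fun t : ℝ => R.eval (tmul f ((Poincare.translation (t • a)).alpha g))) atTop (𝓝 0))
    {q r : ℕ} (hq : 0 < q) (hr : 0 < r) {a : Spacetime s} (ha : mink a a < 0)
    (w : Fin (q + r) → Unit) {t : ℕ → ℝ} (ht : Tendsto t atTop atTop) :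
    ∃ (N : ℕ) (C : ℝ), 0 ≤ C ∧ ∀ i (u : Fin q → 𝓢(Spacetime s, ℂ)) (v : Fin r → 𝓢(Spacetime s, ℂ)),
      ‖R (q + r) w (prodFun (Fin.append u ((Poincare.translation (t i • a)).actOne ∘ v)))‖ ≤
        C * ((∏ l, supSeminorm (Spacetime s) N (u l)) * ∏ l, supSeminorm (Spacetime s) N (v l)) := by
  let T : 𝓢(Conf s (Fin (q + r)), ℂ) →L[ℂ] ℂ := R (q + r) w
  let B : ℕ → 𝓢(Conf s (Fin q), ℂ) → 𝓢(Conf s (Fin r), ℂ) →L[ℂ] ℂ := fun i f =>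
    T ∘L schwartzTensorRight f ∘L (Poincare.translation (t i • a)).act r
  let B' : ℕ → 𝓢(Conf s (Fin r), ℂ) → 𝓢(Conf s (Fin q), ℂ) →L[ℂ] ℂ := fun i g =>
    T ∘L schwartzTensorLeft ((Poincare.translation (t i • a)).act r g)
  have hBB : ∀ i f g, B i f g = B' i g f := fun _ _ _ => rfl
  obtain ⟨N, N', C, hC, hb⟩ := uniform_bound_bilinear B
    (fun i f f' g => by rw [hBB, hBB, hBB, map_add])
    (fun i c f g => by rw [hBB, hBB, map_smul, smul_eq_mul])
    (fun i g => (B' i g).continuous) (fun f g => by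
      have := ((tendsto_mixed hR hq hr ha f g w).comp ht).norm.bddAbove_range
      obtain ⟨C, hC⟩ := this
      exact ⟨C, fun i => hC ⟨i, rfl⟩⟩)
  obtain ⟨M, A, hA, hM⟩ := prodFun_bound_fin s q N
  obtain ⟨M', A', hA', hM'⟩ := prodFun_bound_fin s r N'
  have hmono : ∀ {k m : ℕ} (_ : m ≤ max M M') (u : Fin k → 𝓢(Spacetime s, ℂ)),
      ∏ l, supSeminorm (Spacetime s) m (u l) ≤ ∏ l, supSeminorm (Spacetime s) (max M M') (u l) :=
    fun h u => Finset.prod_le_prod (fun _ _ => apply_nonneg _ _) fun l _ => supSeminorm_mono h _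
  refine ⟨max M M', C * A * A', by positivity, fun i u v => ?_⟩
  have h1 : R (q + r) w (prodFun (Fin.append u ((Poincare.translation (t i • a)).actOne ∘ v))) =
      B i (prodFun u) (prodFun v) := by
    rw [← schwartzTensor_prodFun, ← act_prodFun_eq]
    rfl
  rw [h1]
  have hp : ∀ {k m : ℕ} (u : Fin k → 𝓢(Spacetime s, ℂ)), 0 ≤ ∏ l, supSeminorm (Spacetime s) m (u l) :=
    fun u => Finset.prod_nonneg fun _ _ => apply_nonneg _ _
  calc _ ≤ C * supSeminorm _ N (prodFun u) * supSeminorm _ N' (prodFun v) := hb i _ _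
    _ ≤ C * (A * ∏ l, supSeminorm (Spacetime s) (max M M') (u l)) *
        (A' * ∏ l, supSeminorm (Spacetime s) (max M M') (v l)) := by
        refine mul_le_mul (mul_le_mul_of_nonneg_left ((hM u).trans ?_) hC) ((hM' v).trans ?_)
          (apply_nonneg _ _) (mul_nonneg hC (mul_nonneg hA (hp u)))
        · exact mul_le_mul_of_nonneg_left (hmono (le_max_left _ _) u) hA
        · exact mul_le_mul_of_nonneg_left (hmono (le_max_right _ _) v) hA'
    _ = _ := by ring

/-- Mixed blocks, with respect to the first `n` and the last `m` of `n + m` variables. -/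
def Straddles (n m : ℕ) (B : Finset (Fin (n + m))) : Prop :=
  IsMixed (Fin.castAddEmb m : Fin n ↪ Fin (n + m)) (Fin.natAddEmb n : Fin m ↪ Fin (n + m)) B

theorem mem_iff_orderEmbOfFin {n : ℕ} {B : Finset (Fin n)} {x : Fin n} :
    x ∈ B ↔ ∃ i, B.orderEmbOfFin rfl i = x := by
  rw [← Finset.mem_coe, ← Finset.range_orderEmbOfFin B rfl]
  rfl

/-- A block on one side either does not see the translation or is translated as a whole. -/
theorem onBlock_translate_of_not_straddles {R : Functional s Unit} (hR : R.IsPoincareInvariant)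
    {n m : ℕ} (P : Poincare s) (u : Fin n → 𝓢(Spacetime s, ℂ)) (v : Fin m → 𝓢(Spacetime s, ℂ))
    {B : Finset (Fin (n + m))} (hB : ¬ Straddles n m B) (w : Fin (n + m) → Unit) :
    R.onBlock w (Fin.append u (P.actOne ∘ v)) B = R.onBlock w (Fin.append u v) B := by
  rw [Functional.onBlock_card, Functional.onBlock_card]
  by_cases hlow : ∃ x : Fin n, Fin.castAdd m x ∈ B
  · have hh : ∀ y : Fin m, Fin.natAdd n y ∉ B := fun y hy => hB ⟨hlow, y, hy⟩
    congr 2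
    funext i
    have hi := B.orderEmbOfFin_mem rfl i
    simp only [Function.comp_apply]
    generalize B.orderEmbOfFin rfl i = x at hi
    induction x using Fin.addCases with
    | left x => rw [Fin.append_left, Fin.append_left]
    | right x => exact (hh x hi).elim
  · conv_rhs => rw [← isPoincareInvariant_iff.1 hR P, act_prodFun_eq]
    congr 2
    funext i
    have hi := B.orderEmbOfFin_mem rfl i
    simp only [Function.comp_apply]
    generalize B.orderEmbOfFin rfl i = x at hi
    induction x using Fin.addCases with
    | left x => exact (hlow ⟨x, hi⟩).elim
    | right x => rw [Fin.append_right, Fin.append_right]; rfl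

theorem exists_straddling_block {n m : ℕ} {B : Finset (Fin (n + m))} (hB : Straddles n m B) :
    ∃ (q r : ℕ) (a : Fin q → Fin n) (b : Fin r → Fin m), 0 < q ∧ 0 < r ∧
      StrictMono (Fin.append (Fin.castAdd m ∘ a) (Fin.natAdd n ∘ b)) ∧
      ∀ x, x ∈ B ↔ ∃ i, Fin.append (Fin.castAdd m ∘ a) (Fin.natAdd n ∘ b) i = x := by
  obtain ⟨q, r, h, a, b, ha, hb⟩ := exists_split (B.orderEmbOfFin rfl).strictMono
  have he : Fin.append (Fin.castAdd m ∘ a) (Fin.natAdd n ∘ b) =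
      B.orderEmbOfFin rfl ∘ Fin.cast h := by
    funext i
    refine Fin.addCases (fun i => ?_) (fun i => ?_) i
    · rw [Fin.append_left, Function.comp_apply, Function.comp_apply, ha]
    · rw [Fin.append_right, Function.comp_apply, Function.comp_apply, hb]
  have hmem : ∀ x, x ∈ B ↔ ∃ i, Fin.append (Fin.castAdd m ∘ a) (Fin.natAdd n ∘ b) i = x := by
    intro x
    rw [mem_iff_orderEmbOfFin, he]
    constructor
    · rintro ⟨i, hi⟩; exact ⟨Fin.cast h.symm i, by simpa using hi⟩
    · rintro ⟨i, hi⟩; exact ⟨Fin.cast h i, hi⟩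
  refine ⟨q, r, a, b, ?_, ?_, ?_, hmem⟩
  · obtain ⟨⟨x, hx⟩, -⟩ := hB
    obtain ⟨i, hi⟩ := (hmem _).1 hx
    induction i using Fin.addCases with
    | left i => exact i.pos
    | right i =>
      rw [Fin.append_right] at hi
      have := congrArg Fin.val hi
      simp at this
      omega
  · obtain ⟨-, x, hx⟩ := hB
    obtain ⟨i, hi⟩ := (hmem _).1 hx
    induction i using Fin.addCases with
    | right i => exact i.pos
    | left i =>
      rw [Fin.append_left] at hi
      have := congrArg Fin.val hi
      simp at this
      omega
  · rw [he]
    exact (B.orderEmbOfFin rfl).strictMono.comp (Fin.cast_strictMono h)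

theorem append_comp_append {X : Type*} {n m q r : ℕ} (u : Fin n → X) (v : Fin m → X)
    (a : Fin q → Fin n) (b : Fin r → Fin m) :
    Fin.append u v ∘ Fin.append (Fin.castAdd m ∘ a) (Fin.natAdd n ∘ b) =
      Fin.append (u ∘ a) (v ∘ b) := by
  funext i
  refine Fin.addCases (fun i => ?_) (fun i => ?_) i
  · simp
  · simp

theorem tendsto_onBlock_straddles {R : Functional s Unit}
    (hR : ∀ (f g : Borchers s Unit) (a : Spacetime s), f 0 = 0 → g 0 = 0 → mink a a < 0 →
      Tendsto (fun t : ℝ => R.eval (tmul f ((Poincare.translation (t • a)).alpha g))) atTop (𝓝 0))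
    {n m : ℕ} {a : Spacetime s} (ha : mink a a < 0) (u : Fin n → 𝓢(Spacetime s, ℂ))
    (v : Fin m → 𝓢(Spacetime s, ℂ)) {B : Finset (Fin (n + m))} (hB : Straddles n m B)
    (w : Fin (n + m) → Unit) :
    Tendsto (fun t : ℝ => R.onBlock w
      (Fin.append u ((Poincare.translation (t • a)).actOne ∘ v)) B) atTop (𝓝 0) := by
  obtain ⟨q, r, c, b, hq, hr, hmono, hmem⟩ := exists_straddling_block hB
  refine (tendsto_mixed hR hq hr ha (prodFun (u ∘ c)) (prodFun (v ∘ b))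
    (w ∘ Fin.append (Fin.castAdd m ∘ c) (Fin.natAdd n ∘ b))).congr fun t => ?_
  rw [Functional.onBlock_eq _ _ _ hmono hmem, append_comp_append, act_prodFun_eq,
    schwartzTensor_prodFun]
  rfl

/-- Blocks on both sides are covered by uniform boundedness; on the others the translation drops out
and the product bound is enough. -/
theorem exists_onBlock_bound {R : Functional s Unit}
    (hR : ∀ (f g : Borchers s Unit) (a : Spacetime s), f 0 = 0 → g 0 = 0 → mink a a < 0 →
      Tendsto (fun t : ℝ => R.eval (tmul f ((Poincare.translation (t • a)).alpha g))) atTop (𝓝 0))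
    (hRP : R.IsPoincareInvariant) (hRb : R.ProductBounded) {n m : ℕ} {a : Spacetime s}
    (ha : mink a a < 0) (B : Finset (Fin (n + m))) (w : Fin (n + m) → Unit)
    {t : ℕ → ℝ} (ht : Tendsto t atTop atTop) :
    ∃ (N : ℕ) (C : ℝ), 0 ≤ C ∧ ∀ i (u : Fin n → 𝓢(Spacetime s, ℂ)) (v : Fin m → 𝓢(Spacetime s, ℂ)),
      ‖R.onBlock w (Fin.append u ((Poincare.translation (t i • a)).actOne ∘ v)) B‖ ≤
        C * ∏ l ∈ B, supSeminorm (Spacetime s) N (Fin.append u v l) := by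
  have hprod : ∀ {k : ℕ} {e : Fin k → Fin (n + m)} (_ : StrictMono e)
      (_ : ∀ x, x ∈ B ↔ ∃ i, e i = x) (F : Fin (n + m) → ℝ), ∏ l ∈ B, F l = ∏ i, F (e i) := by
    intro k e he hB F
    have : B = Finset.univ.map ⟨e, he.injective⟩ := by ext x; simp [hB]
    rw [this, Finset.prod_map]
    rfl
  by_cases hB : Straddles n m B
  · obtain ⟨q, r, c, b, hq, hr, hmono, hmem⟩ := exists_straddling_block hB
    obtain ⟨N, C, hC, h⟩ := mixed_bound hR hq hr ha
      (w ∘ Fin.append (Fin.castAdd m ∘ c) (Fin.natAdd n ∘ b)) ht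
    refine ⟨N, C, hC, fun i u v => ?_⟩
    rw [Functional.onBlock_eq _ _ _ hmono hmem, append_comp_append, hprod hmono hmem,
      Fin.prod_univ_add]
    simp only [Fin.append_left, Fin.append_right, Function.comp_apply]
    exact h i (u ∘ c) (v ∘ b)
  · obtain ⟨N, h⟩ := hRb
    obtain ⟨C, hC, h⟩ := h B.card
    refine ⟨N, C, hC, fun i u v => ?_⟩
    rw [onBlock_translate_of_not_straddles hRP _ u v hB, Functional.onBlock_card,
      hprod (B.orderEmbOfFin rfl).strictMono fun x => mem_iff_orderEmbOfFin]
    exact h _ _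

theorem prod_partition {α : Type*} [Fintype α] [DecidableEq α] {P : Finset (Finset α)}
    (hP : IsPartition P) (F : α → ℝ) : ∏ B ∈ P, ∏ l ∈ B, F l = ∏ l, F l := by
  have h : P.biUnion id = Finset.univ := by
    ext x
    obtain ⟨B, ⟨hB, hx⟩, -⟩ := hP.2 x
    simp only [Finset.mem_biUnion, Finset.mem_univ, iff_true]
    exact ⟨B, hB, hx⟩
  rw [← h, Finset.prod_biUnion]
  · rfl
  · intro A hA B hB hAB
    exact Finset.disjoint_left.2 fun x hx hx' => hAB (hP.eq_of_mem hA hB hx hx')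

variable {W : Functional s Unit}

theorem exists_cluster_bound
    (hR : ∀ (f g : Borchers s Unit) (a : Spacetime s), f 0 = 0 → g 0 = 0 → mink a a < 0 →
      Tendsto (fun t : ℝ => Functional.eval W.trunc
        (tmul f ((Poincare.translation (t • a)).alpha g))) atTop (𝓝 0))
    (hRP : Functional.IsPoincareInvariant W.trunc) (hRb : Functional.ProductBounded W.trunc)
    (hW : W.IsNormalized) {n m : ℕ} {a : Spacetime s}
    (ha : mink a a < 0) (w : Fin (n + m) → Unit) {t : ℕ → ℝ} (ht : Tendsto t atTop atTop) :
    ∃ (N : ℕ) (C : ℝ), 0 ≤ C ∧ ∀ i (u : Fin n → 𝓢(Spacetime s, ℂ)) (v : Fin m → 𝓢(Spacetime s, ℂ)),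
      ‖W (n + m) w (prodFun (Fin.append u ((Poincare.translation (t i • a)).actOne ∘ v)))‖ ≤
        C * ((∏ l, supSeminorm (Spacetime s) N (u l)) * ∏ l, supSeminorm (Spacetime s) N (v l)) := by
  choose N C hC hb using fun B => exists_onBlock_bound hR hRP hRb ha B w ht
  let M := Finset.univ.sup N
  refine ⟨M, ∑ P ∈ partitions (Fin (n + m)), ∏ B ∈ P, C B,
    Finset.sum_nonneg fun P _ => Finset.prod_nonneg fun B _ => hC B, fun i u v => ?_⟩
  have hsplit : (∏ l, supSeminorm (Spacetime s) M (u l)) * ∏ l, supSeminorm (Spacetime s) M (v l) =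
      ∏ l, supSeminorm (Spacetime s) M (Fin.append u v l) := by
    rw [Fin.prod_univ_add]
    simp only [Fin.append_left, Fin.append_right]
  rw [sum_onBlock_trunc_of_normalized W hW, hsplit, Finset.sum_mul]
  refine (norm_sum_le _ _).trans (Finset.sum_le_sum fun P hP => ?_)
  rw [norm_prod, ← prod_partition (mem_partitions.1 hP), ← Finset.prod_mul_distrib]
  refine Finset.prod_le_prod (fun _ _ => norm_nonneg _) fun B _ => (hb B i u v).trans ?_
  refine mul_le_mul_of_nonneg_left ?_ (hC B)
  exact Finset.prod_le_prod (fun _ _ => apply_nonneg _ _) fun l _ =>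
    supSeminorm_mono (Finset.le_sup (Finset.mem_univ B)) _

/-- In the limit the partitions with a straddling block drop out. The others are pairs of partitions
of the two groups of variables, so their sum is a product. -/
theorem tendsto_cluster_prodFun
    (hR : ∀ (f g : Borchers s Unit) (a : Spacetime s), f 0 = 0 → g 0 = 0 → mink a a < 0 →
      Tendsto (fun t : ℝ => Functional.eval W.trunc
        (tmul f ((Poincare.translation (t • a)).alpha g))) atTop (𝓝 0))
    (hRP : Functional.IsPoincareInvariant W.trunc) (hW : W.IsNormalized) {n m : ℕ}
    {a : Spacetime s} (ha : mink a a < 0) (w : Fin (n + m) → Unit) (w₁ : Fin n → Unit)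
    (w₂ : Fin m → Unit) (u : Fin n → 𝓢(Spacetime s, ℂ)) (v : Fin m → 𝓢(Spacetime s, ℂ)) :
    Tendsto (fun t : ℝ => W (n + m) w
        (prodFun (Fin.append u ((Poincare.translation (t • a)).actOne ∘ v)))) atTop
      (𝓝 (W n w₁ (prodFun u) * W m w₂ (prodFun v))) := by
  classical
  let κ : Finset (Fin (n + m)) → ℂ := fun B => if Straddles n m B then 0 else
    Functional.onBlock W.trunc w (Fin.append u v) B
  have hκ : ∀ B, Tendsto (fun t : ℝ => Functional.onBlock W.trunc w
      (Fin.append u ((Poincare.translation (t • a)).actOne ∘ v)) B) atTop (𝓝 (κ B)) := by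
    intro B
    by_cases hB : Straddles n m B
    · simp only [κ, if_pos hB]
      exact tendsto_onBlock_straddles hR ha u v hB w
    · simp only [κ, if_neg hB, onBlock_translate_of_not_straddles hRP _ u v hB]
      exact tendsto_const_nhds
  have hsum := sum_partitions_not_mixed (Fin.castAddEmb m : Fin n ↪ Fin (n + m))
    (Fin.natAddEmb n : Fin m ↪ Fin (n + m))
    (fun x y h => by
      have := congrArg Fin.val h
      simp at this
      omega)
    (fun z => by
      induction z using Fin.addCases with
      | left x => exact Or.inl ⟨x, rfl⟩
      | right y => exact Or.inr ⟨y, rfl⟩)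
    κ (fun B hB => if_pos hB)
  have h1 : W n w₁ (prodFun u) = ∑ P ∈ partitions (Fin n), ∏ B ∈ P, κ (B.map (Fin.castAddEmb m)) := by
    rw [sum_onBlock_trunc_of_normalized W hW]
    refine Finset.sum_congr rfl fun P _ => Finset.prod_congr rfl fun B _ => ?_
    have hB : ¬ Straddles n m (B.map (Fin.castAddEmb m)) := by
      rintro ⟨-, y, hy⟩
      obtain ⟨x, -, hx⟩ := Finset.mem_map.1 hy
      have := congrArg Fin.val hx
      simp at this
      omega
    simp only [κ, if_neg hB]
    rw [Functional.onBlock_eq (B := B.map (Fin.castAddEmb m)) W.trunc w (Fin.append u v)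
      (e := Fin.castAdd m ∘ B.orderEmbOfFin rfl)
      ((Fin.strictMono_castAdd m).comp (B.orderEmbOfFin rfl).strictMono) (fun x => by
        simp only [Finset.mem_map, mem_iff_orderEmbOfFin (B := B), Function.comp_apply]
        constructor
        · rintro ⟨_, ⟨i, rfl⟩, hx⟩; exact ⟨i, hx⟩
        · rintro ⟨i, hi⟩; exact ⟨_, ⟨i, rfl⟩, hi⟩), Functional.onBlock_card]
    congr 2
    funext i
    simp
  have h2 : W m w₂ (prodFun v) = ∑ P ∈ partitions (Fin m), ∏ B ∈ P, κ (B.map (Fin.natAddEmb n)) := by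
    rw [sum_onBlock_trunc_of_normalized W hW]
    refine Finset.sum_congr rfl fun P _ => Finset.prod_congr rfl fun B _ => ?_
    have hB : ¬ Straddles n m (B.map (Fin.natAddEmb n)) := by
      rintro ⟨⟨y, hy⟩, -⟩
      obtain ⟨x, -, hx⟩ := Finset.mem_map.1 hy
      have := congrArg Fin.val hx
      simp at this
      omega
    simp only [κ, if_neg hB]
    rw [Functional.onBlock_eq (B := B.map (Fin.natAddEmb n)) W.trunc w (Fin.append u v)
      (e := Fin.natAdd n ∘ B.orderEmbOfFin rfl)
      ((Fin.strictMono_natAdd n).comp (B.orderEmbOfFin rfl).strictMono) (fun x => by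
        simp only [Finset.mem_map, mem_iff_orderEmbOfFin (B := B), Function.comp_apply]
        constructor
        · rintro ⟨_, ⟨i, rfl⟩, hx⟩; exact ⟨i, hx⟩
        · rintro ⟨i, hi⟩; exact ⟨_, ⟨i, rfl⟩, hi⟩), Functional.onBlock_card]
    congr 2
    funext i
    simp
  rw [h1, h2, ← hsum]
  refine (tendsto_finsetSum _ fun P _ => tendsto_finsetProd _ fun B _ => hκ B).congr fun t => ?_
  rw [sum_onBlock_trunc_of_normalized W hW]

/-- The extension from products is made first in `g`, with the left factor a product, and then in
`f`. The first step yields the bound `C * S g` times the product of the norms of `u`, which is the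
product bound required by the second. -/
theorem tendsto_cluster
    (hR : ∀ (f g : Borchers s Unit) (a : Spacetime s), f 0 = 0 → g 0 = 0 → mink a a < 0 →
      Tendsto (fun t : ℝ => Functional.eval W.trunc
        (tmul f ((Poincare.translation (t • a)).alpha g))) atTop (𝓝 0))
    (hRP : Functional.IsPoincareInvariant W.trunc) (hRb : Functional.ProductBounded W.trunc)
    (hW : W.IsNormalized) {n m : ℕ} {a : Spacetime s} (ha : mink a a < 0) (w : Fin (n + m) → Unit)
    (w₁ : Fin n → Unit) (w₂ : Fin m → Unit) (f : 𝓢(Conf s (Fin n), ℂ)) (g : 𝓢(Conf s (Fin m), ℂ)) :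
    Tendsto (fun t : ℝ => W (n + m) w
        (schwartzTensor f ((Poincare.translation (t • a)).act m g))) atTop
      (𝓝 (W n w₁ f * W m w₂ g)) := by
  -- Convergence implies boundedness over the whole index set for sequences, which is what uniform
  -- boundedness requires.
  refine tendsto_of_seq_tendsto fun t ht => ?_
  obtain ⟨N, C, hC, hb⟩ := exists_cluster_bound hR hRP hRb hW ha w ht
  obtain ⟨S, hS0, hS⟩ := tendsto_of_prodFun s m N
  obtain ⟨S', hS0', hS'⟩ := tendsto_of_prodFun s n N
  let T : 𝓢(Conf s (Fin (n + m)), ℂ) →L[ℂ] ℂ := W (n + m) w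
  let T₁ : 𝓢(Conf s (Fin n), ℂ) →L[ℂ] ℂ := W n w₁
  let T₂ : 𝓢(Conf s (Fin m), ℂ) →L[ℂ] ℂ := W m w₂
  have hp : ∀ {k : ℕ} (u : Fin k → 𝓢(Spacetime s, ℂ)), 0 ≤ ∏ l, supSeminorm (Spacetime s) N (u l) :=
    fun u => Finset.prod_nonneg fun _ _ => apply_nonneg _ _
  have hu : ∀ u : Fin n → 𝓢(Spacetime s, ℂ), (∀ i, ‖T (schwartzTensor (prodFun u)
      ((Poincare.translation (t i • a)).act m g))‖ ≤
        (C * ∏ l, supSeminorm (Spacetime s) N (u l)) * S g) ∧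
      Tendsto (fun i => T (schwartzTensor (prodFun u) ((Poincare.translation (t i • a)).act m g)))
        atTop (𝓝 (T₁ (prodFun u) * T₂ g)) := by
    intro u
    refine hS (fun i => T ∘L schwartzTensorRight (prodFun u) ∘L
      (Poincare.translation (t i • a)).act m) (T₁ (prodFun u) • T₂)
      (C * ∏ l, supSeminorm (Spacetime s) N (u l)) (mul_nonneg hC (hp u)) (fun i v => ?_)
      (fun v => ?_) g
    · have := hb i u v
      rw [← schwartzTensor_prodFun, ← act_prodFun_eq, ← mul_assoc] at this
      exact this
    · refine ((tendsto_cluster_prodFun hR hRP hW ha w w₁ w₂ u v).comp ht).congr fun i => ?_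
      rw [Function.comp_apply, ← schwartzTensor_prodFun, ← act_prodFun_eq]
      rfl
  refine (hS' (fun i => T ∘L schwartzTensorLeft ((Poincare.translation (t i • a)).act m g))
    (T₂ g • T₁) (C * S g) (mul_nonneg hC (hS0 g)) (fun i u => ?_) (fun u => ?_) f).2.congr' ?_ |>.trans
      (le_of_eq ?_)
  · refine ((hu u).1 i).trans (le_of_eq (by ring))
  · have := (hu u).2
    rw [mul_comm] at this
    exact this
  · exact Eventually.of_forall fun i => rfl
  · exact congrArg 𝓝 (mul_comm _ _)

theorem cluster_of_trunc
    (hR : ∀ (f g : Borchers s Unit) (a : Spacetime s), f 0 = 0 → g 0 = 0 → mink a a < 0 →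
      Tendsto (fun t : ℝ => Functional.eval W.trunc
        (tmul f ((Poincare.translation (t • a)).alpha g))) atTop (𝓝 0))
    (hRP : Functional.IsPoincareInvariant W.trunc) (hRb : Functional.ProductBounded W.trunc)
    (hW : W.IsNormalized) (f g : Borchers s Unit) {a : Spacetime s} (ha : mink a a < 0) :
    Tendsto (fun t : ℝ => W.eval (tmul f ((Poincare.translation (t • a)).alpha g))) atTop
      (𝓝 (W.eval f * W.eval g)) := by
  induction f using DirectSum.induction_on with
  | zero => simp
  | add f f' hf hf' =>
    simp only [map_add, LinearMap.add_apply, add_mul]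
    exact hf.add hf'
  | of n f =>
    induction g using DirectSum.induction_on with
    | zero => simp
    | add g g' hg hg' =>
      simp only [map_add, mul_add]
      exact hg.add hg'
    | of m g =>
      rw [← DirectSum.lof_eq_of ℂ, ← DirectSum.lof_eq_of ℂ, W.eval_lof_unit _ fun _ => (),
        W.eval_lof_unit _ fun _ => ()]
      refine (tendsto_cluster hR hRP hRb hW ha (fun _ => ()) (fun _ => ()) (fun _ => ()) (f _)
        (g _)).congr fun t => ?_
      rw [alpha_lof, tmul_lof, W.eval_lof_unit _ fun _ => ()]

end Cluster

end

end WightmanScattering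

/-! ### The proposition. -/

theorem proposition3p4 (s : ℕ) (m ε : ℝ) (φ : ℝ → ℝ) (hm : 0 < m) (hε : 0 < ε) (hεm : ε < m ^ 2)
    (hφ : ContDiff ℝ ∞ φ) (hsupp : tsupport φ ⊆ Set.Ioo (-ε) ε)
    (hone : ∀ x ∈ Set.Ioo (-ε / 2) (ε / 2), φ x = 1) (W : Functional s Unit) :
    ((∃ F : Functional s Label, IsFormFactor m φ W F) ↔
      ∃ F' : Functional s Label, IsFormFactor m φ W.trunc F') ∧
    (∀ F F' : Functional s Label, IsFormFactor m φ W F → IsFormFactor m φ W.trunc F' →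
      F' = F.trunc) ∧
    (∀ F : Functional s Label, IsFormFactor m φ W F → ∀ f g : Borchers s Unit,
      BiFunctional.eval (BiFunctional.trunc (scatteringMatrix F)) f g =
        Functional.eval F.trunc (tmul (J Label.inn f) (J Label.out g))) ∧
    (∀ m₀ : ℝ, 0 < m₀ → W.IsNormalized → TruncatedAxioms W.trunc → HasMassGap m₀ W.trunc →
      HasTwoPointForm m m₀ W.trunc →
      (∃ F' : Functional s Label, IsFormFactor m φ W.trunc F' ∧ F'.IsPoincareInvariant ∧
        F'.IsGammaContinuous) →
      ScatteringCondition m m₀ φ W) := by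
  refine ⟨⟨?_, ?_⟩, ?_, ?_, ?_⟩
  · rintro ⟨F, hF⟩
    exact ⟨F.trunc, hF.trunc hm hεm hφ hsupp⟩
  · rintro ⟨F', hF'⟩
    exact exists_isFormFactor_of_trunc hm hεm hφ hsupp hF'
  · exact fun F F' hF hF' => hF'.unique (hF.trunc hm hεm hφ hsupp)
  · intro F _ f g
    rw [scatteringMatrix_trunc, scatteringMatrix_eval]
  · rintro m₀ - hW hT hgap htwo ⟨F', hF', hFP, hFγ⟩
    have hb : Functional.ProductBounded W.trunc := productBounded_of_gamma hT.gamma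
    obtain ⟨F, hF⟩ := exists_isFormFactor_of_trunc hm hεm hφ hsupp hF'
    -- The given limit is the truncation of the form factor `F`, so `F` obtains invariance and the
    -- Hilbert space structure condition from `F.trunc` in the same way as `W` does from `W.trunc`.
    obtain rfl : F' = F.trunc := hF'.unique (hF.trunc hm hεm hφ hsupp)
    exact
      { wightman :=
          { normalized := hW
            poincare := IsPoincareInvariant.of_trunc hT.poincare
            spectral := spectral_of_trunc hT.spectral
            locality := locality_of_trunc hW hT.locality
            hilbert := (ProductBounded.of_trunc hb).hssc
            cluster := fun f g a ha => cluster_of_trunc hT.cluster hT.poincare hb hW f g ha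
            hermitian := IsHermitian.of_trunc hW hT.hermitian }
        massGap := hgap
        twoPoint := htwo
        formFactor := ⟨F, hF, IsPoincareInvariant.of_trunc hFP,
          (ProductBounded.of_trunc (productBounded_of_gamma hFγ)).hssc⟩ }
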